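/- Let $K$ be a field and let $\Lambda=(KQ/\langle I^g\sqcup I^p\rangle,|\cdot|)$ be a graded pinched gentle algebra. That is: $Q$ is a finite $\mathbb Z$-graded quiver with $Q_1=Q_1^g\sqcup Q_1^p$; $I^g$ is a set of paths of length two making $(Q_0,Q_1^g,I^g)$ a gentle bound quiver (at most two arrows of $Q_1^g$ start, and at most two end, at each vertex; for each $a\in Q_1^g$ there is at most one $b\in Q_1^g$ with $ba\in I^g$, at most one composable $b$ with $ba\notin I^g$, and dually); $Q_1^p$ consists of degree $0$ loops $\gamma_v$ at distinct vertices $v$; at each such $v$ the arrows of $Q_1^g$ ending (resp. starting) at $v$ are labelled $\alpha_v^-,\beta_v^-$ (resp. $\alpha_v^+,\beta_v^+$; any of the four may be absent) so that $\beta_v^+\alpha_v^-,\ \alpha_v^+\beta_v^-\in I^g$ whenever the arrows exist; and $I^p$ consists of all $\beta_v^+(\gamma_v+e_v)$, $(\gamma_v+e_v)\beta_v^-$, $\alpha_v^+(\gamma_v-e_v)$, $(\gamma_v-e_v)\alpha_v^-$. Let $(\alpha,\beta)$ be an acyclic graded Kronecker of $\Lambda$: two distinct arrows of $Q_1^g$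 of the same degree, with the same source $1$ and the same target $2\neq 1$, with no loop of $Q_1^p$ at $1$ or $2$, and such that neither $\alpha$ nor $\beta$ lies on an oriented cycle of $(Q^g,I^g)$ (a cyclic sequence of arrows of $Q_1^g$ all of whose cyclically consecutive composites are composable paths not in $I^g$). Let $\mu\in K^*$ and $\omega=\alpha+\mu\beta$. Let $\Lambda[\omega^{-1}]$ be the graded algebra obtained from $\Lambda$ by adding an arrow $\delta:2\to1$ of degree $-|\alpha|$ and the relations $\delta\omega=e_1$, $\omega\delta=e_2$. For a graded algebra $\Gamma=KQ'/\langle I'\rangle$ let $\mathcal P(\Gamma)$ be the DG category (with zero differential) with objects $P_i$, $i\in Q'_0$, and $\mathrm{Hom}(P_i,P_j)=e_j\Gamma e_i$. Fix $s\in\mathbb Z$ and let $$B=\Bigl(P_2[|\alpha|+s]\oplus P_1[1+s],\ \begin{pmatrix}0&\omega\\0&0\end{pmatrix}\Bigr)$$ be the corresponding band object, a one-sided twisted complex over $\mathcal P(\Lambda)$. Let $\mathcal A$ be the full DG subcategory of the DG category $\mathcal P(\Lambda)^{\text{pre-tr}}$ of one-sided twisted complexes on the $P_i$ ($i\in Q_0$)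 and $B$, let $\mathcal B$ be its full DG subcategory on $B$, and let $\mathcal A/\mathcal B$ be the Drinfeld DG quotient, obtained from $\mathcal A$ by freely adjoining a morphism $\epsilon:B\to B$ of degree $-1$ with $d\epsilon=\mathrm{id}_B$. Let $(\mathcal A/\mathcal B)_\circ$ be the full DG subcategory of $\mathcal A/\mathcal B$ on the $P_i$. For $a,b\in\{1,2\}$ let $[e_b)$ and $(e_a]$ be the inclusion in $B$ of its summand $P_b$ and the projection of $B$ to its summand $P_a$, and put, in $(\mathcal A/\mathcal B)_\circ$, $$\epsilon_1=(e_1]\epsilon[e_1),\qquad \epsilon_2=(e_2]\epsilon[e_2),\qquad \delta=(e_1]\epsilon[e_2),\qquad \gamma=(e_2]\epsilon[e_1).$$ Then there is a unique DG functor $F:(\mathcal A/\mathcal B)_\circ\to\mathcal P(\Lambda[\omega^{-1}])$ which is the identity on objects, sends every arrow of $Q$ to itself and $\delta$ to $\delta$, and sends $\epsilon_1$, $\epsilon_2$ and $\gamma$ to $0$. This functor is a quasi-equivalence: $H^*(F)$ is fully faithful and $H^0(F)$ is essentially surjective. In particular $(\mathcal A/\mathcal B)_\circ$ is formal, i.e.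 linked by a finite zigzag of quasi-equivalences to its graded homotopy category $H^*((\mathcal A/\mathcal B)_\circ)$ with zero differential. -/

import Mathlib

universe w u v u'

noncomputable section

namespace PinchedDG

open Quiver

/-! ## DG categories over a field (cohomological convention) -/

/-- A DG category over `K`. The Hom complexes are given by their homogeneous components
`Hom X Y n`. Degrees are carried along with equalities `p + q = r`, `n + 1 = m`. -/
structure DGCat (K : Type w) [Field K] where
  Obj : Type u
  Hom : Obj → Obj → ℤ → Type v
  [addCommGroup : ∀ X Y n, AddCommGroup (Hom X Y n)]
  [module : ∀ X Y n, Module K (Hom X Y n)]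
  id : ∀ X, Hom X X 0
  comp : ∀ {X Y Z : Obj} {p q r : ℤ}, p + q = r →
    (Hom Y Z p →ₗ[K] Hom X Y q →ₗ[K] Hom X Z r)
  d : ∀ {X Y : Obj} {n m : ℤ}, n + 1 = m → (Hom X Y n →ₗ[K] Hom X Y m)
  id_comp : ∀ {X Y : Obj} {n : ℤ} (h : 0 + n = n) (f : Hom X Y n), comp h (id Y) f = f
  comp_id : ∀ {X Y : Obj} {n : ℤ} (h : n + 0 = n) (f : Hom X Y n), comp h f (id X) = f
  assoc : ∀ {X Y Z W : Obj} {p q r pq qr s : ℤ} (h₁ : q + r = qr) (h₂ : p + qr = s)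
    (h₃ : p + q = pq) (h₄ : pq + r = s) (e : Hom Z W p) (g : Hom Y Z q) (f : Hom X Y r),
    comp h₂ e (comp h₁ g f) = comp h₄ (comp h₃ e g) f
  d_d : ∀ {X Y : Obj} {n m l : ℤ} (h : n + 1 = m) (h' : m + 1 = l) (f : Hom X Y n),
    d h' (d h f) = 0
  leibniz : ∀ {X Y Z : Obj} {p q r p' q' r' : ℤ} (h : p + q = r) (hr : r + 1 = r')
    (hp : p + 1 = p') (hq : q + 1 = q') (h₁ : p' + q = r') (h₂ : p + q' = r')
    (g : Hom Y Z p) (f : Hom X Y q),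
    d hr (comp h g f) = comp h₁ (d hp g) f + (-1 : K) ^ p • comp h₂ g (d hq f)

attribute [instance] DGCat.addCommGroup DGCat.module

/-- The DG functors from `C` to `D` whose map on objects is `o`. -/
@[ext]
structure DGFunctor {K : Type w} [Field K] (C : DGCat.{w, u, v} K) (D : DGCat.{w, u', v} K)
    (o : C.Obj → D.Obj) where
  map : ∀ {X Y : C.Obj} {n : ℤ}, C.Hom X Y n →ₗ[K] D.Hom (o X) (o Y) n
  map_id : ∀ X, map (C.id X) = D.id (o X)
  map_comp : ∀ {X Y Z : C.Obj} {p q r : ℤ} (h : p + q = r) (g : C.Hom Y Z p) (f : C.Hom X Y q),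
    map (C.comp h g f) = D.comp h (map g) (map f)
  map_d : ∀ {X Y : C.Obj} {n m : ℤ} (h : n + 1 = m) (f : C.Hom X Y n),
    map (C.d h f) = D.d h (map f)

namespace DGCat

variable {K : Type w} [Field K]

/-- Transport of a morphism of degree `n` to an equal degree `m`. -/
def reindex (C : DGCat.{w, u, v} K) {X Y : C.Obj} {n m : ℤ} (h : n = m) :
    C.Hom X Y n →ₗ[K] C.Hom X Y m :=
  C.comp (show 0 + n = m by omega) (C.id Y)

theorem reindex_rfl (C : DGCat.{w, u, v} K) {X Y : C.Obj} {n : ℤ} (h : n = n)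
    (f : C.Hom X Y n) : C.reindex h f = f := C.id_comp _ f

theorem d_id (C : DGCat.{w, u, v} K) (X : C.Obj) {m : ℤ} (h : 0 + 1 = m) :
    C.d h (C.id X) = 0 := by
  subst h
  have := C.leibniz (show (0 : ℤ) + 0 = 0 by rfl) rfl rfl rfl (by rfl) (by rfl) (C.id X) (C.id X)
  rw [C.comp_id, C.comp_id, C.id_comp] at this
  simpa using this

/-- The full DG subcategory on a family of objects. -/
def full (C : DGCat.{w, u, v} K) {O : Type u'} (ι : O → C.Obj) : DGCat.{w, u', v} K where
  Obj := O
  Hom X Y n := C.Hom (ι X) (ι Y) n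
  id X := C.id (ι X)
  comp h := C.comp h
  d h := C.d h
  id_comp := C.id_comp
  comp_id := C.comp_id
  assoc := C.assoc
  d_d := C.d_d
  leibniz := C.leibniz

/-! ### The graded homotopy category and quasi-equivalences -/

/-- Closed morphisms of degree `n`. -/
def cocycles (C : DGCat.{w, u, v} K) (X Y : C.Obj) (n : ℤ) : Submodule K (C.Hom X Y n) :=
  LinearMap.ker (C.d (X := X) (Y := Y) (rfl : n + 1 = n + 1))

/-- Exact morphisms of degree `n`, among the closed ones. -/
def coboundaries (C : DGCat.{w, u, v} K) (X Y : C.Obj) (n : ℤ) : Submodule K (C.cocycles X Y n) :=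
  (LinearMap.range (C.d (X := X) (Y := Y) (sub_add_cancel n 1))).comap (C.cocycles X Y n).subtype

theorem mem_cocycles (C : DGCat.{w, u, v} K) {X Y : C.Obj} {n m : ℤ} (h : n + 1 = m)
    (f : C.Hom X Y n) : f ∈ C.cocycles X Y n ↔ C.d h f = 0 := by
  subst h; rfl

theorem mem_coboundaries (C : DGCat.{w, u, v} K) {X Y : C.Obj} {n m : ℤ} (h : m + 1 = n)
    (f : C.cocycles X Y n) : f ∈ C.coboundaries X Y n ↔ ∃ g, C.d h g = f.1 := by
  obtain rfl : m = n - 1 := by omega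
  rfl

/-- The cohomology `H^n` of the complex of morphisms from `X` to `Y`. -/
abbrev Cohomology (C : DGCat.{w, u, v} K) (X Y : C.Obj) (n : ℤ) : Type v :=
  C.cocycles X Y n ⧸ C.coboundaries X Y n

/-- Composition of closed morphisms. -/
def cocycleComp (C : DGCat.{w, u, v} K) {X Y Z : C.Obj} {p q r : ℤ} (h : p + q = r) :
    C.cocycles Y Z p →ₗ[K] C.cocycles X Y q →ₗ[K] C.cocycles X Z r :=
  LinearMap.mk₂ K (fun g f => ⟨C.comp h g.1 f.1, by
      have hg := (C.mem_cocycles rfl g.1).1 g.2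
      have hf := (C.mem_cocycles rfl f.1).1 f.2
      rw [C.mem_cocycles rfl, C.leibniz h rfl rfl rfl (by omega) (by omega), hg, hf]
      simp⟩)
    (fun _ _ _ => by ext; simp) (fun _ _ _ => by ext; simp)
    (fun _ _ _ => by ext; simp) (fun _ _ _ => by ext; simp)

theorem cocycleComp_left (C : DGCat.{w, u, v} K) {X Y Z : C.Obj} {p q r : ℤ} (h : p + q = r)
    (g : C.cocycles Y Z p) (hg : g ∈ C.coboundaries Y Z p) (f : C.cocycles X Y q) :
    C.cocycleComp h g f ∈ C.coboundaries X Z r := by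
  obtain ⟨g', hg'⟩ := (C.mem_coboundaries (sub_add_cancel p 1) g).1 hg
  have hf := (C.mem_cocycles rfl f.1).1 f.2
  refine (C.mem_coboundaries (m := p - 1 + q) (by omega) _).2
    ⟨C.comp (rfl : p - 1 + q = p - 1 + q) g' f.1, ?_⟩
  rw [C.leibniz rfl _ (sub_add_cancel p 1) rfl h (by omega), hg', hf]
  simp [cocycleComp]

theorem cocycleComp_right (C : DGCat.{w, u, v} K) {X Y Z : C.Obj} {p q r : ℤ} (h : p + q = r)
    (g : C.cocycles Y Z p) (f : C.cocycles X Y q) (hf : f ∈ C.coboundaries X Y q) :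
    C.cocycleComp h g f ∈ C.coboundaries X Z r := by
  obtain ⟨f', hf'⟩ := (C.mem_coboundaries (sub_add_cancel q 1) f).1 hf
  have hg := (C.mem_cocycles rfl g.1).1 g.2
  refine (C.mem_coboundaries (m := p + (q - 1)) (by omega) _).2
    ⟨(-1 : K) ^ p • C.comp (rfl : p + (q - 1) = p + (q - 1)) g.1 f', ?_⟩
  rw [map_smul, C.leibniz rfl _ rfl (sub_add_cancel q 1) (by omega) h, hf', hg]
  simp [cocycleComp, smul_smul, ← mul_zpow]

/-- Composition of cohomology classes. -/
def cohomComp (C : DGCat.{w, u, v} K) {X Y Z : C.Obj} {p q r : ℤ} (h : p + q = r) :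
    C.Cohomology Y Z p →ₗ[K] C.Cohomology X Y q →ₗ[K] C.Cohomology X Z r :=
  Submodule.liftQ _
    { toFun := fun g => Submodule.mapQ _ _ (C.cocycleComp h g)
        (fun f hf => C.cocycleComp_right h g f hf)
      map_add' := fun g g' => by ext f; simp
      map_smul' := fun c g => by ext f; simp }
    (fun g hg => by
      rw [LinearMap.mem_ker]
      ext f
      simpa using C.cocycleComp_left h g hg f)

/-- The graded homotopy category `H^*(C)`, as a DG category with zero differential. -/
def H (C : DGCat.{w, u, v} K) : DGCat.{w, u, v} K where
  Obj := C.Obj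
  Hom X Y n := C.Cohomology X Y n
  id X := Submodule.Quotient.mk ⟨C.id X, (C.mem_cocycles rfl _).2 (C.d_id X rfl)⟩
  comp h := C.cohomComp h
  d _ := 0
  id_comp h f := by
    obtain ⟨f, rfl⟩ := Submodule.Quotient.mk_surjective _ f
    refine congrArg Submodule.Quotient.mk (Subtype.ext ?_)
    exact C.id_comp h f.1
  comp_id h f := by
    obtain ⟨f, rfl⟩ := Submodule.Quotient.mk_surjective _ f
    refine congrArg Submodule.Quotient.mk (Subtype.ext ?_)
    exact C.comp_id h f.1
  assoc h₁ h₂ h₃ h₄ e g f := by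
    obtain ⟨e, rfl⟩ := Submodule.Quotient.mk_surjective _ e
    obtain ⟨g, rfl⟩ := Submodule.Quotient.mk_surjective _ g
    obtain ⟨f, rfl⟩ := Submodule.Quotient.mk_surjective _ f
    refine congrArg Submodule.Quotient.mk (Subtype.ext ?_)
    exact C.assoc h₁ h₂ h₃ h₄ e.1 g.1 f.1
  d_d _ _ _ := rfl
  leibniz _ _ _ _ _ _ _ _ := by simp

end DGCat

namespace DGFunctor

variable {K : Type w} [Field K] {C : DGCat.{w, u, v} K} {D : DGCat.{w, u', v} K}
  {o : C.Obj → D.Obj}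

/-- The functor on closed morphisms. -/
def mapCocycles (F : DGFunctor C D o) (X Y : C.Obj) (n : ℤ) :
    C.cocycles X Y n →ₗ[K] D.cocycles (o X) (o Y) n :=
  (F.map.comp (C.cocycles X Y n).subtype).codRestrict _ (fun f => by
    have hf := (C.mem_cocycles rfl f.1).1 f.2
    rw [D.mem_cocycles rfl]
    change D.d rfl (F.map f.1) = 0
    rw [← F.map_d, hf, map_zero])

/-- The induced functor `H^*(F) : H^*(C) → H^*(D)`, on morphisms of degree `n`. -/
def mapH (F : DGFunctor C D o) (X Y : C.Obj) (n : ℤ) :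
    C.Cohomology X Y n →ₗ[K] D.Cohomology (o X) (o Y) n :=
  Submodule.mapQ _ _ (F.mapCocycles X Y n) (fun f hf => by
    obtain ⟨g, hg⟩ := (C.mem_coboundaries (sub_add_cancel n 1) f).1 hf
    refine (D.mem_coboundaries (sub_add_cancel n 1) _).2 ⟨F.map g, ?_⟩
    rw [← F.map_d, hg]
    rfl)

/-- `F` is a quasi-equivalence: `H^*(F)` is fully faithful and `H^0(F)` is essentially
surjective. -/
def IsQuasiEquivalence (F : DGFunctor C D o) : Prop :=
  (∀ X Y n, Function.Bijective (F.mapH X Y n)) ∧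
  ∀ Y : D.Obj, ∃ (X : C.Obj) (f : D.H.Hom (o X) Y 0) (g : D.H.Hom Y (o X) 0),
    D.H.comp (add_zero 0) f g = D.H.id Y ∧ D.H.comp (add_zero 0) g f = D.H.id (o X)

end DGFunctor

namespace DGCat

variable {K : Type w} [Field K]

/-- Two DG categories are quasi-equivalent if they are linked by a finite zigzag of
quasi-equivalences. -/
def QuasiEquivalent (C D : DGCat.{w, u, v} K) : Prop :=
  Relation.EqvGen (fun C D : DGCat.{w, u, v} K =>
    ∃ (o : C.Obj → D.Obj) (F : DGFunctor C D o), F.IsQuasiEquivalence) C D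

/-- A DG category is formal if it is quasi-equivalent to its graded homotopy category (with zero
differential). -/
def IsFormal (C : DGCat.{w, u, v} K) : Prop := QuasiEquivalent C C.H

/-! ### One-sided twisted complexes -/

/-- A formal finite sum `⨁ᵢ Cᵢ[rᵢ]`. -/
structure ShiftSum (C : DGCat.{w, u, v} K) where
  len : ℕ
  obj : Fin len → C.Obj
  sh : Fin len → ℤ

/-- The DG category of formal finite sums of shifts: a morphism of degree `n` is a matrix whose
entry `Cⱼ[rⱼ] → C'ᵢ[r'ᵢ]` is a morphism `Cⱼ → C'ᵢ` of degree `n + r'ᵢ - rⱼ`; composition is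
matrix multiplication, and the differential `d_naive` is the entrywise one, with the sign
`(-1)^(r'ᵢ)` coming from the shift. -/
def shiftSum (C : DGCat.{w, u, v} K) : DGCat.{w, u, v} K where
  Obj := ShiftSum C
  Hom X Y n := ∀ (i : Fin Y.len) (j : Fin X.len), C.Hom (X.obj j) (Y.obj i) (n + Y.sh i - X.sh j)
  id X := fun i j => Pi.single
    (M := fun i => C.Hom (X.obj j) (X.obj i) (0 + X.sh i - X.sh j)) j
    (C.reindex (by omega) (C.id (X.obj j))) i
  comp {X Y Z p q r} h := LinearMap.mk₂ K
    (fun g f i j => ∑ k : Fin Y.len, C.comp (by omega) (g i k) (f k j))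
    (fun _ _ _ => by funext i j; simp [Finset.sum_add_distrib])
    (fun _ _ _ => by funext i j; simp [Finset.smul_sum])
    (fun _ _ _ => by funext i j; simp [Finset.sum_add_distrib])
    (fun _ _ _ => by funext i j; simp [Finset.smul_sum])
  d {X Y n m} h :=
    { toFun := fun f i j => (-1 : K) ^ Y.sh i • C.d (by omega) (f i j)
      map_add' := fun _ _ => by funext i j; simp
      map_smul' := fun c _ => by funext i j; simp [smul_comm c] }
  id_comp {X Y n} h f := by
    funext i j
    simp only [LinearMap.mk₂_apply]
    rw [Finset.sum_eq_single i]
    · simp only [Pi.single_eq_same, reindex]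
      rw [← C.assoc (q := 0) (qr := n + Y.sh i - X.sh j) (by omega) (by omega) (by omega)
        (by omega), C.id_comp, C.id_comp]
    · intro k _ hk
      simp [Pi.single_eq_of_ne hk.symm]
    · simp
  comp_id {X Y n} h f := by
    funext i j
    simp only [LinearMap.mk₂_apply]
    rw [Finset.sum_eq_single j]
    · simp only [Pi.single_eq_same, reindex]
      rw [C.assoc (q := 0) (pq := n + Y.sh i - X.sh j) (by omega) (by omega) (by omega)
        (by omega), C.comp_id, C.comp_id]
    · intro k _ hk
      simp [Pi.single_eq_of_ne hk]
    · simp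
  assoc {X Y Z W p q r pq qr s} h₁ h₂ h₃ h₄ e g f := by
    funext i j
    simp only [LinearMap.mk₂_apply, map_sum, LinearMap.sum_apply]
    rw [Finset.sum_comm]
    refine Finset.sum_congr rfl fun k _ => Finset.sum_congr rfl fun l _ => ?_
    exact C.assoc _ _ _ _ _ _ _
  d_d h h' f := by
    funext i j
    simp [C.d_d]
  leibniz {X Y Z p q r p' q' r'} h hr hp hq h₁ h₂ g f := by
    funext i j
    simp only [LinearMap.mk₂_apply, LinearMap.coe_mk, AddHom.coe_mk, map_sum, Pi.add_apply,
      Pi.smul_apply, Finset.smul_sum]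
    rw [← Finset.sum_add_distrib]
    refine Finset.sum_congr rfl fun k _ => ?_
    rw [C.leibniz (p' := p' + Z.sh i - Y.sh k) (q' := q' + Y.sh k - X.sh j) _ _ (by omega)
      (by omega) (by omega) (by omega)]
    simp only [map_smul, LinearMap.smul_apply, smul_add, smul_smul]
    congr 2
    rw [← zpow_add₀ (by simp), ← zpow_add₀ (by simp),
      show Z.sh i + (p + Z.sh i - Y.sh k) = (p + Y.sh k) + 2 * (Z.sh i - Y.sh k) by ring,
      zpow_add₀ (by simp), zpow_mul]
    simp

theorem maurer_cartan_of_entries (C : DGCat.{w, u, v} K) (X : C.shiftSum.Obj)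
    (f : C.shiftSum.Hom X X 1)
    (hd : ∀ i j m h, C.d (m := m) h (f i j) = 0) (h : ∀ i k j, f i k = 0 ∨ f k j = 0) :
    C.shiftSum.d (m := 2) rfl f + C.shiftSum.comp (r := 2) rfl f f = 0 := by
  have h₁ : C.shiftSum.d (m := 2) rfl f = 0 := by
    funext i j
    change (-1 : K) ^ _ • C.d _ (f i j) = 0
    rw [hd, smul_zero]
  have h₂ : C.shiftSum.comp (r := 2) rfl f f = 0 := by
    funext i j
    change ∑ k, C.comp _ (f i k) (f k j) = 0
    refine Finset.sum_eq_zero fun k _ => ?_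
    rcases h i k j with h | h
    · rw [h, map_zero, LinearMap.zero_apply]
    · rw [h, map_zero]
  rw [h₁, h₂, add_zero]

/-- One-sided twisted complexes: a formal sum `⨁ᵢ Cᵢ[rᵢ]` with a strictly upper triangular
endomorphism `∂` of degree `1` such that `d_naive ∂ + ∂² = 0`. -/
structure TwistedComplex (C : DGCat.{w, u, v} K) where
  base : C.shiftSum.Obj
  del : C.shiftSum.Hom base base 1
  del_eq_zero : ∀ i j, j ≤ i → del i j = 0
  maurer_cartan : C.shiftSum.d (m := 2) rfl del + C.shiftSum.comp (r := 2) rfl del del = 0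

/-- The DG category `C^{pre-tr}` of one-sided twisted complexes, with
`d f = d_naive f + ∂' f - (-1)^n f ∂` for `f` of degree `n`. -/
def pretr (C : DGCat.{w, u, v} K) : DGCat.{w, max u v, v} K where
  Obj := TwistedComplex C
  Hom X Y n := C.shiftSum.Hom X.base Y.base n
  id X := C.shiftSum.id X.base
  comp h := C.shiftSum.comp h
  d {X Y n m} h := C.shiftSum.d h + C.shiftSum.comp (show 1 + n = m by omega) Y.del
    - (-1 : K) ^ n • (C.shiftSum.comp (show n + 1 = m from h)).flip X.del
  id_comp := C.shiftSum.id_comp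
  comp_id := C.shiftSum.comp_id
  assoc := C.shiftSum.assoc
  d_d {X Y n m l} h h' f := by
    subst h
    subst h'
    have hX := X.maurer_cartan
    have hY := Y.maurer_cartan
    simp only [LinearMap.sub_apply, LinearMap.add_apply, LinearMap.smul_apply,
      LinearMap.flip_apply, map_sub, map_add, map_smul]
    rw [C.shiftSum.d_d,
      C.shiftSum.leibniz (p' := 2) (q' := n + 1) (show 1 + n = n + 1 by omega) rfl rfl rfl
        (by omega) (by omega),
      C.shiftSum.leibniz (p' := n + 1) (q' := 2) (rfl : n + 1 = n + 1) rfl rfl rfl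
        (by omega) (by omega)]
    rw [C.shiftSum.assoc (pq := 2) (p := 1) (q := 1) (by omega) (by omega) rfl (by omega) Y.del
        Y.del f,
      ← C.shiftSum.assoc (qr := 2) (q := 1) (r := 1) rfl (by omega) (by omega) (by omega) f
        X.del X.del,
      C.shiftSum.assoc (pq := n + 1) (p := 1) (q := n) (r := 1) (by omega) (by omega) (by omega)
        (by omega) Y.del f X.del]
    rw [eq_neg_of_add_eq_zero_left hX, eq_neg_of_add_eq_zero_left hY]
    have hn : ((-1 : K) ^ n) * (-1) ^ n = 1 := by rw [← mul_zpow]; simp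
    simp only [map_neg, LinearMap.neg_apply, smul_add, smul_sub, smul_smul, zpow_one,
      zpow_add₀ (show (-1 : K) ≠ 0 by simp), hn, mul_neg, mul_one, neg_smul, one_smul,
      smul_neg]
    abel
  leibniz {X Y Z p q r p' q' r'} h hr hp hq h₁ h₂ g f := by
    subst hp
    subst hq
    simp only [LinearMap.sub_apply, LinearMap.add_apply, LinearMap.smul_apply,
      LinearMap.flip_apply, map_sub, map_add, map_smul]
    rw [C.shiftSum.leibniz h hr rfl rfl h₁ h₂,
      C.shiftSum.assoc (p := 1) (pq := p + 1) h (by omega) (by omega) h₁ Z.del g f,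
      ← C.shiftSum.assoc (qr := q + 1) (r := 1) rfl h₂ h (by omega) g f X.del,
      ← C.shiftSum.assoc (p := p) (q := 1) (qr := q + 1) (by omega) h₂ rfl h₁ g Y.del f]
    obtain rfl : r = p + q := by omega
    simp only [smul_add, smul_sub, smul_smul, zpow_add₀ (show (-1 : K) ≠ 0 by simp)]
    abel

abbrev TwistedComplex.len {C : DGCat.{w, u, v} K} (X : TwistedComplex C) : ℕ :=
  ShiftSum.len X.base

abbrev TwistedComplex.obj {C : DGCat.{w, u, v} K} (X : TwistedComplex C) :
    Fin X.len → C.Obj := ShiftSum.obj X.base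

abbrev TwistedComplex.sh {C : DGCat.{w, u, v} K} (X : TwistedComplex C) :
    Fin X.len → ℤ := ShiftSum.sh X.base

/-- The formal sum with the single summand `X[0]`. -/
def shiftSingle (C : DGCat.{w, u, v} K) (X : C.Obj) : C.shiftSum.Obj :=
  ShiftSum.mk 1 (fun _ => X) (fun _ => 0)

/-- An object of `C`, as a twisted complex concentrated in one degree. -/
def TwistedComplex.stalk (C : DGCat.{w, u, v} K) (X : C.Obj) : TwistedComplex C where
  base := C.shiftSingle X
  del := 0
  del_eq_zero _ _ _ := rfl
  maurer_cartan := by simp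

/-- The embedding of `C` into `C^{pre-tr}` on morphisms. -/
def TwistedComplex.stalkHom (C : DGCat.{w, u, v} K) {X Y : C.Obj} {n : ℤ} (f : C.Hom X Y n) :
    C.pretr.Hom (stalk C X) (stalk C Y) n :=
  fun _ _ => C.reindex (show n = n + 0 - 0 by omega) f

/-- The morphism `[id) : C_k → X`, of degree `-r_k`, whose only nonzero entry is the identity of
`C_k`. -/
def TwistedComplex.incl {C : DGCat.{w, u, v} K} (X : TwistedComplex C) (k : Fin X.len) :
    C.pretr.Hom (stalk C (X.obj k)) X (-X.sh k) :=
  fun i _ => Pi.single (M := fun i => C.Hom (X.obj k) (X.obj i) (-X.sh k + X.sh i - 0)) k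
    (C.reindex (by omega) (C.id (X.obj k))) i

/-- The morphism `(id] : X → C_k`, of degree `r_k`, whose only nonzero entry is the identity of
`C_k`. -/
def TwistedComplex.proj {C : DGCat.{w, u, v} K} (X : TwistedComplex C) (k : Fin X.len) :
    C.pretr.Hom X (stalk C (X.obj k)) (X.sh k) :=
  fun _ j => Pi.single (M := fun j => C.Hom (X.obj j) (X.obj k) (X.sh k + 0 - X.sh j)) k
    (C.reindex (by omega) (C.id (X.obj k))) j

/-! ### The Drinfeld quotient -/

/-- Formal expressions in the morphisms of `C` and new morphisms `ε_U : U → U` of degree `-1`,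
for `U ∈ S`. -/
inductive QuotExpr (C : DGCat.{w, u, v} K) (S : Set C.Obj) :
    C.Obj → C.Obj → ℤ → Type (max u v w) where
  | of {X Y : C.Obj} {n : ℤ} (f : C.Hom X Y n) : QuotExpr C S X Y n
  | eps {U : C.Obj} {n : ℤ} (hU : U ∈ S) (hn : n = -1) : QuotExpr C S U U n
  | comp {X Y Z : C.Obj} {p q r : ℤ} (h : p + q = r) (g : QuotExpr C S Y Z p)
      (f : QuotExpr C S X Y q) : QuotExpr C S X Z r
  | add {X Y : C.Obj} {n : ℤ} (f g : QuotExpr C S X Y n) : QuotExpr C S X Y n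
  | smul {X Y : C.Obj} {n : ℤ} (c : K) (f : QuotExpr C S X Y n) : QuotExpr C S X Y n

/-- The relations between formal expressions: the axioms of a graded `K`-linear category, and those
saying that `C` maps to it by a graded `K`-linear functor. No relation involves `ε` specially. -/
inductive QuotRel (C : DGCat.{w, u, v} K) (S : Set C.Obj) :
    ∀ {X Y : C.Obj} {n : ℤ}, QuotExpr C S X Y n → QuotExpr C S X Y n → Prop where
  | add_congr_left {X Y : C.Obj} {n : ℤ} {f f' : QuotExpr C S X Y n} (g : QuotExpr C S X Y n) :
      QuotRel C S f f' → QuotRel C S (.add f g) (.add f' g)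
  | smul_congr {X Y : C.Obj} {n : ℤ} {f f' : QuotExpr C S X Y n} (c : K) :
      QuotRel C S f f' → QuotRel C S (.smul c f) (.smul c f')
  | comp_congr_left {X Y Z : C.Obj} {p q r : ℤ} (h : p + q = r) {g g' : QuotExpr C S Y Z p}
      (f : QuotExpr C S X Y q) : QuotRel C S g g' → QuotRel C S (.comp h g f) (.comp h g' f)
  | comp_congr_right {X Y Z : C.Obj} {p q r : ℤ} (h : p + q = r) (g : QuotExpr C S Y Z p)
      {f f' : QuotExpr C S X Y q} : QuotRel C S f f' → QuotRel C S (.comp h g f) (.comp h g f')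
  | add_congr_right {X Y : C.Obj} {n : ℤ} (f : QuotExpr C S X Y n) {g g' : QuotExpr C S X Y n} :
      QuotRel C S g g' → QuotRel C S (.add f g) (.add f g')
  | add_comm {X Y : C.Obj} {n : ℤ} (f g : QuotExpr C S X Y n) : QuotRel C S (.add f g) (.add g f)
  | add_assoc {X Y : C.Obj} {n : ℤ} (f g e : QuotExpr C S X Y n) :
      QuotRel C S (.add (.add f g) e) (.add f (.add g e))
  | zero_add {X Y : C.Obj} {n : ℤ} (f : QuotExpr C S X Y n) : QuotRel C S (.add (.of 0) f) f
  | neg_add {X Y : C.Obj} {n : ℤ} (f : QuotExpr C S X Y n) :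
      QuotRel C S (.add (.smul (-1) f) f) (.of 0)
  | smul_add {X Y : C.Obj} {n : ℤ} (c : K) (f g : QuotExpr C S X Y n) :
      QuotRel C S (.smul c (.add f g)) (.add (.smul c f) (.smul c g))
  | add_smul {X Y : C.Obj} {n : ℤ} (a b : K) (f : QuotExpr C S X Y n) :
      QuotRel C S (.smul (a + b) f) (.add (.smul a f) (.smul b f))
  | mul_smul {X Y : C.Obj} {n : ℤ} (a b : K) (f : QuotExpr C S X Y n) :
      QuotRel C S (.smul (a * b) f) (.smul a (.smul b f))
  | one_smul {X Y : C.Obj} {n : ℤ} (f : QuotExpr C S X Y n) : QuotRel C S (.smul 1 f) f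
  | comp_add {X Y Z : C.Obj} {p q r : ℤ} (h : p + q = r) (g : QuotExpr C S Y Z p)
      (f f' : QuotExpr C S X Y q) :
      QuotRel C S (.comp h g (.add f f')) (.add (.comp h g f) (.comp h g f'))
  | add_comp {X Y Z : C.Obj} {p q r : ℤ} (h : p + q = r) (g g' : QuotExpr C S Y Z p)
      (f : QuotExpr C S X Y q) :
      QuotRel C S (.comp h (.add g g') f) (.add (.comp h g f) (.comp h g' f))
  | comp_smul {X Y Z : C.Obj} {p q r : ℤ} (h : p + q = r) (c : K) (g : QuotExpr C S Y Z p)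
      (f : QuotExpr C S X Y q) : QuotRel C S (.comp h g (.smul c f)) (.smul c (.comp h g f))
  | smul_comp {X Y Z : C.Obj} {p q r : ℤ} (h : p + q = r) (c : K) (g : QuotExpr C S Y Z p)
      (f : QuotExpr C S X Y q) : QuotRel C S (.comp h (.smul c g) f) (.smul c (.comp h g f))
  | comp_assoc {X Y Z W : C.Obj} {p q r pq qr s : ℤ} (h₁ : q + r = qr) (h₂ : p + qr = s)
      (h₃ : p + q = pq) (h₄ : pq + r = s) (e : QuotExpr C S Z W p) (g : QuotExpr C S Y Z q)
      (f : QuotExpr C S X Y r) :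
      QuotRel C S (.comp h₂ e (.comp h₁ g f)) (.comp h₄ (.comp h₃ e g) f)
  | id_comp {X Y : C.Obj} {n : ℤ} (h : 0 + n = n) (f : QuotExpr C S X Y n) :
      QuotRel C S (.comp h (.of (C.id Y)) f) f
  | comp_id {X Y : C.Obj} {n : ℤ} (h : n + 0 = n) (f : QuotExpr C S X Y n) :
      QuotRel C S (.comp h f (.of (C.id X))) f
  | of_add {X Y : C.Obj} {n : ℤ} (f g : C.Hom X Y n) :
      QuotRel C S (.of (f + g)) (.add (.of f) (.of g))
  | of_smul {X Y : C.Obj} {n : ℤ} (c : K) (f : C.Hom X Y n) :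
      QuotRel C S (.of (c • f)) (.smul c (.of f))
  | of_comp {X Y Z : C.Obj} {p q r : ℤ} (h : p + q = r) (g : C.Hom Y Z p) (f : C.Hom X Y q) :
      QuotRel C S (.of (C.comp h g f)) (.comp h (.of g) (.of f))

/-- Morphisms of degree `n` in the Drinfeld quotient. -/
def QuotHom (C : DGCat.{w, u, v} K) (S : Set C.Obj) (X Y : C.Obj) (n : ℤ) : Type (max u v w) :=
  Quot (QuotRel C S (X := X) (Y := Y) (n := n))

namespace QuotHom

variable {C : DGCat.{w, u, v} K} {S : Set C.Obj}

/-- The class of a formal expression. -/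
def mk {X Y : C.Obj} {n : ℤ} (f : QuotExpr C S X Y n) : QuotHom C S X Y n := Quot.mk _ f

theorem ind {X Y : C.Obj} {n : ℤ} {P : QuotHom C S X Y n → Prop}
    (h : ∀ f : QuotExpr C S X Y n, P (mk f)) (x : QuotHom C S X Y n) : P x :=
  Quot.ind h x

theorem sound {X Y : C.Obj} {n : ℤ} {f g : QuotExpr C S X Y n} (h : QuotRel C S f g) :
    mk f = mk g := Quot.sound h

instance (X Y : C.Obj) (n : ℤ) : Zero (QuotHom C S X Y n) := ⟨mk (.of 0)⟩

instance (X Y : C.Obj) (n : ℤ) : Add (QuotHom C S X Y n) :=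
  ⟨Quot.map₂ QuotExpr.add (fun f _ _ h => QuotRel.add_congr_right f h)
    (fun _ _ g h => QuotRel.add_congr_left g h)⟩

instance (X Y : C.Obj) (n : ℤ) : SMul K (QuotHom C S X Y n) :=
  ⟨fun c => Quot.map (QuotExpr.smul c) (fun _ _ h => QuotRel.smul_congr c h)⟩

instance (X Y : C.Obj) (n : ℤ) : Neg (QuotHom C S X Y n) := ⟨fun x => (-1 : K) • x⟩

instance (X Y : C.Obj) (n : ℤ) : AddCommGroup (QuotHom C S X Y n) where
  add_assoc x y z := by
    induction x using ind; induction y using ind; induction z using ind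
    exact sound (.add_assoc _ _ _)
  zero_add x := by
    induction x using ind
    exact sound (.zero_add _)
  add_zero x := by
    induction x using ind
    exact (sound (.add_comm _ _)).trans (sound (.zero_add _))
  add_comm x y := by
    induction x using ind; induction y using ind
    exact sound (.add_comm _ _)
  neg_add_cancel x := by
    induction x using ind
    exact sound (.neg_add _)
  nsmul := nsmulRec
  zsmul := zsmulRec

instance (X Y : C.Obj) (n : ℤ) : Module K (QuotHom C S X Y n) :=
  Module.ofMinimalAxioms
    (fun c x y => by
      induction x using ind; induction y using ind
      exact sound (.smul_add _ _ _))
    (fun a b x => by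
      induction x using ind
      exact sound (.add_smul _ _ _))
    (fun a b x => by
      induction x using ind
      exact sound (.mul_smul _ _ _))
    (fun x => by
      induction x using ind
      exact sound (.one_smul _))

/-- Composition of morphisms in the Drinfeld quotient. -/
def comp {X Y Z : C.Obj} {p q r : ℤ} (h : p + q = r) :
    QuotHom C S Y Z p →ₗ[K] QuotHom C S X Y q →ₗ[K] QuotHom C S X Z r :=
  LinearMap.mk₂ K
    (Quot.map₂ (QuotExpr.comp h) (fun g _ _ hf => QuotRel.comp_congr_right h g hf)
      (fun _ _ f hg => QuotRel.comp_congr_left h f hg))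
    (fun x y z => by
      induction x using ind; induction y using ind; induction z using ind
      exact sound (.add_comp _ _ _ _))
    (fun c x y => by
      induction x using ind; induction y using ind
      exact sound (.smul_comp _ _ _ _))
    (fun x y z => by
      induction x using ind; induction y using ind; induction z using ind
      exact sound (.comp_add _ _ _ _))
    (fun c x y => by
      induction x using ind; induction y using ind
      exact sound (.comp_smul _ _ _ _))

variable (S) in
/-- The image in the Drinfeld quotient of a morphism of `C`. -/
def of {X Y : C.Obj} {n : ℤ} : C.Hom X Y n →ₗ[K] QuotHom C S X Y n where
  toFun f := mk (.of f)
  map_add' f g := sound (.of_add f g)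
  map_smul' c f := sound (.of_smul c f)

/-- The new morphism `ε_U`. -/
def eps {U : C.Obj} (hU : U ∈ S) : QuotHom C S U U (-1) := mk (.eps hU rfl)

theorem assoc {X Y Z W : C.Obj} {p q r pq qr s : ℤ} (h₁ : q + r = qr) (h₂ : p + qr = s)
    (h₃ : p + q = pq) (h₄ : pq + r = s) (x : QuotHom C S Z W p) (y : QuotHom C S Y Z q)
    (z : QuotHom C S X Y r) : comp h₂ x (comp h₁ y z) = comp h₄ (comp h₃ x y) z := by
  induction x using ind; induction y using ind; induction z using ind
  exact sound (.comp_assoc _ _ _ _ _ _ _)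

theorem id_comp {X Y : C.Obj} {n : ℤ} (h : 0 + n = n) (x : QuotHom C S X Y n) :
    comp h (of S (C.id Y)) x = x := by
  induction x using ind
  exact sound (.id_comp _ _)

theorem comp_id {X Y : C.Obj} {n : ℤ} (h : n + 0 = n) (x : QuotHom C S X Y n) :
    comp h x (of S (C.id X)) = x := by
  induction x using ind
  exact sound (.comp_id _ _)

theorem of_comp {X Y Z : C.Obj} {p q r : ℤ} (h : p + q = r) (g : C.Hom Y Z p) (f : C.Hom X Y q) :
    of S (C.comp h g f) = comp h (of S g) (of S f) := sound (.of_comp h g f)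

/-- The differential on formal expressions: that of `C` on morphisms of `C`, the identity of `U` on
`ε_U`, extended by linearity and by the Leibniz rule. -/
def dExpr {X Y : C.Obj} {n : ℤ} :
    QuotExpr C S X Y n → ∀ m : ℤ, n + 1 = m → QuotHom C S X Y m
  | .of f, _, h => of S (C.d h f)
  | .eps (U := U) _ hn, _, h => of S (C.reindex (by omega) (C.id U))
  | .comp (p := p) (q := q) hpq g f, _, h =>
      comp (by omega) (dExpr g (p + 1) rfl) (mk f) +
        (-1 : K) ^ p • comp (by omega) (mk g) (dExpr f (q + 1) rfl)
  | .add f g, m, h => dExpr f m h + dExpr g m h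
  | .smul c f, m, h => c • dExpr f m h

theorem mk_comp {X Y Z : C.Obj} {p q r : ℤ} (h : p + q = r) (g : QuotExpr C S Y Z p)
    (f : QuotExpr C S X Y q) : mk (.comp h g f) = comp h (mk g) (mk f) := rfl

theorem mk_add {X Y : C.Obj} {n : ℤ} (f g : QuotExpr C S X Y n) :
    mk (.add f g) = mk f + mk g := rfl

theorem mk_smul {X Y : C.Obj} {n : ℤ} (c : K) (f : QuotExpr C S X Y n) :
    mk (.smul c f) = c • mk f := rfl

theorem mk_of {X Y : C.Obj} {n : ℤ} (f : C.Hom X Y n) : mk (.of f) = of S f := rfl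

theorem dExpr_rel {X Y : C.Obj} {n : ℤ} {f g : QuotExpr C S X Y n} (h : QuotRel C S f g) :
    ∀ (m : ℤ) (hm : n + 1 = m), dExpr f m hm = dExpr g m hm := by
  induction h with
  | add_congr_left g h ih => intro m hm; simp only [dExpr, ih m hm]
  | add_congr_right g h ih => intro m hm; simp only [dExpr, ih m hm]
  | smul_congr c h ih => intro m hm; simp only [dExpr, ih m hm]
  | comp_congr_left h f hr ih => intro m hm; simp only [dExpr, ih _ rfl, sound hr]
  | comp_congr_right h g hr ih => intro m hm; simp only [dExpr, ih _ rfl, sound hr]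
  | add_comm f g => intro m hm; simp only [dExpr]; exact _root_.add_comm _ _
  | add_assoc f g e => intro m hm; simp only [dExpr]; exact _root_.add_assoc _ _ _
  | zero_add f => intro m hm; simp [dExpr]
  | neg_add f => intro m hm; simp [dExpr]
  | smul_add c f g => intro m hm; simp only [dExpr]; exact _root_.smul_add _ _ _
  | add_smul a b f => intro m hm; simp only [dExpr]; exact _root_.add_smul _ _ _
  | mul_smul a b f => intro m hm; simp only [dExpr]; exact SemigroupAction.mul_smul _ _ _
  | one_smul f => intro m hm; simp only [dExpr]; exact _root_.one_smul _ _
  | comp_add h g f f' =>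
    intro m hm
    simp only [dExpr, mk_add, map_add, _root_.smul_add]
    abel
  | add_comp h g g' f =>
    intro m hm
    simp only [dExpr, mk_add, map_add, LinearMap.add_apply, _root_.smul_add]
    abel
  | comp_smul h c g f =>
    intro m hm
    simp only [dExpr, mk_smul, map_smul, _root_.smul_add, smul_comm c]
  | smul_comp h c g f =>
    intro m hm
    simp only [dExpr, mk_smul, map_smul, LinearMap.smul_apply, _root_.smul_add, smul_comm c]
  | @comp_assoc X Y Z W p q r pq qr s h₁ h₂ h₃ h₄ e g f =>
    intro m hm
    subst h₁
    subst h₃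
    simp only [dExpr, mk_comp, map_add, map_smul, LinearMap.add_apply, LinearMap.smul_apply,
      _root_.smul_add, smul_smul]
    rw [assoc (p := p + 1) (pq := p + q + 1) rfl (by omega) (by omega) (by omega),
      assoc (q := q + 1) (pq := p + q + 1) (by omega) (by omega) (by omega) (by omega),
      assoc (p := p) (r := r + 1) (pq := p + q) (by omega) (by omega) rfl (by omega),
      ← zpow_add₀ (by simp)]
    exact (_root_.add_assoc _ _ _).symm
  | id_comp h f =>
    intro m hm
    subst hm
    simp only [dExpr, C.d_id, map_zero, LinearMap.zero_apply, _root_.zero_add, zpow_zero,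
      _root_.one_smul, mk_of, QuotHom.id_comp]
  | comp_id h f =>
    intro m hm
    subst hm
    simp only [dExpr, C.d_id, map_zero, smul_zero, _root_.add_zero, mk_of, QuotHom.comp_id]
  | of_add f g => intro m hm; simp only [dExpr, map_add]
  | of_smul c f => intro m hm; simp only [dExpr, map_smul]
  | @of_comp X Y Z p q r h g f =>
    intro m hm
    simp only [dExpr, mk_of, ← QuotHom.of_comp]
    rw [← map_smul (of S), ← map_add]
    exact congrArg _ (C.leibniz _ _ _ _ _ _ _ _)

/-- The differential of the Drinfeld quotient. -/
def d {X Y : C.Obj} {n m : ℤ} (h : n + 1 = m) : QuotHom C S X Y n →ₗ[K] QuotHom C S X Y m where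
  toFun := Quot.lift (fun f => dExpr f m h) (fun _ _ hfg => dExpr_rel hfg m h)
  map_add' x y := by
    induction x using ind; induction y using ind
    rfl
  map_smul' c x := by
    induction x using ind
    rfl

theorem d_mk {X Y : C.Obj} {n m : ℤ} (h : n + 1 = m) (f : QuotExpr C S X Y n) :
    d h (mk f) = dExpr f m h := rfl

theorem leibniz {X Y Z : C.Obj} {p q r p' q' r' : ℤ} (h : p + q = r) (hr : r + 1 = r')
    (hp : p + 1 = p') (hq : q + 1 = q') (h₁ : p' + q = r') (h₂ : p + q' = r')
    (x : QuotHom C S Y Z p) (y : QuotHom C S X Y q) :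
    d hr (comp h x y) = comp h₁ (d hp x) y + (-1 : K) ^ p • comp h₂ x (d hq y) := by
  subst hp
  subst hq
  induction x using ind
  induction y using ind
  rfl

theorem d_of {X Y : C.Obj} {n m : ℤ} (h : n + 1 = m) (f : C.Hom X Y n) :
    d h (of S f) = of S (C.d h f) := rfl

theorem d_d {X Y : C.Obj} {n m l : ℤ} (h : n + 1 = m) (h' : m + 1 = l)
    (x : QuotHom C S X Y n) : d h' (d h x) = 0 := by
  induction x using ind with
  | h f =>
    rw [d_mk]
    induction f generalizing m l with
    | of f => rw [dExpr, d_of, C.d_d, map_zero]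
    | eps hU hn =>
      obtain rfl : m = 0 := by omega
      rw [dExpr, d_of, reindex_rfl, C.d_id, map_zero]
    | @comp X Y Z p q r hpq g f ihg ihf =>
      subst hpq
      subst h
      rw [dExpr, map_add, map_smul,
        leibniz (p' := p + 1 + 1) (q' := q + 1) (by omega) h' rfl rfl (by omega) (by omega),
        leibniz (p' := p + 1) (q' := q + 1 + 1) (by omega) h' rfl rfl (by omega) (by omega),
        ihg, ihf, d_mk, d_mk]
      simp [zpow_add₀ (show (-1 : K) ≠ 0 by simp)]
    | add f g ihf ihg => rw [dExpr, map_add, ihf, ihg, _root_.add_zero]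
    | smul c f ih => rw [dExpr, map_smul, ih, smul_zero]

end QuotHom

/-- The Drinfeld quotient of `C` by its full subcategory on the set of objects `S`: freely adjoin
to `C` morphisms `ε_U : U → U` of degree `-1` with `d ε_U = id_U`, for `U ∈ S`. -/
def drinfeld (C : DGCat.{w, u, v} K) (S : Set C.Obj) : DGCat.{w, u, max u v w} K where
  Obj := C.Obj
  Hom := QuotHom C S
  id X := QuotHom.of S (C.id X)
  comp := QuotHom.comp
  d := QuotHom.d
  id_comp := QuotHom.id_comp
  comp_id := QuotHom.comp_id
  assoc := QuotHom.assoc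
  d_d := QuotHom.d_d
  leibniz := QuotHom.leibniz

end DGCat
/-! ## Graded quivers with relations -/

/-- A graded quiver; finiteness is required where it is used. -/
structure GradedQuiver where
  V : Type u
  E : Type u
  src : E → V
  tgt : E → V
  deg : E → ℤ

namespace GradedQuiver

/-- Arrows from `x` to `y`. -/
def Arrow (Q : GradedQuiver.{u}) (x y : Q.V) : Type u := {e : Q.E // Q.src e = x ∧ Q.tgt e = y}

instance (Q : GradedQuiver.{u}) : Quiver Q.V := ⟨Q.Arrow⟩

/-- The degree of a path is the sum of the degrees of its arrows. -/
def pathDeg (Q : GradedQuiver.{u}) {x : Q.V} : ∀ {y : Q.V}, Path x y → ℤ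
  | _, .nil => 0
  | _, .cons p e => Q.pathDeg p + Q.deg e.1

theorem pathDeg_comp (Q : GradedQuiver.{u}) {x y z : Q.V} (p : Path x y) (q : Path y z) :
    Q.pathDeg (p.comp q) = Q.pathDeg p + Q.pathDeg q := by
  induction q with
  | nil => simp [pathDeg]
  | cons q e ih => simp [pathDeg, ih, add_assoc]

variable (K : Type w) [Field K]

/-- `e_y KQ e_x`: linear combinations of paths from `x` to `y`. -/
abbrev FreeHom (Q : GradedQuiver.{u}) (x y : Q.V) : Type (max u w) := Path x y →₀ K

variable {K}

/-- Multiplication in the path algebra. In `pathMul g f` the path `f` comes first. Note that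
Mathlib's `Path.comp p q` runs through `p` first. -/
def pathMul (Q : GradedQuiver.{u}) {x y z : Q.V} :
    Q.FreeHom K y z →ₗ[K] Q.FreeHom K x y →ₗ[K] Q.FreeHom K x z :=
  Finsupp.linearCombination K
    (fun q : Path y z => Finsupp.lmapDomain K K (fun p : Path x y => p.comp q))

theorem pathMul_single (Q : GradedQuiver.{u}) {x y z : Q.V} (q : Path y z) (p : Path x y)
    (a b : K) : Q.pathMul (Finsupp.single q a) (Finsupp.single p b)
      = Finsupp.single (p.comp q) (a * b) := by
  simp [pathMul]

theorem pathMul_nil (Q : GradedQuiver.{u}) {x y : Q.V} (f : Q.FreeHom K x y) :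
    Q.pathMul f (Finsupp.single Path.nil 1) = f := by
  induction f using Finsupp.induction_linear with
  | zero => simp
  | add f f' ih ih' => simp only [map_add, LinearMap.add_apply, ih, ih']
  | single p a => rw [pathMul_single, Path.nil_comp, mul_one]

theorem pathMul_assoc (Q : GradedQuiver.{u}) {x y z t : Q.V} (h : Q.FreeHom K z t)
    (g : Q.FreeHom K y z) (f : Q.FreeHom K x y) :
    Q.pathMul h (Q.pathMul g f) = Q.pathMul (Q.pathMul h g) f := by
  induction h using Finsupp.induction_linear with
  | zero => simp
  | add h h' ih ih' => simp only [map_add, LinearMap.add_apply, ih, ih']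
  | single r c =>
    induction g using Finsupp.induction_linear with
    | zero => simp
    | add h h' ih ih' => simp only [map_add, LinearMap.add_apply, ih, ih']
    | single q b =>
      induction f using Finsupp.induction_linear with
      | zero => simp
      | add h h' ih ih' => simp only [map_add, ih, ih']
      | single p a => simp only [pathMul_single, mul_assoc, Path.comp_assoc]

/-- A family of relations: for all vertices `x`, `y`, a set of elements of `e_y KQ e_x`. -/
abbrev Relations (K : Type w) [Field K] (Q : GradedQuiver.{u}) : Type (max u w) :=
  ∀ x y : Q.V, Set (Q.FreeHom K x y)

/-- `e_y ⟨I⟩ e_x`, for the two-sided ideal `⟨I⟩` generated by the relations `I`. -/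
def ideal (Q : GradedQuiver.{u}) (I : Relations K Q) (x y : Q.V) : Submodule K (Q.FreeHom K x y) :=
  Submodule.span K {f | ∃ (a b : Q.V) (q : Q.FreeHom K b y) (r : Q.FreeHom K a b)
    (p : Q.FreeHom K x a), r ∈ I a b ∧ f = Q.pathMul q (Q.pathMul r p)}

theorem pathMul_mem_left (Q : GradedQuiver.{u}) (I : Relations K Q) {x y z : Q.V}
    (g : Q.FreeHom K y z) {f : Q.FreeHom K x y} (hf : f ∈ Q.ideal I x y) :
    Q.pathMul g f ∈ Q.ideal I x z := by
  refine (Submodule.span_le (p := (Q.ideal I x z).comap (Q.pathMul g))).2 ?_ hf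
  rintro _ ⟨a, b, q, r, p, hr, rfl⟩
  exact Submodule.subset_span ⟨a, b, Q.pathMul g q, r, p, hr, Q.pathMul_assoc _ _ _⟩

theorem pathMul_mem_right (Q : GradedQuiver.{u}) (I : Relations K Q) {x y z : Q.V}
    {g : Q.FreeHom K y z} (hg : g ∈ Q.ideal I y z) (f : Q.FreeHom K x y) :
    Q.pathMul g f ∈ Q.ideal I x z := by
  refine (Submodule.span_le (p := (Q.ideal I x z).comap (Q.pathMul.flip f))).2 ?_ hg
  rintro _ ⟨a, b, q, r, p, hr, rfl⟩
  refine Submodule.subset_span ⟨a, b, q, r, Q.pathMul p f, hr, ?_⟩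
  simp [pathMul_assoc]

/-- `e_y Λ e_x`, for `Λ = KQ / ⟨I⟩`. -/
abbrev QuotAlg (Q : GradedQuiver.{u}) (I : Relations K Q) (x y : Q.V) : Type (max u w) :=
  Q.FreeHom K x y ⧸ Q.ideal I x y

/-- Multiplication in `Λ = KQ / ⟨I⟩`. -/
def mul (Q : GradedQuiver.{u}) (I : Relations K Q) {x y z : Q.V} :
    Q.QuotAlg I y z →ₗ[K] Q.QuotAlg I x y →ₗ[K] Q.QuotAlg I x z :=
  Submodule.liftQ _
    { toFun := fun g => Submodule.mapQ _ _ (Q.pathMul g) (fun _ hf => Q.pathMul_mem_left I g hf)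
      map_add' := fun g g' => by ext f; simp
      map_smul' := fun c g => by ext f; simp }
    (fun g hg => by
      rw [LinearMap.mem_ker]
      ext f
      simpa using Q.pathMul_mem_right I hg (Finsupp.single f 1))

theorem mul_mk (Q : GradedQuiver.{u}) (I : Relations K Q) {x y z : Q.V} (g : Q.FreeHom K y z)
    (f : Q.FreeHom K x y) : Q.mul I ((Q.ideal I y z).mkQ g) ((Q.ideal I x y).mkQ f)
      = (Q.ideal I x z).mkQ (Q.pathMul g f) := rfl

/-- The class in `Λ` of a path. -/
def pathClass (Q : GradedQuiver.{u}) (I : Relations K Q) {x y : Q.V} (p : Path x y) :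
    Q.QuotAlg I x y :=
  (Q.ideal I x y).mkQ (Finsupp.single p 1)

theorem mul_pathClass (Q : GradedQuiver.{u}) (I : Relations K Q) {x y z : Q.V} (q : Path y z)
    (p : Path x y) : Q.mul I (Q.pathClass I q) (Q.pathClass I p)
      = Q.pathClass I (p.comp q) := by
  simp only [pathClass, mul_mk, pathMul_single, mul_one]

/-- The homogeneous component of degree `n` of `e_y Λ e_x`. -/
def component (Q : GradedQuiver.{u}) (I : Relations K Q) (x y : Q.V) (n : ℤ) :
    Submodule K (Q.QuotAlg I x y) :=
  Submodule.span K {f | ∃ p : Path x y, Q.pathDeg p = n ∧ f = Q.pathClass I p}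

theorem mul_mem_component (Q : GradedQuiver.{u}) (I : Relations K Q) {x y z : Q.V} {m n l : ℤ}
    (h : m + n = l) {g : Q.QuotAlg I y z} (hg : g ∈ Q.component I y z m) {f : Q.QuotAlg I x y}
    (hf : f ∈ Q.component I x y n) : Q.mul I g f ∈ Q.component I x z l := by
  refine (Submodule.span_le (p := (Q.component I x z l).comap ((Q.mul I).flip f))).2 ?_ hg
  rintro _ ⟨q, hq, rfl⟩
  refine (Submodule.span_le
    (p := (Q.component I x z l).comap (Q.mul I (Q.pathClass I q)))).2 ?_ hf
  rintro _ ⟨p, hp, rfl⟩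
  refine Submodule.subset_span ⟨p.comp q, ?_, Q.mul_pathClass I q p⟩
  rw [pathDeg_comp, hp, hq, ← h, add_comm]

/-- The DG category `𝒫(Λ)`, for `Λ = KQ / ⟨I⟩` (with zero differential): its objects are the
vertices, and its morphisms from `x` to `y` are the elements of `e_y Λ e_x`. -/
def projCat (Q : GradedQuiver.{u}) (I : Relations K Q) : DGCat.{w, u, max u w} K where
  Obj := Q.V
  Hom x y n := Q.component I x y n
  addCommGroup x y n := Submodule.addCommGroup (Q.component I x y n)
  module x y n := Submodule.module (Q.component I x y n)
  id x := ⟨Q.pathClass I Path.nil, Submodule.subset_span ⟨Path.nil, rfl, rfl⟩⟩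
  comp h := LinearMap.mk₂ K (fun g f => ⟨Q.mul I g.1 f.1, Q.mul_mem_component I h g.2 f.2⟩)
    (fun _ _ _ => by ext; simp) (fun _ _ _ => by ext; simp)
    (fun _ _ _ => by ext; simp) (fun _ _ _ => by ext; simp)
  d _ := 0
  id_comp {x y n} h f := by
    obtain ⟨f, hf⟩ := f
    refine Subtype.ext ?_
    obtain ⟨f, rfl⟩ := Submodule.mkQ_surjective _ f
    change Q.mul I (Q.pathClass I Path.nil) _ = _
    rw [pathClass, mul_mk]
    simp only [pathMul, Finsupp.linearCombination_single, one_smul, Path.comp_nil]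
    exact congrArg _ (Finsupp.mapDomain_id)
  comp_id {x y n} h f := by
    obtain ⟨f, hf⟩ := f
    refine Subtype.ext ?_
    obtain ⟨f, rfl⟩ := Submodule.mkQ_surjective _ f
    change Q.mul I _ (Q.pathClass I Path.nil) = _
    rw [pathClass, mul_mk, pathMul_nil]
  assoc h₁ h₂ h₃ h₄ e g f := by
    obtain ⟨e, _⟩ := e
    obtain ⟨g, _⟩ := g
    obtain ⟨f, _⟩ := f
    refine Subtype.ext ?_
    obtain ⟨e, rfl⟩ := Submodule.mkQ_surjective _ e
    obtain ⟨g, rfl⟩ := Submodule.mkQ_surjective _ g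
    obtain ⟨f, rfl⟩ := Submodule.mkQ_surjective _ f
    exact congrArg (Submodule.mkQ _) (Q.pathMul_assoc e g f)
  d_d _ _ _ := rfl
  leibniz _ _ _ _ _ _ _ _ := by
    simp only [LinearMap.zero_apply, map_zero, smul_zero, add_zero]

/-- An arrow, as a morphism of `𝒫(Λ)`. -/
def arrowHom (Q : GradedQuiver.{u}) (I : Relations K Q) (e : Q.E) {x y : Q.V} {n : ℤ}
    (hx : Q.src e = x) (hy : Q.tgt e = y) (hn : Q.deg e = n) : Q.component I x y n :=
  ⟨Q.pathClass I (Hom.toPath (⟨e, hx, hy⟩ : Q.Arrow x y)),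
    Submodule.subset_span ⟨_, by simp [Hom.toPath, pathDeg, hn], rfl⟩⟩

end GradedQuiver

/-! ## Graded pinched gentle algebras -/

/-- The data `(Q, I)` defining a graded pinched gentle algebra.
* `pinched e` says that `e ∈ Q_1^p`; the other arrows form `Q_1^g`.
* `rel b a` says that the path `b a` (first `a`, then `b`) belongs to `I^g`.
* `inSign` and `outSign` encode the choice of `α_v^±` and `β_v^±` at the vertices `v` carrying a
  pinched loop: the arrow `a` of `Q_1^g` ending at `v` is `α_v^-` if `inSign a = 1` and `β_v^-` if
  `inSign a = -1`; the arrow `b` of `Q_1^g` starting at `v` is `α_v^+` if `outSign b = 1` and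
  `β_v^+` if `outSign b = -1`. -/
structure PinchedGentle extends GradedQuiver.{u} where
  finite_V : Finite V
  finite_E : Finite E
  pinched : E → Prop
  rel : E → E → Prop
  inSign : E → ℤˣ
  outSign : E → ℤˣ
  rel_comp : ∀ {b a}, rel b a → ¬ pinched b ∧ ¬ pinched a ∧ tgt a = src b
  out_le_two : ∀ v, {e | ¬ pinched e ∧ src e = v}.encard ≤ 2
  in_le_two : ∀ v, {e | ¬ pinched e ∧ tgt e = v}.encard ≤ 2
  rel_left_unique : ∀ {a b b'}, rel b a → rel b' a → b = b'
  rel_right_unique : ∀ {b a a'}, rel b a → rel b a' → a = a'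
  nonrel_left_unique : ∀ {a b b'}, ¬ pinched a → ¬ pinched b → ¬ pinched b' →
    tgt a = src b → tgt a = src b' → ¬ rel b a → ¬ rel b' a → b = b'
  nonrel_right_unique : ∀ {b a a'}, ¬ pinched b → ¬ pinched a → ¬ pinched a' →
    tgt a = src b → tgt a' = src b → ¬ rel b a → ¬ rel b a' → a = a'
  pinched_loop : ∀ {c}, pinched c → src c = tgt c
  pinched_deg : ∀ {c}, pinched c → deg c = 0
  pinched_unique : ∀ {c c'}, pinched c → pinched c' → src c = src c' → c = c'
  inSign_injective : ∀ {c a a'}, pinched c → ¬ pinched a → ¬ pinched a' →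
    tgt a = src c → tgt a' = src c → inSign a = inSign a' → a = a'
  outSign_injective : ∀ {c b b'}, pinched c → ¬ pinched b → ¬ pinched b' →
    src b = src c → src b' = src c → outSign b = outSign b' → b = b'
  rel_of_sign_ne : ∀ {c a b}, pinched c → ¬ pinched a → ¬ pinched b →
    tgt a = src c → src b = src c → outSign b ≠ inSign a → rel b a

namespace PinchedGentle

variable (Λ : PinchedGentle.{u})

/-- The relations `I = I^g ⊔ I^p`. -/
inductive IsRelation (K : Type w) [Field K] : ∀ x y : Λ.V, Λ.FreeHom K x y → Prop where
  | gentle {x y z : Λ.V} (a : Λ.Arrow x y) (b : Λ.Arrow y z) (h : Λ.rel b.1 a.1) :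
      IsRelation K x z (Finsupp.single ((Hom.toPath a).comp (Hom.toPath b)) 1)
  /-- `α_v^+ (γ_v - e_v)` and `β_v^+ (γ_v + e_v)` -/
  | pinched_out {v y : Λ.V} (c : Λ.Arrow v v) (b : Λ.Arrow v y) (hc : Λ.pinched c.1)
      (hb : ¬ Λ.pinched b.1) :
      IsRelation K v y (Finsupp.single ((Hom.toPath c).comp (Hom.toPath b)) 1
        - Finsupp.single (Hom.toPath b) ((Λ.outSign b.1 : ℤ) : K))
  /-- `(γ_v - e_v) α_v^-` and `(γ_v + e_v) β_v^-` -/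
  | pinched_in {x v : Λ.V} (a : Λ.Arrow x v) (c : Λ.Arrow v v) (hc : Λ.pinched c.1)
      (ha : ¬ Λ.pinched a.1) :
      IsRelation K x v (Finsupp.single ((Hom.toPath a).comp (Hom.toPath c)) 1
        - Finsupp.single (Hom.toPath a) ((Λ.inSign a.1 : ℤ) : K))

/-- The relations `I`, as a family of sets. -/
def relations (K : Type w) [Field K] : GradedQuiver.Relations K Λ.toGradedQuiver :=
  fun x y => {r | Λ.IsRelation K x y r}

/-- The DG category `𝒫(Λ)`. -/
def catP (K : Type w) [Field K] : DGCat.{w, u, max u w} K :=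
  Λ.toGradedQuiver.projCat (Λ.relations K)

/-- `(α, β)` is a graded Kronecker of `Λ`. -/
structure IsKronecker (α β : Λ.E) : Prop where
  ne : α ≠ β
  not_pinched_left : ¬ Λ.pinched α
  not_pinched_right : ¬ Λ.pinched β
  src_eq : Λ.src β = Λ.src α
  tgt_eq : Λ.tgt β = Λ.tgt α
  deg_eq : Λ.deg β = Λ.deg α
  not_loop : Λ.src α ≠ Λ.tgt α
  no_pinched_src : ∀ c, Λ.pinched c → Λ.src c ≠ Λ.src α
  no_pinched_tgt : ∀ c, Λ.pinched c → Λ.src c ≠ Λ.tgt α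

/-- `b a` is a nonzero path of length two of the gentle bound quiver `(Q^g, I^g)`. -/
def Follows (a b : Λ.E) : Prop :=
  ¬ Λ.pinched a ∧ ¬ Λ.pinched b ∧ Λ.tgt a = Λ.src b ∧ ¬ Λ.rel b a

/-- The arrow `e` belongs to an oriented cycle of `(Q^g, I^g)`: a cyclic sequence of arrows, all of
whose cyclically consecutive compositions are nonzero. -/
def OnCycle (e : Λ.E) : Prop := Relation.TransGen Λ.Follows e e

/-- `(α, β)` is an acyclic graded Kronecker of `Λ`. -/
structure IsAcyclicKronecker (α β : Λ.E) : Prop extends Λ.IsKronecker α β where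
  not_onCycle_left : ¬ Λ.OnCycle α
  not_onCycle_right : ¬ Λ.OnCycle β

/-! ### The localization at `ω = α + μ β` -/

/-- The graded quiver obtained from `Q` by adding an arrow `δ` (the element `none`) from `2 = τ(α)`
to `1 = σ(α)` of degree `-|α|`. -/
def locQuiver (α : Λ.E) : GradedQuiver.{u} where
  V := Λ.V
  E := Option Λ.E
  src e := e.elim (Λ.tgt α) Λ.src
  tgt e := e.elim (Λ.src α) Λ.tgt
  deg e := e.elim (-Λ.deg α) Λ.deg

/-- The inclusion of `Q` in the enlarged quiver. -/
def locIncl (α : Λ.E) : @Prefunctor Λ.V _ (Λ.locQuiver α).V _ where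
  obj x := x
  map a := ⟨some a.1, a.2⟩

/-- The new arrow `δ`. -/
def locδ (α : Λ.E) : (Λ.locQuiver α).Arrow (Λ.tgt α) (Λ.src α) := ⟨none, rfl, rfl⟩

variable {Λ} {α β : Λ.E}

/-- `α`, as an arrow from `1` to `2` in the enlarged quiver. -/
def IsKronecker.locα (_ : Λ.IsKronecker α β) : (Λ.locQuiver α).Arrow (Λ.src α) (Λ.tgt α) :=
  ⟨some α, rfl, rfl⟩

/-- `β`, as an arrow from `1` to `2` in the enlarged quiver. -/
def IsKronecker.locβ (hK : Λ.IsKronecker α β) : (Λ.locQuiver α).Arrow (Λ.src α) (Λ.tgt α) :=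
  ⟨some β, hK.src_eq, hK.tgt_eq⟩

variable {K : Type w} [Field K]

/-- The relations of the localization `Λ[ω⁻¹]`: those of `Λ`, `δ ω - e_1` and `ω δ - e_2`. -/
inductive IsLocRelation (hK : Λ.IsKronecker α β) (μ : K) :
    ∀ x y : (Λ.locQuiver α).V, (Λ.locQuiver α).FreeHom K x y → Prop where
  | old {x y : Λ.V} (r : Λ.FreeHom K x y) (h : Λ.IsRelation K x y r) :
      IsLocRelation hK μ ((Λ.locIncl α).obj x) ((Λ.locIncl α).obj y)
        (Finsupp.mapDomain (Λ.locIncl α).mapPath r)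
  | left : IsLocRelation hK μ (Λ.src α) (Λ.src α)
      (Finsupp.single ((Hom.toPath hK.locα).comp (Hom.toPath (Λ.locδ α))) 1
        + μ • Finsupp.single ((Hom.toPath hK.locβ).comp (Hom.toPath (Λ.locδ α))) 1
        - Finsupp.single Path.nil 1)
  | right : IsLocRelation hK μ (Λ.tgt α) (Λ.tgt α)
      (Finsupp.single ((Hom.toPath (Λ.locδ α)).comp (Hom.toPath hK.locα)) 1
        + μ • Finsupp.single ((Hom.toPath (Λ.locδ α)).comp (Hom.toPath hK.locβ)) 1
        - Finsupp.single Path.nil 1)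

/-- The relations of `Λ[ω⁻¹]`, as a family of sets. -/
def IsKronecker.locRelations (hK : Λ.IsKronecker α β) (μ : K) :
    GradedQuiver.Relations K (Λ.locQuiver α) :=
  fun x y => {r | IsLocRelation hK μ x y r}

/-- The DG category `𝒫(Λ[ω⁻¹])`, for `ω = α + μ β`. -/
def IsKronecker.locCat (hK : Λ.IsKronecker α β) (μ : K) : DGCat.{w, u, max u w} K :=
  (Λ.locQuiver α).projCat (hK.locRelations μ)

/-! ### The band object and the quotient -/

/-- `ω = α + μ β`, as a morphism of degree `n = |α|` from `1` to `2` in `𝒫(Λ)`. -/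
def IsKronecker.omega (hK : Λ.IsKronecker α β) (μ : K) {n : ℤ} (hn : Λ.deg α = n) :
    (Λ.catP K).Hom (Λ.src α) (Λ.tgt α) n :=
  show Λ.component (Λ.relations K) (Λ.src α) (Λ.tgt α) n from
    Λ.arrowHom (Λ.relations K) α rfl rfl hn
      + μ • Λ.arrowHom (Λ.relations K) β hK.src_eq hK.tgt_eq (hK.deg_eq.trans hn)

/-- The summands `P_2`, `P_1` of the band object. -/
def bandObj (K : Type w) [Field K] (α : Λ.E) : Fin 2 → (Λ.catP K).Obj :=
  ![(Λ.tgt α : Λ.V), (Λ.src α : Λ.V)]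

/-- The shifts of the summands of the band object. -/
def bandSh (α : Λ.E) (s : ℤ) : Fin 2 → ℤ := ![Λ.deg α + s, 1 + s]

/-- The entries of the differential `∂` of the band object: the only nonzero one is
`ω : P_1[1 + s] → P_2[|α| + s]`. -/
def IsKronecker.bandEntry (hK : Λ.IsKronecker α β) (μ : K) (s : ℤ) : ∀ i j : Fin 2,
    (Λ.catP K).Hom (bandObj K α j) (bandObj K α i) (1 + bandSh α s i - bandSh α s j)
  | 0, 1 => hK.omega μ (show Λ.deg α = 1 + (Λ.deg α + s) - (1 + s) by ring)
  | 0, 0 => 0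
  | 1, 0 => 0
  | 1, 1 => 0

theorem IsKronecker.bandEntry_eq_zero (hK : Λ.IsKronecker α β) (μ : K) (s : ℤ) :
    ∀ i j : Fin 2, j ≤ i → hK.bandEntry μ s i j = 0
  | 0, 1, h => absurd h (by decide)
  | 0, 0, _ => rfl
  | 1, 0, _ => rfl
  | 1, 1, _ => rfl

/-- The band object `B = (P_2[|α| + s] ⊕ P_1[1 + s], ∂)` with parameter `μ`. -/
def IsKronecker.band (hK : Λ.IsKronecker α β) (μ : K) (s : ℤ) :
    DGCat.TwistedComplex (Λ.catP K) where
  base := DGCat.ShiftSum.mk 2 (bandObj K α) (bandSh α s)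
  del := hK.bandEntry μ s
  del_eq_zero := hK.bandEntry_eq_zero μ s
  maurer_cartan := DGCat.maurer_cartan_of_entries _ _ _ (fun _ _ _ _ => rfl)
    (fun (i k j : Fin 2) => (lt_or_ge i k).elim
      (fun hik => Or.inr (hK.bandEntry_eq_zero μ s k j (by omega)))
      (fun hik => Or.inl (hK.bandEntry_eq_zero μ s i k hik)))

/-- The full DG subcategory `𝒜` of `𝒫(Λ)^{pre-tr}` on the projectives `P_i` (the objects `some i`)
and `B` (the object `none`). -/
def IsKronecker.catA (hK : Λ.IsKronecker α β) (μ : K) (s : ℤ) : DGCat.{w, u, max u w} K :=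
  (Λ.catP K).pretr.full
    (fun i : Option Λ.V => i.elim (hK.band μ s) (DGCat.TwistedComplex.stalk (Λ.catP K)))

/-- The Drinfeld quotient `𝒜/ℬ`, where `ℬ` is the full DG subcategory of `𝒜` on `B`. -/
def IsKronecker.catAB (hK : Λ.IsKronecker α β) (μ : K) (s : ℤ) : DGCat.{w, u, max u w} K :=
  (hK.catA μ s).drinfeld {none}

/-- The full DG subcategory `(𝒜/ℬ)_∘` of `𝒜/ℬ` on the projectives. -/
def IsKronecker.catABProj (hK : Λ.IsKronecker α β) (μ : K) (s : ℤ) : DGCat.{w, u, max u w} K :=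
  (hK.catAB μ s).full (fun i : Λ.V => (some i : Option Λ.V))

/-- The image in `(𝒜/ℬ)_∘` of a morphism of `𝒫(Λ)`. -/
def IsKronecker.ofProj (hK : Λ.IsKronecker α β) (μ : K) (s : ℤ) {x y : Λ.V} {n : ℤ}
    (f : (Λ.catP K).Hom x y n) : (hK.catABProj μ s).Hom x y n :=
  DGCat.QuotHom.of (C := hK.catA μ s) (X := some x) (Y := some y) {none}
    (DGCat.TwistedComplex.stalkHom (Λ.catP K) f)

/-- For `k, l ∈ {0, 1}` indexing the summands of `B` (`0` for `P_2`, `1` for `P_1`), the composite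
`(e_k] ε_B [e_l)` in `(𝒜/ℬ)_∘` of the inclusion of the summand `l` in `B`, of `ε_B`, and of the
projection of `B` to its summand `k`. -/
def IsKronecker.bracket (hK : Λ.IsKronecker α β) (μ : K) (s : ℤ) (k l : Fin 2) {n : ℤ}
    (hn : (hK.band μ s).sh k + (-1 + -(hK.band μ s).sh l) = n) :
    (hK.catABProj μ s).Hom ((hK.band μ s).obj l) ((hK.band μ s).obj k) n :=
  (hK.catAB μ s).comp (X := some ((hK.band μ s).obj l)) (Y := none)
    (Z := some ((hK.band μ s).obj k)) hn
    (DGCat.QuotHom.of (C := hK.catA μ s) (X := none) (Y := some ((hK.band μ s).obj k)) {none}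
      ((hK.band μ s).proj k))
    ((hK.catAB μ s).comp (X := some ((hK.band μ s).obj l)) (Y := none) (Z := none) rfl
      (DGCat.QuotHom.eps (C := hK.catA μ s) (Set.mem_singleton none))
      (DGCat.QuotHom.of (C := hK.catA μ s) (X := some ((hK.band μ s).obj l)) (Y := none) {none}
        ((hK.band μ s).incl l)))

/-- The loop `ε_1` at `1`. -/
def IsKronecker.eps₁ (hK : Λ.IsKronecker α β) (μ : K) (s : ℤ) :
    (hK.catABProj μ s).Hom (Λ.src α) (Λ.src α) (-1) :=
  hK.bracket μ s 1 1 (show (1 + s) + (-1 + -(1 + s)) = -1 by ring)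

/-- The loop `ε_2` at `2`. -/
def IsKronecker.eps₂ (hK : Λ.IsKronecker α β) (μ : K) (s : ℤ) :
    (hK.catABProj μ s).Hom (Λ.tgt α) (Λ.tgt α) (-1) :=
  hK.bracket μ s 0 0 (show (Λ.deg α + s) + (-1 + -(Λ.deg α + s)) = -1 by ring)

/-- The morphism `δ` from `2` to `1`. -/
def IsKronecker.delta (hK : Λ.IsKronecker α β) (μ : K) (s : ℤ) :
    (hK.catABProj μ s).Hom (Λ.tgt α) (Λ.src α) (-Λ.deg α) :=
  hK.bracket μ s 1 0 (show (1 + s) + (-1 + -(Λ.deg α + s)) = -Λ.deg α by ring)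

/-- The morphism `γ` from `1` to `2`. -/
def IsKronecker.gamma (hK : Λ.IsKronecker α β) (μ : K) (s : ℤ) :
    (hK.catABProj μ s).Hom (Λ.src α) (Λ.tgt α) (Λ.deg α - 2) :=
  hK.bracket μ s 0 1 (show (Λ.deg α + s) + (-1 + -(1 + s)) = Λ.deg α - 2 by ring)

/-- The identity map on objects `(𝒜/ℬ)_∘ → 𝒫(Λ[ω⁻¹])`. -/
def IsKronecker.objMap (hK : Λ.IsKronecker α β) (μ : K) (s : ℤ) :
    (hK.catABProj μ s).Obj → (hK.locCat μ).Obj := fun (i : Λ.V) => i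

/-- `F : (𝒜/ℬ)_∘ → 𝒫(Λ[ω⁻¹])`, a DG functor which is the identity on objects, is induced by `φ`: it
is the identity on the arrows of `Q` and on `δ`, and kills `ε_1`, `ε_2` and `γ`. -/
structure IsKronecker.IsInducedByφ (hK : Λ.IsKronecker α β) (μ : K) (s : ℤ)
    (F : DGFunctor (hK.catABProj μ s) (hK.locCat μ) (hK.objMap μ s)) : Prop where
  map_arrow : ∀ e : Λ.E,
    F.map (hK.ofProj μ s (Λ.arrowHom (Λ.relations K) e rfl rfl rfl))
      = (Λ.locQuiver α).arrowHom (hK.locRelations μ) (some e) rfl rfl rfl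
  map_delta : F.map (hK.delta μ s)
    = (Λ.locQuiver α).arrowHom (hK.locRelations μ) none rfl rfl rfl
  map_eps₁ : F.map (hK.eps₁ μ s) = 0
  map_eps₂ : F.map (hK.eps₂ μ s) = 0
  map_gamma : F.map (hK.gamma μ s) = 0

end PinchedGentle

end PinchedDG

universe v'

namespace PinchedDG

/-! ## Graded functors, and the universal property of the Drinfeld quotient -/

/-! Existence. Write i₁, i₂, p₁, p₂ for the inclusions and projections of the summands P₁, P₂ of B.
Since B is a shifted cone of ω, inverting ω makes it contractible, with contraction i₁ δ p₂. The
universal property of the Drinfeld quotient (`drinfeldLift`) therefore extends the localization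
functor to 𝒜/ℬ by ε ↦ i₁ δ p₂, with values in twisted complexes over 𝒫(Λ[ω⁻¹]). Its restriction to
the projectives is F (`phi`), and p₂ i₁ = 0 gives the prescribed values.

Uniqueness. Inserting id_B = i₁ p₁ + i₂ p₂ wherever a word passes through B shows that 𝒫(Λ), ε₁, ε₂,
δ and γ generate all morphisms between projectives (`mem_of_generators`).

Quasi-equivalence. In cohomology δ = p₁ ε i₂ is inverse to ω: up to sign, p₁ ε i₁ and p₂ ε i₂ bound
1 - δω and 1 - ωδ. So the universal property of Λ[ω⁻¹] yields a functor σ (`sigma`) to H^*((𝒜/ℬ)_∘),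
and H^*(F) σ = id can be checked on arrows. It remains to see that σ is onto: every closed morphism
between projectives is, up to exact ones, a combination of composites of δ and morphisms of 𝒫(Λ).

For this, filter the morphisms of 𝒜/ℬ by the number of factors ε. Two facts about Λ enter:
multiplication with ω is injective on either side, and the cokernel of e_y Λ e_2 → e_y Λ e_1, v ↦
vω, is spanned by e_1 if y = 1, by β if y = 2, and is zero otherwise. Both are read off from
explicit representations on e_y Λ e_2 × K × K and e_1 Λ e_x × K × K (`rightAct`, `leftAct`), so no
normal forms for Λ are needed. It follows that Hom(B, P_y) retracts to the span of one morphism gen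
p₁, that End(B) retracts to the span of 1 and t = i₂ β p₁ with t² = 0, and that the cohomology of
Hom(X, B) is represented by a subspace N of i₂ Hom(X, P₂) with tN = 0.

Hence the first page of the filtration is spanned by words gen p₁ ε u₁ ε … ε u_k ε n with each u_i
equal to 1 or t and n in N (`spans_strata`, `independent_strata`). On them the differential is that
of the bar construction of K[t]/t², and modulo exact ones the closed words are combinations of those
with all u_i = t (`exists_be_eq`). Such a word is gen δ β δ β … δ c with c in 𝒫(Λ), which is a
composite of the required kind.

In place of tensor products, the coefficients of words are extracted by a Fox derivative (`fox`),
which exists because ε is freely adjoined. Formality follows because F and its factorization through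
cohomology form a zigzag over a category with zero differential. -/

/-- Graded functors between the graded categories underlying two DG categories. -/
structure GradedFunctor {K : Type w} [Field K] (C : DGCat.{w, u, v} K) (D : DGCat.{w, u', v'} K)
    (o : C.Obj → D.Obj) where
  map : ∀ {X Y : C.Obj} {n : ℤ}, C.Hom X Y n →ₗ[K] D.Hom (o X) (o Y) n
  map_id : ∀ X, map (C.id X) = D.id (o X)
  map_comp : ∀ {X Y Z : C.Obj} {p q r : ℤ} (h : p + q = r) (g : C.Hom Y Z p) (f : C.Hom X Y q),
    map (C.comp h g f) = D.comp h (map g) (map f)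

/-- The graded functor underlying a DG functor. -/
def DGFunctor.toGraded {K : Type w} [Field K] {C : DGCat.{w, u, v} K} {D : DGCat.{w, u', v} K}
    {o : C.Obj → D.Obj} (F : DGFunctor C D o) : GradedFunctor C D o where
  map := F.map
  map_id := F.map_id
  map_comp := F.map_comp

namespace DGCat

variable {K : Type w} [Field K]

theorem d_reindex (C : DGCat.{w, u, v} K) {X Y : C.Obj} {n m k : ℤ} (h : n = m) (h' : m + 1 = k)
    (f : C.Hom X Y n) : C.d h' (C.reindex h f) = C.d (by omega) f := by
  subst h
  rw [reindex_rfl]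

theorem reindex_d (C : DGCat.{w, u, v} K) {X Y : C.Obj} {n m k : ℤ} (h : n + 1 = m) (h' : m = k)
    (f : C.Hom X Y n) : C.reindex h' (C.d h f) = C.d (by omega) f := by
  subst h'
  rw [reindex_rfl]

theorem reindex_comp (C : DGCat.{w, u, v} K) {X Y Z : C.Obj} {p q r s : ℤ} (h : p + q = r)
    (h' : r = s) (g : C.Hom Y Z p) (f : C.Hom X Y q) :
    C.reindex h' (C.comp h g f) = C.comp (by omega) g f := by
  subst h'
  rw [reindex_rfl]

theorem comp_reindex_left (C : DGCat.{w, u, v} K) {X Y Z : C.Obj} {p p' q r : ℤ} (h : p' + q = r)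
    (h' : p = p') (g : C.Hom Y Z p) (f : C.Hom X Y q) :
    C.comp h (C.reindex h' g) f = C.comp (by omega) g f := by
  subst h'
  rw [reindex_rfl]

theorem comp_reindex_right (C : DGCat.{w, u, v} K) {X Y Z : C.Obj} {p q q' r : ℤ} (h : p + q' = r)
    (h' : q = q') (g : C.Hom Y Z p) (f : C.Hom X Y q) :
    C.comp h g (C.reindex h' f) = C.comp (by omega) g f := by
  subst h'
  rw [reindex_rfl]

theorem reindex_reindex (C : DGCat.{w, u, v} K) {X Y : C.Obj} {n m k : ℤ} (h : n = m) (h' : m = k)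
    (f : C.Hom X Y n) : C.reindex h' (C.reindex h f) = C.reindex (h.trans h') f := by
  subst h'
  rw [reindex_rfl]

end DGCat

theorem GradedFunctor.map_reindex {K : Type w} [Field K] {C : DGCat.{w, u, v} K}
    {D : DGCat.{w, u', v'} K} {o : C.Obj → D.Obj} (F : GradedFunctor C D o) {X Y : C.Obj} {n m : ℤ}
    (h : n = m) (f : C.Hom X Y n) : F.map (C.reindex h f) = D.reindex h (F.map f) := by
  subst h
  rw [C.reindex_rfl, D.reindex_rfl]

namespace DGCat

variable {K : Type w} [Field K] {C : DGCat.{w, u, v} K} {D : DGCat.{w, u', v'} K}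
  {o : C.Obj → D.Obj}

namespace QuotHom

/-- Evaluation of formal expressions, given a graded functor and images of the `ε_U`. -/
def liftExpr {S : Set C.Obj} (G : GradedFunctor C D o) (η : ∀ U ∈ S, D.Hom (o U) (o U) (-1)) :
    ∀ {X Y : C.Obj} {n : ℤ}, QuotExpr C S X Y n → D.Hom (o X) (o Y) n
  | _, _, _, .of f => G.map f
  | _, _, _, .eps (U := U) hU hn => D.reindex hn.symm (η U hU)
  | _, _, _, .comp h g f => D.comp h (liftExpr G η g) (liftExpr G η f)
  | _, _, _, .add f g => liftExpr G η f + liftExpr G η g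
  | _, _, _, .smul c f => c • liftExpr G η f

theorem liftExpr_rel {S : Set C.Obj} (G : GradedFunctor C D o)
    (η : ∀ U ∈ S, D.Hom (o U) (o U) (-1)) {X Y : C.Obj} {n : ℤ} {f g : QuotExpr C S X Y n}
    (h : QuotRel C S f g) : liftExpr G η f = liftExpr G η g := by
  induction h with
  | add_congr_left g h ih => simp only [liftExpr, ih]
  | add_congr_right g h ih => simp only [liftExpr, ih]
  | smul_congr c h ih => simp only [liftExpr, ih]
  | comp_congr_left h f hr ih => simp only [liftExpr, ih]
  | comp_congr_right h g hr ih => simp only [liftExpr, ih]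
  | add_comm f g => exact _root_.add_comm _ _
  | add_assoc f g e => exact _root_.add_assoc _ _ _
  | zero_add f => simp [liftExpr]
  | neg_add f => simp [liftExpr]
  | smul_add c f g => exact _root_.smul_add _ _ _
  | add_smul a b f => exact _root_.add_smul _ _ _
  | mul_smul a b f => exact SemigroupAction.mul_smul _ _ _
  | one_smul f => exact _root_.one_smul _ _
  | comp_add h g f f' => simp [liftExpr]
  | add_comp h g g' f => simp [liftExpr]
  | comp_smul h c g f => simp [liftExpr]
  | smul_comp h c g f => simp [liftExpr]
  | comp_assoc h₁ h₂ h₃ h₄ e g f => exact D.assoc _ _ _ _ _ _ _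
  | id_comp h f => simp only [liftExpr, G.map_id, D.id_comp]
  | comp_id h f => simp only [liftExpr, G.map_id, D.comp_id]
  | of_add f g => simp [liftExpr]
  | of_smul c f => simp [liftExpr]
  | of_comp h g f => exact G.map_comp _ _ _

/-- The linear map on the morphisms of the Drinfeld quotient induced by a graded functor and images
of the `ε_U`. -/
def lift {S : Set C.Obj} (G : GradedFunctor C D o) (η : ∀ U ∈ S, D.Hom (o U) (o U) (-1))
    {X Y : C.Obj} {n : ℤ} : QuotHom C S X Y n →ₗ[K] D.Hom (o X) (o Y) n where
  toFun := Quot.lift (liftExpr G η) (fun _ _ h => liftExpr_rel G η h)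
  map_add' x y := by
    induction x using ind; induction y using ind
    rfl
  map_smul' c x := by
    induction x using ind
    rfl

section lift

variable {S : Set C.Obj} (G : GradedFunctor C D o) (η : ∀ U ∈ S, D.Hom (o U) (o U) (-1))

theorem lift_comp {X Y Z : C.Obj} {p q r : ℤ} (h : p + q = r) (x : QuotHom C S Y Z p)
    (y : QuotHom C S X Y q) : lift G η (comp h x y) = D.comp h (lift G η x) (lift G η y) := by
  induction x using ind; induction y using ind
  rfl

theorem lift_of {X Y : C.Obj} {n : ℤ} (f : C.Hom X Y n) : lift G η (of S f) = G.map f := rfl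

theorem lift_eps {U : C.Obj} (hU : U ∈ S) : lift G η (eps hU) = η U hU := D.reindex_rfl _ _

/-- Both composites of `lift` with the differentials obey the same Leibniz rule, so only generators
matter: `hG` settles the morphisms of `C` and `hη` settles the ε_U. -/
theorem lift_d (hG : ∀ {X Y : C.Obj} {n m : ℤ} (h : n + 1 = m) (f : C.Hom X Y n),
      G.map (C.d h f) = D.d h (G.map f))
    (hη : ∀ U hU, D.d (m := 0) (by omega) (η U hU) = D.id (o U)) {X Y : C.Obj} {n m : ℤ}
    (h : n + 1 = m) (x : QuotHom C S X Y n) : lift G η (d h x) = D.d h (lift G η x) := by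
  induction x using ind with
  | h f =>
    rw [d_mk]
    change _ = D.d h (liftExpr G η f)
    induction f generalizing m with
    | of f => exact hG h f
    | @eps U n hU hn =>
      subst hn
      obtain rfl : m = 0 := by omega
      rw [dExpr, reindex_rfl, lift_of, G.map_id, liftExpr, D.d_reindex]
      exact (hη U hU).symm
    | comp hpq g f ihg ihf =>
      rw [dExpr, map_add, map_smul, liftExpr, lift_comp, lift_comp, ihg, ihf,
        D.leibniz hpq h rfl rfl (by omega) (by omega)]
      rfl
    | add f g ihf ihg => rw [dExpr, map_add, ihf, ihg, liftExpr, map_add]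
    | smul c f ih => rw [dExpr, map_smul, ih, liftExpr, map_smul]

end lift

end QuotHom

/-- The map on objects induced by a map on objects of `C`. -/
def drinfeldObj (S : Set C.Obj) (o : C.Obj → D.Obj) : (C.drinfeld S).Obj → D.Obj := o

/-- The universal property of the Drinfeld quotient. -/
def drinfeldLift {D : DGCat.{w, u', max u v w} K} {o : C.Obj → D.Obj} {S : Set C.Obj}
    (G : GradedFunctor C D o)
    (hG : ∀ {X Y : C.Obj} {n m : ℤ} (h : n + 1 = m) (f : C.Hom X Y n),
      G.map (C.d h f) = D.d h (G.map f))
    (η : ∀ U ∈ S, D.Hom (o U) (o U) (-1))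
    (hη : ∀ U hU, D.d (m := 0) (by omega) (η U hU) = D.id (o U)) :
    DGFunctor (C.drinfeld S) D (drinfeldObj S o) where
  map := QuotHom.lift G η
  map_id X := G.map_id X
  map_comp := QuotHom.lift_comp G η
  map_d := QuotHom.lift_d G η hG hη

end DGCat

/-! ### Functoriality of twisted complexes -/

namespace DGFunctor

variable {K : Type w} [Field K] {C : DGCat.{w, u, v} K} {D : DGCat.{w, u', v} K}
  {o : C.Obj → D.Obj}

theorem map_reindex (F : DGFunctor C D o) {X Y : C.Obj} {n m : ℤ}
    (h : n = m) (f : C.Hom X Y n) : F.map (C.reindex h f) = D.reindex h (F.map f) :=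
  F.toGraded.map_reindex h f

/-- The map on formal sums of shifts. -/
def shiftSumObj (o : C.Obj → D.Obj) (X : C.shiftSum.Obj) : D.shiftSum.Obj :=
  DGCat.ShiftSum.mk (DGCat.ShiftSum.len X) (fun i => o (DGCat.ShiftSum.obj X i))
    (DGCat.ShiftSum.sh X)

theorem map_single_id (F : DGFunctor C D o) {ι : Type*} [DecidableEq ι] (Z : ι → C.Obj)
    (r : ι → ℤ) (i j : ι) :
    F.map (Pi.single (M := fun i => C.Hom (Z j) (Z i) (0 + r i - r j)) j
        (C.reindex (by omega) (C.id (Z j))) i)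
      = Pi.single (M := fun i => D.Hom (o (Z j)) (o (Z i)) (0 + r i - r j)) j
        (D.reindex (by omega) (D.id (o (Z j)))) i := by
  rcases eq_or_ne i j with rfl | h
  · rw [Pi.single_eq_same, Pi.single_eq_same, map_reindex, F.map_id]
  · rw [Pi.single_eq_of_ne h, Pi.single_eq_of_ne h, map_zero]

/-- The functor on formal sums of shifts. -/
def shiftSumMap (F : DGFunctor C D o) : DGFunctor C.shiftSum D.shiftSum (shiftSumObj o) where
  map :=
    { toFun := fun f i j => F.map (f i j)
      map_add' := fun _ _ => by funext i j; exact map_add F.map _ _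
      map_smul' := fun _ _ => by funext i j; exact map_smul F.map _ _ }
  map_id X := by
    funext i j
    exact F.map_single_id (DGCat.ShiftSum.obj X) (DGCat.ShiftSum.sh X) i j
  map_comp {X Y Z p q r} h g f := by
    funext i j
    refine (map_sum F.map (fun k => C.comp _ (g i k) (f k j)) Finset.univ).trans ?_
    exact Finset.sum_congr rfl fun k _ => F.map_comp _ _ _
  map_d {X Y n m} h f := by
    funext i j
    exact (map_smul F.map _ _).trans (congrArg _ (F.map_d _ _))

/-- The functor on objects of `C^{pre-tr}`. -/
def twistedMap (F : DGFunctor C D o) (X : DGCat.TwistedComplex C) : DGCat.TwistedComplex D where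
  base := shiftSumObj o X.base
  del := F.shiftSumMap.map X.del
  del_eq_zero i j h := (congrArg F.map (X.del_eq_zero i j h)).trans (map_zero F.map)
  maurer_cartan := by
    rw [← F.shiftSumMap.map_d, ← F.shiftSumMap.map_comp, ← map_add]
    exact (congrArg _ X.maurer_cartan).trans (map_zero _)

/-- The functor on twisted complexes. -/
def pretrMap (F : DGFunctor C D o) : DGFunctor C.pretr D.pretr F.twistedMap where
  map := F.shiftSumMap.map
  map_id _ := F.shiftSumMap.map_id _
  map_comp := F.shiftSumMap.map_comp
  map_d {X Y n m} h f := by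
    refine (map_sub F.shiftSumMap.map _ _).trans (congrArg₂ _
      ((map_add F.shiftSumMap.map _ _).trans (congrArg₂ _ ?_ ?_))
      ((map_smul F.shiftSumMap.map _ _).trans (congrArg _ ?_)))
    · exact F.shiftSumMap.map_d h f
    · exact F.shiftSumMap.map_comp _ _ _
    · exact F.shiftSumMap.map_comp h _ _

end DGFunctor

/-! ### Formality -/

namespace DGFunctor

variable {K : Type w} [Field K] {C : DGCat.{w, u, v} K} {D : DGCat.{w, u, v} K}
  {o : C.Obj → D.Obj}

/-- The map on the objects of the graded homotopy category. -/
def hObj (o : C.Obj → D.Obj) : C.H.Obj → D.Obj := o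

variable (F : DGFunctor C D o)
  (hD : ∀ {X Y : D.Obj} {n m : ℤ} (h : n + 1 = m) (f : D.Hom X Y n), D.d h f = 0)

/-- A DG functor to a graded category, on cohomology classes. -/
def ofHMap (X Y : C.Obj) (n : ℤ) : C.Cohomology X Y n →ₗ[K] D.Hom (o X) (o Y) n :=
  Submodule.liftQ _ (F.map.comp (C.cocycles X Y n).subtype) (fun f hf => by
    obtain ⟨g, hg⟩ := (C.mem_coboundaries (sub_add_cancel n 1) f).1 hf
    rw [LinearMap.mem_ker, LinearMap.comp_apply, Submodule.subtype_apply, ← hg, F.map_d, hD])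

/-- A DG functor to a graded category factors over the graded homotopy category. -/
def ofH : DGFunctor C.H D (hObj o) where
  map {X Y n} := F.ofHMap hD X Y n
  map_id X := F.map_id X
  map_comp h g f := by
    obtain ⟨f, rfl⟩ := Submodule.Quotient.mk_surjective _ f
    obtain ⟨g, rfl⟩ := Submodule.Quotient.mk_surjective _ g
    exact F.map_comp h g.1 f.1
  map_d h f := (map_zero (F.ofHMap hD _ _ _)).trans (hD _ _).symm

/-- As `D` has zero differential it is its own cohomology, so `ofHMap` is `mapH` up to this
identification. Essential surjectivity is already visible on objects, with identity morphisms as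
isomorphisms. -/
theorem isQuasiEquivalence_of_bijective (ho : Function.Surjective o)
    (hF : ∀ X Y n, Function.Bijective (F.ofHMap hD X Y n)) : F.IsQuasiEquivalence := by
  refine ⟨fun X Y n => ⟨?_, ?_⟩, fun Y => ?_⟩
  · refine (injective_iff_map_eq_zero _).2 fun f hf => (hF X Y n).1 ?_
    obtain ⟨f, rfl⟩ := Submodule.Quotient.mk_surjective _ f
    obtain ⟨g, hg⟩ := (D.mem_coboundaries (sub_add_cancel n 1) _).1
      ((Submodule.Quotient.mk_eq_zero _).1 hf)
    rw [hD] at hg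
    exact hg.symm.trans (map_zero (F.ofHMap hD X Y n)).symm
  · intro g
    obtain ⟨g, rfl⟩ := Submodule.Quotient.mk_surjective _ g
    obtain ⟨f, hf⟩ := (hF X Y n).2 g.1
    obtain ⟨f, rfl⟩ := Submodule.Quotient.mk_surjective _ f
    have hf' : F.mapCocycles X Y n f = g := Subtype.ext hf
    exact ⟨Submodule.Quotient.mk f, congrArg Submodule.Quotient.mk hf'⟩
  · obtain ⟨X, rfl⟩ := ho Y
    exact ⟨X, D.H.id _, D.H.id _, D.H.id_comp _ _, D.H.id_comp _ _⟩

/-- The zigzag is C → D ← H^*(C). Its right leg is the factorization `ofH` of `F`, which is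
bijective on morphisms because `F` is so in cohomology. -/
theorem isFormal_of_bijective (ho : Function.Surjective o)
    (hF : ∀ X Y n, Function.Bijective (F.ofHMap hD X Y n)) : C.IsFormal := by
  refine Relation.EqvGen.trans _ D _
    (.rel _ _ ⟨o, F, F.isQuasiEquivalence_of_bijective hD ho hF⟩)
    (.symm _ _ (.rel _ _ ⟨_, F.ofH hD, (F.ofH hD).isQuasiEquivalence_of_bijective hD ho
      fun X Y n => ⟨?_, ?_⟩⟩))
  · refine (injective_iff_map_eq_zero _).2 fun f hf => ?_
    obtain ⟨f, rfl⟩ := Submodule.Quotient.mk_surjective _ f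
    have h0 : f.1 = (0 : C.Cohomology X Y n) :=
      (hF X Y n).1 (Eq.trans hf (map_zero (F.ofHMap hD X Y n)).symm)
    have h1 : f = 0 := Subtype.ext h0
    rw [h1]
    rfl
  · intro g
    obtain ⟨f, hf⟩ := (hF X Y n).2 g
    exact ⟨Submodule.Quotient.mk ⟨f, rfl⟩, hf⟩

end DGFunctor

end PinchedDG

namespace PinchedDG

open Quiver

/-! ## The universal property of `𝒫(Λ)` -/

namespace GradedQuiver

variable {K : Type w} [Field K]

section eval

variable (Q : GradedQuiver.{u}) (D : DGCat.{w, u', v'} K) (o : Q.V → D.Obj)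
  (a : ∀ {x y : Q.V} (e : Q.Arrow x y), D.Hom (o x) (o y) (Q.deg e.1))

/-- The value on a path of an assignment of morphisms to arrows. -/
def evalPath {x : Q.V} : ∀ {y : Q.V} (p : Path x y), D.Hom (o x) (o y) (Q.pathDeg p)
  | _, .nil => D.id _
  | _, .cons p e => D.comp (add_comm _ _) (a e) (evalPath p)

theorem evalPath_comp {x y z : Q.V} (p : Path x y) (q : Path y z)
    (h : Q.pathDeg q + Q.pathDeg p = Q.pathDeg (p.comp q)) :
    Q.evalPath D o a (p.comp q) = D.comp h (Q.evalPath D o a q) (Q.evalPath D o a p) := by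
  induction q with
  | nil => exact (D.id_comp _ _).symm
  | cons q e ih =>
    have h' : Q.pathDeg q + Q.pathDeg p = Q.pathDeg (p.comp q) := by
      rw [pathDeg_comp, add_comm]
    refine (congrArg (D.comp _ (a e)) (ih h')).trans ?_
    exact D.assoc _ _ _ _ _ _ _

/-- The homogeneous part of degree `n` of the value on a linear combination of paths. -/
def evalDeg {x y : Q.V} (n : ℤ) : Q.FreeHom K x y →ₗ[K] D.Hom (o x) (o y) n :=
  Finsupp.linearCombination K
    (fun p : Path x y => if h : Q.pathDeg p = n then D.reindex h (Q.evalPath D o a p) else 0)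

theorem evalDeg_single {x y : Q.V} {n : ℤ} (p : Path x y) (h : Q.pathDeg p = n) (c : K) :
    Q.evalDeg D o a n (Finsupp.single p c) = c • D.reindex h (Q.evalPath D o a p) := by
  simp [evalDeg, h]

theorem evalDeg_single_ne {x y : Q.V} {n : ℤ} (p : Path x y) (h : Q.pathDeg p ≠ n) (c : K) :
    Q.evalDeg D o a n (Finsupp.single p c) = 0 := by
  simp [evalDeg, h]

theorem evalDeg_pathMul_left {x y z : Q.V} {n r : ℤ} (q : Path y z) (h : Q.pathDeg q + n = r)
    (c : K) (f : Q.FreeHom K x y) : Q.evalDeg D o a r (Q.pathMul (Finsupp.single q c) f)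
      = c • D.comp h (Q.evalPath D o a q) (Q.evalDeg D o a n f) := by
  induction f using Finsupp.induction_linear with
  | zero => simp
  | add f g hf hg => simp only [map_add, hf, hg, smul_add]
  | single p b =>
    rw [pathMul_single]
    by_cases hp : Q.pathDeg p = n
    · subst hp
      rw [Q.evalDeg_single D o a _ (by rw [pathDeg_comp]; omega),
        Q.evalDeg_single D o a p rfl, D.reindex_rfl,
        Q.evalPath_comp D o a p q (by rw [pathDeg_comp, add_comm]), D.reindex_comp, map_smul,
        smul_smul]
    · rw [Q.evalDeg_single_ne D o a p hp,
        Q.evalDeg_single_ne D o a (p.comp q) (by rw [pathDeg_comp]; omega), map_zero, smul_zero]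

theorem evalDeg_pathMul_right {x y z : Q.V} {n r : ℤ} (p : Path x y) (h : n + Q.pathDeg p = r)
    (c : K) (f : Q.FreeHom K y z) : Q.evalDeg D o a r (Q.pathMul f (Finsupp.single p c))
      = c • D.comp h (Q.evalDeg D o a n f) (Q.evalPath D o a p) := by
  induction f using Finsupp.induction_linear with
  | zero => simp
  | add f g hf hg => simp only [map_add, hf, hg, smul_add, LinearMap.add_apply]
  | single q b =>
    rw [pathMul_single]
    by_cases hq : Q.pathDeg q = n
    · subst hq
      rw [Q.evalDeg_single D o a _ (by rw [pathDeg_comp]; omega),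
        Q.evalDeg_single D o a q rfl, D.reindex_rfl,
        Q.evalPath_comp D o a p q (by rw [pathDeg_comp, add_comm]), D.reindex_comp, map_smul,
        LinearMap.smul_apply, smul_smul, mul_comm]
    · rw [Q.evalDeg_single_ne D o a q hq,
        Q.evalDeg_single_ne D o a (p.comp q) (by rw [pathDeg_comp]; omega), map_zero,
        LinearMap.zero_apply, smul_zero]

/-- Multiplying a relation by paths on both sides turns its evaluation in degree `n` into a
composite with its evaluation in a shifted degree. This is why `hI` is asked in all degrees; the
relations need not be known to be homogeneous. -/
theorem evalDeg_ideal {I : Relations K Q}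
    (hI : ∀ x y, ∀ r ∈ I x y, ∀ n, Q.evalDeg D o a n r = 0) {x y : Q.V} (n : ℤ) :
    Q.ideal I x y ≤ LinearMap.ker (Q.evalDeg D o a (x := x) (y := y) n) := by
  refine Submodule.span_le.2 ?_
  rintro _ ⟨s, t, q, r, p, hr, rfl⟩
  change Q.evalDeg D o a n _ = 0
  induction q using Finsupp.induction_linear with
  | zero => simp
  | add f g hf hg => simp only [map_add, hf, hg, add_zero, LinearMap.add_apply]
  | single q b =>
    rw [Q.evalDeg_pathMul_left D o a (n := n - Q.pathDeg q) q (by omega)]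
    induction p using Finsupp.induction_linear with
    | zero => simp
    | add f g hf hg => simp only [map_add, smul_add, hf, hg, add_zero]
    | single p c =>
      rw [Q.evalDeg_pathMul_right D o a (n := n - Q.pathDeg q - Q.pathDeg p) p (by omega),
        hI _ _ r hr]
      simp

/-- The linear map on homogeneous components induced by an assignment of morphisms to arrows that
respects the relations. -/
def liftHom {I : Relations K Q} (hI : ∀ x y, ∀ r ∈ I x y, ∀ n, Q.evalDeg D o a n r = 0)
    {x y : Q.V} (n : ℤ) : Q.component I x y n →ₗ[K] D.Hom (o x) (o y) n :=
  (Submodule.liftQ _ (Q.evalDeg D o a n) (Q.evalDeg_ideal D o a hI n)).comp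
    (Q.component I x y n).subtype

end eval

/-- The class of a path, as an element of a homogeneous component. -/
def pathHom (Q : GradedQuiver.{u}) (I : Relations K Q) {x y : Q.V} {n : ℤ} (p : Path x y)
    (h : Q.pathDeg p = n) : Q.component I x y n :=
  ⟨Q.pathClass I p, Submodule.subset_span ⟨p, h, rfl⟩⟩

theorem component_induction (Q : GradedQuiver.{u}) (I : Relations K Q) {x y : Q.V} {n : ℤ}
    {P : Q.component I x y n → Prop}
    (hp : ∀ (p : Path x y) (h : Q.pathDeg p = n),
      P (Q.pathHom I p h)) (h0 : P 0) (hadd : ∀ f g, P f → P g → P (f + g))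
    (hsmul : ∀ (c : K) f, P f → P (c • f)) (f : Q.component I x y n) : P f := by
  obtain ⟨f, hf⟩ := f
  induction hf using Submodule.span_induction with
  | mem f hf => obtain ⟨p, hp', rfl⟩ := hf; exact hp p hp'
  | zero => exact h0
  | add f g hf hg ihf ihg => exact hadd ⟨f, hf⟩ ⟨g, hg⟩ ihf ihg
  | smul c f hf ih => exact hsmul c ⟨f, hf⟩ ih

/-- Composition of morphisms of `𝒫(Λ)`. -/
def compHom (Q : GradedQuiver.{u}) (I : Relations K Q) {x y z : Q.V} {p q r : ℤ} (h : p + q = r) :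
    Q.component I y z p →ₗ[K] Q.component I x y q →ₗ[K] Q.component I x z r :=
  (Q.projCat I).comp h

theorem compHom_val (Q : GradedQuiver.{u}) (I : Relations K Q) {x y z : Q.V} {p q r : ℤ}
    (h : p + q = r) (g : Q.component I y z p) (f : Q.component I x y q) :
    (Q.compHom I h g f).1 = Q.mul I g.1 f.1 := rfl

theorem pathHom_comp (Q : GradedQuiver.{u}) (I : Relations K Q) {x y z : Q.V} {n m r : ℤ}
    (p : Path x y) (q : Path y z) (hp : Q.pathDeg p = n) (hq : Q.pathDeg q = m) (h : m + n = r)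
    (h' : Q.pathDeg (p.comp q) = r) :
    Q.compHom I h (Q.pathHom I q hq) (Q.pathHom I p hp) = Q.pathHom I (p.comp q) h' :=
  Subtype.ext (Q.mul_pathClass I q p)

section lift

variable (Q : GradedQuiver.{u}) {D : DGCat.{w, u', v'} K} {o : Q.V → D.Obj}
  (a : ∀ {x y : Q.V} (e : Q.Arrow x y), D.Hom (o x) (o y) (Q.deg e.1))
  {I : Relations K Q} (hI : ∀ x y, ∀ r ∈ I x y, ∀ n, Q.evalDeg D o a n r = 0)

theorem liftHom_pathHom {x y : Q.V} {n : ℤ} (p : Path x y) (h : Q.pathDeg p = n) :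
    Q.liftHom D o a hI n (Q.pathHom I p h) = D.reindex h (Q.evalPath D o a p) := by
  refine (Q.evalDeg_single D o a p h 1).trans (one_smul _ _)

theorem liftHom_comp {x y z : Q.V} {p q r : ℤ} (h : p + q = r) (g : Q.component I y z p)
    (f : Q.component I x y q) : Q.liftHom D o a hI r (Q.compHom I h g f)
      = D.comp h (Q.liftHom D o a hI p g) (Q.liftHom D o a hI q f) := by
  induction f using Q.component_induction I with
  | h0 => simp only [map_zero]
  | hadd f f' hf hf' => simp only [map_add, hf, hf']
  | hsmul c f hf => simp only [map_smul, hf]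
  | hp p₁ hp₁ =>
    induction g using Q.component_induction I with
    | h0 => simp only [map_zero, LinearMap.zero_apply]
    | hadd f f' hf hf' => simp only [map_add, LinearMap.add_apply, hf, hf']
    | hsmul c f hf => simp only [map_smul, LinearMap.smul_apply, hf]
    | hp q₁ hq₁ =>
      cases hp₁; cases hq₁
      have h' : Q.pathDeg (p₁.comp q₁) = r := by rw [pathDeg_comp]; omega
      rw [Q.pathHom_comp I p₁ q₁ rfl rfl h h', Q.liftHom_pathHom, Q.liftHom_pathHom,
        Q.liftHom_pathHom, D.reindex_rfl, D.reindex_rfl,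
        Q.evalPath_comp D o a p₁ q₁ (by omega), D.reindex_comp]

/-- The map on objects induced by a map on vertices. -/
def projObj (Q : GradedQuiver.{u}) (I : Relations K Q) {D : DGCat.{w, u', v'} K}
    (o : Q.V → D.Obj) : (Q.projCat I).Obj → D.Obj := o

/-- The universal property of `𝒫(Λ)`. -/
def lift : GradedFunctor (Q.projCat I) D (Q.projObj I o) where
  map {_ _ n} := Q.liftHom D o a hI n
  map_id _ := (Q.liftHom_pathHom a hI Path.nil rfl).trans (D.reindex_rfl _ _)
  map_comp h g f := Q.liftHom_comp a hI h g f

theorem liftHom_arrowHom {x y : Q.V} (e : Q.Arrow x y) :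
    Q.liftHom D o a hI _ (Q.arrowHom I e.1 e.2.1 e.2.2 rfl) = a e := by
  have h : Q.pathDeg (Hom.toPath e) = Q.deg e.1 := zero_add _
  refine (Q.liftHom_pathHom a hI (Hom.toPath e) h).trans ?_
  exact (D.reindex_comp _ _ _ _).trans (D.comp_id _ _)

end lift

/-- A graded functor on `𝒫(Λ)`, on homogeneous components. -/
def _root_.PinchedDG.GradedFunctor.onComponent {Q : GradedQuiver.{u}} {I : Relations K Q}
    {D : DGCat.{w, u', v'} K} {o : Q.V → D.Obj}
    (F : GradedFunctor (Q.projCat I) D (Q.projObj I o)) (x y : Q.V) (n : ℤ) :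
    Q.component I x y n →ₗ[K] D.Hom (o x) (o y) n := F.map

/-- Two graded functors on `𝒫(Λ)` that agree on the arrows are equal. -/
theorem map_ext (Q : GradedQuiver.{u}) {I : Relations K Q} {D : DGCat.{w, u', v'} K}
    {o : Q.V → D.Obj} (F G : GradedFunctor (Q.projCat I) D (Q.projObj I o))
    (h : ∀ {x y : Q.V} (e : Q.Arrow x y),
      F.onComponent x y _ (Q.arrowHom I e.1 e.2.1 e.2.2 rfl)
      = G.onComponent x y _ (Q.arrowHom I e.1 e.2.1 e.2.2 rfl)) {x y : Q.V} {n : ℤ}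
    (f : Q.component I x y n) : F.onComponent x y n f = G.onComponent x y n f := by
  induction f using Q.component_induction I with
  | h0 => simp only [map_zero]
  | hadd f f' hf hf' => simp only [map_add, hf, hf']
  | hsmul c f hf => simp only [map_smul, hf]
  | hp p hp =>
    cases hp
    induction p with
    | nil => exact (F.map_id x).trans (G.map_id x).symm
    | cons p e ih =>
      have h₁ : Q.compHom I (add_comm (Q.deg e.1) (Q.pathDeg p))
          (Q.arrowHom I e.1 e.2.1 e.2.2 rfl) (Q.pathHom I p rfl) = Q.pathHom I (p.cons e) rfl :=
        Subtype.ext (Q.mul_pathClass I (Hom.toPath e) p)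
      rw [← h₁]
      refine (F.map_comp _ _ _).trans (Eq.trans ?_ (G.map_comp _ _ _).symm)
      exact congrArg₂ (fun s t => D.comp _ s t) (h e) ih

end GradedQuiver

end PinchedDG

namespace PinchedDG

/-! ## The Drinfeld quotient is freely generated by the `ε_U` -/

/-- The identity functor. -/
def GradedFunctor.refl {K : Type w} [Field K] (C : DGCat.{w, u, v} K) :
    GradedFunctor C C (fun X => X) where
  map := LinearMap.id
  map_id _ := rfl
  map_comp _ _ _ := rfl

namespace DGCat

variable {K : Type w} [Field K] {C : DGCat.{w, u, v} K}

namespace QuotHom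

variable {S : Set C.Obj}

/-- The graded functor to `C` that kills the `ε_U`. -/
def killEps {X Y : C.Obj} {n : ℤ} : QuotHom C S X Y n →ₗ[K] C.Hom X Y n :=
  lift (GradedFunctor.refl C) (fun _ _ => 0)

theorem killEps_comp {X Y Z : C.Obj} {p q r : ℤ} (h : p + q = r) (x : QuotHom C S Y Z p)
    (y : QuotHom C S X Y q) : killEps (comp h x y) = C.comp h (killEps x) (killEps y) :=
  lift_comp _ _ h x y

theorem killEps_of {X Y : C.Obj} {n : ℤ} (f : C.Hom X Y n) : killEps (of S f) = f := rfl

theorem killEps_eps {U : C.Obj} (hU : U ∈ S) : killEps (eps hU) = 0 :=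
  lift_eps (GradedFunctor.refl C) (fun _ _ => 0) hU

/-- `killEps` is a left inverse: adjoining the ε_U creates no new relation between morphisms of `C`.
-/
theorem of_injective {X Y : C.Obj} {n : ℤ} :
    Function.Injective (of S : C.Hom X Y n →ₗ[K] QuotHom C S X Y n) :=
  Function.LeftInverse.injective killEps_of

variable (C S) in
/-- Families of linear maps of degree `k` on the morphisms from objects of `S` to `Y`. -/
abbrev Family (Y Y' : C.Obj) (k : ℤ) : Type (max u v w) :=
  ∀ U ∈ S, ∀ p q : ℤ, p + k = q → (C.Hom U Y p →ₗ[K] QuotHom C S U Y' q)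

/-- The pointwise sum of two families. -/
def Family.add {Y Y' : C.Obj} {k : ℤ} (h h' : Family C S Y Y' k) : Family C S Y Y' k :=
  fun U hU p q e => h U hU p q e + h' U hU p q e

/-- Pointwise scalar multiplication of a family. -/
def Family.smul {Y Y' : C.Obj} {k : ℤ} (h : Family C S Y Y' k) (c : K) : Family C S Y Y' k :=
  fun U hU p q e => c • h U hU p q e

/-- Precomposition of a family with the postcomposition with a morphism. -/
def Family.precomp {Y Z Y' : C.Obj} {k p : ℤ} (h : Family C S Z Y' k) (g : C.Hom Y Z p) :
    Family C S Y Y' (p + k) :=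
  fun U hU a b hab => (h U hU (p + a) b (by omega)).comp (C.comp rfl g)

theorem Family.apply_reindex {Y Y' : C.Obj} {k : ℤ} (h : Family C S Y Y' k) (U : C.Obj)
    (hU : U ∈ S) {a a' b : ℤ} (e : a = a') (hab : a' + k = b) (x : C.Hom U Y a) :
    h U hU a' b hab (C.reindex e x) = h U hU a b (by omega) x := by
  subst e
  rw [reindex_rfl]

/-- See `fox`. -/
def foxExpr : ∀ {X Y : C.Obj} {n : ℤ}, QuotExpr C S X Y n → ∀ {Y' : C.Obj} {k : ℤ},
    Family C S Y Y' k → ∀ {m : ℤ}, n + 1 + k = m → QuotHom C S X Y' m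
  | _, _, _, .of _, _, _, _, _, _ => 0
  -- The generator is read as id · ε_U · id, so the family is evaluated at the identity.
  | _, _, _, .eps (U := U) hU hn, _, _, h, m, hm => h U hU 0 m (by omega) (C.id U)
  -- Crossed Leibniz rule. The leftmost ε of a word lies either in `g`, and then `f` stays on its
  -- right, or in `f`, and then `g` contributes only its part without ε, which `killEps` extracts.
  | _, _, _, .comp (p := p) (q := q) hpq g f, _, k, h, _, hm =>
      comp (p := p + 1 + k) (by omega) (foxExpr g h rfl) (mk f)
        + foxExpr f (h.precomp (killEps (mk g))) (by omega)
  | _, _, _, .add f g, _, _, h, _, hm => foxExpr f h hm + foxExpr g h hm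
  | _, _, _, .smul c f, _, _, h, _, hm => c • foxExpr f h hm

/-- Iterated `precomp` shifts the degree by p + (q + k) or (p + q) + k, which are equal but not by
definition; this lemma bridges such families. -/
theorem foxExpr_congr {X Y : C.Obj} {n : ℤ} (f : QuotExpr C S X Y n) {Y' : C.Obj} {k k' : ℤ}
    (hk : k = k') (h : Family C S Y Y' k) (h' : Family C S Y Y' k')
    (hh : ∀ U hU a b hab x, h U hU a b hab x = h' U hU a b (by omega) x) {m : ℤ}
    (hm : n + 1 + k = m) : foxExpr f h hm = foxExpr f h' (by omega) := by
  subst hk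
  obtain rfl : h = h' := by
    funext U hU a b hab
    exact LinearMap.ext (hh U hU a b hab)
  rfl

theorem foxExpr_add_family {X Y : C.Obj} {n : ℤ} (f : QuotExpr C S X Y n) {Y' : C.Obj} {k : ℤ}
    (h h' : Family C S Y Y' k) {m : ℤ} (hm : n + 1 + k = m) :
    foxExpr f (h.add h') hm = foxExpr f h hm + foxExpr f h' hm := by
  induction f generalizing k m with
  | of f => simp [foxExpr]
  | eps hU hn => simp [foxExpr, Family.add]
  | comp hpq g f ihg ihf =>
    have : (h.add h').precomp (killEps (mk g))
      = (h.precomp (killEps (mk g))).add (h'.precomp (killEps (mk g))) := rfl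
    simp only [foxExpr, this, ihg, ihf, map_add, LinearMap.add_apply]
    abel
  | add f g ihf ihg => simp only [foxExpr, ihf, ihg]; abel
  | smul c f ih => simp only [foxExpr, ih, _root_.smul_add]

theorem foxExpr_smul_family {X Y : C.Obj} {n : ℤ} (f : QuotExpr C S X Y n) {Y' : C.Obj} {k : ℤ}
    (c : K) (h : Family C S Y Y' k) {m : ℤ} (hm : n + 1 + k = m) :
    foxExpr f (h.smul c) hm = c • foxExpr f h hm := by
  induction f generalizing k m with
  | of f => simp [foxExpr]
  | eps hU hn => simp [foxExpr, Family.smul]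
  | comp hpq g f ihg ihf =>
    have : (h.smul c).precomp (killEps (mk g)) = (h.precomp (killEps (mk g))).smul c := rfl
    simp only [foxExpr, this, ihg, ihf, map_smul, LinearMap.smul_apply, _root_.smul_add]
  | add f g ihf ihg => simp only [foxExpr, ihf, ihg, _root_.smul_add]
  | smul a f ih => simp only [foxExpr, ih, smul_comm a]

theorem Family.precomp_add {Y Z Y' : C.Obj} {k p : ℤ} (h : Family C S Z Y' k)
    (g g' : C.Hom Y Z p) : h.precomp (g + g') = (h.precomp g).add (h.precomp g') := by
  funext U hU a b hab
  ext x
  simp [Family.precomp, Family.add]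

theorem Family.precomp_smul {Y Z Y' : C.Obj} {k p : ℤ} (h : Family C S Z Y' k)
    (c : K) (g : C.Hom Y Z p) : h.precomp (c • g) = (h.precomp g).smul c := by
  funext U hU a b hab
  ext x
  simp [Family.precomp, Family.smul]

/-- The crossed Leibniz rule respects associativity and units because `killEps` is a functor, and
bilinearity because `foxExpr` is additive and homogeneous in the family. -/
theorem foxExpr_rel {X Y : C.Obj} {n : ℤ} {f g : QuotExpr C S X Y n} (hr : QuotRel C S f g)
    {Y' : C.Obj} {k : ℤ} (h : Family C S Y Y' k) {m : ℤ} (hm : n + 1 + k = m) :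
    foxExpr f h hm = foxExpr g h hm := by
  induction hr generalizing k m with
  | add_congr_left g h ih => simp only [foxExpr, ih]
  | add_congr_right g h ih => simp only [foxExpr, ih]
  | smul_congr c h ih => simp only [foxExpr, ih]
  | comp_congr_left h f hr ih => simp only [foxExpr, ih, sound hr]
  | comp_congr_right h g hr ih => simp only [foxExpr, ih, sound hr]
  | add_comm f g => exact _root_.add_comm _ _
  | add_assoc f g e => exact _root_.add_assoc _ _ _
  | zero_add f => simp [foxExpr]
  | neg_add f => simp [foxExpr]
  | smul_add c f g => exact _root_.smul_add _ _ _
  | add_smul a b f => exact _root_.add_smul _ _ _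
  | mul_smul a b f => exact SemigroupAction.mul_smul _ _ _
  | one_smul f => exact _root_.one_smul _ _
  | comp_add h g f f' =>
    simp only [foxExpr, mk_add, map_add]
    abel
  | add_comp h g g' f =>
    simp only [foxExpr, mk_add, map_add, LinearMap.add_apply, Family.precomp_add,
      foxExpr_add_family]
    abel
  | comp_smul h c g f => simp only [foxExpr, mk_smul, map_smul, _root_.smul_add]
  | smul_comp h c g f =>
    simp only [foxExpr, mk_smul, map_smul, LinearMap.smul_apply, _root_.smul_add,
      Family.precomp_smul, foxExpr_smul_family]
  | @comp_assoc X Y Z W p q r pq qr s h₁ h₂ h₃ h₄ e g f =>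
    subst h₁ h₃
    simp only [foxExpr, mk_comp, map_add, LinearMap.add_apply]
    rw [assoc (pq := p + q + 1 + k) (by omega) _ (by omega) (by omega)]
    refine Eq.trans ?_ (_root_.add_assoc _ _ _).symm
    -- The intermediate degree is made a variable, so that its two spellings can be identified by
    -- substitution.
    have h₅ : ∀ (t : ℤ) (ht : q + 1 + (p + k) = t) (ht' : t + r = m),
        comp (p := q + 1 + (p + k)) (by omega)
          (foxExpr g (h.precomp (killEps (mk e))) rfl) (mk f)
          = comp ht' (foxExpr g (h.precomp (killEps (mk e))) ht) (mk f) := by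
      rintro _ rfl _
      rfl
    refine congrArg₂ _ rfl (congrArg₂ _ (h₅ _ _ _) ?_)
    refine foxExpr_congr f (by omega) _ _ (fun U hU a b hab x => ?_) _
    simp only [Family.precomp, LinearMap.comp_apply, killEps_comp]
    rw [← h.apply_reindex U hU (show p + (q + a) = p + q + a by omega), C.reindex_comp,
      C.assoc rfl (by omega) rfl rfl]
  | id_comp h f =>
    simp only [foxExpr, map_zero, LinearMap.zero_apply, _root_.zero_add, mk_of, killEps_of]
    refine foxExpr_congr f (by omega) _ _ (fun U hU a b hab x => ?_) _
    exact Family.apply_reindex _ U hU (by omega) _ x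
  | comp_id h f =>
    subst hm
    exact (_root_.add_zero _).trans (comp_id _ _)
  | of_add f g => simp [foxExpr]
  | of_smul c f => simp [foxExpr]
  | of_comp h g f => simp [foxExpr]

/-- The linear map `b ε_U z ↦ h(b) z`, for `b` in `C`; it kills the morphisms of `C`. -/
def fox {X Y Y' : C.Obj} {k : ℤ} (h : Family C S Y Y' k) {n m : ℤ} (hm : n + 1 + k = m) :
    QuotHom C S X Y n →ₗ[K] QuotHom C S X Y' m where
  toFun := Quot.lift (fun f => foxExpr f h hm) (fun _ _ hr => foxExpr_rel hr h hm)
  map_add' x y := by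
    induction x using ind; induction y using ind
    rfl
  map_smul' c x := by
    induction x using ind
    rfl

theorem fox_of {X Y Y' : C.Obj} {k : ℤ} (h : Family C S Y Y' k) {n m : ℤ} (hm : n + 1 + k = m)
    (f : C.Hom X Y n) : fox h hm (of S f) = 0 := rfl

theorem fox_comp {X Y Z Y' : C.Obj} {k : ℤ} (h : Family C S Z Y' k) {p q r m : ℤ} (hr : p + q = r)
    (hm : r + 1 + k = m) (x : QuotHom C S Y Z p) (y : QuotHom C S X Y q) :
    fox h hm (comp hr x y) = comp (by omega) (fox h (rfl : p + 1 + k = p + 1 + k) x) y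
      + fox (h.precomp (killEps x)) (by omega) y := by
  induction x using ind; induction y using ind
  rfl

theorem fox_eps {U Y' : C.Obj} (hU : U ∈ S) {k : ℤ} (h : Family C S U Y' k) {m : ℤ}
    (hm : -1 + 1 + k = m) : fox h hm (eps hU) = h U hU 0 m (by omega) (C.id U) := rfl

/-- Left multiplication with `ε_U`. -/
def epsComp {U X : C.Obj} (hU : U ∈ S) {n m : ℤ} (h : m + 1 = n) :
    QuotHom C S X U n →ₗ[K] QuotHom C S X U m := comp (by omega) (eps hU)

/-- Left multiplication with a morphism of `C`. -/
def ofComp {X Y Z : C.Obj} {p q r : ℤ} (h : p + q = r) :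
    C.Hom Y Z p →ₗ[K] QuotHom C S X Y q →ₗ[K] QuotHom C S X Z r :=
  (comp h).comp (of S)

theorem ofComp_apply {X Y Z : C.Obj} {p q r : ℤ} (h : p + q = r) (b : C.Hom Y Z p)
    (z : QuotHom C S X Y q) : ofComp h b z = comp h (of S b) z := rfl

theorem ofComp_of {X Y Z : C.Obj} {p q r : ℤ} (h : p + q = r) (b : C.Hom Y Z p)
    (z : C.Hom X Y q) : ofComp h b (of S z) = of S (C.comp h b z) := (of_comp h b z).symm

theorem ofComp_ofComp {X Y Z W : C.Obj} {p q r pq qr s : ℤ} (h₁ : q + r = qr) (h₂ : p + qr = s)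
    (h₃ : p + q = pq) (h₄ : pq + r = s) (a : C.Hom Z W p) (b : C.Hom Y Z q)
    (z : QuotHom C S X Y r) : ofComp h₂ a (ofComp h₁ b z) = ofComp h₄ (C.comp h₃ a b) z := by
  rw [ofComp_apply, ofComp_apply, ofComp_apply, of_comp, assoc]

theorem ofComp_id {X Y : C.Obj} {n : ℤ} (h : 0 + n = n) (z : QuotHom C S X Y n) :
    ofComp h (C.id Y) z = z := id_comp h z

theorem comp_comm_epsComp {U X W : C.Obj} (hU : U ∈ S) {n m r s t : ℤ} (h : m + 1 = n)
    (h₁ : m + r = s) (h₂ : n + r = t) (z : QuotHom C S X U n) (f : QuotHom C S W X r) :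
    comp h₁ (epsComp hU h z) f = epsComp hU (by omega) (comp h₂ z f) :=
  (assoc _ _ _ _ _ _ _).symm

/-- Only the leftmost ε is differentiated: the remaining Leibniz term differentiates `z` along a
family precomposed with `killEps` of ε, which is zero. -/
theorem fox_ofComp_epsComp {X Y Y' U : C.Obj} (hU : U ∈ S) {k : ℤ} (h : Family C S Y Y' k)
    {p q q' n m : ℤ} (hq : q' + 1 = q) (hn : p + q' = n) (hm : n + 1 + k = m) (b : C.Hom U Y p)
    (z : QuotHom C S X U q) : fox h hm (ofComp hn b (epsComp hU hq z))
      = comp (by omega) (h U hU p (p + k) rfl b) z := by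
  rw [ofComp_apply, epsComp, fox_comp, fox_of, map_zero, LinearMap.zero_apply, _root_.zero_add,
    fox_comp, fox_eps, killEps_of, killEps_eps]
  -- A family precomposed with zero is 0 times itself, so homogeneity in the family makes its
  -- derivative vanish.
  have h0 : (h.precomp b).precomp (0 : C.Hom U U (-1))
      = ((h.precomp b).precomp 0).smul (0 : K) := by
    rw [← Family.precomp_smul, smul_zero]
  have h1 : fox ((h.precomp b).precomp (0 : C.Hom U U (-1)))
      (show q + 1 + (-1 + (p + k)) = m by omega) z = 0 := by
    induction z using ind with
    | h f =>
      change foxExpr f _ _ = 0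
      rw [h0, foxExpr_smul_family, zero_smul]
  rw [h1, _root_.add_zero]
  have h2 : ∀ (s : ℤ) (hs : 0 + (p + k) = s) (hs' : s + q = m),
      comp hs' ((h.precomp b) U hU 0 s hs (C.id U)) z
        = comp (by omega) (h U hU p (p + k) rfl b) z := by
    intro s hs hs'
    obtain rfl : s = p + k := by omega
    rw [Family.precomp, LinearMap.comp_apply]
    have h3 := h.apply_reindex U hU (show p = p + 0 by omega)
      (show p + 0 + k = p + k by omega) b
    rw [← h3]
    congr 3
    rw [← C.comp_id (by omega) b, C.reindex_comp, C.comp_id]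
  exact h2 _ _ _

/-! ### The differential -/

theorem d_eps {U : C.Obj} (hU : U ∈ S) (h : -1 + 1 = (0 : ℤ)) :
    d h (eps hU) = of S (C.id U) := by
  change of S (C.reindex _ (C.id U)) = _
  rw [reindex_rfl]

theorem d_epsComp {U X : C.Obj} (hU : U ∈ S) {n m l : ℤ} (h : m + 1 = n) (h' : n + 1 = l)
    (z : QuotHom C S X U n) : d h (epsComp hU h z) = z - epsComp hU h' (d h' z) := by
  rw [epsComp, leibniz (p' := 0) _ h (by omega) h' (by omega) (by omega), d_eps, id_comp]
  simp [epsComp, sub_eq_add_neg]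

theorem d_ofComp {X Y Z : C.Obj} {p q r p' q' r' : ℤ} (h : p + q = r) (hr : r + 1 = r')
    (hp : p + 1 = p') (hq : q + 1 = q') (b : C.Hom Y Z p) (z : QuotHom C S X Y q) :
    d hr (ofComp h b z) = ofComp (by omega) (C.d hp b) z
      + (-1 : K) ^ p • ofComp (by omega) b (d hq z) :=
  leibniz h hr hp hq _ _ _ _

end QuotHom

end DGCat

end PinchedDG

namespace PinchedDG

namespace DGCat

variable {K : Type w} [Field K] {C : DGCat.{w, u, v} K}

/-! ## Cohomology of the Drinfeld quotient by one object -/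

namespace QuotHom

variable {B X Y : C.Obj}

/-- A family of linear maps on the morphisms from `B`. -/
def Family.single {Y' : C.Obj} {k : ℤ}
    (h : ∀ p q : ℤ, p + k = q → (C.Hom B Y p →ₗ[K] QuotHom C {B} B Y' q)) :
    Family C {B} Y Y' k := fun U hU => by
  obtain rfl : U = B := hU
  exact h

/-- `b, z ↦ b ε_B z`. -/
def be {p q n : ℤ} (h : p + q = n + 1) :
    C.Hom B Y p →ₗ[K] QuotHom C {B} X B q →ₗ[K] QuotHom C {B} X Y n :=
  (ofComp (show p + (q - 1) = n by omega)).compl₂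
    (epsComp (Set.mem_singleton B) (sub_add_cancel q 1))

theorem be_eq {p q q' n : ℤ} (h : p + q = n + 1) (hq : q' + 1 = q) (hn : p + q' = n)
    (b : C.Hom B Y p) (z : QuotHom C {B} X B q) :
    be h b z = ofComp hn b (epsComp (Set.mem_singleton B) hq z) := by
  obtain rfl : q' = q - 1 := by omega
  rfl

theorem fox_be {Y' : C.Obj} {k : ℤ}
    (h : ∀ p q : ℤ, p + k = q → (C.Hom B Y p →ₗ[K] QuotHom C {B} B Y' q)) {p q r n m : ℤ}
    (hn : p + q = n + 1) (hm : n + 1 + k = m) (hr : p + k = r) (b : C.Hom B Y p)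
    (z : QuotHom C {B} X B q) :
    fox (Family.single h) hm (be hn b z) = comp (by omega) (h p r hr b) z := by
  subst hr
  exact fox_ofComp_epsComp _ _ _ _ _ _ _

theorem ofComp_be {Y' : C.Obj} {p q n r s m : ℤ} (h : p + q = n + 1) (h₁ : r + n = m)
    (h₂ : r + p = s) (a : C.Hom Y Y' r) (b : C.Hom B Y p) (z : QuotHom C {B} X B q) :
    ofComp h₁ a (be h b z) = be (by omega) (C.comp h₂ a b) z := by
  rw [be_eq h (sub_add_cancel q 1) (by omega), be_eq _ (sub_add_cancel q 1) (by omega),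
    ofComp_ofComp]

theorem be_id {q n : ℤ} (h : 0 + q = n + 1) (z : QuotHom C {B} X B q) :
    be h (C.id B) z = epsComp (Set.mem_singleton B) (by omega) z := by
  rw [be_eq h (q' := n) (by omega) (by omega), ofComp_id]

theorem be_comp {W : C.Obj} {p q n r s t : ℤ} (h : p + q = n + 1) (h₁ : n + r = s)
    (h₂ : q + r = t) (b : C.Hom B Y p) (z : QuotHom C {B} X B q) (f : QuotHom C {B} W X r) :
    comp h₁ (be h b z) f = be (by omega) b (comp h₂ z f) := by
  rw [be_eq h (sub_add_cancel q 1) (by omega), be_eq _ (q' := q - 1 + r) (by omega) (by omega),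
    ofComp_apply, ofComp_apply, ← assoc (q := q - 1) (qr := q - 1 + r) rfl (by omega) (by omega)
      (by omega), comp_comm_epsComp (h₂ := h₂)]

theorem d_be {p q n p' q' n' : ℤ} (h : p + q = n + 1) (hp : p + 1 = p') (hq : q + 1 = q')
    (hn : n + 1 = n') (b : C.Hom B Y p) (z : QuotHom C {B} X B q) :
    d hn (be h b z) = be (by omega) (C.d hp b) z
      + (-1 : K) ^ p • (ofComp (by omega) b z - be (by omega) b (d hq z)) := by
  rw [be_eq h (sub_add_cancel q 1) (by omega), d_ofComp (hp := hp) (hq := sub_add_cancel q 1),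
    d_epsComp (h' := hq), be_eq _ (sub_add_cancel q 1) (by omega),
    be_eq _ (q' := q) (by omega) (by omega), map_sub]

theorem d_be_closed {p q n q' n' : ℤ} (h : p + q = n + 1) (hq : q + 1 = q')
    (hn : n + 1 = n') (b : C.Hom B Y p) (hb : C.d rfl b = 0) (z : QuotHom C {B} X B q) :
    d hn (be h b z) = (-1 : K) ^ p • (ofComp (by omega) b z - be (by omega) b (d hq z)) := by
  rw [d_be h rfl hq hn, hb, map_zero, LinearMap.zero_apply, _root_.zero_add]

/-- Linear combinations of products with fewer than `m` factors `ε_B`. -/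
def weightLT (X : C.Obj) : ℕ → ∀ (Y : C.Obj) (n : ℤ), Submodule K (QuotHom C {B} X Y n)
  | 0, _, _ => ⊥
  | m + 1, Y, n => LinearMap.range (of {B} : C.Hom X Y n →ₗ[K] _) ⊔
      Submodule.span K {f | ∃ (p q : ℤ) (h : p + q = n + 1) (b : C.Hom B Y p),
        ∃ z ∈ weightLT X m B q, f = be h b z}

theorem of_mem_weightLT (m : ℕ) {n : ℤ} (f : C.Hom X Y n) :
    of {B} f ∈ weightLT (B := B) X (m + 1) Y n :=
  Submodule.mem_sup_left ⟨f, rfl⟩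

theorem be_mem_weightLT {m : ℕ} {p q n : ℤ} (h : p + q = n + 1) (b : C.Hom B Y p)
    {z : QuotHom C {B} X B q} (hz : z ∈ weightLT X m B q) :
    be h b z ∈ weightLT X (m + 1) Y n :=
  Submodule.mem_sup_right (Submodule.subset_span ⟨p, q, h, b, z, hz, rfl⟩)

theorem weightLT_induction {m : ℕ} {n : ℤ} {P : QuotHom C {B} X Y n → Prop}
    (h_of : ∀ f, P (of {B} f))
    (h_be : ∀ {p q : ℤ} (h : p + q = n + 1) (b : C.Hom B Y p),
      ∀ z ∈ weightLT X m B q, P (be h b z))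
    (h_add : ∀ f g, P f → P g → P (f + g)) (h_smul : ∀ (c : K) f, P f → P (c • f))
    {f : QuotHom C {B} X Y n} (hf : f ∈ weightLT X (m + 1) Y n) : P f := by
  obtain ⟨_, ⟨a, rfl⟩, g, hg, rfl⟩ := Submodule.mem_sup.1 hf
  refine h_add _ _ (h_of a) ?_
  clear hf
  induction hg using Submodule.span_induction with
  | mem g hg => obtain ⟨p, q, h, b, z, hz, rfl⟩ := hg; exact h_be h b z hz
  | zero => simpa using h_of 0
  | add f g _ _ ihf ihg => exact h_add _ _ ihf ihg
  | smul c f _ ih => exact h_smul _ _ ih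

theorem weightLT_le {m : ℕ} {n : ℤ} {T : Submodule K (QuotHom C {B} X Y n)}
    (h_of : ∀ f, of {B} f ∈ T)
    (h_be : ∀ {p q : ℤ} (h : p + q = n + 1) (b : C.Hom B Y p),
      ∀ z ∈ weightLT X m B q, be h b z ∈ T) : weightLT X (m + 1) Y n ≤ T := fun _ hf =>
  weightLT_induction (P := fun f => f ∈ T) h_of h_be (fun _ _ => add_mem)
    (fun c _ => T.smul_mem c) hf

theorem weightLT_mono (X : C.Obj) (m : ℕ) (Y : C.Obj) (n : ℤ) :
    weightLT (B := B) X m Y n ≤ weightLT X (m + 1) Y n := by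
  induction m generalizing Y n with
  | zero => exact bot_le
  | succ m ih =>
    exact weightLT_le (of_mem_weightLT _) fun h b z hz => be_mem_weightLT h b (ih _ _ hz)

theorem ofComp_mem_weightLT {Y' : C.Obj} {m : ℕ} {p q n : ℤ} (h : p + q = n) (a : C.Hom Y Y' p)
    {f : QuotHom C {B} X Y q} (hf : f ∈ weightLT X m Y q) : ofComp h a f ∈ weightLT X m Y' n := by
  cases m with
  | zero =>
    obtain rfl : f = 0 := hf
    rw [map_zero]
    exact zero_mem _
  | succ m =>
    refine weightLT_le (T := (weightLT X (m + 1) Y' n).comap (ofComp h a)) (fun f => ?_)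
      (fun h' b z hz => ?_) hf
    · rw [Submodule.mem_comap, ofComp_of]
      exact of_mem_weightLT _ _
    · rw [Submodule.mem_comap, ofComp_be _ _ rfl]
      exact be_mem_weightLT _ _ hz

/-- Numbers of ε add under composition. For positive `m` and `k` the bound `m + k - 1` would be
sharp; the weaker one is enough for exhaustiveness. -/
theorem comp_mem_weightLT {W : C.Obj} {m k : ℕ} {p q n : ℤ} (h : p + q = n)
    {g : QuotHom C {B} X Y p} (hg : g ∈ weightLT X m Y p) {f : QuotHom C {B} W X q}
    (hf : f ∈ weightLT W k X q) : comp h g f ∈ weightLT W (m + k) Y n := by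
  have mono : ∀ (j i : ℕ) (Y : C.Obj) (n : ℤ),
      weightLT (B := B) W i Y n ≤ weightLT W (j + i) Y n := by
    intro j i Y n
    induction j with
    | zero => rw [Nat.zero_add]
    | succ j ih => rw [Nat.succ_add]; exact ih.trans (weightLT_mono _ _ _ _)
  induction m generalizing Y p n with
  | zero =>
    obtain rfl : g = 0 := hg
    rw [map_zero, LinearMap.zero_apply]
    exact zero_mem _
  | succ m ih =>
    refine weightLT_le (T := (weightLT W (m + 1 + k) Y n).comap ((comp h).flip f)) (fun a => ?_)
      (fun h' b z hz => ?_) hg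
    · exact mono _ _ _ _ (ofComp_mem_weightLT h a hf)
    · rw [Submodule.mem_comap, LinearMap.flip_apply, be_comp h' h rfl, Nat.succ_add]
      exact be_mem_weightLT _ _ (ih rfl hz)

/-- The filtration is exhaustive, which allows induction on the number of ε for an arbitrary
morphism. -/
theorem exists_mem_weightLT {n : ℤ} (f : QuotHom C {B} X Y n) :
    ∃ m, f ∈ weightLT X (m + 1) Y n := by
  have mono : ∀ (m k : ℕ) {X Y : C.Obj} {n : ℤ},
      weightLT (B := B) X m Y n ≤ weightLT X (m + k) Y n := by
    intro m k X Y n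
    induction k with
    | zero => exact le_rfl
    | succ k ih => exact ih.trans (weightLT_mono _ _ _ _)
  induction f using ind with
  | h f =>
    induction f with
    | of f => exact ⟨0, of_mem_weightLT _ _⟩
    | @eps U n hU hn =>
      obtain rfl : U = B := hU
      subst hn
      -- The generator is id · ε · id, with one factor ε, hence it has fewer than two.
      refine ⟨1, ?_⟩
      have h1 : mk (.eps (Set.mem_singleton U) rfl) = be (show (0 : ℤ) + 0 = -1 + 1 by rfl) (C.id U)
          (of {U} (C.id U)) := by
        rw [be_id]
        exact (comp_id _ _).symm
      rw [h1]
      exact be_mem_weightLT _ _ (of_mem_weightLT _ _)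
    | comp h g f ihg ihf =>
      obtain ⟨m, hm⟩ := ihg
      obtain ⟨k, hk⟩ := ihf
      exact ⟨m + 1 + k, comp_mem_weightLT h hm hk⟩
    | add f g ihf ihg =>
      obtain ⟨m, hm⟩ := ihf
      obtain ⟨k, hk⟩ := ihg
      refine ⟨m + k, add_mem (?_ : mk f ∈ _) (?_ : mk g ∈ _)⟩
      · rw [Nat.add_right_comm]; exact mono _ _ hm
      · rw [Nat.add_comm m, Nat.add_right_comm]; exact mono _ _ hk
    | smul c f ih =>
      obtain ⟨m, hm⟩ := ih
      exact ⟨m, Submodule.smul_mem _ c hm⟩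

/-! ### Coefficients -/

/-- The coefficient map `b ε_B z ↦ χ(b) z`, for a functional `χ` on the morphisms `B → Y` of
degree `p`. -/
def coeff {p q n : ℤ} (χ : C.Hom B Y p →ₗ[K] K) (h : p + q = n + 1) :
    QuotHom C {B} X Y n →ₗ[K] QuotHom C {B} X B q :=
  -- The family sends `b` of degree `p` to χ(b) times the identity of `B`, which has degree 0,
  -- whence the shift by `-p`.
  fox (k := -p) (Family.single fun p' r hr =>
    if e : p' = p then
      (LinearMap.toSpanSingleton K _ (of {B} (C.reindex (show 0 = r by omega) (C.id B)))).comp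
        (χ.comp (C.reindex e))
    else 0) (by omega)

theorem coeff_of {p q n : ℤ} (χ : C.Hom B Y p →ₗ[K] K) (h : p + q = n + 1) (f : C.Hom X Y n) :
    coeff χ h (of {B} f) = 0 := rfl

theorem coeff_be {p q n : ℤ} (χ : C.Hom B Y p →ₗ[K] K) (h : p + q = n + 1) (b : C.Hom B Y p)
    (z : QuotHom C {B} X B q) : coeff χ h (be h b z) = χ b • z := by
  rw [coeff, fox_be _ h _ (show p + -p = 0 by omega), dif_pos rfl]
  simp only [LinearMap.comp_apply, LinearMap.toSpanSingleton_apply, map_smul,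
    LinearMap.smul_apply, reindex_rfl, id_comp]

theorem coeff_be_ne {p q p' q' n : ℤ} (χ : C.Hom B Y p →ₗ[K] K) (h : p + q = n + 1)
    (h' : p' + q' = n + 1) (hp : p' ≠ p) (b : C.Hom B Y p') (z : QuotHom C {B} X B q') :
    coeff χ h (be h' b z) = 0 := by
  rw [coeff, fox_be _ h' _ rfl, dif_neg hp]
  simp only [LinearMap.zero_apply, map_zero]

theorem coeff_mem_weightLT {m : ℕ} {p q n : ℤ} (χ : C.Hom B Y p →ₗ[K] K) (h : p + q = n + 1)
    {f : QuotHom C {B} X Y n} (hf : f ∈ weightLT X (m + 1) Y n) :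
    coeff χ h f ∈ weightLT X m B q := by
  refine weightLT_le (T := (weightLT X m B q).comap (coeff χ h)) (fun f => ?_)
    (fun {p' q'} h' b z hz => ?_) hf
  · rw [Submodule.mem_comap, coeff_of]
    exact zero_mem _
  · rw [Submodule.mem_comap]
    by_cases hp : p' = p
    · subst hp
      obtain rfl : q = q' := by omega
      rw [coeff_be]
      exact Submodule.smul_mem _ _ hz
    · rw [coeff_be_ne _ _ _ hp]
      exact zero_mem _

/-- From d(b ε z) = db ε z ± (b z - b ε dz): the functional kills boundaries, the coefficient of b z
has one ε fewer, and the term with dz is what the sign in the statement cancels. So taking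
coefficients is a chain map up to sign and lower weight. -/
theorem coeff_d {m : ℕ} {p q n q' n' : ℤ} (χ : C.Hom B Y p →ₗ[K] K)
    (hχ : ∀ b : C.Hom B Y (p - 1), χ (C.d (sub_add_cancel p 1) b) = 0) (h : p + q = n + 1)
    (hq : q + 1 = q') (hn : n + 1 = n') (h' : p + q' = n' + 1)
    {f : QuotHom C {B} X Y n} (hf : f ∈ weightLT X (m + 2) Y n) :
    coeff χ h' (d hn f) + (-1 : K) ^ p • d hq (coeff χ h f) ∈ weightLT X m B q' := by
  refine weightLT_le (m := m + 1) (T := (weightLT X m B q').comap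
    ((coeff χ h').comp (d hn) + (-1 : K) ^ p • (d hq).comp (coeff χ h))) (fun f => ?_)
    (fun {p₁ q₁} h₁ b z hz => ?_) hf
  · simp only [Submodule.mem_comap, LinearMap.add_apply, LinearMap.comp_apply,
      LinearMap.smul_apply, d_of, coeff_of, map_zero, smul_zero, _root_.add_zero]
    exact zero_mem _
  · simp only [Submodule.mem_comap, LinearMap.add_apply, LinearMap.comp_apply,
      LinearMap.smul_apply]
    rw [d_be h₁ rfl rfl hn, map_add, map_smul, map_sub]
    have h₂ : coeff χ h' (ofComp (show p₁ + q₁ = n' by omega) b z) ∈ weightLT X m B q' :=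
      coeff_mem_weightLT _ _ (ofComp_mem_weightLT _ _ hz)
    by_cases hp : p₁ = p
    · subst hp
      obtain rfl : q = q₁ := by omega
      obtain rfl : q + 1 = q' := by omega
      rw [coeff_be_ne _ _ _ (by omega), coeff_be, coeff_be, map_smul, smul_sub]
      convert Submodule.smul_mem _ ((-1 : K) ^ p₁) h₂ using 1
      abel
    · rw [coeff_be_ne χ h h₁ hp, coeff_be_ne χ h' _ hp, map_zero, smul_zero, sub_zero,
        _root_.add_zero]
      refine add_mem ?_ (Submodule.smul_mem _ _ h₂)
      -- The term db ε z can have a nonzero coefficient only if db has degree `p`, and there χ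
      -- vanishes on boundaries.
      by_cases hp' : p₁ + 1 = p
      · obtain rfl : p₁ = p - 1 := by omega
        have h₃ : ∀ (s : ℤ) (hs : p - 1 + 1 = s) (hs' : s + q₁ = n' + 1), s = p →
            coeff χ h' (be hs' (C.d hs b) z) = 0 := by
          rintro s hs hs' rfl
          obtain rfl : q₁ = q' := by omega
          rw [coeff_be, hχ, zero_smul]
        rw [h₃ _ _ _ hp']
        exact zero_mem _
      · rw [coeff_be_ne _ _ _ hp']
        exact zero_mem _

/-! ### Homotopies -/

/-- The map `b ε_B z ↦ h(b) ε_B z`. -/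
def homotopy (h : ∀ p q : ℤ, q + 1 = p → (C.Hom B Y p →ₗ[K] C.Hom B Y q)) {n m : ℤ}
    (hm : m + 1 = n) : QuotHom C {B} X Y n →ₗ[K] QuotHom C {B} X Y m :=
  -- The shift is -2 because h(b) ε has degree two less than b.
  fox (k := -2) (Family.single fun p r hr =>
    LinearMap.comp (LinearMap.flip
      (comp (C := C) (S := {B}) (X := B) (Y := B) (Z := Y) (show p - 1 + -1 = r by omega))
      (eps (Set.mem_singleton B))) ((of (C := C) (X := B) {B}).comp
        (h p (p - 1) (sub_add_cancel p 1))))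
      (by omega)

theorem homotopy_of (h : ∀ p q : ℤ, q + 1 = p → (C.Hom B Y p →ₗ[K] C.Hom B Y q)) {n m : ℤ}
    (hm : m + 1 = n) (f : C.Hom X Y n) : homotopy h hm (of {B} f) = 0 := rfl

theorem homotopy_be (h : ∀ p q : ℤ, q + 1 = p → (C.Hom B Y p →ₗ[K] C.Hom B Y q)) {n m p q p' : ℤ}
    (hm : m + 1 = n) (hn : p + q = n + 1) (hp : p' + 1 = p) (b : C.Hom B Y p)
    (z : QuotHom C {B} X B q) :
    homotopy h hm (be hn b z) = be (by omega) (h p p' hp b) z := by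
  obtain rfl : p' = p - 1 := by omega
  rw [homotopy, fox_be _ hn _ (show p + -2 = p - 2 by omega),
    be_eq _ (sub_add_cancel q 1) (by omega)]
  exact (QuotHom.assoc (C := C) (S := {B}) _ _ _ _ (of {B} (h p (p - 1) hp b)) (eps _)
    z).symm

theorem homotopy_mem_weightLT (h : ∀ p q : ℤ, q + 1 = p → (C.Hom B Y p →ₗ[K] C.Hom B Y q)) {k : ℕ}
    {n m : ℤ} (hm : m + 1 = n) {f : QuotHom C {B} X Y n} (hf : f ∈ weightLT X (k + 1) Y n) :
    homotopy h hm f ∈ weightLT X (k + 1) Y m := by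
  refine weightLT_le (T := (weightLT X (k + 1) Y m).comap (homotopy h hm)) (fun f => ?_)
    (fun {p' q'} h' b z hz => ?_) hf
  · rw [Submodule.mem_comap, homotopy_of]
    exact zero_mem _
  · rw [Submodule.mem_comap, homotopy_be h hm h' (sub_add_cancel p' 1)]
    exact be_mem_weightLT _ _ hz

end QuotHom

/-- A homotopy retraction of the complex of morphisms `B → Y` to the span of two closed morphisms of
distinct degrees `p`, `p'` (which are allowed to be zero). -/
structure Retraction (C : DGCat.{w, u, v} K) (B Y : C.Obj) (p p' : ℤ) where
  ne : p ≠ p'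
  m₀ : C.Hom B Y p
  m₁ : C.Hom B Y p'
  d_m₀ : C.d rfl m₀ = 0
  d_m₁ : C.d rfl m₁ = 0
  χ₀ : C.Hom B Y p →ₗ[K] K
  χ₁ : C.Hom B Y p' →ₗ[K] K
  χ₀_d : ∀ b, χ₀ (C.d (sub_add_cancel p 1) b) = 0
  χ₁_d : ∀ b, χ₁ (C.d (sub_add_cancel p' 1) b) = 0
  χ₀_m₀ : m₀ = 0 ∨ χ₀ m₀ = 1
  χ₁_m₁ : m₁ = 0 ∨ χ₁ m₁ = 1
  h : ∀ r s : ℤ, s + 1 = r → (C.Hom B Y r →ₗ[K] C.Hom B Y s)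
  eq_of_ne : ∀ {r r' s : ℤ} (e : r + 1 = r') (e' : s + 1 = r) (b : C.Hom B Y r), r ≠ p → r ≠ p' →
    b = C.d e' (h r s e' b) + h r' r e (C.d e b)
  eq₀ : ∀ {r' s : ℤ} (e : p + 1 = r') (e' : s + 1 = p) (b : C.Hom B Y p),
    b = C.d e' (h p s e' b) + h r' p e (C.d e b) + χ₀ b • m₀
  eq₁ : ∀ {r' s : ℤ} (e : p' + 1 = r') (e' : s + 1 = p') (b : C.Hom B Y p'),
    b = C.d e' (h p' s e' b) + h r' p' e (C.d e b) + χ₁ b • m₁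

namespace Retraction

open QuotHom

variable {B X Y : C.Obj} {p p' : ℤ}

/-- The retraction identity for `b`, multiplied by ε z. A coefficient map vanishes on `b` of any
other degree, so the three cases of the definition merge into one formula. -/
theorem be_eq (R : C.Retraction B Y p p') {r r' s q q₀ q₁ n : ℤ} (h : r + q = n + 1)
    (e : r + 1 = r') (e' : s + 1 = r) (h₀ : p + q₀ = n + 1) (h₁ : p' + q₁ = n + 1)
    (b : C.Hom B Y r) (z : QuotHom C {B} X B q) :
    be h b z = be h (C.d e' (R.h r s e' b)) z + be h (R.h r' r e (C.d e b)) z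
      + be h₀ R.m₀ (coeff R.χ₀ h₀ (be h b z)) + be h₁ R.m₁ (coeff R.χ₁ h₁ (be h b z)) := by
  by_cases hp : r = p
  · subst hp
    obtain rfl : q₀ = q := by omega
    rw [coeff_be, coeff_be_ne R.χ₁ h₁ h R.ne, map_zero, _root_.add_zero, map_smul,
      ← LinearMap.smul_apply, ← map_smul, ← LinearMap.add_apply, ← LinearMap.add_apply, ← map_add,
      ← map_add, ← R.eq₀]
  · by_cases hp' : r = p'
    · subst hp'
      obtain rfl : q₁ = q := by omega
      rw [coeff_be, coeff_be_ne R.χ₀ h₀ h hp, map_zero, _root_.add_zero, map_smul,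
        ← LinearMap.smul_apply, ← map_smul, ← LinearMap.add_apply, ← LinearMap.add_apply,
        ← map_add, ← map_add, ← R.eq₁]
    · rw [coeff_be_ne R.χ₀ h₀ h hp, coeff_be_ne R.χ₁ h₁ h hp', map_zero, map_zero,
        _root_.add_zero, _root_.add_zero, ← LinearMap.add_apply, ← map_add,
        ← R.eq_of_ne e e' b hp hp']

/-- Acting on the leftmost factor, the homotopy retraction of Hom(B, Y) extends to words b ε z. It
fails to be exact only through the terms in which d hits the leftmost ε, and these have lower
weight. -/
theorem homotopy_formula (R : C.Retraction B Y p p') {m : ℕ} {n n' l q₀ q₁ : ℤ} (hn : n + 1 = n')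
    (hl : l + 1 = n) (h₀ : p + q₀ = n + 1) (h₁ : p' + q₁ = n + 1)
    {f : QuotHom C {B} X Y n} (hf : f ∈ weightLT X (m + 2) Y n) :
    f - (QuotHom.d hl (homotopy R.h hl f) + homotopy R.h hn (QuotHom.d hn f)
      + be h₀ R.m₀ (coeff R.χ₀ h₀ f) + be h₁ R.m₁ (coeff R.χ₁ h₁ f))
      ∈ weightLT X (m + 1) Y n := by
  refine weightLT_le (m := m + 1) (T := (weightLT X (m + 1) Y n).comap
    (LinearMap.id - ((QuotHom.d hl).comp (homotopy R.h hl) + (homotopy R.h hn).comp (QuotHom.d hn)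
      + (be h₀ R.m₀).comp (coeff R.χ₀ h₀) + (be h₁ R.m₁).comp (coeff R.χ₁ h₁)))) (fun f => ?_)
    (fun {r q} h b z hz => ?_) hf
  · simp only [Submodule.mem_comap, LinearMap.sub_apply, LinearMap.add_apply,
      LinearMap.comp_apply, LinearMap.id_apply, QuotHom.d_of, homotopy_of, coeff_of, map_zero,
      _root_.add_zero, sub_zero]
    exact of_mem_weightLT _ _
  · simp only [Submodule.mem_comap, LinearMap.sub_apply, LinearMap.add_apply,
      LinearMap.comp_apply, LinearMap.id_apply]
    have h₂ : ofComp (show r - 1 + q = n by omega) (R.h r (r - 1) (sub_add_cancel r 1) b) z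
        ∈ weightLT X (m + 1) Y n := ofComp_mem_weightLT _ _ hz
    have h₃ : homotopy R.h hn (ofComp (show r + q = n' by omega) b z) ∈ weightLT X (m + 1) Y n :=
      homotopy_mem_weightLT _ _ (ofComp_mem_weightLT _ _ hz)
    -- For f = b ε z the error is (-1)^r (h(b) z - H(b z)), where H is the extended homotopy; both
    -- terms have the weight of `z`.
    convert Submodule.smul_mem _ ((-1 : K) ^ r) (sub_mem h₂ h₃) using 1
    conv_lhs => enter [1]; rw [R.be_eq h rfl (sub_add_cancel r 1) h₀ h₁ b z]
    rw [homotopy_be R.h hl h (sub_add_cancel r 1), d_be _ (sub_add_cancel r 1) rfl,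
      d_be h rfl rfl hn, map_add, map_smul, map_sub,
      homotopy_be R.h hn _ (show r + 1 = r + 1 from rfl),
      homotopy_be R.h hn _ (sub_add_cancel r 1), zpow_sub_one₀ (by simp)]
    simp only [inv_neg, inv_one, mul_neg, mul_one, neg_smul, smul_sub]
    abel

end Retraction

end DGCat

end PinchedDG

/-! ### Cohomology of the associated graded pieces, and the words that survive -/

namespace PinchedDG

namespace DGCat

variable {K : Type w} [Field K] {C : DGCat.{w, u, v} K}

namespace QuotHom

variable {B X Y : C.Obj}

theorem exists_eq_of {n : ℤ} {f : QuotHom C {B} X Y n} (hf : f ∈ weightLT X 1 Y n) :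
    ∃ a, f = of {B} a := by
  have : weightLT X 1 Y n ≤ LinearMap.range (of {B} : C.Hom X Y n →ₗ[K] _) := by
    refine weightLT_le (fun f => ⟨f, rfl⟩) fun h b z hz => ?_
    obtain rfl : z = 0 := hz
    rw [map_zero]
    exact zero_mem _
  obtain ⟨a, ha⟩ := this hf
  exact ⟨a, ha.symm⟩

/-- Every morphism in `weightLT X (m + 1)` which is closed modulo `weightLT X m` is, modulo exact
ones and `weightLT X m`, in `T`. -/
def Spans (T : ∀ n, Submodule K (QuotHom C {B} X Y n)) (m : ℕ) : Prop :=
  ∀ {n n' l : ℤ} (hn : n + 1 = n') (hl : l + 1 = n), ∀ f ∈ weightLT X (m + 1) Y n,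
    d hn f ∈ weightLT X m Y n' → ∃ g ∈ weightLT X (m + 1) Y l, ∃ z ∈ T n, ∃ w ∈ weightLT X m Y n,
      f = d hl g + z + w

/-- No nonzero element of `T` is exact modulo `weightLT X m`. -/
def Independent (T : ∀ n, Submodule K (QuotHom C {B} X Y n)) (m : ℕ) : Prop :=
  ∀ {n l : ℤ} (hl : l + 1 = n), ∀ z ∈ T n, ∀ g ∈ weightLT X (m + 1) Y l,
    z - d hl g ∈ weightLT X m Y n → z = 0

end QuotHom

namespace Retraction

open QuotHom

variable {B X Y : C.Obj} {p p' : ℤ}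

/-- The span of `m₀ ε_B T` and `m₁ ε_B T`. -/
def layer (R : C.Retraction B Y p p') (T : ∀ n, Submodule K (QuotHom C {B} X B n)) (n : ℤ) :
    Submodule K (QuotHom C {B} X Y n) :=
  (T (n + 1 - p)).map (be (by omega) R.m₀) ⊔ (T (n + 1 - p')).map (be (by omega) R.m₁)

theorem be_m₀_mem_layer (R : C.Retraction B Y p p') {T : ∀ n, Submodule K (QuotHom C {B} X B n)}
    {q n : ℤ} (h : p + q = n + 1) {z : QuotHom C {B} X B q} (hz : z ∈ T q) :
    be h R.m₀ z ∈ R.layer T n := by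
  obtain rfl : q = n + 1 - p := by omega
  exact Submodule.mem_sup_left ⟨z, hz, rfl⟩

theorem be_m₁_mem_layer (R : C.Retraction B Y p p') {T : ∀ n, Submodule K (QuotHom C {B} X B n)}
    {q n : ℤ} (h : p' + q = n + 1) {z : QuotHom C {B} X B q} (hz : z ∈ T q) :
    be h R.m₁ z ∈ R.layer T n := by
  obtain rfl : q = n + 1 - p' := by omega
  exact Submodule.mem_sup_right ⟨z, hz, rfl⟩

theorem mem_layer (R : C.Retraction B Y p p') {T : ∀ n, Submodule K (QuotHom C {B} X B n)}
    {q q' n : ℤ} (h : p + q = n + 1) (h' : p' + q' = n + 1) {f : QuotHom C {B} X Y n} :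
    f ∈ R.layer T n ↔ ∃ z ∈ T q, ∃ w ∈ T q', f = be h R.m₀ z + be h' R.m₁ w := by
  obtain rfl : q = n + 1 - p := by omega
  obtain rfl : q' = n + 1 - p' := by omega
  constructor
  · intro hf
    obtain ⟨_, ⟨z, hz, rfl⟩, _, ⟨w, hw, rfl⟩, rfl⟩ := Submodule.mem_sup.1 hf
    exact ⟨z, hz, w, hw, rfl⟩
  · rintro ⟨z, hz, w, hw, rfl⟩
    exact add_mem (R.be_m₀_mem_layer _ hz) (R.be_m₁_mem_layer _ hw)

/-- A coefficient inherits closedness modulo lower weight, by `coeff_d` and because coefficients of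
lower terms are lower. -/
theorem d_coeff_mem {m : ℕ} {p q n q' n' : ℤ} (χ : C.Hom B Y p →ₗ[K] K)
    (hχ : ∀ b : C.Hom B Y (p - 1), χ (C.d (sub_add_cancel p 1) b) = 0) (h : p + q = n + 1)
    (hq : q + 1 = q') (hn : n + 1 = n') {f : QuotHom C {B} X Y n} (hf : f ∈ weightLT X (m + 2) Y n)
    (hdf : QuotHom.d hn f ∈ weightLT X (m + 1) Y n') :
    QuotHom.d hq (coeff χ h f) ∈ weightLT X m B q' := by
  have h₁ := coeff_d χ hχ h hq hn (by omega) hf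
  have h₂ := (Submodule.add_mem_iff_right _ (coeff_mem_weightLT χ _ hdf)).1 h₁
  exact (Submodule.smul_mem_iff _ (zpow_ne_zero p (by simp))).1 h₂

/-- As M is closed, M ε dg is up to sign M g minus the differential of M ε g. So a decomposition of
`z` modulo exact and lower terms carries over to M ε z. -/
theorem exists_be_eq {m : ℕ} {T : ∀ n, Submodule K (QuotHom C {B} X B n)} (hT : Spans T m)
    {q q' n l : ℤ} (h : p + q = n + 1) (hq : q + 1 = q') (hl : l + 1 = n) (M : C.Hom B Y p)
    (hM : C.d rfl M = 0) (z : QuotHom C {B} X B q) (hz : z ∈ weightLT X (m + 1) B q)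
    (hdz : QuotHom.d hq z ∈ weightLT X m B q') :
    ∃ g ∈ weightLT X (m + 2) Y l, ∃ y ∈ T q, ∃ w ∈ weightLT X (m + 1) Y n,
      be h M z = QuotHom.d hl g + be h M y + w := by
  obtain ⟨g, hg, y, hy, w, hw, rfl⟩ := hT hq (sub_add_cancel q 1) z hz hdz
  refine ⟨-((-1 : K) ^ p • be (by omega) M g),
    neg_mem (Submodule.smul_mem _ _ (be_mem_weightLT _ _ hg)), y, hy,
    ofComp (by omega) M g + be h M w,
    add_mem (ofComp_mem_weightLT _ _ hg) (be_mem_weightLT _ _ hw), ?_⟩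
  rw [map_neg, map_smul, d_be_closed _ (sub_add_cancel q 1) hl M hM, smul_smul,
    ← mul_zpow, neg_one_mul, neg_neg, one_zpow, _root_.one_smul, map_add, map_add]
  abel

/-- `homotopy_formula` replaces f by m₀ ε z₀ + m₁ ε z₁, where z₀ and z₁ are the coefficients of f.
These are closed modulo lower weight, so the hypothesis on `T` applies to each. -/
theorem spans_layer (R : C.Retraction B Y p p') {m : ℕ}
    {T : ∀ n, Submodule K (QuotHom C {B} X B n)} (hT : Spans T m) :
    Spans (R.layer T) (m + 1) := by
  intro n n' l hn hl f hf hdf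
  have h₀ : p + (n + 1 - p) = n + 1 := by omega
  have h₁ : p' + (n + 1 - p') = n + 1 := by omega
  have hw := R.homotopy_formula hn hl h₀ h₁ hf
  obtain ⟨g₀, hg₀, y₀, hy₀, w₀, hw₀, e₀⟩ := exists_be_eq hT h₀ rfl hl R.m₀ R.d_m₀ _
    (coeff_mem_weightLT R.χ₀ h₀ hf) (d_coeff_mem R.χ₀ R.χ₀_d h₀ rfl hn hf hdf)
  obtain ⟨g₁, hg₁, y₁, hy₁, w₁, hw₁, e₁⟩ := exists_be_eq hT h₁ rfl hl R.m₁ R.d_m₁ _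
    (coeff_mem_weightLT R.χ₁ h₁ hf) (d_coeff_mem R.χ₁ R.χ₁_d h₁ rfl hn hf hdf)
  rw [e₀, e₁] at hw
  refine ⟨homotopy R.h hl f + g₀ + g₁, add_mem (add_mem (homotopy_mem_weightLT _ _ hf) hg₀) hg₁,
    be h₀ R.m₀ y₀ + be h₁ R.m₁ y₁,
    add_mem (R.be_m₀_mem_layer _ hy₀) (R.be_m₁_mem_layer _ hy₁), _,
    add_mem (add_mem (add_mem hw (homotopy_mem_weightLT R.h hn hdf)) hw₀) hw₁, ?_⟩
  rw [map_add, map_add]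
  abel

/-- If f is exact modulo lower weight via g, then up to sign the coefficient of g makes the
coefficient of f exact modulo lower weight. -/
theorem eq_zero_of_independent {m : ℕ} {T : ∀ n, Submodule K (QuotHom C {B} X B n)}
    (hT : Independent T m) {p q n l : ℤ} (χ : C.Hom B Y p →ₗ[K] K)
    (hχ : ∀ b : C.Hom B Y (p - 1), χ (C.d (sub_add_cancel p 1) b) = 0) (h : p + q = n + 1)
    (hl : l + 1 = n) (f : QuotHom C {B} X Y n) (hf : coeff χ h f ∈ T q)
    (g : QuotHom C {B} X Y l) (hg : g ∈ weightLT X (m + 2) Y l)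
    (hfg : f - QuotHom.d hl g ∈ weightLT X (m + 1) Y n) : coeff χ h f = 0 := by
  have h₁ := coeff_d χ hχ (show p + (q - 1) = l + 1 by omega) (sub_add_cancel q 1) hl h hg
  have h₂ := coeff_mem_weightLT χ h hfg
  refine hT (sub_add_cancel q 1) _ hf (-((-1 : K) ^ p • coeff χ (by omega) g))
    (neg_mem (Submodule.smul_mem _ _ (coeff_mem_weightLT _ _ hg))) ?_
  convert add_mem h₂ h₁ using 1
  rw [map_sub, map_neg, map_smul]
  abel

/-- The functionals χ₀ and χ₁ live in distinct degrees, so the two coefficient maps separate m₀ ε y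
from m₁ ε w. A zero generator contributes nothing. -/
theorem independent_layer (R : C.Retraction B Y p p') {m : ℕ}
    {T : ∀ n, Submodule K (QuotHom C {B} X B n)} (hT : Independent T m) :
    Independent (R.layer T) (m + 1) := by
  intro n l hl f hf g hg hfg
  have h₀ : p + (n + 1 - p) = n + 1 := by omega
  have h₁ : p' + (n + 1 - p') = n + 1 := by omega
  obtain ⟨y, hy, w, hw, rfl⟩ := (R.mem_layer h₀ h₁).1 hf
  have e₀ : be h₀ R.m₀ y = 0 := by
    rcases R.χ₀_m₀ with h | h
    · rw [h, map_zero, LinearMap.zero_apply]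
    · have hc : coeff R.χ₀ h₀ (be h₀ R.m₀ y + be h₁ R.m₁ w) = y := by
        rw [map_add, coeff_be, h, _root_.one_smul, coeff_be_ne _ _ _ R.ne.symm, _root_.add_zero]
      have := eq_zero_of_independent hT R.χ₀ R.χ₀_d h₀ hl _ (by rwa [hc]) g hg hfg
      rw [hc] at this
      rw [this, map_zero]
  have e₁ : be h₁ R.m₁ w = 0 := by
    rcases R.χ₁_m₁ with h | h
    · rw [h, map_zero, LinearMap.zero_apply]
    · have hc : coeff R.χ₁ h₁ (be h₀ R.m₀ y + be h₁ R.m₁ w) = w := by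
        rw [map_add, coeff_be, h, _root_.one_smul, coeff_be_ne _ _ _ R.ne, _root_.zero_add]
      have := eq_zero_of_independent hT R.χ₁ R.χ₁_d h₁ hl _ (by rwa [hc]) g hg hfg
      rw [hc] at this
      rw [this, map_zero]
  rw [e₀, e₁, _root_.add_zero]

end Retraction

/-- The hypotheses on an object `B` and an object `X`, under which the cohomology of the morphisms
from `X` in the Drinfeld quotient by `B` can be computed: the endomorphisms of `B` retract to the
span of the identity and a morphism `t` of degree `1` with `t² = 0`, and `N` represents the
cohomology of the morphisms from `X` to `B`, with `t N = 0`. -/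
structure SphereLike (C : DGCat.{w, u, v} K) (X B : C.Obj) where
  R : C.Retraction B B 0 1
  m₀_eq : R.m₀ = C.id B
  sq_zero : C.comp (show (1 : ℤ) + 1 = 2 by rfl) R.m₁ R.m₁ = 0
  χ₁_m₁ : R.χ₁ R.m₁ = 1
  N : ∀ n, Submodule K (C.Hom X B n)
  d_N : ∀ {n : ℤ}, ∀ b ∈ N n, C.d rfl b = 0
  exists_of_closed : ∀ {n l : ℤ} (hl : l + 1 = n) (b : C.Hom X B n), C.d rfl b = 0 →
    ∃ a ∈ N n, ∃ c, b = a + C.d hl c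
  eq_zero_of_exact : ∀ {n l : ℤ} (hl : l + 1 = n) (c : C.Hom X B l), C.d hl c ∈ N n →
    C.d hl c = 0
  comp_N : ∀ {n : ℤ}, ∀ b ∈ N n, C.comp (rfl : 1 + n = 1 + n) R.m₁ b = 0

namespace SphereLike

open QuotHom

variable {B X : C.Obj} (S : C.SphereLike X B)

/-- Representatives of the associated graded of the cohomology. -/
def strata : ℕ → ∀ n, Submodule K (QuotHom C {B} X B n)
  -- Index shift as in `weightLT`: index m + 1 carries the words with exactly m factors ε, starting
  -- with `N` at index 1.
  | 0 => fun _ => ⊥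
  | 1 => fun n => (S.N n).map (of {B})
  | m + 2 => S.R.layer (strata (m + 1))

/-- For positive indices this is equality by definition. The point is index 0, where the layer over
zero is zero although index 1 holds `N`. -/
theorem layer_le_strata (m : ℕ) (n : ℤ) : S.R.layer (S.strata m) n ≤ S.strata (m + 1) n := by
  cases m with
  | zero =>
    rintro _ hf
    obtain ⟨_, rfl, _, rfl, rfl⟩ := (S.R.mem_layer (q := n + 1) (q' := n) (by omega)
      (by omega)).1 hf
    rw [map_zero, map_zero, _root_.add_zero]
    exact zero_mem _
  | succ m => exact le_rfl

/-- Weight below one means `C` itself, where `N` represents the cohomology of Hom(X, B). Each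
further ε is handled by `spans_layer`. -/
theorem spans_strata (m : ℕ) : Spans (S.strata (m + 1)) m := by
  induction m with
  | zero =>
    intro n n' l hn hl f hf hdf
    subst hn
    obtain ⟨a, rfl⟩ := exists_eq_of hf
    have h₁ : of {B} (C.d rfl a) = 0 := hdf
    obtain ⟨b, hb, c, rfl⟩ := S.exists_of_closed hl a (of_injective (h₁.trans (map_zero _).symm))
    refine ⟨of {B} c, of_mem_weightLT _ _, of {B} b, ⟨b, hb, rfl⟩, 0, zero_mem _, ?_⟩
    rw [QuotHom.d_of, map_add]
    abel
  | succ m ih => exact S.R.spans_layer ih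

theorem independent_strata (m : ℕ) : Independent (S.strata (m + 1)) m := by
  induction m with
  | zero =>
    rintro n l hl _ ⟨a, ha, rfl⟩ g hg h
    obtain ⟨c, rfl⟩ := exists_eq_of hg
    have h₁ : of {B} a = of {B} (C.d hl c) := sub_eq_zero.1 h
    have h₂ := of_injective h₁
    rw [h₂] at ha ⊢
    rw [S.eq_zero_of_exact hl c ha, map_zero]
  | succ m ih => exact S.R.independent_layer ih

theorem mem_strata {m : ℕ} {n : ℤ} {f : QuotHom C {B} X B n} :
    f ∈ S.strata (m + 2) n ↔ ∃ z ∈ S.strata (m + 1) (n + 1), ∃ w ∈ S.strata (m + 1) n,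
      f = be (by omega) (C.id B) z + be (by omega) S.R.m₁ w := by
  rw [← S.m₀_eq]
  exact S.R.mem_layer _ _

/-- A closed morphism `M` with `M t = 0` and `M N = 0`. -/
structure Annihilates {Y : C.Obj} {p : ℤ} (M : C.Hom B Y p) : Prop where
  closed : C.d rfl M = 0
  comp_m₁ : C.comp (rfl : p + 1 = p + 1) M S.R.m₁ = 0
  comp_N : ∀ {n : ℤ}, ∀ b ∈ S.N n, C.comp (rfl : p + n = p + n) M b = 0

theorem annihilates_m₁ : S.Annihilates S.R.m₁ := ⟨S.R.d_m₁, S.sq_zero, S.comp_N⟩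

namespace Annihilates

variable {S} {Y : C.Obj} {p : ℤ} {M : C.Hom B Y p}

theorem ofComp_be_m₁ (hM : S.Annihilates M) {q n r : ℤ} (h : 1 + q = n + 1) (h₁ : p + n = r)
    (z : QuotHom C {B} X B q) : ofComp h₁ M (be h S.R.m₁ z) = 0 := by
  rw [ofComp_be h h₁ rfl, hM.comp_m₁, map_zero, LinearMap.zero_apply]

theorem ofComp_be_id {q n r : ℤ} (h : 0 + q = n + 1) (h₁ : p + n = r)
    (z : QuotHom C {B} X B q) : ofComp h₁ M (be h (C.id B) z) = be (by omega) M z := by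
  rw [ofComp_be h h₁ (_root_.add_zero p), C.comp_id]

/-- Write f = ε z + t ε w. Since M t = 0 only M ε z remains, and the innermost factors vanish by M N
= 0. -/
theorem ofComp_strata (hM : S.Annihilates M) {m : ℕ} {n r : ℤ} (h : p + n = r)
    {f : QuotHom C {B} X B n} (hf : f ∈ S.strata (m + 1) n) :
    ∃ z ∈ S.strata m (n + 1), ofComp h M f = be (by omega) M z := by
  cases m with
  | zero =>
    obtain ⟨a, ha, rfl⟩ := hf
    subst h
    refine ⟨0, zero_mem _, ?_⟩
    rw [ofComp_of, hM.comp_N a ha, map_zero, map_zero]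
  | succ m =>
    obtain ⟨z, hz, w, hw, rfl⟩ := S.mem_strata.1 hf
    refine ⟨z, hz, ?_⟩
    rw [map_add, hM.ofComp_be_m₁, ofComp_be_id, _root_.add_zero]

end Annihilates

/-- On the chosen representatives the differential is the bar differential: it removes exactly one
ε, without corrections. This uses that 1 and t are closed, t² = 0 and t N = 0. -/
theorem d_strata {m : ℕ} {n n' : ℤ} (hn : n + 1 = n') {f : QuotHom C {B} X B n}
    (hf : f ∈ S.strata (m + 1) n) : QuotHom.d hn f ∈ S.strata m n' := by
  subst hn
  induction m generalizing n with
  | zero =>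
    obtain ⟨a, ha, rfl⟩ := hf
    rw [QuotHom.d_of, S.d_N a ha, map_zero]
    exact zero_mem _
  | succ m ih =>
    obtain ⟨z, hz, w, hw, rfl⟩ := S.mem_strata.1 hf
    have h₁ : ∀ {q k : ℤ} (h : 0 + q = k + 1) (y : QuotHom C {B} X B q), y ∈ S.strata m q →
        be h (C.id B) y ∈ S.strata (m + 1) k := by
      intro q k h y hy
      rw [← S.m₀_eq]
      exact S.layer_le_strata _ _ (S.R.be_m₀_mem_layer _ hy)
    have h₂ : ∀ {q k : ℤ} (h : 1 + q = k + 1) (y : QuotHom C {B} X B q), y ∈ S.strata m q →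
        be h S.R.m₁ y ∈ S.strata (m + 1) k := fun h y hy =>
      S.layer_le_strata _ _ (S.R.be_m₁_mem_layer _ hy)
    rw [map_add, d_be_closed _ rfl rfl _ (C.d_id B rfl), d_be_closed _ rfl rfl _ S.R.d_m₁]
    refine add_mem (Submodule.smul_mem _ _ (sub_mem ?_ (h₁ _ _ (ih hz))))
      (Submodule.smul_mem _ _ (sub_mem ?_ (h₂ _ _ (ih hw))))
    · rw [ofComp_id]
      exact hz
    · obtain ⟨y, hy, e⟩ := S.annihilates_m₁.ofComp_strata (show 1 + n = n + 1 by omega) hw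
      rw [e]
      exact h₂ _ _ hy

/-- The bar complex of K[t]/t² made explicit: a closed combination of words after M can be altered
by an exact one until all inner letters are t. `J` is any family containing `N` and stable under z ↦
t ε z, so it contains the surviving words. -/
theorem Annihilates.exists_be_eq {Y : C.Obj} {p : ℤ} {M : C.Hom B Y p} {S : C.SphereLike X B}
    (hM : S.Annihilates M) (χ : C.Hom B Y p →ₗ[K] K) (hχ : χ M = 1)
    {J : ∀ n, Submodule K (QuotHom C {B} X B n)} (hN : ∀ n, (S.N n).map (of {B}) ≤ J n)
    (hJ : ∀ n, ∀ j ∈ J n, be (_root_.add_comm 1 n) S.R.m₁ j ∈ J n)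
    {m : ℕ} {q n n' l : ℤ} (h : p + q = n + 1) (hn : n + 1 = n') (hl : l + 1 = n)
    {z : QuotHom C {B} X B q} (hz : z ∈ S.strata m q) (hd : QuotHom.d hn (be h M z) = 0) :
    ∃ c : QuotHom C {B} X B (q - 1), ∃ j ∈ J q,
      be h M z = QuotHom.d hl (be (by omega) M c) + be h M j := by
  have sgn : ∀ (k : ℤ) {Z : C.Obj} {r : ℤ} (f : QuotHom C {B} X Z r),
      (-1 : K) ^ k • (-1 : K) ^ k • f = f := fun k Z r f => by
    rw [smul_smul, ← mul_zpow, neg_one_mul, neg_neg, one_zpow, _root_.one_smul]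
  -- The coefficient at M' with respect to χ' recovers f from M' ε f.
  have inj : ∀ {Z : C.Obj} {r k i : ℤ} {M' : C.Hom B Z r} (χ' : C.Hom B Z r →ₗ[K] K),
      χ' M' = 1 → ∀ (h' : r + k = i + 1) (f : QuotHom C {B} X B k), be h' M' f = 0 → f = 0 := by
    intro Z r k i M' χ' e h' f hf
    have := coeff_be χ' h' M' f
    rwa [hf, map_zero, e, _root_.one_smul, eq_comm] at this
  induction m generalizing Y p n n' l q with
  | zero =>
    obtain rfl : z = 0 := hz
    exact ⟨0, 0, zero_mem _, by simp⟩
  | succ m ih =>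
    cases m with
    | zero => exact ⟨0, z, hN _ hz, by simp⟩
    | succ m =>
      obtain ⟨z', hz', w, hw, rfl⟩ := S.mem_strata.1 hz
      set f := be (show 0 + (q + 1) = q + 1 by omega) (C.id B) z'
        + be (show 1 + q = q + 1 by omega) S.R.m₁ w with hf
      -- Closedness of M ε f says M f = M ε df. Since M t = 0, the left side is M ε z', and M ε · is
      -- injective.
      have e₁ : z' = QuotHom.d rfl f := by
        rw [d_be_closed _ rfl hn _ hM.closed, hf, map_add, hM.ofComp_be_m₁,
          Annihilates.ofComp_be_id, _root_.add_zero, ← hf, ← map_sub,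
          smul_eq_zero_iff_right (zpow_ne_zero _ (by simp))] at hd
        exact sub_eq_zero.1 (inj χ hχ _ _ hd)
      -- By `e₁`, d(ε f) = f - ε z'. Hence in ± d(M ε ε f) = M ε f - M ε d(ε f) only M ε ε z'
      -- survives: the part of f beginning with the letter 1 is exact after M ε.
      have e₂ : be h M (be (by omega) (C.id B) z') = (-1 : K) ^ p • QuotHom.d hl
          (be (by omega) M (be (show 0 + q = q - 1 + 1 by omega) (C.id B) f)) := by
        rw [d_be_closed _ (sub_add_cancel q 1) hl _ hM.closed, sgn, Annihilates.ofComp_be_id,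
          d_be_closed _ rfl (sub_add_cancel q 1) _ (C.d_id B rfl), ofComp_id, zpow_zero,
          _root_.one_smul, map_sub, ← e₁]
        abel
      -- Exact words beginning with t remain exact after M ε, since the missing term M t ε y
      -- vanishes.
      have e₃ : ∀ {i : ℤ} (hi : i + 1 = q) (y : QuotHom C {B} X B i),
          be h M (QuotHom.d hi (be (_root_.add_comm 1 i) S.R.m₁ y)) = -((-1 : K) ^ p • QuotHom.d hl
            (be (by omega) M (be (_root_.add_comm 1 i) S.R.m₁ y))) := by
        intro i hi y
        rw [d_be_closed _ hi hl _ hM.closed, sgn, hM.ofComp_be_m₁, _root_.zero_sub, neg_neg]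
      -- By `e₂` what remains, M ε t ε w, is closed. As M t = 0 its differential is ± M ε d(t ε w),
      -- so t ε w is closed itself.
      have e₄ : QuotHom.d rfl (be (show 1 + q = q + 1 by omega) S.R.m₁ w) = 0 := by
        refine inj χ hχ (show p + (q + 1) = n' + 1 by omega) _ ?_
        have : QuotHom.d hn (be h M (be (show 1 + q = q + 1 by omega) S.R.m₁ w)) = 0 := by
          rw [hf, map_add, map_add, e₂, map_smul, QuotHom.d_d, smul_zero, _root_.zero_add] at hd
          exact hd
        rw [d_be_closed _ rfl hn _ hM.closed, hM.ofComp_be_m₁, _root_.zero_sub, smul_neg,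
          neg_eq_zero, smul_eq_zero_iff_right (zpow_ne_zero _ (by simp))] at this
        exact this
      -- The induction proceeds with M replaced by t, which is itself annihilating; this is why `M`
      -- and `Y` are generalized.
      obtain ⟨c, j, hj, e⟩ := ih S.annihilates_m₁ S.R.χ₁ S.χ₁_m₁ (_root_.add_comm 1 q) rfl
        (sub_add_cancel q 1) hw e₄
      refine ⟨(-1 : K) ^ p • (be (show 0 + q = q - 1 + 1 by omega) (C.id B) f
        - be (_root_.add_comm 1 (q - 1)) S.R.m₁ c), be (_root_.add_comm 1 q) S.R.m₁ j,
        hJ _ _ hj, ?_⟩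
      have e₅ := congrArg (be h M) hf
      clear_value f
      rw [map_add, e₂, e, map_add, e₃] at e₅
      simp only [e₅, map_smul, map_sub, smul_sub]
      abel

/-- Induction on the number of ε: the top part of f is corrected to a genuinely closed combination
of words, which `exists_be_eq` brings into the form m₀ ε j modulo exact terms. What remains is
closed with fewer ε. -/
theorem Annihilates.exists_eq_of_closed {Y : C.Obj} {p p' : ℤ} {S : C.SphereLike X B}
    (R : C.Retraction B Y p p') (hM : S.Annihilates R.m₀) (hR : R.m₁ = 0)
    {J : ∀ n, Submodule K (QuotHom C {B} X B n)} (hN : ∀ n, (S.N n).map (of {B}) ≤ J n)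
    (hJ : ∀ n, ∀ j ∈ J n, be (_root_.add_comm 1 n) S.R.m₁ j ∈ J n) {q n n' l : ℤ}
    (h : p + q = n + 1) (hn : n + 1 = n') (hl : l + 1 = n) (f : QuotHom C {B} X Y n)
    (hf : QuotHom.d hn f = 0) :
    ∃ (g : QuotHom C {B} X Y l) (a : C.Hom X Y n), ∃ j ∈ J q,
      f = QuotHom.d hl g + of {B} a + be h R.m₀ j := by
  obtain ⟨m, hm⟩ := exists_mem_weightLT f
  induction m generalizing f with
  | zero =>
    obtain ⟨a, rfl⟩ := exists_eq_of hm
    exact ⟨0, a, 0, zero_mem _, by simp⟩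
  | succ m ih =>
    obtain ⟨g, hg, y, hy, w, hw, e⟩ := R.spans_layer (S.spans_strata m) hn hl f hm
      (by rw [hf]; exact zero_mem _)
    obtain ⟨z, hz, z', -, rfl⟩ := (R.mem_layer h (q' := n + 1 - p') (by omega)).1 hy
    rw [hR, map_zero, LinearMap.zero_apply, _root_.add_zero] at e
    -- The differential of the top part lies in the next lower layer and equals the differential of
    -- -w. Independence of that layer forces it to vanish, so no higher differential occurs.
    have hdz : QuotHom.d hn (be h R.m₀ z) = 0 := by
      have hdw : QuotHom.d hn (be h R.m₀ z) - QuotHom.d hn (-w) = 0 := by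
        rw [e, map_add, map_add, QuotHom.d_d, _root_.zero_add] at hf
        rw [map_neg, sub_neg_eq_add, hf]
      obtain ⟨y, hy, ey⟩ := hM.ofComp_strata (show p + q = n' by omega) hz
      have hmem : QuotHom.d hn (be h R.m₀ z) ∈ R.layer (S.strata m) n' := by
        rw [d_be_closed _ rfl hn _ R.d_m₀, ey]
        exact Submodule.smul_mem _ _ (sub_mem (R.be_m₀_mem_layer _ hy)
          (R.be_m₀_mem_layer _ (S.d_strata rfl hz)))
      cases m with
      | zero =>
        obtain ⟨_, rfl, _, rfl, e₀⟩ := (R.mem_layer (q := q + 1) (q' := n' + 1 - p') (by omega)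
          (by omega)).1 hmem
        rw [e₀, map_zero, map_zero, _root_.add_zero]
      | succ m =>
        exact R.independent_layer (S.independent_strata m) hn _ hmem (-w) (neg_mem hw)
          (by rw [hdw]; exact zero_mem _)
    obtain ⟨c, j, hj, e'⟩ : ∃ c : QuotHom C {B} X B (q - 1), ∃ j ∈ J q,
        be h R.m₀ z = QuotHom.d hl (be (by omega) R.m₀ c) + be h R.m₀ j := by
      rcases R.χ₀_m₀ with h₀ | h₀
      · refine ⟨0, 0, zero_mem _, ?_⟩
        simp only [h₀, map_zero, LinearMap.zero_apply, _root_.add_zero]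
      · exact hM.exists_be_eq R.χ₀ h₀ hN hJ h hn hl hz hdz
    obtain ⟨g', a, j', hj', rfl⟩ := ih w (by
      rwa [e, map_add, map_add, QuotHom.d_d, hdz, _root_.zero_add, _root_.zero_add] at hf) hw
    refine ⟨g + be (by omega) R.m₀ c + g', a, j + j', add_mem hj hj', ?_⟩
    rw [e, e']
    simp only [map_add]
    abel

end SphereLike

end DGCat

end PinchedDG

namespace PinchedDG

open Quiver

/-! ## Graded representations -/

section gradedMod

variable {K : Type w} [Field K] {V : Type u} (U : V → Type v') [∀ x, AddCommGroup (U x)]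
  [∀ x, Module K (U x)] (G : ∀ x, ℤ → Submodule K (U x))

/-- The linear maps of degree `n` between two graded vector spaces. -/
def homogeneousMaps (x y : V) (n : ℤ) : Submodule K (U x →ₗ[K] U y) where
  carrier := {f | ∀ k, ∀ u ∈ G x k, f u ∈ G y (n + k)}
  add_mem' hf hg k u hu := add_mem (hf k u hu) (hg k u hu)
  zero_mem' _ _ _ := zero_mem _
  smul_mem' c _ hf k u hu := Submodule.smul_mem _ c (hf k u hu)

theorem comp_mem_homogeneousMaps {x y z : V} {p q r : ℤ} (h : p + q = r) {g : U y →ₗ[K] U z}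
    (hg : g ∈ homogeneousMaps U G y z p) {f : U x →ₗ[K] U y}
    (hf : f ∈ homogeneousMaps U G x y q) : g.comp f ∈ homogeneousMaps U G x z r := by
  intro k u hu
  rw [← h, add_assoc]
  exact hg _ _ (hf k u hu)

theorem id_mem_homogeneousMaps (x : V) :
    (LinearMap.id : U x →ₗ[K] U x) ∈ homogeneousMaps U G x x 0 := by
  intro k u hu
  rwa [zero_add]

/-- The graded category of a family of graded vector spaces. -/
def gradedMod : DGCat.{w, u, v'} K where
  Obj := V
  Hom x y n := homogeneousMaps U G x y n
  id x := ⟨LinearMap.id, id_mem_homogeneousMaps U G x⟩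
  comp h := LinearMap.mk₂ K (fun g f => ⟨g.1.comp f.1, comp_mem_homogeneousMaps U G h g.2 f.2⟩)
    (fun _ _ _ => rfl) (fun _ _ _ => rfl)
    (fun _ _ _ => by ext; simp) (fun _ _ _ => by ext; simp)
  d _ := 0
  id_comp _ _ := rfl
  comp_id _ _ := rfl
  assoc _ _ _ _ _ _ _ := rfl
  d_d _ _ _ := rfl
  leibniz _ _ _ _ _ _ _ _ := by
    simp only [LinearMap.zero_apply, map_zero, smul_zero, add_zero]

/-- The opposite of the graded category of a family of graded vector spaces. -/
def gradedModOp : DGCat.{w, u, v'} K where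
  Obj := V
  Hom x y n := homogeneousMaps U G y x n
  id x := ⟨LinearMap.id, id_mem_homogeneousMaps U G x⟩
  -- No Koszul sign is needed: unsigned reversed composition is associative, and with zero
  -- differential the Leibniz rule is void.
  comp h := LinearMap.mk₂ K (fun g f => ⟨f.1.comp g.1,
      comp_mem_homogeneousMaps U G ((add_comm _ _).trans h) f.2 g.2⟩)
    (fun _ _ _ => by ext; simp) (fun _ _ _ => by ext; simp)
    (fun _ _ _ => rfl) (fun _ _ _ => rfl)
  d _ := 0
  id_comp _ _ := rfl
  comp_id _ _ := rfl
  assoc _ _ _ _ _ _ _ := rfl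
  d_d _ _ _ := rfl
  leibniz _ _ _ _ _ _ _ _ := by
    simp only [LinearMap.zero_apply, map_zero, smul_zero, add_zero]

end gradedMod

namespace GradedQuiver

variable {K : Type w} [Field K] (Q : GradedQuiver.{u}) (I : Relations K Q)

theorem mem_ideal {x y : Q.V} {r : Q.FreeHom K x y} (hr : r ∈ I x y) : r ∈ Q.ideal I x y := by
  refine Submodule.subset_span ⟨x, y, Finsupp.single Path.nil 1, r, Finsupp.single Path.nil 1, hr,
    ?_⟩
  rw [pathMul_nil]
  simp only [pathMul, Finsupp.linearCombination_single, one_smul, Path.comp_nil]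
  exact Finsupp.mapDomain_id.symm

theorem mul_assoc' {x y z t : Q.V} (h : Q.QuotAlg I z t) (g : Q.QuotAlg I y z)
    (f : Q.QuotAlg I x y) : Q.mul I h (Q.mul I g f) = Q.mul I (Q.mul I h g) f := by
  obtain ⟨h, rfl⟩ := Submodule.mkQ_surjective _ h
  obtain ⟨g, rfl⟩ := Submodule.mkQ_surjective _ g
  obtain ⟨f, rfl⟩ := Submodule.mkQ_surjective _ f
  exact congrArg (Submodule.mkQ _) (Q.pathMul_assoc h g f)

theorem mul_nil {x y : Q.V} (f : Q.QuotAlg I x y) : Q.mul I f (Q.pathClass I Path.nil) = f := by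
  obtain ⟨f, rfl⟩ := Submodule.mkQ_surjective _ f
  rw [pathClass, mul_mk, pathMul_nil]

theorem nil_mul {x y : Q.V} (f : Q.QuotAlg I x y) : Q.mul I (Q.pathClass I Path.nil) f = f := by
  obtain ⟨f, rfl⟩ := Submodule.mkQ_surjective _ f
  rw [pathClass, mul_mk]
  simp only [pathMul, Finsupp.linearCombination_single, one_smul, Path.comp_nil]
  exact congrArg _ Finsupp.mapDomain_id

theorem pathDeg_toPath {x y : Q.V} (e : Q.Arrow x y) : Q.pathDeg (Hom.toPath e) = Q.deg e.1 :=
  zero_add _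

theorem pathDeg_toPath_comp {x y z : Q.V} (a : Q.Arrow x y) (b : Q.Arrow y z) :
    Q.pathDeg ((Hom.toPath a).comp (Hom.toPath b)) = Q.deg b.1 + Q.deg a.1 := by
  rw [pathDeg_comp, pathDeg_toPath, pathDeg_toPath, add_comm]

section evalDeg

variable (D : DGCat.{w, u', v'} K) (o : Q.V → D.Obj)
  (f : ∀ {x y : Q.V} (e : Q.Arrow x y), D.Hom (o x) (o y) (Q.deg e.1))

theorem evalDeg_toPath {x y : Q.V} (a : Q.Arrow x y) {n : ℤ} (h : Q.deg a.1 = n) (c : K) :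
    Q.evalDeg D o f n (Finsupp.single (Hom.toPath a) c) = c • D.reindex h (f a) := by
  subst h
  rw [Q.evalDeg_single D o f (Hom.toPath a) (zero_add _), D.reindex_rfl]
  refine congrArg _ ((D.reindex_comp _ _ _ _).trans ?_)
  exact D.comp_id _ _

theorem evalDeg_toPath_ne {x y : Q.V} (a : Q.Arrow x y) {n : ℤ} (h : Q.deg a.1 ≠ n) (c : K) :
    Q.evalDeg D o f n (Finsupp.single (Hom.toPath a) c) = 0 :=
  Q.evalDeg_single_ne D o f _ (by rwa [pathDeg_toPath]) c

theorem evalDeg_toPath_comp {x y z : Q.V} (a : Q.Arrow x y) (b : Q.Arrow y z) {n : ℤ}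
    (h : Q.deg b.1 + Q.deg a.1 = n) (c : K) :
    Q.evalDeg D o f n (Finsupp.single ((Hom.toPath a).comp (Hom.toPath b)) c)
      = c • D.comp h (f b) (f a) := by
  rw [Q.evalDeg_single D o f _ (by rw [← h, pathDeg_toPath_comp])]
  refine congrArg _ ((D.reindex_comp _ _ _ _).trans ?_)
  have h₁ : D.comp (add_comm (Q.deg a.1) 0) (f a) (D.id (o x))
      = D.reindex (zero_add _).symm (f a) :=
    (D.reindex_comp (add_zero _) _ _ _).symm.trans (congrArg _ (D.comp_id _ _))
  refine (congrArg _ h₁).trans ?_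
  exact D.comp_reindex_right _ _ _ _

theorem evalDeg_toPath_comp_ne {x y z : Q.V} (a : Q.Arrow x y) (b : Q.Arrow y z) {n : ℤ}
    (h : Q.deg b.1 + Q.deg a.1 ≠ n) (c : K) :
    Q.evalDeg D o f n (Finsupp.single ((Hom.toPath a).comp (Hom.toPath b)) c) = 0 :=
  Q.evalDeg_single_ne D o f _ (by rwa [pathDeg_toPath_comp]) c

end evalDeg

/-- The class of an arrow. -/
def arrowClass {x y : Q.V} (e : Q.Arrow x y) : Q.QuotAlg I x y := Q.pathClass I (Hom.toPath e)

theorem arrowClass_mem {x y : Q.V} (e : Q.Arrow x y) {n : ℤ} (h : Q.deg e.1 = n) :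
    Q.arrowClass I e ∈ Q.component I x y n :=
  Submodule.subset_span ⟨Hom.toPath e, (Q.pathDeg_toPath e).trans h, rfl⟩

end GradedQuiver

/-! ### The defining relations of a pinched gentle algebra -/

namespace PinchedGentle

variable {Λ : PinchedGentle.{u}} {K : Type w} [Field K]

theorem mul_arrowClass_of_rel {x y z : Λ.V} (a : Λ.Arrow x y) (b : Λ.Arrow y z)
    (h : Λ.rel b.1 a.1) : Λ.mul (Λ.relations K) (Λ.arrowClass _ b) (Λ.arrowClass _ a) = 0 := by
  rw [GradedQuiver.arrowClass, GradedQuiver.arrowClass, GradedQuiver.mul_pathClass]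
  exact (Submodule.Quotient.mk_eq_zero _).2 (Λ.mem_ideal _ (IsRelation.gentle a b h))

theorem mul_arrowClass_pinched_out {v y : Λ.V} (c : Λ.Arrow v v) (b : Λ.Arrow v y)
    (hc : Λ.pinched c.1) (hb : ¬ Λ.pinched b.1) :
    Λ.mul (Λ.relations K) (Λ.arrowClass _ b) (Λ.arrowClass _ c)
      = ((Λ.outSign b.1 : ℤ) : K) • Λ.arrowClass _ b := by
  rw [GradedQuiver.arrowClass, GradedQuiver.arrowClass, GradedQuiver.mul_pathClass,
    GradedQuiver.pathClass, GradedQuiver.pathClass, ← map_smul, Finsupp.smul_single, smul_eq_mul,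
    mul_one]
  exact (Submodule.Quotient.eq _).2 (Λ.mem_ideal _ (IsRelation.pinched_out c b hc hb))

theorem mul_arrowClass_pinched_in {x v : Λ.V} (a : Λ.Arrow x v) (c : Λ.Arrow v v)
    (hc : Λ.pinched c.1) (ha : ¬ Λ.pinched a.1) :
    Λ.mul (Λ.relations K) (Λ.arrowClass _ c) (Λ.arrowClass _ a)
      = ((Λ.inSign a.1 : ℤ) : K) • Λ.arrowClass _ a := by
  rw [GradedQuiver.arrowClass, GradedQuiver.arrowClass, GradedQuiver.mul_pathClass,
    GradedQuiver.pathClass, GradedQuiver.pathClass, ← map_smul, Finsupp.smul_single, smul_eq_mul,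
    mul_one]
  exact (Submodule.Quotient.eq _).2 (Λ.mem_ideal _ (IsRelation.pinched_in a c hc ha))

/-- To give a graded functor on `𝒫(Λ)`, it suffices to check the following relations. -/
theorem evalDeg_eq_zero (D : DGCat.{w, u', v'} K) (o : Λ.V → D.Obj)
    (f : ∀ {x y : Λ.V} (e : Λ.Arrow x y), D.Hom (o x) (o y) (Λ.deg e.1))
    (h_gentle : ∀ {x y z : Λ.V} (a : Λ.Arrow x y) (b : Λ.Arrow y z), Λ.rel b.1 a.1 →
      D.comp rfl (f b) (f a) = 0)
    (h_out : ∀ {v y : Λ.V} (c : Λ.Arrow v v) (b : Λ.Arrow v y) (hc : Λ.pinched c.1),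
      ¬ Λ.pinched b.1 → D.comp (by rw [Λ.pinched_deg hc, add_zero]) (f b) (f c)
        = ((Λ.outSign b.1 : ℤ) : K) • f b)
    (h_in : ∀ {x v : Λ.V} (a : Λ.Arrow x v) (c : Λ.Arrow v v) (hc : Λ.pinched c.1),
      ¬ Λ.pinched a.1 → D.comp (by rw [Λ.pinched_deg hc, zero_add]) (f c) (f a)
        = ((Λ.inSign a.1 : ℤ) : K) • f a) :
    ∀ x y, ∀ r ∈ Λ.relations K x y, ∀ n, Λ.evalDeg D o f n r = 0 := by
  rintro x y r hr n
  cases hr with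
  | gentle a b h =>
    by_cases hn : Λ.deg b.1 + Λ.deg a.1 = n
    · subst hn
      rw [Λ.evalDeg_toPath_comp D o f a b rfl, h_gentle a b h, smul_zero]
    · exact Λ.evalDeg_toPath_comp_ne D o f a b hn _
  | pinched_out c b hc hb =>
    rw [map_sub]
    by_cases hn : Λ.deg b.1 = n
    · subst hn
      rw [Λ.evalDeg_toPath_comp D o f c b (by rw [Λ.pinched_deg hc, add_zero]),
        Λ.evalDeg_toPath D o f b rfl, D.reindex_rfl, h_out c b hc hb, one_smul, sub_self]
    · rw [Λ.evalDeg_toPath_comp_ne D o f c b (by rwa [Λ.pinched_deg hc, add_zero]),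
        Λ.evalDeg_toPath_ne D o f b hn, sub_zero]
  | pinched_in a c hc ha =>
    rw [map_sub]
    by_cases hn : Λ.deg a.1 = n
    · subst hn
      rw [Λ.evalDeg_toPath_comp D o f a c (by rw [Λ.pinched_deg hc, zero_add]),
        Λ.evalDeg_toPath D o f a rfl, D.reindex_rfl, h_in a c hc ha, one_smul, sub_self]
    · rw [Λ.evalDeg_toPath_comp_ne D o f a c (by rwa [Λ.pinched_deg hc, zero_add]),
        Λ.evalDeg_toPath_ne D o f a hn, sub_zero]

end PinchedGentle

end PinchedDG

namespace PinchedDG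

open Quiver

namespace PinchedGentle

variable {Λ : PinchedGentle.{u}} {K : Type w} [Field K]

/-! ## Multiplication with `ω` -/

section strip

open Classical in
/-- The identity of `t`, as a morphism from `t` to `y`; zero if `y ≠ t`. -/
def idClass (K : Type w) [Field K] (t y : Λ.V) : Λ.QuotAlg (Λ.relations K) t y :=
  if h : t = y then Λ.pathClass _ ((Path.nil : Path t t).cast rfl h) else 0

open Classical in
/-- The arrow `e`, as a morphism from `x` to `y`; zero if it does not go from `x` to `y`. -/
def arrowClassOf (K : Type w) [Field K] (e : Λ.E) (x y : Λ.V) : Λ.QuotAlg (Λ.relations K) x y :=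
  if h : Λ.src e = x ∧ Λ.tgt e = y then Λ.arrowClass _ ⟨e, h⟩ else 0

theorem idClass_self (t : Λ.V) : idClass K t t = Λ.pathClass _ Path.nil := dif_pos rfl

theorem idClass_of_ne {t y : Λ.V} (h : t ≠ y) : idClass K t y = 0 := dif_neg h

theorem idClass_mem (t y : Λ.V) : idClass K t y ∈ Λ.component (Λ.relations K) t y 0 := by
  by_cases h : t = y
  · subst h
    rw [idClass_self]
    exact Submodule.subset_span ⟨Path.nil, rfl, rfl⟩
  · rw [idClass_of_ne h]
    exact zero_mem _

theorem arrowClassOf_eq {x y : Λ.V} (e : Λ.Arrow x y) :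
    arrowClassOf K e.1 x y = Λ.arrowClass _ e := dif_pos e.2

theorem arrowClassOf_of_not {e : Λ.E} {x y : Λ.V} (h : ¬ (Λ.src e = x ∧ Λ.tgt e = y)) :
    arrowClassOf K e x y = 0 := dif_neg h

theorem arrowClassOf_mem (e : Λ.E) (x y : Λ.V) :
    arrowClassOf K e x y ∈ Λ.component (Λ.relations K) x y (Λ.deg e) := by
  by_cases h : Λ.src e = x ∧ Λ.tgt e = y
  · rw [arrowClassOf_eq ⟨e, h⟩]
    exact Λ.arrowClass_mem _ _ rfl
  · rw [arrowClassOf_of_not h]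
    exact zero_mem _

variable {α β : Λ.E}

/-- The graded pieces of `M × K × K`, with `M` in degrees shifted by `a`, and with the two copies
of `K` in degrees `0` and `a`. -/
def stripDeg {M : Type*} [AddCommGroup M] [Module K M] (G : ℤ → Submodule K M) (a : ℤ) (k : ℤ) :
    Submodule K (M × K × K) where
  carrier := {v | v.1 ∈ G (k - a) ∧ (k ≠ 0 → v.2.1 = 0) ∧ (k ≠ a → v.2.2 = 0)}
  add_mem' hu hv := ⟨add_mem hu.1 hv.1, fun h => by simp [hu.2.1 h, hv.2.1 h],
    fun h => by simp [hu.2.2 h, hv.2.2 h]⟩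
  zero_mem' := ⟨zero_mem _, fun _ => rfl, fun _ => rfl⟩
  smul_mem' c _ hu := ⟨Submodule.smul_mem _ c hu.1, fun h => by simp [hu.2.1 h],
    fun h => by simp [hu.2.2 h]⟩

/-- The linear map `(v, a, b) ↦ (f v + c₁ a i + c₂ b j, 0, c₃ a)`. -/
def stripMap {M N : Type*} [AddCommGroup M] [Module K M] [AddCommGroup N] [Module K N]
    (f : M →ₗ[K] N) (i j : N) (c₁ c₂ c₃ : K) : M × K × K →ₗ[K] N × K × K where
  toFun v := (f v.1 + (c₁ * v.2.1) • i + (c₂ * v.2.2) • j, 0, c₃ * v.2.1)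
  map_add' v w := by
    refine Prod.ext ?_ (Prod.ext (add_zero _).symm (mul_add _ _ _))
    simp only [Prod.fst_add, Prod.snd_add, map_add, mul_add, add_smul]
    abel
  map_smul' c v := by
    refine Prod.ext ?_ (Prod.ext (smul_zero _).symm (mul_left_comm _ _ _))
    simp only [Prod.smul_fst, Prod.smul_snd, map_smul, smul_add, smul_smul, smul_eq_mul,
      mul_left_comm c, RingHom.id_apply]

theorem stripMap_mem {M N : Type*} [AddCommGroup M] [Module K M] [AddCommGroup N] [Module K N]
    {G : ℤ → Submodule K M} {G' : ℤ → Submodule K N} {a n : ℤ} {f : M →ₗ[K] N} {i j : N}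
    {c₁ c₂ c₃ : K} (hf : ∀ k, ∀ v ∈ G k, f v ∈ G' (n + k)) (hi : i ∈ G' 0) (hj : j ∈ G' n)
    (h₁ : n ≠ a → c₁ = 0) (h₃ : n ≠ a → c₃ = 0) {k : ℤ} {v : M × K × K}
    (hv : v ∈ stripDeg G a k) : stripMap f i j c₁ c₂ c₃ v ∈ stripDeg G' a (n + k) := by
  refine ⟨add_mem (add_mem ?_ ?_) ?_, fun _ => rfl, fun h => ?_⟩
  · rw [add_sub_assoc]
    exact hf _ _ hv.1
  · by_cases hn : n = a
    · by_cases hk : k = 0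
      · subst hn hk
        rw [show n + 0 - n = 0 by ring]
        exact Submodule.smul_mem _ _ hi
      · rw [hv.2.1 hk, mul_zero, zero_smul]
        exact zero_mem _
    · rw [h₁ hn, zero_mul, zero_smul]
      exact zero_mem _
  · by_cases hk : k = a
    · subst hk
      rw [add_sub_cancel_right]
      exact Submodule.smul_mem _ _ hj
    · rw [hv.2.2 hk, mul_zero, zero_smul]
      exact zero_mem _
  · change c₃ * v.2.1 = 0
    by_cases hn : n = a
    · rw [hv.2.1 (by omega), mul_zero]
    · rw [h₃ hn, zero_mul]

open Classical in
/-- The indicator of a proposition. -/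
def indicator (K : Type w) [Field K] (p : Prop) : K := if p then 1 else 0

theorem indicator_of {p : Prop} (h : p) : indicator K p = 1 := if_pos h

theorem indicator_not {p : Prop} (h : ¬ p) : indicator K p = 0 := if_neg h

variable (K α) in
/-- The vector space `e_y Λ e_2 × K × K`. -/
abbrev RightMod (y : Λ.V) : Type (max u w) := Λ.QuotAlg (Λ.relations K) (Λ.tgt α) y × K × K

variable (K α) in
/-- The vector space `e_1 Λ e_x × K × K`. -/
abbrev LeftMod (x : Λ.V) : Type (max u w) := Λ.QuotAlg (Λ.relations K) x (Λ.src α) × K × K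

/-- The module structure is restated over the additive monoid underlying the additive group, the
form in which `homogeneousMaps` and `gradedMod` ask for it. -/
instance (y : Λ.V) : @Module K (RightMod K α y) _ AddCommGroup.toAddCommMonoid := inferInstance

instance (x : Λ.V) : @Module K (LeftMod K α x) _ AddCommGroup.toAddCommMonoid := inferInstance

variable (K α) in
/-- The graded pieces of `e_y Λ e_2 × K × K`. -/
def rightDeg (y : Λ.V) (k : ℤ) :
    Submodule K (RightMod K α y) :=
  stripDeg (fun n => Λ.component (Λ.relations K) (Λ.tgt α) y n) (Λ.deg α) k

variable (α β) in
/-- The action of an arrow on the representation `y ↦ e_y Λ e_2 × K × K` isomorphic to `Λ e_1`. -/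
def rightAct (μ : K) {x y : Λ.V} (e : Λ.Arrow x y) :
    RightMod K α x →ₗ[K] RightMod K α y :=
  -- Read (v, a, b) as v ω + a e_1 + b β and multiply by e on the left. The entries encode α e_1 = ω
  -- - μ β and β e_1 = β. If eα is a relation, eω = μ eβ, so eβ = μ⁻¹ eω; otherwise eβ is a relation
  -- for e starting at 2. The action is defined on the formal triples, without assuming that they
  -- embed in Λ e_1.
  stripMap (Λ.mul _ (Λ.arrowClass _ e)) (idClass K (Λ.tgt α) y) (arrowClassOf K e.1 (Λ.tgt α) y)
    (indicator K (e.1 = α)) (indicator K (Λ.rel e.1 α) * μ⁻¹)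
    (indicator K (e.1 = β) - μ * indicator K (e.1 = α))

variable (K α) in
/-- The graded pieces of `e_1 Λ e_x × K × K`. -/
def leftDeg (x : Λ.V) (k : ℤ) :
    Submodule K (LeftMod K α x) :=
  stripDeg (fun n => Λ.component (Λ.relations K) x (Λ.src α) n) (Λ.deg α) k

variable (α β) in
/-- The action of an arrow on the representation `x ↦ e_1 Λ e_x × K × K` isomorphic to
`e_2 Λ`. -/
def leftAct (μ : K) {x y : Λ.V} (e : Λ.Arrow x y) :
    LeftMod K α y →ₗ[K] LeftMod K α x :=
  -- Here (v, a, b) stands for ω v + a e_2 + b β, multiplied by e on the right.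
  stripMap ((Λ.mul _).flip (Λ.arrowClass _ e)) (idClass K x (Λ.src α))
    (arrowClassOf K e.1 x (Λ.src α))
    (indicator K (e.1 = α)) (indicator K (Λ.rel α e.1) * μ⁻¹)
    (indicator K (e.1 = β) - μ * indicator K (e.1 = α))

variable (μ : K)

theorem IsKronecker.indicator_eq_zero (hK : Λ.IsKronecker α β) {e : Λ.E} (h : Λ.deg e ≠ Λ.deg α) :
    indicator K (e = α) = 0 ∧ indicator K (e = β) - μ * indicator K (e = α) = 0 := by
  have h₁ : indicator K (e = α) = 0 := indicator_not fun h' => h (h' ▸ rfl)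
  have h₂ : indicator K (e = β) = 0 := indicator_not fun h' => h (h' ▸ hK.deg_eq)
  exact ⟨h₁, by rw [h₁, h₂, mul_zero, sub_zero]⟩

theorem IsKronecker.rightAct_mem (hK : Λ.IsKronecker α β) {x y : Λ.V} (e : Λ.Arrow x y) :
    rightAct α β μ e ∈ homogeneousMaps (RightMod K α) (rightDeg K α) x y (Λ.deg e.1) :=
  fun _ _ hv => stripMap_mem
    (fun _ _ hu => Λ.mul_mem_component _ rfl (Λ.arrowClass_mem _ e rfl) hu)
    (idClass_mem _ _) (arrowClassOf_mem _ _ _) (fun h => (hK.indicator_eq_zero μ h).1)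
    (fun h => (hK.indicator_eq_zero μ h).2) hv

theorem IsKronecker.leftAct_mem (hK : Λ.IsKronecker α β) {x y : Λ.V} (e : Λ.Arrow x y) :
    leftAct α β μ e ∈ homogeneousMaps (LeftMod K α) (leftDeg K α) y x (Λ.deg e.1) :=
  fun _ _ hv => stripMap_mem
    (fun _ _ hu => Λ.mul_mem_component _ (add_comm _ _) hu
      (Λ.arrowClass_mem _ e rfl))
    (idClass_mem _ _) (arrowClassOf_mem _ _ _) (fun h => (hK.indicator_eq_zero μ h).1)
    (fun h => (hK.indicator_eq_zero μ h).2) hv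

/-- Arrows other than `α`, `β` act by multiplication on the first summand. -/
theorem rightAct_of_ne {x y : Λ.V} (e : Λ.Arrow x y) (h : e.1 ≠ α) (h' : e.1 ≠ β)
    (v : RightMod K α x) : rightAct α β μ e v
      = (Λ.mul _ (Λ.arrowClass _ e) v.1
        + (indicator K (Λ.rel e.1 α) * μ⁻¹ * v.2.2) • arrowClassOf K e.1 (Λ.tgt α) y, 0, 0) := by
  simp only [rightAct, stripMap, LinearMap.coe_mk, AddHom.coe_mk, indicator_not h,
    indicator_not h', zero_mul, zero_smul, add_zero, mul_zero, sub_zero]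

theorem leftAct_of_ne {x y : Λ.V} (e : Λ.Arrow x y) (h : e.1 ≠ α) (h' : e.1 ≠ β)
    (v : LeftMod K α y) : leftAct α β μ e v
      = (Λ.mul _ v.1 (Λ.arrowClass _ e)
        + (indicator K (Λ.rel α e.1) * μ⁻¹ * v.2.2) • arrowClassOf K e.1 x (Λ.src α), 0, 0) := by
  simp only [leftAct, stripMap, LinearMap.coe_mk, AddHom.coe_mk, indicator_not h,
    indicator_not h', zero_mul, zero_smul, add_zero, mul_zero, sub_zero, LinearMap.flip_apply]

theorem mul_arrowClassOf_right {x y z : Λ.V} (a : Λ.Arrow x y) (b : Λ.Arrow y z)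
    (h : Λ.rel b.1 a.1) (t : Λ.V) :
    Λ.mul (Λ.relations K) (Λ.arrowClass _ b) (arrowClassOf K a.1 t y) = 0 := by
  by_cases ht : Λ.src a.1 = t
  · rw [arrowClassOf_eq ⟨a.1, ht, a.2.2⟩]
    exact mul_arrowClass_of_rel _ _ h
  · rw [arrowClassOf_of_not fun h' => ht h'.1, map_zero]

theorem mul_arrowClassOf_left {x y z : Λ.V} (a : Λ.Arrow x y) (b : Λ.Arrow y z)
    (h : Λ.rel b.1 a.1) (t : Λ.V) :
    Λ.mul (Λ.relations K) (arrowClassOf K b.1 y t) (Λ.arrowClass _ a) = 0 := by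
  by_cases ht : Λ.tgt b.1 = t
  · rw [arrowClassOf_eq ⟨b.1, b.2.1, ht⟩]
    exact mul_arrowClass_of_rel _ _ h
  · rw [arrowClassOf_of_not fun h' => ht h'.2, map_zero, LinearMap.zero_apply]

/-- Critical is a = α: the generator goes to ω - μ β, and b kills this because b e_2 and μ⁻¹ b ·
(-μ) cancel. For a = β, a relation bβ excludes bα, so b ignores the β-coordinate. -/
theorem IsKronecker.rightAct_gentle (hK : Λ.IsKronecker α β) (hμ : μ ≠ 0) {x y z : Λ.V}
    (a : Λ.Arrow x y) (b : Λ.Arrow y z) (h : Λ.rel b.1 a.1) (v : RightMod K α x) :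
    rightAct α β μ b (rightAct α β μ a v) = 0 := by
  refine Prod.ext ?_ (Prod.ext rfl (mul_zero _))
  simp only [rightAct, stripMap, LinearMap.coe_mk, AddHom.coe_mk, map_add, map_smul,
    mul_arrowClassOf_right a b h, smul_zero, add_zero, mul_zero, zero_smul, Prod.fst_zero,
    Λ.mul_assoc', mul_arrowClass_of_rel a b h, map_zero, LinearMap.zero_apply, zero_add]
  by_cases ha : a.1 = α
  · obtain ⟨a, rfl, rfl⟩ := a
    change a = α at ha
    subst ha
    rw [indicator_of rfl, indicator_of h, indicator_not hK.ne, idClass_self, Λ.mul_nil,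
      arrowClassOf_eq b, ← add_smul]
    simp [hμ]
  · by_cases hb : a.1 = β
    · have hb' : ¬ Λ.rel b.1 α := fun h' => ha (Λ.rel_right_unique h h')
      rw [indicator_not ha, indicator_not hb']
      simp
    · rw [indicator_not ha, indicator_not hb]
      simp

/-- The mirror image of `rightAct_gentle`; the exclusion now comes from uniqueness of the arrow b
with ba in I^g. -/
theorem IsKronecker.leftAct_gentle (hK : Λ.IsKronecker α β) (hμ : μ ≠ 0) {x y z : Λ.V}
    (a : Λ.Arrow x y) (b : Λ.Arrow y z) (h : Λ.rel b.1 a.1) (v : LeftMod K α z) :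
    leftAct α β μ a (leftAct α β μ b v) = 0 := by
  refine Prod.ext ?_ (Prod.ext rfl (mul_zero _))
  simp only [leftAct, stripMap, LinearMap.coe_mk, AddHom.coe_mk, map_add, map_smul,
    LinearMap.flip_apply, LinearMap.add_apply, LinearMap.smul_apply,
    mul_arrowClassOf_left a b h, smul_zero, add_zero, mul_zero, zero_smul, Prod.fst_zero,
    ← Λ.mul_assoc', mul_arrowClass_of_rel a b h, map_zero, zero_add]
  by_cases hb : b.1 = α
  · obtain ⟨b, rfl, rfl⟩ := b
    change b = α at hb
    subst hb
    rw [indicator_of rfl, indicator_of h, indicator_not hK.ne, idClass_self, Λ.nil_mul,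
      arrowClassOf_eq a, ← add_smul]
    simp [hμ]
  · by_cases ha : b.1 = β
    · have ha' : ¬ Λ.rel α a.1 := fun h' => hb (Λ.rel_left_unique h h')
      rw [indicator_not hb, indicator_not ha']
      simp
    · rw [indicator_not hb, indicator_not ha]
      simp

section pinched

variable (hK : Λ.IsKronecker α β)

/-- This and the next two lemmas exploit that no pinched loop sits at 1 or 2: the exceptional
coordinates of the representation never meet a pinched relation. -/
theorem IsKronecker.ne_of_pinched {c : Λ.E} (hc : Λ.pinched c) :
    Λ.IsKronecker α β → c ≠ α ∧ c ≠ β ∧ ¬ Λ.rel c α ∧ ¬ Λ.rel α c := fun hK =>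
  ⟨fun h => hK.not_pinched_left (h ▸ hc), fun h => hK.not_pinched_right (h ▸ hc),
    fun h => (Λ.rel_comp h).1 hc, fun h => (Λ.rel_comp h).2.1 hc⟩

theorem IsKronecker.ne_of_src_pinched (hK : Λ.IsKronecker α β) {c b : Λ.E} (hc : Λ.pinched c)
    (h : Λ.src b = Λ.src c) : b ≠ α ∧ b ≠ β ∧ ¬ Λ.rel b α :=
  ⟨fun h' => hK.no_pinched_src c hc (by rw [← h, h']),
    fun h' => hK.no_pinched_src c hc (by rw [← h, h', hK.src_eq]),
    fun h' => hK.no_pinched_tgt c hc (by rw [← h, ← (Λ.rel_comp h').2.2])⟩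

theorem IsKronecker.ne_of_tgt_pinched (hK : Λ.IsKronecker α β) {c a : Λ.E} (hc : Λ.pinched c)
    (h : Λ.tgt a = Λ.src c) : a ≠ α ∧ a ≠ β ∧ ¬ Λ.rel α a :=
  ⟨fun h' => hK.no_pinched_tgt c hc (by rw [← h, h']),
    fun h' => hK.no_pinched_tgt c hc (by rw [← h, h', hK.tgt_eq]),
    fun h' => hK.no_pinched_src c hc (by rw [← h, (Λ.rel_comp h').2.2])⟩

theorem IsKronecker.rightAct_pinched_out (hK : Λ.IsKronecker α β) {v y : Λ.V} (c : Λ.Arrow v v)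
    (b : Λ.Arrow v y) (hc : Λ.pinched c.1) (hb : ¬ Λ.pinched b.1) (m : RightMod K α v) :
    rightAct α β μ b (rightAct α β μ c m) = ((Λ.outSign b.1 : ℤ) : K) • rightAct α β μ b m := by
  obtain ⟨h₁, h₂, h₃, -⟩ := IsKronecker.ne_of_pinched hc hK
  obtain ⟨h₄, h₅, h₆⟩ := hK.ne_of_src_pinched hc (b.2.1.trans c.2.1.symm)
  rw [rightAct_of_ne μ c h₁ h₂, rightAct_of_ne μ b h₄ h₅, rightAct_of_ne μ b h₄ h₅,
    indicator_not h₃, indicator_not h₆]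
  refine Prod.ext ?_ (Prod.ext (smul_zero _).symm (smul_zero _).symm)
  simp [Λ.mul_assoc', mul_arrowClass_pinched_out c b hc hb]

theorem IsKronecker.rightAct_pinched_in (hK : Λ.IsKronecker α β) {x v : Λ.V} (a : Λ.Arrow x v)
    (c : Λ.Arrow v v) (hc : Λ.pinched c.1) (ha : ¬ Λ.pinched a.1) (m : RightMod K α x) :
    rightAct α β μ c (rightAct α β μ a m) = ((Λ.inSign a.1 : ℤ) : K) • rightAct α β μ a m := by
  obtain ⟨h₁, h₂, h₃, -⟩ := IsKronecker.ne_of_pinched hc hK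
  obtain ⟨h₄, h₅, -⟩ := hK.ne_of_tgt_pinched hc (a.2.2.trans c.2.1.symm)
  have h₆ : Λ.mul (Λ.relations K) (Λ.arrowClass _ c) (arrowClassOf K a.1 (Λ.tgt α) v)
      = ((Λ.inSign a.1 : ℤ) : K) • arrowClassOf K a.1 (Λ.tgt α) v := by
    by_cases h : Λ.src a.1 = Λ.tgt α
    · rw [arrowClassOf_eq ⟨a.1, h, a.2.2⟩]
      exact mul_arrowClass_pinched_in _ c hc ha
    · rw [arrowClassOf_of_not fun h' => h h'.1, map_zero, smul_zero]
  rw [rightAct_of_ne μ a h₄ h₅, rightAct_of_ne μ c h₁ h₂, indicator_not h₃]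
  refine Prod.ext ?_ (Prod.ext (smul_zero _).symm (smul_zero _).symm)
  simp [Λ.mul_assoc', mul_arrowClass_pinched_in a c hc ha, h₆, smul_comm ((Λ.inSign a.1 : ℤ) : K)]

theorem IsKronecker.leftAct_pinched_in (hK : Λ.IsKronecker α β) {x v : Λ.V} (a : Λ.Arrow x v)
    (c : Λ.Arrow v v) (hc : Λ.pinched c.1) (ha : ¬ Λ.pinched a.1) (m : LeftMod K α v) :
    leftAct α β μ a (leftAct α β μ c m) = ((Λ.inSign a.1 : ℤ) : K) • leftAct α β μ a m := by
  obtain ⟨h₁, h₂, -, h₃⟩ := IsKronecker.ne_of_pinched hc hK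
  obtain ⟨h₄, h₅, h₆⟩ := hK.ne_of_tgt_pinched hc (a.2.2.trans c.2.1.symm)
  rw [leftAct_of_ne μ c h₁ h₂, leftAct_of_ne μ a h₄ h₅, leftAct_of_ne μ a h₄ h₅,
    indicator_not h₃, indicator_not h₆]
  refine Prod.ext ?_ (Prod.ext (smul_zero _).symm (smul_zero _).symm)
  simp [← Λ.mul_assoc', mul_arrowClass_pinched_in a c hc ha]

theorem IsKronecker.leftAct_pinched_out (hK : Λ.IsKronecker α β) {v y : Λ.V} (c : Λ.Arrow v v)
    (b : Λ.Arrow v y) (hc : Λ.pinched c.1) (hb : ¬ Λ.pinched b.1) (m : LeftMod K α y) :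
    leftAct α β μ c (leftAct α β μ b m) = ((Λ.outSign b.1 : ℤ) : K) • leftAct α β μ b m := by
  obtain ⟨h₁, h₂, -, h₃⟩ := IsKronecker.ne_of_pinched hc hK
  obtain ⟨h₄, h₅, -⟩ := hK.ne_of_src_pinched hc (b.2.1.trans c.2.1.symm)
  have h₆ : Λ.mul (Λ.relations K) (arrowClassOf K b.1 v (Λ.src α)) (Λ.arrowClass _ c)
      = ((Λ.outSign b.1 : ℤ) : K) • arrowClassOf K b.1 v (Λ.src α) := by
    by_cases h : Λ.tgt b.1 = Λ.src α
    · rw [arrowClassOf_eq ⟨b.1, b.2.1, h⟩]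
      exact mul_arrowClass_pinched_out c _ hc hb
    · rw [arrowClassOf_of_not fun h' => h h'.2, map_zero, LinearMap.zero_apply, smul_zero]
  rw [leftAct_of_ne μ b h₄ h₅, leftAct_of_ne μ c h₁ h₂, indicator_not h₃]
  refine Prod.ext ?_ (Prod.ext (smul_zero _).symm (smul_zero _).symm)
  simp [← Λ.mul_assoc', mul_arrowClass_pinched_out c b hc hb, h₆,
    smul_comm ((Λ.outSign b.1 : ℤ) : K)]

end pinched

end strip

end PinchedGentle

end PinchedDG

/-! ### Splitting the multiplications with ω by means of the two representations -/

namespace PinchedDG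

open Quiver

/-- The class of a trivial path. -/
def GradedQuiver.idHom {K : Type w} [Field K] (Q : GradedQuiver.{u})
    (I : GradedQuiver.Relations K Q) (x : Q.V) : Q.component I x x 0 :=
  Q.pathHom I Path.nil rfl

theorem GradedQuiver.idHom_val {K : Type w} [Field K] (Q : GradedQuiver.{u})
    (I : GradedQuiver.Relations K Q) (x : Q.V) : (Q.idHom I x).1 = Q.pathClass I Path.nil := rfl

/-- A splitting of the right multiplication `Hom(X₂, Y) → Hom(X₁, Y)` with a morphism `ω`, whose
cokernel is spanned by a morphism `gen` of degree `q` (which is allowed to be zero). -/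
structure DGCat.RightStrip {K : Type w} [Field K] (C : DGCat.{w, u, v} K) {X₁ X₂ : C.Obj} {a : ℤ}
    (ω : C.Hom X₁ X₂ a) {Y : C.Obj} {q : ℤ} (gen : C.Hom X₁ Y q) where
  sec : ∀ {n m : ℤ}, m + a = n → (C.Hom X₁ Y n →ₗ[K] C.Hom X₂ Y m)
  coeff : C.Hom X₁ Y q →ₗ[K] K
  sec_comp : ∀ {n m : ℤ} (h : m + a = n) (f : C.Hom X₂ Y m), sec h (C.comp h f ω) = f
  coeff_comp : ∀ {m : ℤ} (h : m + a = q) (f : C.Hom X₂ Y m), coeff (C.comp h f ω) = 0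
  coeff_gen : gen = 0 ∨ coeff gen = 1
  eq_of_ne : ∀ {n m : ℤ} (h : m + a = n) (f : C.Hom X₁ Y n), n ≠ q → f = C.comp h (sec h f) ω
  eq_add : ∀ {m : ℤ} (h : m + a = q) (f : C.Hom X₁ Y q),
    f = C.comp h (sec h f) ω + coeff f • gen

/-- A splitting of the left multiplication `Hom(X, X₁) → Hom(X, X₂)` with a morphism `ω`. -/
structure DGCat.LeftStrip {K : Type w} [Field K] (C : DGCat.{w, u, v} K) {X₁ X₂ : C.Obj} {a : ℤ}
    (ω : C.Hom X₁ X₂ a) (X : C.Obj) where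
  sec : ∀ {n m : ℤ}, a + m = n → (C.Hom X X₂ n →ₗ[K] C.Hom X X₁ m)
  sec_comp : ∀ {n m : ℤ} (h : a + m = n) (f : C.Hom X X₁ m), sec h (C.comp h ω f) = f

namespace PinchedGentle.IsKronecker

variable {Λ : PinchedGentle.{u}} {K : Type w} [Field K] {α β : Λ.E} (hK : Λ.IsKronecker α β)
  (μ : K)

variable (α) in
/-- `α`, as an arrow from `1` to `2`. -/
def arrowα : Λ.Arrow (Λ.src α) (Λ.tgt α) := ⟨α, rfl, rfl⟩

/-- `β`, as an arrow from `1` to `2`. -/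
def arrowβ : Λ.Arrow (Λ.src α) (Λ.tgt α) := ⟨β, hK.src_eq, hK.tgt_eq⟩

/-- `ω`, as an element of the algebra. -/
def omegaClass : Λ.QuotAlg (Λ.relations K) (Λ.src α) (Λ.tgt α) :=
  Λ.arrowClass _ ⟨α, rfl, rfl⟩ + μ • Λ.arrowClass _ hK.arrowβ

variable (α) in
/-- The category of the right representation. -/
abbrev rightCat (K : Type w) [Field K] : DGCat.{w, u, max u w} K :=
  gradedMod (RightMod K α) (rightDeg K α)

variable (α) in
/-- The identity on vertices. -/
def rightObj (K : Type w) [Field K] : Λ.V → (rightCat α K).Obj := fun x => x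

/-- The right representation, on arrows. -/
def rightRep {x y : Λ.V} (e : Λ.Arrow x y) :
    (rightCat α K).Hom (rightObj α K x) (rightObj α K y) (Λ.deg e.1) :=
  ⟨rightAct α β μ e, hK.rightAct_mem μ e⟩

theorem rightRep_relations (hμ : μ ≠ 0) : ∀ x y, ∀ r ∈ Λ.relations K x y, ∀ n,
    Λ.evalDeg (rightCat α K) (rightObj α K) (hK.rightRep μ) n r = 0 :=
  evalDeg_eq_zero _ _ _
    (fun a b h => Subtype.ext (LinearMap.ext (hK.rightAct_gentle μ hμ a b h)))
    (fun c b hc hb => Subtype.ext (LinearMap.ext (hK.rightAct_pinched_out μ c b hc hb)))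
    (fun a c hc ha => Subtype.ext (LinearMap.ext (hK.rightAct_pinched_in μ a c hc ha)))

variable (α) in
/-- The category of the left representation. -/
abbrev leftCat (K : Type w) [Field K] : DGCat.{w, u, max u w} K :=
  gradedModOp (LeftMod K α) (leftDeg K α)

variable (α) in
/-- The identity on vertices. -/
def leftObj (K : Type w) [Field K] : Λ.V → (leftCat α K).Obj := fun x => x

/-- The left representation, on arrows. -/
def leftRep {x y : Λ.V} (e : Λ.Arrow x y) :
    (leftCat α K).Hom (leftObj α K x) (leftObj α K y) (Λ.deg e.1) :=
  ⟨leftAct α β μ e, hK.leftAct_mem μ e⟩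

theorem leftRep_relations (hμ : μ ≠ 0) : ∀ x y, ∀ r ∈ Λ.relations K x y, ∀ n,
    Λ.evalDeg (leftCat α K) (leftObj α K) (hK.leftRep μ) n r = 0 :=
  evalDeg_eq_zero _ _ _
    (fun a b h => Subtype.ext (LinearMap.ext (hK.leftAct_gentle μ hμ a b h)))
    (fun c b hc hb => Subtype.ext (LinearMap.ext (hK.leftAct_pinched_out μ c b hc hb)))
    (fun a c hc ha => Subtype.ext (LinearMap.ext (hK.leftAct_pinched_in μ a c hc ha)))

/-- The right representation. -/
def rightLift (hμ : μ ≠ 0) (x y : Λ.V) (n : ℤ) :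
    Λ.component (Λ.relations K) x y n →ₗ[K] homogeneousMaps (RightMod K α) (rightDeg K α) x y n :=
  Λ.liftHom (rightCat α K) (rightObj α K) (hK.rightRep μ) (hK.rightRep_relations μ hμ) n

/-- The left representation. -/
def leftLift (hμ : μ ≠ 0) (x y : Λ.V) (n : ℤ) :
    Λ.component (Λ.relations K) x y n →ₗ[K] homogeneousMaps (LeftMod K α) (leftDeg K α) y x n :=
  Λ.liftHom (leftCat α K) (leftObj α K) (hK.leftRep μ) (hK.leftRep_relations μ hμ) n

variable {μ} (hμ : μ ≠ 0)

theorem rightLift_comp {x y z : Λ.V} {p q r : ℤ} (h : p + q = r)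
    (g : Λ.component (Λ.relations K) y z p) (f : Λ.component (Λ.relations K) x y q)
    (v : RightMod K α x) :
    (hK.rightLift μ hμ x z r (Λ.compHom _ h g f)).1 v
      = (hK.rightLift μ hμ y z p g).1 ((hK.rightLift μ hμ x y q f).1 v) :=
  congrArg (fun f : homogeneousMaps (RightMod K α) (rightDeg K α) x z r => f.1 v)
    (Λ.liftHom_comp (hK.rightRep μ) (hK.rightRep_relations μ hμ) h g f)

theorem leftLift_comp {x y z : Λ.V} {p q r : ℤ} (h : p + q = r)
    (g : Λ.component (Λ.relations K) y z p) (f : Λ.component (Λ.relations K) x y q)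
    (v : LeftMod K α z) :
    (hK.leftLift μ hμ x z r (Λ.compHom _ h g f)).1 v
      = (hK.leftLift μ hμ x y q f).1 ((hK.leftLift μ hμ y z p g).1 v) :=
  congrArg (fun f : homogeneousMaps (LeftMod K α) (leftDeg K α) z x r => f.1 v)
    (Λ.liftHom_comp (hK.leftRep μ) (hK.leftRep_relations μ hμ) h g f)

theorem rightLift_arrowHom {x y : Λ.V} (e : Λ.Arrow x y) {n : ℤ} (h : Λ.deg e.1 = n) :
    (hK.rightLift μ hμ x y n (Λ.arrowHom _ e.1 e.2.1 e.2.2 h)).1 = rightAct α β μ e := by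
  subst h
  exact congrArg Subtype.val
    (Λ.liftHom_arrowHom (hK.rightRep μ) (hK.rightRep_relations μ hμ) e)

theorem leftLift_arrowHom {x y : Λ.V} (e : Λ.Arrow x y) {n : ℤ} (h : Λ.deg e.1 = n) :
    (hK.leftLift μ hμ x y n (Λ.arrowHom _ e.1 e.2.1 e.2.2 h)).1 = leftAct α β μ e := by
  subst h
  exact congrArg Subtype.val
    (Λ.liftHom_arrowHom (hK.leftRep μ) (hK.leftRep_relations μ hμ) e)

theorem rightLift_nil (x : Λ.V) (v : RightMod K α x) :
    (hK.rightLift μ hμ x x 0 (Λ.idHom _ x)).1 v = v :=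
  congrArg (fun f : homogeneousMaps (RightMod K α) (rightDeg K α) x x 0 => f.1 v)
    ((Λ.liftHom_pathHom (hK.rightRep μ) (hK.rightRep_relations μ hμ) Path.nil rfl).trans
      ((rightCat α K).reindex_rfl _ _))

theorem leftLift_nil (x : Λ.V) (v : LeftMod K α x) :
    (hK.leftLift μ hμ x x 0 (Λ.idHom _ x)).1 v = v :=
  congrArg (fun f : homogeneousMaps (LeftMod K α) (leftDeg K α) x x 0 => f.1 v)
    ((Λ.liftHom_pathHom (hK.leftRep μ) (hK.leftRep_relations μ hμ) Path.nil rfl).trans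
      ((leftCat α K).reindex_rfl _ _))

end PinchedGentle.IsKronecker

/-- Induction by adding arrows at the end of paths; the motive ranges over all targets and degrees,
since both change at each arrow. -/
theorem GradedQuiver.component_cons_induction {K : Type w} [Field K] (Q : GradedQuiver.{u})
    (I : GradedQuiver.Relations K Q) {x : Q.V} {P : ∀ (y : Q.V) (n : ℤ), Q.component I x y n → Prop}
    (h_nil : P x 0 (Q.idHom I x))
    (h_cons : ∀ {y z : Q.V} {n m : ℤ} (f : Q.component I x y n) (e : Q.Arrow y z)
      (h : Q.deg e.1 + n = m), P y n f →
      P z m (Q.compHom I h (Q.arrowHom I e.1 e.2.1 e.2.2 rfl) f))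
    (h_zero : ∀ y n, P y n 0) (h_add : ∀ {y n} f g, P y n f → P y n g → P y n (f + g))
    (h_smul : ∀ {y n} (c : K) f, P y n f → P y n (c • f)) {y : Q.V} {n : ℤ}
    (f : Q.component I x y n) : P y n f := by
  induction f using Q.component_induction I with
  | h0 => exact h_zero y n
  | hadd f g hf hg => exact h_add f g hf hg
  | hsmul c f hf => exact h_smul c f hf
  | hp p h =>
    cases h
    induction p with
    | nil => exact h_nil
    | @cons y z p e ih =>
      have h₁ : Q.compHom I (add_comm (Q.deg e.1) (Q.pathDeg p))
          (Q.arrowHom I e.1 e.2.1 e.2.2 rfl) (Q.pathHom I p rfl) = Q.pathHom I (p.cons e) rfl :=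
        Subtype.ext (Q.mul_pathClass I (Hom.toPath e) p)
      rw [← h₁]
      exact h_cons (Q.pathHom I p rfl) e _ ih

namespace PinchedGentle.IsKronecker

variable {Λ : PinchedGentle.{u}} {K : Type w} [Field K] {α β : Λ.E} (hK : Λ.IsKronecker α β)
  {μ : K} (hμ : μ ≠ 0)

theorem stripMap_fst {M N : Type*} [AddCommGroup M] [Module K M] [AddCommGroup N] [Module K N]
    (f : M →ₗ[K] N) (i j : N) (c₁ c₂ c₃ : K) (v : M) :
    stripMap f i j c₁ c₂ c₃ (v, 0, 0) = (f v, 0, 0) := by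
  simp [stripMap]

/-- The triples (l, 0, 0) form a subrepresentation on which Λ acts by its own multiplication. It
will be identified with the elements divisible by ω. -/
theorem rightLift_fst {x y : Λ.V} {n : ℤ} (f : Λ.component (Λ.relations K) x y n)
    (l : Λ.QuotAlg (Λ.relations K) (Λ.tgt α) x) :
    (hK.rightLift μ hμ x y n f).1 (l, 0, 0) = (Λ.mul _ f.1 l, 0, 0) := by
  induction f using Λ.component_cons_induction (Λ.relations K) with
  | h_zero => rw [map_zero, ZeroMemClass.coe_zero, ZeroMemClass.coe_zero, map_zero]; rfl
  | h_add f g hf hg =>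
    simp only [map_add, Submodule.coe_add, LinearMap.add_apply, hf, hg, Prod.mk_add_mk, add_zero]
  | h_smul c f hf =>
    simp only [map_smul, Submodule.coe_smul, LinearMap.smul_apply, hf, Prod.smul_mk, smul_zero]
  | h_nil => rw [hK.rightLift_nil, Λ.idHom_val, Λ.nil_mul]
  | h_cons f e h ih =>
    rw [hK.rightLift_comp, ih, hK.rightLift_arrowHom, rightAct, stripMap_fst, Λ.compHom_val,
      Λ.mul_assoc']
    rfl

theorem leftLift_fst {x y : Λ.V} {n : ℤ} (f : Λ.component (Λ.relations K) x y n)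
    (l : Λ.QuotAlg (Λ.relations K) y (Λ.src α)) :
    (hK.leftLift μ hμ x y n f).1 (l, 0, 0) = (Λ.mul _ l f.1, 0, 0) := by
  induction f using Λ.component_cons_induction (Λ.relations K) with
  | h_zero => rw [map_zero, ZeroMemClass.coe_zero, ZeroMemClass.coe_zero, map_zero]; rfl
  | h_add f g hf hg =>
    simp only [map_add, Submodule.coe_add, LinearMap.add_apply, hf, hg, Prod.mk_add_mk, add_zero]
  | h_smul c f hf =>
    simp only [map_smul, Submodule.coe_smul, LinearMap.smul_apply, hf, Prod.smul_mk, smul_zero]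
  | h_nil => rw [hK.leftLift_nil, Λ.idHom_val, Λ.mul_nil]
  | h_cons f e h ih =>
    rw [hK.leftLift_comp, hK.leftLift_arrowHom, leftAct, stripMap_fst, ih, Λ.compHom_val,
      Λ.mul_assoc']
    rfl

/-! ### The strips -/

theorem arrowClassOf_arrowβ :
    arrowClassOf K β (Λ.src α) (Λ.tgt α) = Λ.arrowClass _ hK.arrowβ := arrowClassOf_eq hK.arrowβ

variable (μ) in
/-- `ω`, as an element of a homogeneous component. -/
def omegaHom : Λ.component (Λ.relations K) (Λ.src α) (Λ.tgt α) (Λ.deg α) :=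
  Λ.arrowHom _ α rfl rfl rfl + μ • Λ.arrowHom _ β hK.src_eq hK.tgt_eq hK.deg_eq

/-- Without a pinched loop at 1, and with at most two arrows of Q^g starting there, the arrows
leaving 1 are α = ω - μ β and β only. This justifies the first set of entries of `rightAct` inside
Λ. -/
theorem mul_idClass_right {y z : Λ.V} (e : Λ.Arrow y z) :
    Λ.mul (Λ.relations K) (Λ.arrowClass _ e) (idClass K (Λ.src α) y)
      = indicator K (e.1 = α) • Λ.mul (Λ.relations K) (idClass K (Λ.tgt α) z) (hK.omegaClass μ)
        + (indicator K (e.1 = β) - μ * indicator K (e.1 = α))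
          • arrowClassOf K β (Λ.src α) z := by
  by_cases hy : Λ.src α = y
  · subst hy
    rw [idClass_self, Λ.mul_nil]
    have he : e.1 = α ∨ e.1 = β := by
      have h₁ : ¬ Λ.pinched e.1 := fun h => hK.no_pinched_src _ h e.2.1
      by_contra! h₂
      -- A third arrow starting at 1 would contradict `out_le_two`.
      have h₃ : ({α, β, e.1} : Set Λ.E) ⊆ {e | ¬ Λ.pinched e ∧ Λ.src e = Λ.src α} := by
        rintro _ (rfl | rfl | rfl)
        · exact ⟨hK.not_pinched_left, rfl⟩
        · exact ⟨hK.not_pinched_right, hK.src_eq⟩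
        · exact ⟨h₁, e.2.1⟩
      have h₄ := (Set.encard_le_encard h₃).trans (Λ.out_le_two (Λ.src α))
      rw [Set.encard_insert_of_notMem (by simp [hK.ne, Ne.symm h₂.1]),
        Set.encard_pair (Ne.symm h₂.2)] at h₄
      exact absurd h₄ (by decide)
    rcases he with he | he
    · obtain ⟨e, h, rfl⟩ := e
      change e = α at he
      subst he
      rw [indicator_of rfl, indicator_not hK.ne, idClass_self, Λ.nil_mul, omegaClass,
        hK.arrowClassOf_arrowβ]
      simp
    · obtain ⟨e, h, rfl⟩ := e
      change e = β at he
      subst he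
      rw [indicator_of rfl, indicator_not hK.ne.symm, arrowClassOf_eq ⟨e, h, rfl⟩]
      simp
  · have h₁ : e.1 ≠ α := fun h => hy (by rw [← h, e.2.1])
    have h₂ : e.1 ≠ β := fun h => hy (by rw [← hK.src_eq, ← h, e.2.1])
    rw [idClass_of_ne hy, indicator_not h₁, indicator_not h₂]
    simp

/-- If eα is a relation then eω = μ eβ. Otherwise eβ is one, because e composes nontrivially with at
most one arrow of Q^g ending at 2. This justifies the remaining entry of `rightAct`. -/
theorem mul_arrowClassOf_β (hμ : μ ≠ 0) {y z : Λ.V} (e : Λ.Arrow y z) :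
    Λ.mul (Λ.relations K) (Λ.arrowClass _ e) (arrowClassOf K β (Λ.src α) y)
      = (indicator K (Λ.rel e.1 α) * μ⁻¹)
        • Λ.mul (Λ.relations K) (arrowClassOf K e.1 (Λ.tgt α) z) (hK.omegaClass μ) := by
  by_cases hy : Λ.tgt α = y
  · subst hy
    rw [arrowClassOf_eq e, hK.arrowClassOf_arrowβ, omegaClass]
    by_cases h : Λ.rel e.1 α
    · rw [indicator_of h, map_add, map_smul, mul_arrowClass_of_rel ⟨α, rfl, rfl⟩ e h, zero_add,
        smul_smul, one_mul, inv_mul_cancel₀ hμ, one_smul]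
    · rw [indicator_not h, zero_mul, zero_smul]
      refine mul_arrowClass_of_rel hK.arrowβ e ?_
      by_contra h'
      exact hK.ne (Λ.nonrel_right_unique (fun hp => hK.no_pinched_tgt _ hp e.2.1)
        hK.not_pinched_left hK.not_pinched_right e.2.1.symm (hK.tgt_eq.trans e.2.1.symm) h h')
  · have h₁ : ¬ Λ.rel e.1 α := fun h => hy ((Λ.rel_comp h).2.2.trans e.2.1)
    rw [indicator_not h₁, arrowClassOf_of_not fun h => hy (hK.tgt_eq.symm.trans h.2)]
    simp

/-- The value of the right representation on the generator. -/
def rightEval (y : Λ.V) (n : ℤ) :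
    Λ.component (Λ.relations K) (Λ.src α) y n →ₗ[K] RightMod K α y :=
  (LinearMap.applyₗ ((0, 1, 0) : RightMod K α (Λ.src α))).comp
    ((Submodule.subtype _).comp (hK.rightLift μ hμ (Λ.src α) y n))

theorem rightEval_mem (y : Λ.V) (n : ℤ) (f : Λ.component (Λ.relations K) (Λ.src α) y n) :
    hK.rightEval hμ y n f ∈ rightDeg K α y n := by
  have h := (hK.rightLift μ hμ (Λ.src α) y n f).2 0 (0, 1, 0)
    ⟨zero_mem _, fun h => absurd rfl h, fun _ => rfl⟩
  rwa [add_zero] at h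

/-- Evaluating at the generator (0, 1, 0) and then reading triples as elements of Λ e_1 is the
identity: true for the trivial path, and preserved by left multiplication with arrows. Hence Λ e_1
is spanned by multiples of ω, e_1 and β. -/
theorem eq_rightEval {y : Λ.V} {n : ℤ} (f : Λ.component (Λ.relations K) (Λ.src α) y n) :
    f.1 = Λ.mul _ (hK.rightEval hμ y n f).1 (hK.omegaClass μ)
      + (hK.rightEval hμ y n f).2.1 • idClass K (Λ.src α) y
      + (hK.rightEval hμ y n f).2.2 • arrowClassOf K β (Λ.src α) y := by
  induction f using Λ.component_cons_induction (Λ.relations K) with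
  | h_zero => simp
  | h_add f g hf hg =>
    simp only [map_add, Submodule.coe_add, Prod.fst_add, Prod.snd_add, LinearMap.add_apply,
      add_smul]
    conv_lhs => rw [hf, hg]
    abel
  | h_smul c f hf =>
    simp only [map_smul, Submodule.coe_smul, Prod.smul_fst, Prod.smul_snd, LinearMap.smul_apply,
      smul_eq_mul, mul_smul]
    conv_lhs => rw [hf]
    simp only [smul_add]
  | h_nil =>
    have h : hK.rightEval hμ (Λ.src α) 0 (Λ.idHom _ _) = (0, 1, 0) :=
      hK.rightLift_nil hμ _ _
    rw [h, idClass_self]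
    simp [Λ.idHom_val]
  | @h_cons y z n m f e h ih =>
    have h₁ : hK.rightEval hμ z m (Λ.compHom _ h (Λ.arrowHom _ e.1 e.2.1 e.2.2 rfl) f)
        = rightAct α β μ e (hK.rightEval hμ y n f) := by
      refine (hK.rightLift_comp hμ h _ f _).trans ?_
      rw [hK.rightLift_arrowHom]
      rfl
    rw [h₁, Λ.compHom_val]
    conv_lhs => rw [ih]
    rw [map_add, map_add, map_smul, map_smul, Λ.mul_assoc']
    change Λ.mul _ (Λ.mul _ (Λ.arrowClass _ e) _) _ + _ • Λ.mul _ (Λ.arrowClass _ e) _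
      + _ • Λ.mul _ (Λ.arrowClass _ e) _ = _
    rw [hK.mul_idClass_right (μ := μ), hK.mul_arrowClassOf_β hμ]
    simp only [rightAct, stripMap, LinearMap.coe_mk, AddHom.coe_mk, map_add, map_smul,
      LinearMap.add_apply, LinearMap.smul_apply, smul_add, smul_smul, zero_smul, add_zero,
      mul_comm]
    abel

/-- ω sends the generator to (e_2, 0, -μ) + μ (0, 0, 1) = (e_2, 0, 0), and f then acts on the first
summand. So f can be recovered from f ω. -/
theorem rightEval_comp_omega {y : Λ.V} {n m : ℤ} (h : m + Λ.deg α = n)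
    (f : Λ.component (Λ.relations K) (Λ.tgt α) y m) :
    hK.rightEval hμ y n (Λ.compHom _ h f (hK.omegaHom μ)) = (f.1, 0, 0) := by
  refine (hK.rightLift_comp hμ h f _ _).trans ?_
  have h₁ : (hK.rightLift μ hμ (Λ.src α) (Λ.tgt α) (Λ.deg α) (hK.omegaHom μ)).1 (0, 1, 0)
      = (Λ.pathClass _ Path.nil, 0, 0) := by
    have hα : (hK.rightLift μ hμ _ _ _ (Λ.arrowHom _ α rfl rfl rfl)).1
        = rightAct α β μ (arrowα α) := hK.rightLift_arrowHom hμ (arrowα α) rfl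
    have hβ : (hK.rightLift μ hμ _ _ _ (Λ.arrowHom _ β hK.src_eq hK.tgt_eq hK.deg_eq)).1
        = rightAct α β μ hK.arrowβ := hK.rightLift_arrowHom hμ hK.arrowβ hK.deg_eq
    rw [omegaHom, map_add, map_smul, Submodule.coe_add, Submodule.coe_smul, hα, hβ]
    simp [rightAct, stripMap, arrowα, arrowβ, indicator_of, indicator_not hK.ne,
      indicator_not hK.ne.symm,
      idClass_self]
  rw [h₁, hK.rightLift_fst, Λ.mul_nil]

/-- The value of the left representation on the generator. -/
def leftEval (x : Λ.V) (n : ℤ) :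
    Λ.component (Λ.relations K) x (Λ.tgt α) n →ₗ[K] LeftMod K α x :=
  (LinearMap.applyₗ ((0, 1, 0) : LeftMod K α (Λ.tgt α))).comp
    ((Submodule.subtype _).comp (hK.leftLift μ hμ x (Λ.tgt α) n))

theorem leftEval_mem (x : Λ.V) (n : ℤ) (f : Λ.component (Λ.relations K) x (Λ.tgt α) n) :
    hK.leftEval hμ x n f ∈ leftDeg K α x n := by
  have h := (hK.leftLift μ hμ x (Λ.tgt α) n f).2 0 (0, 1, 0)
    ⟨zero_mem _, fun h => absurd rfl h, fun _ => rfl⟩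
  rwa [add_zero] at h

/-- The mirror image of `rightEval_comp_omega`. On this side injectivity of the multiplication
suffices; its cokernel is never described. -/
theorem leftEval_omega_comp {x : Λ.V} {n m : ℤ} (h : Λ.deg α + m = n)
    (f : Λ.component (Λ.relations K) x (Λ.src α) m) :
    hK.leftEval hμ x n (Λ.compHom _ h (hK.omegaHom μ) f) = (f.1, 0, 0) := by
  refine (hK.leftLift_comp hμ h _ f _).trans ?_
  have h₁ : (hK.leftLift μ hμ (Λ.src α) (Λ.tgt α) (Λ.deg α) (hK.omegaHom μ)).1 (0, 1, 0)
      = (Λ.pathClass _ Path.nil, 0, 0) := by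
    have hα : (hK.leftLift μ hμ _ _ _ (Λ.arrowHom _ α rfl rfl rfl)).1
        = leftAct α β μ (arrowα α) := hK.leftLift_arrowHom hμ (arrowα α) rfl
    have hβ : (hK.leftLift μ hμ _ _ _ (Λ.arrowHom _ β hK.src_eq hK.tgt_eq hK.deg_eq)).1
        = leftAct α β μ hK.arrowβ := hK.leftLift_arrowHom hμ hK.arrowβ hK.deg_eq
    rw [omegaHom, map_add, map_smul, Submodule.coe_add, Submodule.coe_smul, hα, hβ]
    simp [leftAct, stripMap, arrowα, arrowβ, indicator_of, indicator_not hK.ne,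
      indicator_not hK.ne.symm,
      idClass_self]
  rw [h₁, hK.leftLift_fst, Λ.nil_mul]

/-- The section of the left multiplication with `ω`. -/
def leftSec (x : Λ.V) {n m : ℤ} (h : Λ.deg α + m = n) :
    Λ.component (Λ.relations K) x (Λ.tgt α) n →ₗ[K] Λ.component (Λ.relations K) x (Λ.src α) m :=
  ((LinearMap.fst K _ _).comp (hK.leftEval hμ x n)).codRestrict _ fun f => by
    have h₁ := (hK.leftEval_mem hμ x n f).1
    rwa [show n - Λ.deg α = m by omega] at h₁

/-- The section of the right multiplication with `ω`. -/
def rightSec (y : Λ.V) {n m : ℤ} (h : m + Λ.deg α = n) :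
    Λ.component (Λ.relations K) (Λ.src α) y n →ₗ[K] Λ.component (Λ.relations K) (Λ.tgt α) y m :=
  ((LinearMap.fst K _ _).comp (hK.rightEval hμ y n)).codRestrict _ fun f => by
    have h₁ := (hK.rightEval_mem hμ y n f).1
    rwa [show n - Λ.deg α = m by omega] at h₁

theorem leftSec_comp (x : Λ.V) {n m : ℤ} (h : Λ.deg α + m = n)
    (f : Λ.component (Λ.relations K) x (Λ.src α) m) :
    hK.leftSec hμ x h (Λ.compHom _ h (hK.omegaHom μ) f) = f :=
  Subtype.ext (congrArg Prod.fst (hK.leftEval_omega_comp hμ h f))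

theorem rightSec_comp (y : Λ.V) {n m : ℤ} (h : m + Λ.deg α = n)
    (f : Λ.component (Λ.relations K) (Λ.tgt α) y m) :
    hK.rightSec hμ y h (Λ.compHom _ h f (hK.omegaHom μ)) = f :=
  Subtype.ext (congrArg Prod.fst (hK.rightEval_comp_omega hμ h f))

theorem eq_rightSec {y : Λ.V} {n m : ℤ} (h : m + Λ.deg α = n)
    (f : Λ.component (Λ.relations K) (Λ.src α) y n) :
    f.1 = (Λ.compHom _ h (hK.rightSec hμ y h f) (hK.omegaHom μ)).1
      + (hK.rightEval hμ y n f).2.1 • idClass K (Λ.src α) y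
      + (hK.rightEval hμ y n f).2.2 • arrowClassOf K β (Λ.src α) y := hK.eq_rightEval hμ f

/-- The first coefficient of an element of `Λ e_1`. -/
def rightCoeff₁ (y : Λ.V) (n : ℤ) : Λ.component (Λ.relations K) (Λ.src α) y n →ₗ[K] K :=
  (LinearMap.fst K K K).comp ((LinearMap.snd K _ _).comp (hK.rightEval hμ y n))

/-- The second coefficient of an element of `Λ e_1`. -/
def rightCoeff₂ (y : Λ.V) (n : ℤ) : Λ.component (Λ.relations K) (Λ.src α) y n →ₗ[K] K :=
  (LinearMap.snd K K K).comp ((LinearMap.snd K _ _).comp (hK.rightEval hμ y n))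

theorem eq_rightSec_src {n m : ℤ} (h : m + Λ.deg α = n)
    (f : Λ.component (Λ.relations K) (Λ.src α) (Λ.src α) n) (hn : n ≠ 0) :
    f = Λ.compHom _ h (hK.rightSec hμ _ h f) (hK.omegaHom μ) := by
  refine Subtype.ext ((hK.eq_rightSec hμ h f).trans ?_)
  rw [(hK.rightEval_mem hμ _ n f).2.1 hn,
    arrowClassOf_of_not fun h => hK.not_loop (h.2.symm.trans hK.tgt_eq), zero_smul, smul_zero,
    add_zero, add_zero]

theorem eq_add_rightSec_src {m : ℤ} (h : m + Λ.deg α = 0)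
    (f : Λ.component (Λ.relations K) (Λ.src α) (Λ.src α) 0) :
    f = Λ.compHom _ h (hK.rightSec hμ _ h f) (hK.omegaHom μ)
      + hK.rightCoeff₁ hμ _ _ f • Λ.idHom _ _ := by
  refine Subtype.ext ((hK.eq_rightSec hμ h f).trans ?_)
  rw [arrowClassOf_of_not fun h => hK.not_loop (h.2.symm.trans hK.tgt_eq), smul_zero, add_zero,
    idClass_self]
  rfl

theorem eq_rightSec_tgt {n m : ℤ} (h : m + Λ.deg α = n)
    (f : Λ.component (Λ.relations K) (Λ.src α) (Λ.tgt α) n) (hn : n ≠ Λ.deg α) :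
    f = Λ.compHom _ h (hK.rightSec hμ _ h f) (hK.omegaHom μ) := by
  refine Subtype.ext ((hK.eq_rightSec hμ h f).trans ?_)
  rw [(hK.rightEval_mem hμ _ n f).2.2 hn, idClass_of_ne hK.not_loop, zero_smul, smul_zero,
    add_zero, add_zero]

theorem eq_add_rightSec_tgt {m : ℤ} (h : m + Λ.deg α = Λ.deg α)
    (f : Λ.component (Λ.relations K) (Λ.src α) (Λ.tgt α) (Λ.deg α)) :
    f = Λ.compHom _ h (hK.rightSec hμ _ h f) (hK.omegaHom μ)
      + hK.rightCoeff₂ hμ _ _ f • Λ.arrowHom _ β hK.src_eq hK.tgt_eq hK.deg_eq := by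
  refine Subtype.ext ((hK.eq_rightSec hμ h f).trans ?_)
  rw [idClass_of_ne hK.not_loop, smul_zero, add_zero, hK.arrowClassOf_arrowβ]
  rfl

theorem eq_rightSec_other {y : Λ.V} (h₁ : Λ.src α ≠ y) (h₂ : Λ.tgt α ≠ y) {n m : ℤ}
    (h : m + Λ.deg α = n) (f : Λ.component (Λ.relations K) (Λ.src α) y n) :
    f = Λ.compHom _ h (hK.rightSec hμ _ h f) (hK.omegaHom μ) := by
  refine Subtype.ext ((hK.eq_rightSec hμ h f).trans ?_)
  rw [arrowClassOf_of_not fun h => h₂ (hK.tgt_eq.symm.trans h.2), idClass_of_ne h₁, smul_zero,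
    smul_zero, add_zero, add_zero]

theorem rightCoeff₁_id : hK.rightCoeff₁ hμ _ _ (Λ.idHom _ (Λ.src α)) = 1 :=
  congrArg (fun v : RightMod K α _ => v.2.1) (hK.rightLift_nil hμ _ (0, 1, 0))

theorem rightCoeff₂_β : hK.rightCoeff₂ hμ _ _
    (Λ.arrowHom _ β hK.src_eq hK.tgt_eq hK.deg_eq) = 1 := by
  have h : hK.rightEval hμ _ _ (Λ.arrowHom _ β hK.src_eq hK.tgt_eq hK.deg_eq)
      = rightAct α β μ hK.arrowβ (0, 1, 0) :=
    congrArg (fun g : RightMod K α _ →ₗ[K] RightMod K α _ => g (0, 1, 0))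
      (hK.rightLift_arrowHom hμ hK.arrowβ hK.deg_eq)
  refine (congrArg (fun v : RightMod K α _ => v.2.2) h).trans ?_
  simp [rightAct, stripMap, arrowβ, indicator_of, indicator_not hK.ne.symm]

theorem rightCoeff₁_comp {y : Λ.V} {n m : ℤ} (h : m + Λ.deg α = n)
    (f : Λ.component (Λ.relations K) (Λ.tgt α) y m) :
    hK.rightCoeff₁ hμ _ _ (Λ.compHom _ h f (hK.omegaHom μ)) = 0 :=
  congrArg (fun v : RightMod K α _ => v.2.1) (hK.rightEval_comp_omega hμ h f)

theorem rightCoeff₂_comp {y : Λ.V} {n m : ℤ} (h : m + Λ.deg α = n)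
    (f : Λ.component (Λ.relations K) (Λ.tgt α) y m) :
    hK.rightCoeff₂ hμ _ _ (Λ.compHom _ h f (hK.omegaHom μ)) = 0 :=
  congrArg (fun v : RightMod K α _ => v.2.2) (hK.rightEval_comp_omega hμ h f)

/-- A vertex, as an object of `𝒫(Λ)`. -/
def catObj (K : Type w) [Field K] (x : Λ.V) : (Λ.catP K).Obj := x

/-- `ω`, as a morphism of `𝒫(Λ)`. -/
def omegaP (μ : K) : (Λ.catP K).Hom (catObj K (Λ.src α)) (catObj K (Λ.tgt α)) (Λ.deg α) :=
  hK.omega μ rfl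

/-- `β`, as a morphism of `𝒫(Λ)`. -/
def betaP (K : Type w) [Field K] :
    (Λ.catP K).Hom (catObj K (Λ.src α)) (catObj K (Λ.tgt α)) (Λ.deg α) :=
  Λ.arrowHom (Λ.relations K) β hK.src_eq hK.tgt_eq hK.deg_eq

/-- The left strip at `x`. -/
def leftStrip (x : Λ.V) : (Λ.catP K).LeftStrip (hK.omegaP μ) (catObj K x) where
  sec h := hK.leftSec hμ x h
  sec_comp h f := hK.leftSec_comp hμ x h f

/-- The right strip at the source of `α`. -/
def rightStripSrc : (Λ.catP K).RightStrip (hK.omegaP μ) ((Λ.catP K).id (catObj K (Λ.src α))) where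
  sec h := hK.rightSec hμ _ h
  coeff := hK.rightCoeff₁ hμ _ _
  sec_comp h f := hK.rightSec_comp hμ _ h f
  coeff_comp h f := hK.rightCoeff₁_comp hμ h f
  coeff_gen := Or.inr (hK.rightCoeff₁_id hμ)
  eq_of_ne h f hn := hK.eq_rightSec_src hμ h f hn
  eq_add h f := hK.eq_add_rightSec_src hμ h f

/-- The right strip at the target of `α`. -/
def rightStripTgt : (Λ.catP K).RightStrip (hK.omegaP μ) (hK.betaP K) where
  sec h := hK.rightSec hμ _ h
  coeff := hK.rightCoeff₂ hμ _ _
  sec_comp h f := hK.rightSec_comp hμ _ h f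
  coeff_comp h f := hK.rightCoeff₂_comp hμ h f
  coeff_gen := Or.inr (hK.rightCoeff₂_β hμ)
  eq_of_ne h f hn := hK.eq_rightSec_tgt hμ h f hn
  eq_add h f := hK.eq_add_rightSec_tgt hμ h f

/-- The right strip at the other vertices. -/
def rightStripOther {y : Λ.V} (h₁ : Λ.src α ≠ y) (h₂ : Λ.tgt α ≠ y) :
    (Λ.catP K).RightStrip (Y := catObj K y) (q := 0) (hK.omegaP μ) 0 where
  sec h := hK.rightSec hμ _ h
  -- Every morphism from 1 to such a vertex is divisible by ω: the generator is zero, and its degree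
  -- 0 is an arbitrary choice.
  coeff := 0
  sec_comp h f := hK.rightSec_comp hμ _ h f
  coeff_comp _ _ := rfl
  coeff_gen := Or.inl rfl
  eq_of_ne h f _ := hK.eq_rightSec_other hμ h₁ h₂ h f
  eq_add h f := (hK.eq_rightSec_other hμ h₁ h₂ h f).trans
    (by rw [smul_zero, add_zero]; rfl)

end PinchedGentle.IsKronecker

end PinchedDG

/-! ### Morphisms to and from a cone in matrix form -/

namespace PinchedDG

namespace DGCat

variable {K : Type w} [Field K]

/-- The differential vanishes on the morphisms from `X` to `Y`. -/
def NoDiff (C : DGCat.{w, u, v} K) (X Y : C.Obj) : Prop :=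
  ∀ {n m : ℤ} (h : n + 1 = m) (f : C.Hom X Y n), C.d h f = 0

/-- `B` is a shifted cone of `ω`: as a graded object, it is the sum of `P₂[c₂]` and `P₁[c₁]`, and
its differential is `ω`. -/
structure Cone (C : DGCat.{w, u, v} K) {P₁ P₂ : C.Obj} {a : ℤ} (ω : C.Hom P₁ P₂ a) (B : C.Obj)
    (c₁ c₂ : ℤ) where
  shift : c₁ + a = c₂ + 1
  i₁ : C.Hom P₁ B (-c₁)
  i₂ : C.Hom P₂ B (-c₂)
  p₁ : C.Hom B P₁ c₁
  p₂ : C.Hom B P₂ c₂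
  p₁_i₁ : ∀ {n : ℤ} (h : c₁ + -c₁ = n) (h' : 0 = n), C.comp h p₁ i₁ = C.reindex h' (C.id P₁)
  p₂_i₂ : ∀ {n : ℤ} (h : c₂ + -c₂ = n) (h' : 0 = n), C.comp h p₂ i₂ = C.reindex h' (C.id P₂)
  p₁_i₂ : ∀ {n : ℤ} (h : c₁ + -c₂ = n), C.comp h p₁ i₂ = 0
  p₂_i₁ : ∀ {n : ℤ} (h : c₂ + -c₁ = n), C.comp h p₂ i₁ = 0
  id_eq : C.id B = C.comp (neg_add_cancel c₁) i₁ p₁ + C.comp (neg_add_cancel c₂) i₂ p₂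
  d_i₁ : ∀ {n : ℤ} (h : -c₁ + 1 = n) (h' : -c₂ + a = n), C.d h i₁ = C.comp h' i₂ ω
  d_i₂ : ∀ {n : ℤ} (h : -c₂ + 1 = n), C.d h i₂ = 0
  d_p₁ : ∀ {n : ℤ} (h : c₁ + 1 = n), C.d h p₁ = 0
  d_p₂ : ∀ {n : ℤ} (h : c₂ + 1 = n) (h' : a + c₁ = n),
    C.d h p₂ = -((-1 : K) ^ c₂ • C.comp h' ω p₁)

namespace Cone

variable {C : DGCat.{w, u, v} K} {P₁ P₂ B : C.Obj} {a c₁ c₂ : ℤ} {ω : C.Hom P₁ P₂ a}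
  (T : C.Cone ω B c₁ c₂) {X Y : C.Obj}

theorem eq_in {n k₁ k₂ : ℤ} (h₁ : c₁ + n = k₁) (h₂ : c₂ + n = k₂) (c : C.Hom X B n) :
    c = C.comp (show -c₁ + k₁ = n by omega) T.i₁ (C.comp h₁ T.p₁ c)
      + C.comp (show -c₂ + k₂ = n by omega) T.i₂ (C.comp h₂ T.p₂ c) := by
  conv_lhs => rw [← C.id_comp (zero_add n) c, T.id_eq, map_add, LinearMap.add_apply]
  rw [C.assoc h₁ _ (neg_add_cancel c₁) (zero_add n), C.assoc h₂ _ (neg_add_cancel c₂) (zero_add n)]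

theorem eq_out {n k₁ k₂ : ℤ} (h₁ : n + -c₁ = k₁) (h₂ : n + -c₂ = k₂) (b : C.Hom B Y n) :
    b = C.comp (show k₁ + c₁ = n by omega) (C.comp h₁ b T.i₁) T.p₁
      + C.comp (show k₂ + c₂ = n by omega) (C.comp h₂ b T.i₂) T.p₂ := by
  conv_lhs => rw [← C.comp_id (add_zero n) b, T.id_eq, map_add]
  rw [C.assoc (neg_add_cancel c₁) (add_zero n) h₁, C.assoc (neg_add_cancel c₂) (add_zero n) h₂]

theorem p₁_comp_i₁ {n k : ℤ} (h : -c₁ + k = n) (h' : c₁ + n = k) (f : C.Hom X P₁ k) :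
    C.comp h' T.p₁ (C.comp h T.i₁ f) = f := by
  rw [C.assoc h h' (add_neg_cancel c₁) (zero_add k), T.p₁_i₁ _ rfl, reindex_rfl, C.id_comp]

theorem p₂_comp_i₂ {n k : ℤ} (h : -c₂ + k = n) (h' : c₂ + n = k) (f : C.Hom X P₂ k) :
    C.comp h' T.p₂ (C.comp h T.i₂ f) = f := by
  rw [C.assoc h h' (add_neg_cancel c₂) (zero_add k), T.p₂_i₂ _ rfl, reindex_rfl, C.id_comp]

theorem p₁_comp_i₂ {n k k' : ℤ} (h : -c₂ + k = n) (h' : c₁ + n = k') (f : C.Hom X P₂ k) :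
    C.comp h' T.p₁ (C.comp h T.i₂ f) = 0 := by
  rw [C.assoc (pq := c₁ + -c₂) h h' rfl (by omega), T.p₁_i₂, map_zero, LinearMap.zero_apply]

theorem p₂_comp_i₁ {n k k' : ℤ} (h : -c₁ + k = n) (h' : c₂ + n = k') (f : C.Hom X P₁ k) :
    C.comp h' T.p₂ (C.comp h T.i₁ f) = 0 := by
  rw [C.assoc (pq := c₂ + -c₁) h h' rfl (by omega), T.p₂_i₁, map_zero, LinearMap.zero_apply]

theorem comp_p₁_i₁ {n k : ℤ} (h : k + c₁ = n) (h' : n + -c₁ = k) (f : C.Hom P₁ Y k) :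
    C.comp h' (C.comp h f T.p₁) T.i₁ = f := by
  rw [← C.assoc (add_neg_cancel c₁) (add_zero k) h h', T.p₁_i₁ _ rfl, reindex_rfl, C.comp_id]

theorem comp_p₁_i₂ {n k k' : ℤ} (h : k + c₁ = n) (h' : n + -c₂ = k') (f : C.Hom P₁ Y k) :
    C.comp h' (C.comp h f T.p₁) T.i₂ = 0 := by
  rw [← C.assoc (qr := c₁ + -c₂) rfl (by omega) h h', T.p₁_i₂, map_zero]

section diff

/-- Since d i₁ = i₂ ω, the P₁-component of db contains the P₂-component of b multiplied by ω: Hom(B,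
Y) is a shifted cone of right multiplication with ω. -/
theorem comp_d_i₁ {n k m k' : ℤ} (hn : n + 1 = m) (hk : n + -c₁ = k) (hk' : k + 1 = k')
    (hm : m + -c₁ = k') {l : ℤ} (hl : n + -c₂ = l) (hl' : l + a = k') (b : C.Hom B Y n) :
    C.comp hm (C.d hn b) T.i₁
      = C.d hk' (C.comp hk b T.i₁) - (-1 : K) ^ n • C.comp hl' (C.comp hl b T.i₂) ω := by
  have hs := T.shift
  rw [C.leibniz hk hk' hn rfl hm (by omega), T.d_i₁ rfl (by omega),
    C.assoc (by omega) (by omega) hl hl', add_sub_cancel_right]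

theorem d_i₁_comp {n k l m : ℤ} (h : -c₁ + k = n) (hn : n + 1 = m) (hl : a + k = l)
    (hm : -c₂ + l = m) (f : C.Hom X P₁ k) (hf : C.d rfl f = 0) :
    C.d hn (C.comp h T.i₁ f) = C.comp hm T.i₂ (C.comp hl ω f) := by
  have hs := T.shift
  rw [C.leibniz (p' := -c₁ + 1) h hn rfl rfl (by omega) (by omega), hf, map_zero, smul_zero,
    add_zero, T.d_i₁ rfl (by omega), ← C.assoc hl hm]

theorem d_i₂_comp {n k m : ℤ} (h : -c₂ + k = n) (hn : n + 1 = m)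
    (f : C.Hom X P₂ k) (hf : C.d rfl f = 0) :
    C.d hn (C.comp h T.i₂ f) = 0 := by
  rw [C.leibniz (p' := -c₂ + 1) h hn rfl rfl (by omega) (by omega), hf, map_zero, smul_zero,
    add_zero, T.d_i₂, map_zero, LinearMap.zero_apply]

theorem d_comp_p₁ {n k m k' : ℤ} (h : k + c₁ = n) (hn : n + 1 = m) (hk : k + 1 = k')
    (hm : k' + c₁ = m) (f : C.Hom P₁ Y k) :
    C.d hn (C.comp h f T.p₁) = C.comp hm (C.d hk f) T.p₁ := by
  rw [C.leibniz h hn hk rfl hm (by omega), T.d_p₁, map_zero, smul_zero, add_zero]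

theorem d_comp_p₂ {n k m k' l : ℤ} (h : k + c₂ = n) (hn : n + 1 = m) (hk : k + 1 = k')
    (hm : k' + c₂ = m) (hl : k + a = l) (hm' : l + c₁ = m) (f : C.Hom P₂ Y k) :
    C.d hn (C.comp h f T.p₂) = C.comp hm (C.d hk f) T.p₂
      - (-1 : K) ^ n • C.comp hm' (C.comp hl f ω) T.p₁ := by
  have hs := T.shift
  subst h
  rw [C.leibniz rfl hn hk rfl hm (by omega), T.d_p₂ rfl (by omega), map_neg, map_smul,
    smul_neg, smul_smul, C.assoc (by omega) (by omega) hl hm', ← zpow_add₀ (by simp),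
    ← sub_eq_add_neg]

end diff

end Cone

end DGCat

end PinchedDG

/-! ### Retractions of the morphism complexes of a cone -/

namespace PinchedDG

namespace DGCat.Cone

variable {K : Type w} [Field K] {C : DGCat.{w, u, v} K} {P₁ P₂ B : C.Obj} {a c₁ c₂ : ℤ}
  {ω : C.Hom P₁ P₂ a} (T : C.Cone ω B c₁ c₂) {X Y : C.Obj}

theorem neg_one_zpow_mul_self (n : ℤ) : (-1 : K) ^ n * (-1) ^ n = 1 := by
  rw [← mul_zpow]
  simp

/-- The homotopy `b ↦ ± σ(b i₁) p₂` on the morphisms from `B` to `Y`. -/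
def homotopy (σ : ∀ {n m : ℤ}, m + a = n → (C.Hom P₁ Y n →ₗ[K] C.Hom P₂ Y m)) (r s : ℤ)
    (h : s + 1 = r) : C.Hom B Y r →ₗ[K] C.Hom B Y s :=
  (-1 : K) ^ r • ((C.comp (show s - c₂ + c₂ = s by omega)).flip T.p₂).comp
    ((σ (show s - c₂ + a = r + -c₁ by have := T.shift; omega)).comp
      ((C.comp (rfl : r + -c₁ = r + -c₁)).flip T.i₁))

theorem homotopy_apply (σ : ∀ {n m : ℤ}, m + a = n → (C.Hom P₁ Y n →ₗ[K] C.Hom P₂ Y m)) {r s : ℤ}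
    (h : s + 1 = r) {k l : ℤ} (hk : r + -c₁ = k) (hl : l + a = k) (hs : l + c₂ = s)
    (b : C.Hom B Y r) :
    T.homotopy σ r s h b = (-1 : K) ^ r • C.comp hs (σ hl (C.comp hk b T.i₁)) T.p₂ := by
  subst hk
  obtain rfl : l = s - c₂ := by omega
  rfl

/-- A section σ of right multiplication with ω contracts its cone up to two errors: the failure of
σ(x) ω = x on the P₁-component, and the failure of σ to commute with d on the P₂-component. -/
theorem eq_homotopy (σ : ∀ {n m : ℤ}, m + a = n → (C.Hom P₁ Y n →ₗ[K] C.Hom P₂ Y m))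
    (hσ : ∀ {n m : ℤ} (h : m + a = n) (f : C.Hom P₂ Y m), σ h (C.comp h f ω) = f)
    {r r' s : ℤ} (e : r + 1 = r') (e' : s + 1 = r) {k k' l l' : ℤ} (hk : r + -c₁ = k)
    (hl : l + a = k) (hl' : l + 1 = l') (hk' : k + 1 = k') (hlk : l' + a = k') (hkr : k + c₁ = r)
    (hlr : l' + c₂ = r) (b : C.Hom B Y r) :
    b = C.d e' (T.homotopy σ r s e' b) + T.homotopy σ r' r e (C.d e b)
      + C.comp hkr (C.comp hk b T.i₁ - C.comp hl (σ hl (C.comp hk b T.i₁)) ω) T.p₁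
      + (-1 : K) ^ r • C.comp hlr (σ hlk (C.d hk' (C.comp hk b T.i₁))
        - C.d hl' (σ hl (C.comp hk b T.i₁))) T.p₂ := by
  have hs := T.shift
  rw [T.homotopy_apply σ e' hk hl (by omega), T.homotopy_apply σ e (show r' + -c₁ = k' by omega)
    hlk hlr, T.comp_d_i₁ e hk hk' (by omega) (show r + -c₂ = l' by omega) hlk, map_sub,
    map_smul (σ hlk), hσ, map_smul (C.d e'), T.d_comp_p₂ (by omega) e' hl' hlr hl hkr]
  conv_lhs => rw [T.eq_out hk (show r + -c₂ = l' by omega) b]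
  subst e
  subst e'
  simp only [map_sub, map_smul, map_neg, LinearMap.sub_apply, LinearMap.smul_apply,
    LinearMap.neg_apply, smul_neg, smul_sub, smul_smul, zpow_add₀ (show (-1 : K) ≠ 0 by simp),
    zpow_one, mul_neg, mul_one, neg_mul, neg_smul,
    neg_one_zpow_mul_self, one_smul, neg_neg]
  abel

/-- Without differentials the commutator error disappears, and the error left is the cokernel of
right multiplication with ω. -/
theorem eq_homotopy_strip {q : ℤ} {gen : C.Hom P₁ Y q} (R : C.RightStrip ω gen)
    (hY₁ : C.NoDiff P₁ Y) (hY₂ : C.NoDiff P₂ Y) {r r' s : ℤ} (e : r + 1 = r') (e' : s + 1 = r)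
    {k l : ℤ} (hk : r + -c₁ = k) (hl : l + a = k) (hkr : k + c₁ = r) (b : C.Hom B Y r) :
    b = C.d e' (T.homotopy R.sec r s e' b) + T.homotopy R.sec r' r e (C.d e b)
      + C.comp hkr (C.comp hk b T.i₁ - C.comp hl (R.sec hl (C.comp hk b T.i₁)) ω) T.p₁ := by
  have hs := T.shift
  conv_lhs => rw [T.eq_homotopy R.sec R.sec_comp e e' hk hl (rfl : l + 1 = _)
    (rfl : k + 1 = _) (by omega) hkr (by omega) b]
  rw [hY₁, hY₂, map_zero, sub_zero, map_zero, LinearMap.zero_apply, smul_zero, add_zero]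

/-- The retraction of the morphisms from a cone to an object. -/
def retraction {q : ℤ} {gen : C.Hom P₁ Y q} (R : C.RightStrip ω gen) (hY₁ : C.NoDiff P₁ Y)
    (hY₂ : C.NoDiff P₂ Y) : C.Retraction B Y (q + c₁) (q + c₁ + 1) where
  ne := by omega
  m₀ := C.comp rfl gen T.p₁
  -- At most a line survives, spanned by gen p₁. The second generator is zero, and its degree only
  -- has to differ from the first.
  m₁ := 0
  d_m₀ := by
    rw [T.d_comp_p₁ rfl rfl rfl (by omega), hY₁, map_zero, LinearMap.zero_apply]
  d_m₁ := map_zero _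
  χ₀ := R.coeff.comp ((C.comp (show q + c₁ + -c₁ = q by omega)).flip T.i₁)
  χ₁ := 0
  χ₀_d b := by
    have hs := T.shift
    rw [LinearMap.comp_apply, LinearMap.flip_apply,
      T.comp_d_i₁ (k := q - 1) (l := q - a) _ (by omega) (by omega) _ (by omega) (by omega), hY₁,
      zero_sub, map_neg, map_smul, R.coeff_comp, smul_zero, neg_zero]
  χ₁_d _ := rfl
  χ₀_m₀ := R.coeff_gen.imp (fun h => by rw [h, map_zero, LinearMap.zero_apply]) fun h => by
    rw [LinearMap.comp_apply, LinearMap.flip_apply, T.comp_p₁_i₁, h]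
  χ₁_m₁ := Or.inl rfl
  h := T.homotopy R.sec
  eq_of_ne {r r' s} e e' b h _ := by
    have hs := T.shift
    conv_lhs => rw [T.eq_homotopy_strip R hY₁ hY₂ e e' rfl
      (show r + -c₁ - a + a = r + -c₁ by omega) (by omega) b]
    rw [← R.eq_of_ne _ _ (by omega), sub_self, map_zero, LinearMap.zero_apply, add_zero]
  eq₀ {r' s} e e' b := by
    have hs := T.shift
    conv_lhs => rw [T.eq_homotopy_strip R hY₁ hY₂ e e' (show _ = q by omega)
      (show q - a + a = q by omega) rfl b]
    rw [LinearMap.comp_apply, LinearMap.flip_apply, ← LinearMap.smul_apply, ← map_smul,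
      sub_eq_iff_eq_add'.2 (R.eq_add (show q - a + a = q by omega) _)]
  eq₁ {r' s} e e' b := by
    have hs := T.shift
    conv_lhs => rw [T.eq_homotopy_strip R hY₁ hY₂ e e' (show _ = q + 1 by omega)
      (show q + 1 - a + a = q + 1 by omega) (by omega) b]
    rw [← R.eq_of_ne _ _ (by omega), sub_self, map_zero, LinearMap.zero_apply, smul_zero]

/-! ### The endomorphisms of a cone -/

section endo

variable (R₁ : C.RightStrip ω (C.id P₁)) {β : C.Hom P₁ P₂ a} (R₂ : C.RightStrip ω β)

/-- The section on the morphisms from `P₁` to `B`. -/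
def sec {n m : ℤ} (h : m + a = n) : C.Hom P₁ B n →ₗ[K] C.Hom P₂ B m :=
  (C.comp (show -c₁ + (c₁ + m) = m by omega) T.i₁).comp
      ((R₁.sec (show c₁ + m + a = c₁ + n by omega)).comp (C.comp rfl T.p₁))
    + (C.comp (show -c₂ + (c₂ + m) = m by omega) T.i₂).comp
      ((R₂.sec (show c₂ + m + a = c₂ + n by omega)).comp (C.comp rfl T.p₂))

theorem sec_apply {n m k₁ l₁ k₂ l₂ : ℤ} (h : m + a = n) (hk₁ : c₁ + n = k₁) (hl₁ : l₁ + a = k₁)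
    (hm₁ : -c₁ + l₁ = m) (hk₂ : c₂ + n = k₂) (hl₂ : l₂ + a = k₂) (hm₂ : -c₂ + l₂ = m)
    (b : C.Hom P₁ B n) :
    T.sec R₁ R₂ h b = C.comp hm₁ T.i₁ (R₁.sec hl₁ (C.comp hk₁ T.p₁ b))
      + C.comp hm₂ T.i₂ (R₂.sec hl₂ (C.comp hk₂ T.p₂ b)) := by
  subst hk₁
  subst hk₂
  obtain rfl : l₁ = c₁ + m := by omega
  obtain rfl : l₂ = c₂ + m := by omega
  rfl

theorem sec_comp {n m : ℤ} (h : m + a = n) (f : C.Hom P₂ B m) :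
    T.sec R₁ R₂ h (C.comp h f ω) = f := by
  rw [T.sec_apply R₁ R₂ h (l₁ := c₁ + m) (l₂ := c₂ + m) rfl (by omega) (by omega) rfl (by omega)
    (by omega), C.assoc h rfl rfl (by omega), C.assoc h rfl rfl (by omega), R₁.sec_comp,
    R₂.sec_comp]
  exact (T.eq_in _ _ f).symm

/-- Outside degree 0 every endomorphism of P₁ is divisible by ω, so f = σ₁(f) ω and therefore ω f =
(ω σ₁(f)) ω. -/
theorem comp_sec_of_ne {n m l k : ℤ} (h : m + a = n) (hk : a + n = k) (hl : a + m = l)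
    (hlk : l + a = k) (f : C.Hom P₁ P₁ n) (hn : n ≠ 0) :
    R₂.sec hlk (C.comp hk ω f) = C.comp hl ω (R₁.sec h f) := by
  conv_lhs => rw [R₁.eq_of_ne h f hn, C.assoc h hk hl hlk, R₂.sec_comp]

theorem comp_sec {m l k : ℤ} (h : m + a = 0) (hk : a + 0 = k) (hl : a + m = l)
    (hlk : l + a = k) (f : C.Hom P₁ P₁ 0) :
    R₂.sec hlk (C.comp hk ω f)
      = C.comp hl ω (R₁.sec h f) + R₁.coeff f • C.reindex (by omega) (C.id P₂) := by
  obtain rfl : l = 0 := by omega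
  obtain rfl : k = a := by omega
  have h₂ := R₂.sec_comp hlk (C.id P₂)
  rw [C.id_comp] at h₂
  conv_lhs => rw [R₁.eq_add h f, map_add, C.assoc h hk hl hlk, map_smul, C.comp_id, map_add,
    map_smul, R₂.sec_comp, h₂]
  rw [reindex_rfl]

/-- Writing f = gω + c · id gives ω f = (ω g + c · id) ω, a multiple of ω, whose β-coefficient is
zero. -/
theorem coeff_omega_comp (R₁ : C.RightStrip ω (C.id P₁)) (h : a + 0 = a) (f : C.Hom P₁ P₁ 0) :
    R₂.coeff (C.comp h ω f) = 0 := by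
  have h₂ := R₂.coeff_comp (zero_add a) (C.id P₂)
  rw [C.id_comp] at h₂
  rw [R₁.eq_add (neg_add_cancel a) f, map_add, C.assoc (pq := 0) _ _ (by omega) (by omega),
    map_smul, C.comp_id, map_add, map_smul, R₂.coeff_comp, h₂, smul_zero, add_zero]

/-- The endomorphism of a cone induced by a morphism from `P₁` to `P₂`. -/
def endHom (β : C.Hom P₁ P₂ a) : C.Hom B B 1 :=
  C.comp (show -c₂ + (c₂ + 1) = 1 by omega) T.i₂
    (C.comp (show a + c₁ = c₂ + 1 by have := T.shift; omega) β T.p₁)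

theorem d_eq (hX₁ : C.NoDiff X P₁) (hX₂ : C.NoDiff X P₂) {n m k l : ℤ} (hn : n + 1 = m)
    (hk : c₁ + n = k) (hl : a + k = l) (hm : -c₂ + l = m) (c : C.Hom X B n) :
    C.d hn c = C.comp hm T.i₂ (C.comp hl ω (C.comp hk T.p₁ c)) := by
  conv_lhs => rw [T.eq_in hk rfl c, map_add]
  rw [T.d_i₁_comp _ _ hl hm _ (hX₁ _ _), T.d_i₂_comp _ _ _ (hX₂ _ _), add_zero]

theorem sec_d_of_ne (h₁₁ : C.NoDiff P₁ P₁) (h₁₂ : C.NoDiff P₁ P₂) (h₂₁ : C.NoDiff P₂ P₁)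
    (h₂₂ : C.NoDiff P₂ P₂) {n m n' m' : ℤ} (h : m + a = n) (hn : n + 1 = n') (hm : m + 1 = m')
    (h' : m' + a = n') (c : C.Hom P₁ B n) (hne : n ≠ -c₁) :
    T.sec R₁ R₂ h' (C.d hn c) - C.d hm (T.sec R₁ R₂ h c) = 0 := by
  have hs := T.shift
  rw [T.d_eq h₁₁ h₁₂ hn rfl rfl (by omega), T.d_eq (l := c₂ + m') h₂₁ h₂₂ hm rfl (by omega)
      (by omega),
    T.sec_apply R₁ R₂ h' (l₁ := c₁ + m') (l₂ := c₂ + m') rfl (by omega) (by omega)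
      (show c₂ + n' = a + (c₁ + n) by omega) (by omega) (by omega), T.p₁_comp_i₂, map_zero,
    map_zero, zero_add, T.p₂_comp_i₂,
    T.sec_apply R₁ R₂ h (l₁ := c₁ + m) (l₂ := c₂ + m) rfl (by omega) (by omega) rfl (by omega)
      (by omega), map_add, T.p₁_comp_i₁, T.p₁_comp_i₂, add_zero,
    comp_sec_of_ne R₁ R₂ (show c₁ + m + a = c₁ + n by omega) _
      (show a + (c₁ + m) = c₂ + m' by omega) _ _ (by omega), sub_self]

/-- In degree -c₁ the P₁-component of c may contain a multiple of the identity of P₁, which σ₁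
drops. After multiplication with ω it is divisible by ω, and σ₂ returns the same multiple of the
identity of P₂. -/
theorem sec_d (h₁₁ : C.NoDiff P₁ P₁) (h₁₂ : C.NoDiff P₁ P₂) (h₂₁ : C.NoDiff P₂ P₁)
    (h₂₂ : C.NoDiff P₂ P₂) {m n' : ℤ} (h : m + a = -c₁) (hn : -c₁ + 1 = n') (hm : m + 1 = -c₂)
    (h' : -c₂ + a = n') (c : C.Hom P₁ B (-c₁)) :
    T.sec R₁ R₂ h' (C.d hn c) - C.d hm (T.sec R₁ R₂ h c)
      = R₁.coeff (C.comp (add_neg_cancel c₁) T.p₁ c) • T.i₂ := by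
  have hs := T.shift
  rw [T.d_eq (l := a) h₁₁ h₁₂ hn (add_neg_cancel c₁) (by omega) h',
    T.d_eq (l := 0) h₂₁ h₂₂ hm rfl (by omega) (by omega),
    T.sec_apply R₁ R₂ h' (l₁ := c₁ + -c₂) (l₂ := 0) rfl (by omega) (by omega)
      (show c₂ + n' = a by omega) (by omega) (by omega), T.p₁_comp_i₂, map_zero,
    map_zero, zero_add, T.p₂_comp_i₂,
    T.sec_apply R₁ R₂ h (l₁ := c₁ + m) (l₂ := c₂ + m) (add_neg_cancel c₁) (by omega) (by omega)
      rfl (by omega) (by omega), map_add, T.p₁_comp_i₁, T.p₁_comp_i₂,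
    add_zero (R₁.sec _ _), comp_sec R₁ R₂ (show c₁ + m + a = 0 by omega) _
      (show a + (c₁ + m) = 0 by omega) _ _,
    map_add, add_sub_cancel_left, map_smul, reindex_rfl, C.comp_id]

theorem sub_sec_comp {n m k₁ k₂ l₁ l₂ : ℤ} (h : m + a = n) (hk₁ : c₁ + n = k₁)
    (hl₁ : l₁ + a = k₁) (hk₂ : c₂ + n = k₂) (hl₂ : l₂ + a = k₂) (hn₁ : -c₁ + k₁ = n)
    (hn₂ : -c₂ + k₂ = n) (c : C.Hom P₁ B n) :
    c - C.comp h (T.sec R₁ R₂ h c) ω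
      = C.comp hn₁ T.i₁ (C.comp hk₁ T.p₁ c - C.comp hl₁ (R₁.sec hl₁ (C.comp hk₁ T.p₁ c)) ω)
        + C.comp hn₂ T.i₂
          (C.comp hk₂ T.p₂ c - C.comp hl₂ (R₂.sec hl₂ (C.comp hk₂ T.p₂ c)) ω) := by
  conv_lhs => enter [1]; rw [T.eq_in hk₁ hk₂ c]
  rw [T.sec_apply R₁ R₂ h hk₁ hl₁ (by omega) hk₂ hl₂ (by omega), map_add, LinearMap.add_apply,
    ← C.assoc hl₁ hn₁, ← C.assoc hl₂ hn₂, map_sub, map_sub]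
  abel

theorem sub_sec_comp_of_ne {n m : ℤ} (h : m + a = n) (c : C.Hom P₁ B n) (h₀ : n ≠ -c₁)
    (h₁ : n ≠ -c₁ + 1) : c - C.comp h (T.sec R₁ R₂ h c) ω = 0 := by
  have hs := T.shift
  rw [T.sub_sec_comp R₁ R₂ h rfl (show c₁ + m + a = c₁ + n by omega) rfl
    (show c₂ + m + a = c₂ + n by omega) (by omega) (by omega), ← R₁.eq_of_ne _ _ (by omega),
    ← R₂.eq_of_ne _ _ (by omega), sub_self, sub_self, map_zero, map_zero, add_zero]

/-- In this degree only the identity of P₁ in the first component obstructs divisibility by ω; in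
the next degree, treated by `sub_sec_comp₂`, it is β in the second. -/
theorem sub_sec_comp₁ {m : ℤ} (h : m + a = -c₁) (c : C.Hom P₁ B (-c₁)) :
    c - C.comp h (T.sec R₁ R₂ h c) ω
      = R₁.coeff (C.comp (add_neg_cancel c₁) T.p₁ c) • T.i₁ := by
  have hs := T.shift
  rw [T.sub_sec_comp R₁ R₂ h (add_neg_cancel c₁) (show c₁ + m + a = 0 by omega) rfl
    (show c₂ + m + a = c₂ + -c₁ by omega) (by omega) (by omega), ← R₂.eq_of_ne _ _ (by omega),
    sub_self, map_zero, add_zero, sub_eq_iff_eq_add'.2 (R₁.eq_add _ _), map_smul, C.comp_id]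

theorem sub_sec_comp₂ {n m : ℤ} (hn : n = -c₁ + 1) (h : m + a = n) (hk : c₂ + n = a)
    (hβ : -c₂ + a = n) (c : C.Hom P₁ B n) :
    c - C.comp h (T.sec R₁ R₂ h c) ω
      = R₂.coeff (C.comp hk T.p₂ c) • C.comp hβ T.i₂ β := by
  have hs := T.shift
  rw [T.sub_sec_comp R₁ R₂ h rfl (show c₁ + m + a = c₁ + n by omega) hk
    (show c₂ + m + a = a by omega) (by omega) hβ, ← R₁.eq_of_ne _ _ (by omega),
    sub_self, map_zero, zero_add, sub_eq_iff_eq_add'.2 (R₂.eq_add _ _), map_smul]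

theorem endHom_eq {n : ℤ} (h : -c₂ + a = n) (h' : n + c₁ = 1) :
    T.endHom β = C.comp h' (C.comp h T.i₂ β) T.p₁ := C.assoc _ _ _ _ _ _ _

theorem d_endHom (h₁₂ : C.NoDiff P₁ P₂) : C.d rfl (T.endHom β) = 0 := by
  have hs := T.shift
  rw [T.endHom_eq rfl (by omega), T.d_comp_p₁ _ _ rfl (by omega), T.d_i₂_comp _ _ _ (h₁₂ _ _),
    map_zero, LinearMap.zero_apply]

theorem endHom_comp {n k m r : ℤ} (hk : c₁ + n = k) (hm : a + k = m) (hr : -c₂ + m = r)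
    (h : 1 + n = r) (c : C.Hom X B n) :
    C.comp h (T.endHom β) c = C.comp hr T.i₂ (C.comp hm β (C.comp hk T.p₁ c)) := by
  have hs := T.shift
  rw [endHom, ← C.assoc (p := -c₂) (show c₂ + 1 + n = m by omega) hr _ _,
    ← C.assoc hk hm]

theorem coeff_endHom (hR₂ : R₂.coeff β = 1) (h : c₂ + (1 + -c₁) = a) :
    R₂.coeff (C.comp h T.p₂ (C.comp rfl (T.endHom β) T.i₁)) = 1 := by
  have hs := T.shift
  rw [T.endHom_comp (m := a) (add_neg_cancel c₁) (by omega) (by omega) rfl, T.p₁_i₁ _ rfl,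
    reindex_rfl, C.comp_id, T.p₂_comp_i₂, hR₂]

/-- The retraction of the endomorphisms of a cone. -/
def endRetraction (h₁₁ : C.NoDiff P₁ P₁) (h₁₂ : C.NoDiff P₁ P₂) (h₂₁ : C.NoDiff P₂ P₁)
    (h₂₂ : C.NoDiff P₂ P₂) (hR₁ : R₁.coeff (C.id P₁) = 1) (hR₂ : R₂.coeff β = 1) :
    C.Retraction B B 0 1 where
  ne := by omega
  m₀ := C.id B
  m₁ := T.endHom β
  d_m₀ := C.d_id B rfl
  d_m₁ := T.d_endHom h₁₂
  -- The functionals read the coefficient of the identity in p₁ b i₁ and that of β in p₂ b i₁. On a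
  -- boundary these entries are multiples of ω on the right, up to a summand ω f that
  -- `coeff_omega_comp` handles.
  χ₀ := R₁.coeff.comp ((C.comp (add_neg_cancel c₁) T.p₁).comp
    ((C.comp (zero_add (-c₁))).flip T.i₁))
  χ₁ := R₂.coeff.comp ((C.comp (show c₂ + (1 + -c₁) = a by have := T.shift; omega) T.p₂).comp
    ((C.comp rfl).flip T.i₁))
  χ₀_d b := by
    have hs := T.shift
    simp only [LinearMap.comp_apply, LinearMap.flip_apply]
    rw [T.comp_d_i₁ (l := 0 - 1 + -c₂) _ rfl (by omega) _ rfl (by omega),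
      T.d_eq h₁₁ h₁₂ _ rfl rfl (by omega), map_sub, T.p₁_comp_i₂, zero_sub, map_smul,
      C.assoc (pq := -a) _ _ (by omega) (by omega), map_neg, map_smul, R₁.coeff_comp, smul_zero,
      neg_zero]
  χ₁_d b := by
    have hs := T.shift
    simp only [LinearMap.comp_apply, LinearMap.flip_apply]
    rw [T.comp_d_i₁ (l := 1 - 1 + -c₂) _ rfl (by omega) _ rfl (by omega),
      T.d_eq (k := 0) (l := a) h₁₁ h₁₂ _ (by omega) (by omega) (by omega), map_sub, T.p₂_comp_i₂,
      map_smul, C.assoc (pq := 0) _ _ (by omega) (by omega) T.p₂, map_sub, map_smul,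
      R₂.coeff_comp, smul_zero, sub_zero, coeff_omega_comp R₂ R₁]
  χ₀_m₀ := Or.inr (by
    simp only [LinearMap.comp_apply, LinearMap.flip_apply]
    rw [C.id_comp, T.p₁_i₁ _ rfl, reindex_rfl, hR₁])
  χ₁_m₁ := Or.inr (T.coeff_endHom R₂ hR₂ _)
  h := T.homotopy (T.sec R₁ R₂)
  eq_of_ne {r r' s} e e' b h₀ h₁ := by
    have hs := T.shift
    conv_lhs => rw [T.eq_homotopy (T.sec R₁ R₂) (T.sec_comp R₁ R₂) e e' rfl
      (show r + -c₁ - a + a = r + -c₁ by omega) rfl rfl (by omega) (by omega) (by omega) b]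
    rw [T.sub_sec_comp_of_ne R₁ R₂ _ _ (by omega) (by omega),
      T.sec_d_of_ne R₁ R₂ h₁₁ h₁₂ h₂₁ h₂₂ _ _ _ _ _ (by omega), map_zero, LinearMap.zero_apply,
      map_zero, LinearMap.zero_apply, smul_zero, add_zero, add_zero]
  eq₀ {r' s} e e' b := by
    have hs := T.shift
    conv_lhs => rw [T.eq_homotopy (T.sec R₁ R₂) (T.sec_comp R₁ R₂) e e' (zero_add (-c₁))
      (show -c₁ - a + a = -c₁ by omega) (show -c₁ - a + 1 = -c₂ by omega) rfl (by omega)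
      (neg_add_cancel c₁) (neg_add_cancel c₂) b]
    -- The two errors are χ₀(b) i₁ p₁ and χ₀(b) i₂ p₂, which add up to χ₀(b) id_B.
    rw [T.sub_sec_comp₁ R₁ R₂, T.sec_d R₁ R₂ h₁₁ h₁₂ h₂₁ h₂₂, zpow_zero, one_smul, map_smul,
      LinearMap.smul_apply, map_smul, LinearMap.smul_apply, add_assoc, ← smul_add, ← T.id_eq]
    rfl
  eq₁ {r' s} e e' b := by
    have hs := T.shift
    conv_lhs => rw [T.eq_homotopy (T.sec R₁ R₂) (T.sec_comp R₁ R₂) e e' rfl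
      (show 1 + -c₁ - a + a = 1 + -c₁ by omega) rfl rfl (by omega) (by omega) (by omega) b]
    rw [T.sub_sec_comp₂ R₁ R₂ (by omega) _ (by omega) (by omega),
      T.sec_d_of_ne R₁ R₂ h₁₁ h₁₂ h₂₁ h₂₂ _ _ _ _ _ (by omega), map_smul, LinearMap.smul_apply,
      map_zero, LinearMap.zero_apply, smul_zero, add_zero, ← T.endHom_eq]
    rfl

/-- A cone is a sphere-like object. -/
def sphereLike (h₁₁ : C.NoDiff P₁ P₁) (h₁₂ : C.NoDiff P₁ P₂) (h₂₁ : C.NoDiff P₂ P₁)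
    (h₂₂ : C.NoDiff P₂ P₂) (hR₁ : R₁.coeff (C.id P₁) = 1) (hR₂ : R₂.coeff β = 1)
    (hX₁ : C.NoDiff X P₁) (hX₂ : C.NoDiff X P₂) (L : C.LeftStrip ω X) : C.SphereLike X B where
  R := T.endRetraction R₁ R₂ h₁₁ h₁₂ h₂₁ h₂₂ hR₁ hR₂
  m₀_eq := rfl
  sq_zero := by
    have hs := T.shift
    change C.comp _ (T.endHom β) (T.endHom β) = 0
    rw [T.endHom_comp rfl rfl (by omega), endHom, T.p₁_comp_i₂, map_zero, map_zero]
  χ₁_m₁ := T.coeff_endHom R₂ hR₂ _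
  -- These are the morphisms i₂ c with c in the kernel of the section of left multiplication with ω,
  -- a complement of its image.
  N n := LinearMap.ker (C.comp (rfl : c₁ + n = c₁ + n) T.p₁) ⊓
    LinearMap.ker ((L.sec (show a + (c₂ + n - a) = c₂ + n by omega)).comp
      (C.comp (rfl : c₂ + n = c₂ + n) T.p₂))
  d_N {n} b hb := by
    have hs := T.shift
    rw [T.d_eq hX₁ hX₂ rfl rfl rfl (by omega), LinearMap.mem_ker.1 hb.1, map_zero, map_zero]
  exists_of_closed {n l} hl b hb := by
    have hs := T.shift
    rw [T.d_eq hX₁ hX₂ rfl rfl (show a + (c₁ + n) = c₂ + (n + 1) by omega) (by omega)] at hb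
    -- Closedness means ω p₁ b = 0, and left multiplication with ω is injective, so p₁ b = 0.
    have hb' := congrArg (fun c => L.sec (show a + (c₁ + n) = c₂ + (n + 1) by omega)
      (C.comp rfl T.p₂ c)) hb
    simp only [map_zero] at hb'
    rw [T.p₂_comp_i₂, L.sec_comp] at hb'
    have h₁ : a + (c₂ + n - a) = c₂ + n := by omega
    refine ⟨C.comp (by omega) T.i₂ (C.comp rfl T.p₂ b
      - C.comp h₁ ω (L.sec h₁ (C.comp rfl T.p₂ b))), ⟨?_, ?_⟩,
      C.comp (show -c₁ + (c₂ + n - a) = l by omega) T.i₁ (L.sec h₁ (C.comp rfl T.p₂ b)), ?_⟩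
    · exact LinearMap.mem_ker.2 (T.p₁_comp_i₂ _ _ _)
    · refine LinearMap.mem_ker.2 ?_
      rw [LinearMap.comp_apply, T.p₂_comp_i₂, map_sub, L.sec_comp, sub_self]
    · rw [T.d_i₁_comp _ hl h₁ (by omega) _ (hX₁ _ _), ← map_add, sub_add_cancel]
      conv_lhs => rw [T.eq_in rfl rfl b, hb', map_zero, zero_add]
  eq_zero_of_exact {n l} hl c hc := by
    have hs := T.shift
    have h₁ : a + (c₁ + l) = c₂ + n := by omega
    have hc' := LinearMap.mem_ker.1 hc.2
    -- An exact morphism is i₂ ω p₁ c. The section sends its P₂-component to p₁ c, so membership in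
    -- `N` forces p₁ c = 0.
    rw [LinearMap.comp_apply, T.d_eq hX₁ hX₂ hl (show c₁ + l = c₂ + n - a by omega)
      (show a + (c₂ + n - a) = c₂ + n by omega) (by omega), T.p₂_comp_i₂, L.sec_comp] at hc'
    rw [T.d_eq hX₁ hX₂ hl (show c₁ + l = c₂ + n - a by omega)
      (show a + (c₂ + n - a) = c₂ + n by omega) (by omega), hc', map_zero, map_zero]
  comp_N {n} b hb := by
    have hs := T.shift
    refine (T.endHom_comp rfl rfl (by omega) _ b).trans ?_
    rw [LinearMap.mem_ker.1 hb.1, map_zero, map_zero]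

end endo

end DGCat.Cone

end PinchedDG

/-! ### The inverse of ω in the Drinfeld quotient, and closed morphisms from the retractions -/

namespace PinchedDG

namespace DGCat

variable {K : Type w} [Field K] {C : DGCat.{w, u, v} K}

namespace QuotHom

/-- The composite `b ε_B c`. -/
def sandwich {B X Y : C.Obj} {p q n : ℤ} (h : p + (-1 + q) = n) (b : C.Hom B Y p)
    (c : C.Hom X B q) : QuotHom C {B} X Y n :=
  comp h (of {B} b) (comp rfl (eps (Set.mem_singleton B)) (of {B} c))

theorem sandwich_eq {B X Y : C.Obj} {p q n k : ℤ} (h : p + (-1 + q) = n) (h₁ : -1 + q = k)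
    (h₂ : p + k = n) (b : C.Hom B Y p) (c : C.Hom X B q) :
    sandwich h b c = comp h₂ (of {B} b) (comp h₁ (eps (Set.mem_singleton B)) (of {B} c)) := by
  subst h₁
  rfl

theorem d_sandwich {B X Y : C.Obj} {p q n m p' q' : ℤ} (h : p + (-1 + q) = n) (hm : n + 1 = m)
    (hp : p + 1 = p') (hq : q + 1 = q') (hp' : p' + (-1 + q) = m) (hq' : p + (-1 + q') = m)
    (hpq : p + q = m) (b : C.Hom B Y p) (c : C.Hom X B q) :
    d hm (sandwich h b c) = sandwich hp' (C.d hp b) c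
      + (-1 : K) ^ p • (of {B} (C.comp hpq b c) - sandwich hq' b (C.d hq c)) := by
  subst hq
  have h₁ : d (show (-1 : ℤ) + 1 = 0 by rfl) (eps (Set.mem_singleton B)) = of {B} (C.id B) :=
    congrArg (of {B}) (C.reindex_rfl _ _)
  rw [sandwich, leibniz h hm hp (show -1 + q + 1 = q by omega) hp' hpq,
    leibniz (p := -1) (q := q) rfl _ (show (-1 : ℤ) + 1 = 0 by rfl) rfl (zero_add q)
      (show -1 + (q + 1) = q by omega), h₁, d_of, d_of, id_comp, of_comp hpq, map_add, map_smul,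
    zpow_neg_one, inv_neg, inv_one, neg_smul, one_smul, ← sub_eq_add_neg,
    sandwich_eq hq' (show -1 + (q + 1) = q by omega) hpq]
  rfl

theorem comp_sandwich {B X Y Z : C.Obj} {p q n r p' m : ℤ} (h : p + (-1 + q) = n) (hm : r + n = m)
    (hr : r + p = p') (h' : p' + (-1 + q) = m) (f : C.Hom Y Z r) (b : C.Hom B Y p)
    (c : C.Hom X B q) :
    comp hm (of {B} f) (sandwich h b c) = sandwich h' (C.comp hr f b) c := by
  rw [sandwich, sandwich, assoc h hm hr h', of_comp]

theorem sandwich_comp {B X Y Z : C.Obj} {p q n r q' m : ℤ} (h : p + (-1 + q) = n) (hm : n + r = m)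
    (hr : q + r = q') (h' : p + (-1 + q') = m) (b : C.Hom B Y p)
    (c : C.Hom X B q) (f : C.Hom Z X r) :
    comp hm (sandwich h b c) (of {B} f) = sandwich h' b (C.comp hr c f) := by
  subst hr
  rw [sandwich, sandwich, ← assoc (qr := -1 + (q + r)) (by omega) h' h hm,
    ← assoc rfl rfl rfl (by omega), of_comp]

/-- Regroups b ε (c z) as (b ε c) z. For b = p₁ and c = i₂ this makes δ visible inside a word. -/
theorem be_ofComp {B X Y Z : C.Obj} {p q n k l r : ℤ} (h : p + l = n + 1) (hl : q + k = l)
    (hr : p + (-1 + q) = r) (hn : r + k = n) (b : C.Hom B Y p) (c : C.Hom Z B q)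
    (z : QuotHom C {B} X Z k) :
    be h b (comp hl (of {B} c) z) = comp hn (sandwich hr b c) z := by
  rw [be_eq (q' := -1 + l) h (by omega) (by omega), ofComp_apply, epsComp, sandwich,
    ← assoc (p := p) (q := -1 + q) (r := k) (qr := -1 + l) (by omega) (by omega) hr hn,
    assoc hl _ rfl _]

end QuotHom

namespace Cone

open QuotHom

variable {P₁ P₂ B : C.Obj} {a c₁ c₂ : ℤ} {ω : C.Hom P₁ P₂ a} (T : C.Cone ω B c₁ c₂)
  {X Y : C.Obj}

/-- The composite `p₁ ε_B i₂`, which is inverse to `ω` in the graded homotopy category of the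
Drinfeld quotient. -/
def delta : QuotHom C {B} P₂ P₁ (-a) :=
  sandwich (show c₁ + (-1 + -c₂) = -a by have := T.shift; omega) T.p₁ T.i₂

theorem d_delta {m : ℤ} (h : -a + 1 = m) : QuotHom.d h T.delta = 0 := by
  have hs := T.shift
  rw [delta, d_sandwich _ h rfl rfl (by omega) (by omega) (by omega), T.d_p₁, T.d_i₂, T.p₁_i₂]
  simp [sandwich]

/-- In p₁ ε i₁ the differential hits ε, giving p₁ i₁ = 1, and i₁, giving p₁ ε i₂ ω = δω. -/
theorem delta_omega (h : c₁ + (-1 + -c₁) = -1) :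
    QuotHom.d (show (-1 : ℤ) + 1 = 0 by rfl) ((-1 : K) ^ c₁ • sandwich h T.p₁ T.i₁)
      = of {B} (C.id P₁) - QuotHom.comp (neg_add_cancel a) T.delta (of {B} ω) := by
  have hs := T.shift
  rw [map_smul, d_sandwich h _ rfl (show -c₁ + 1 = -c₂ + a by omega) (by omega) (by omega)
    (by omega), T.d_p₁, T.d_i₁ _ rfl, T.p₁_i₁ _ rfl, reindex_rfl, delta,
    sandwich_comp _ (neg_add_cancel a) rfl (by omega), smul_add, smul_smul,
    neg_one_zpow_mul_self, one_smul]
  simp [sandwich]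

/-- In p₂ ε i₂ the differential hits ε, giving p₂ i₂ = 1, and p₂, giving up to sign ω p₁ ε i₂ = ωδ.
-/
theorem omega_delta (h : c₂ + (-1 + -c₂) = -1) :
    QuotHom.d (show (-1 : ℤ) + 1 = 0 by rfl) ((-1 : K) ^ c₂ • sandwich h T.p₂ T.i₂)
      = of {B} (C.id P₂) - QuotHom.comp (add_neg_cancel a) (of {B} ω) T.delta := by
  have hs := T.shift
  rw [map_smul, d_sandwich h _ (show c₂ + 1 = a + c₁ by omega) rfl (by omega) (by omega)
    (by omega), T.d_i₂, T.d_p₂ _ rfl, T.p₂_i₂ _ rfl, reindex_rfl, delta,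
    comp_sandwich _ (add_neg_cancel a) rfl (by omega)]
  simp only [sandwich, map_neg, map_smul, LinearMap.neg_apply, LinearMap.smul_apply, smul_add,
    smul_sub, smul_neg, smul_smul, neg_one_zpow_mul_self, one_smul, map_zero]
  abel

/-- The surviving words translated into δ: gen p₁ ε i₂ z is gen δ z, and each letter t = i₂ β p₁
contributes a factor β δ. `A` is any family that contains Hom(X, P₂) and is stable under z ↦ β δ z.
-/
theorem exists_eq_of_closed {β : C.Hom P₁ P₂ a} (R₁ : C.RightStrip ω (C.id P₁))
    (R₂ : C.RightStrip ω β) (hR₁ : R₁.coeff (C.id P₁) = 1) (hR₂ : R₂.coeff β = 1)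
    (L : C.LeftStrip ω X) {k : ℤ} {gen : C.Hom P₁ Y k} (R : C.RightStrip ω gen)
    (h₁₁ : C.NoDiff P₁ P₁) (h₁₂ : C.NoDiff P₁ P₂) (h₂₁ : C.NoDiff P₂ P₁)
    (h₂₂ : C.NoDiff P₂ P₂) (hX₁ : C.NoDiff X P₁) (hX₂ : C.NoDiff X P₂) (hY₁ : C.NoDiff P₁ Y)
    (hY₂ : C.NoDiff P₂ Y) (A : ∀ n, Submodule K (QuotHom C {B} X P₂ n))
    (hA : ∀ n (f : C.Hom X P₂ n), of {B} f ∈ A n)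
    (hβ : ∀ {n m : ℤ} (h : -a + n = m) (h' : a + m = n), ∀ z ∈ A n,
      QuotHom.comp h' (of {B} β) (QuotHom.comp h T.delta z) ∈ A n)
    {n n' l m q : ℤ} (hn : n + 1 = n') (hl : l + 1 = n) (hm : -a + m = q) (hq : k + q = n)
    (f : QuotHom C {B} X Y n)
    (hf : QuotHom.d hn f = 0) :
    ∃ (g : QuotHom C {B} X Y l) (b : C.Hom X Y n), ∃ z ∈ A m,
      f = QuotHom.d hl g + of {B} b + QuotHom.comp hq (of {B} gen) (QuotHom.comp hm T.delta z) := by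
  have hs := T.shift
  have hM : (T.sphereLike R₁ R₂ h₁₁ h₁₂ h₂₁ h₂₂ hR₁ hR₂ hX₁ hX₂ L).Annihilates
      (T.retraction R hY₁ hY₂).m₀ := by
    refine ⟨(T.retraction R hY₁ hY₂).d_m₀, ?_, fun {n} b hb => ?_⟩
    · change C.comp _ (C.comp _ gen T.p₁) (C.comp _ T.i₂ _) = 0
      rw [C.assoc (pq := k + c₁ + -c₂) _ _ rfl (by omega), T.comp_p₁_i₂, map_zero,
        LinearMap.zero_apply]
    · change C.comp _ (C.comp _ gen T.p₁) b = 0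
      rw [← C.assoc (rfl : c₁ + n = _) (show k + (c₁ + n) = k + c₁ + n by omega),
        LinearMap.mem_ker.1 hb.1, map_zero]
  -- J = i₂ A contains N, because b = i₂ p₂ b when p₁ b = 0, and t ε i₂ z = i₂ β δ z shows its
  -- stability.
  let J : ∀ n, Submodule K (QuotHom C {B} X B n) := fun n =>
    (A (c₂ + n)).map (QuotHom.comp (show -c₂ + (c₂ + n) = n by omega) (of {B} T.i₂))
  have hN : ∀ n, ((T.sphereLike R₁ R₂ h₁₁ h₁₂ h₂₁ h₂₂ hR₁ hR₂ hX₁ hX₂ L).N n).map (of {B})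
      ≤ J n := by
    rintro n _ ⟨b, hb, rfl⟩
    refine ⟨of {B} (C.comp rfl T.p₂ b), hA _ _, ?_⟩
    rw [← of_comp]
    conv_rhs => rw [T.eq_in rfl rfl b, LinearMap.mem_ker.1 hb.1, map_zero, zero_add]
  have hJ : ∀ n, ∀ j ∈ J n, be (add_comm 1 n) (T.endHom β) j ∈ J n := by
    rintro n _ ⟨z, hz, rfl⟩
    refine ⟨_, hβ (m := c₂ + n - a) (by omega) (by omega) z hz, ?_⟩
    rw [be_ofComp (r := -c₂) _ _ (by omega) (by omega), endHom,
      ← comp_sandwich (p := c₂ + 1) (n := 0) (by omega) (add_zero (-c₂)) _ (by omega),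
      ← comp_sandwich (n := -a) (by omega) (add_neg_cancel a) _ (by omega),
      ← QuotHom.assoc (p := -c₂) (q := 0) (qr := c₂ + n) (zero_add _) (by omega),
      ← QuotHom.assoc (p := a) (q := -a) (qr := c₂ + n - a) (by omega) (by omega)]
    rfl
  -- An element of J of degree q' comes from A in degree c₂ + q'.
  obtain ⟨q', rfl⟩ : ∃ q', m = c₂ + q' := ⟨m - c₂, by omega⟩
  obtain ⟨g, b, _, ⟨z, hz, rfl⟩, h⟩ := hM.exists_eq_of_closed (T.retraction R hY₁ hY₂) rfl
    hN hJ (q := q') (by omega) hn hl f hf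
  refine ⟨g, b, z, hz, h.trans (congrArg _ ?_)⟩
  change be _ (C.comp _ gen T.p₁) _ = _
  rw [be_ofComp (r := k + -a) _ _ (by omega) (by omega),
    ← comp_sandwich (n := -a) (by omega) rfl _ (by omega), ← QuotHom.assoc hm hq]
  rfl

end Cone

end DGCat

end PinchedDG

namespace PinchedDG

namespace DGCat

variable {K : Type w} [Field K] {C : DGCat.{w, u, v} K}

/-! ### Twisted complexes: projections and inclusions -/

theorem reindex_id_comp {X Y : C.Obj} {p q r : ℤ} (h : p + q = r) (hp : 0 = p) (hr : q = r)
    (f : C.Hom X Y q) : C.comp h (C.reindex hp (C.id Y)) f = C.reindex hr f := by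
  subst hp
  rw [reindex_rfl]
  rfl

theorem comp_reindex_id {X Y : C.Obj} {p q r : ℤ} (h : p + q = r) (hq : 0 = q) (hr : p = r)
    (f : C.Hom X Y p) : C.comp h f (C.reindex hq (C.id X)) = C.reindex hr f := by
  subst hq
  subst hr
  rw [reindex_rfl, reindex_rfl, C.comp_id]

theorem pretr_comp_apply {X Y Z : C.pretr.Obj} {p q r : ℤ} (h : p + q = r)
    (g : C.pretr.Hom Y Z p) (f : C.pretr.Hom X Y q) (i : Fin (TwistedComplex.len Z))
    (j : Fin (TwistedComplex.len X)) :
    C.pretr.comp h g f i j = ∑ k : Fin (TwistedComplex.len Y),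
      C.comp (by omega) (g i k) (f k j) := rfl

theorem pretr_d_apply {X Y : C.pretr.Obj} {n m : ℤ} (h : n + 1 = m) (f : C.pretr.Hom X Y n)
    (i : Fin (TwistedComplex.len Y)) (j : Fin (TwistedComplex.len X)) :
    C.pretr.d h f i j = (-1 : K) ^ TwistedComplex.sh Y i • C.d (by omega) (f i j)
      + ∑ k : Fin (TwistedComplex.len Y), C.comp (by omega) (TwistedComplex.del Y i k) (f k j)
      - (-1 : K) ^ n • ∑ k : Fin (TwistedComplex.len X),
        C.comp (by omega) (f i k) (TwistedComplex.del X k j) := rfl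

/-- A stalk complex, as an object of `C^{pre-tr}`. -/
def stalkObj (C : DGCat.{w, u, v} K) (X : C.Obj) : C.pretr.Obj := TwistedComplex.stalk C X

/-- The embedding of `C` in `C^{pre-tr}`, on morphisms. -/
def stalkMap (C : DGCat.{w, u, v} K) (X Y : C.Obj) (n : ℤ) :
    C.Hom X Y n →ₗ[K] C.pretr.Hom (C.stalkObj X) (C.stalkObj Y) n where
  toFun f := TwistedComplex.stalkHom C f
  map_add' _ _ := by funext i j; exact map_add _ _ _
  map_smul' _ _ := by funext i j; exact map_smul _ _ _

/-- The inclusion of a summand of a twisted complex. -/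
def inclMor (X : C.pretr.Obj) (k : Fin (TwistedComplex.len X)) :
    C.pretr.Hom (C.stalkObj (TwistedComplex.obj X k)) X (-TwistedComplex.sh X k) :=
  TwistedComplex.incl X k

/-- The projection to a summand of a twisted complex. -/
def projMor (X : C.pretr.Obj) (k : Fin (TwistedComplex.len X)) :
    C.pretr.Hom X (C.stalkObj (TwistedComplex.obj X k)) (TwistedComplex.sh X k) :=
  TwistedComplex.proj X k

section entries

variable (X : C.pretr.Obj) {i k : Fin (TwistedComplex.len X)} (j : Fin 1)

theorem inclMor_same : inclMor X k k j
    = C.reindex (show 0 = -TwistedComplex.sh X k + TwistedComplex.sh X k - 0 by omega)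
      (C.id (TwistedComplex.obj X k)) :=
  Pi.single_eq_same _ _

theorem inclMor_ne (h : i ≠ k) : inclMor X k i j = 0 := Pi.single_eq_of_ne h _

theorem projMor_same : projMor X k j k
    = C.reindex (show 0 = TwistedComplex.sh X k + 0 - TwistedComplex.sh X k by omega)
      (C.id (TwistedComplex.obj X k)) :=
  Pi.single_eq_same _ _

theorem projMor_ne (h : i ≠ k) : projMor X k j i = 0 := Pi.single_eq_of_ne h _

theorem pretr_id_same : C.pretr.id X k k
    = C.reindex (show 0 = 0 + TwistedComplex.sh X k - TwistedComplex.sh X k by omega)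
      (C.id (TwistedComplex.obj X k)) :=
  Pi.single_eq_same _ _

theorem pretr_id_ne (h : i ≠ k) : C.pretr.id X i k = 0 := Pi.single_eq_of_ne h _

end entries

theorem comp_stalkMap_apply {X Y : C.Obj} {Z : C.pretr.Obj} {p q r : ℤ}
    (h : p + q = r) (g : C.pretr.Hom (C.stalkObj Y) Z p) (f : C.Hom X Y q)
    (i : Fin (TwistedComplex.len Z)) (j : Fin 1) :
    C.pretr.comp h g (C.stalkMap X Y q f) i j
      = C.comp (show p + TwistedComplex.sh Z i - 0 + q = r + TwistedComplex.sh Z i - 0 by omega)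
        (g i (0 : Fin 1)) f :=
  (pretr_comp_apply h g (C.stalkMap X Y q f) i j).trans
    ((Fin.sum_univ_one _).trans (C.comp_reindex_right _ _ _ _))

theorem stalkMap_comp_apply {X : C.pretr.Obj} {Y Z : C.Obj} {p q r : ℤ} (h : p + q = r)
    (g : C.Hom Y Z p) (f : C.pretr.Hom X (C.stalkObj Y) q) (i : Fin 1)
    (j : Fin (TwistedComplex.len X)) :
    C.pretr.comp h (C.stalkMap Y Z p g) f i j
      = C.comp (show p + (q + 0 - TwistedComplex.sh X j) = r + 0 - TwistedComplex.sh X j by omega)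
        g (f (0 : Fin 1) j) :=
  (pretr_comp_apply h (C.stalkMap Y Z p g) f i j).trans
    ((Fin.sum_univ_one _).trans (C.comp_reindex_left _ _ _ _))

theorem stalkMap_id (X : C.Obj) : C.stalkMap X X 0 (C.id X) = C.pretr.id (C.stalkObj X) := by
  funext i j
  obtain rfl : i = j := Subsingleton.elim (α := Fin 1) _ _
  exact (pretr_id_same (C.stalkObj X) (k := i)).symm

theorem stalkMap_comp {X Y Z : C.Obj} {p q r : ℤ} (h : p + q = r) (g : C.Hom Y Z p)
    (f : C.Hom X Y q) :
    C.stalkMap X Z r (C.comp h g f)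
      = C.pretr.comp h (C.stalkMap Y Z p g) (C.stalkMap X Y q f) := by
  funext i j
  exact (C.reindex_comp _ _ _ _).trans
    ((C.comp_reindex_left (show p + 0 - 0 + q = r + 0 - 0 by omega) _ _ _).symm.trans
      (comp_stalkMap_apply h (C.stalkMap Y Z p g) f i j).symm)

theorem d_stalkMap {X Y : C.Obj} {n m : ℤ} (h : n + 1 = m) (f : C.Hom X Y n) :
    C.pretr.d h (C.stalkMap X Y n f) = C.stalkMap X Y m (C.d h f) := by
  funext i j
  have h₁ : (-1 : K) ^ (0 : ℤ) • C.d (show n + 0 - 0 + 1 = m + 0 - 0 by omega)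
      (C.reindex (show n = n + 0 - 0 by omega) f)
      = C.reindex (show m = m + 0 - 0 by omega) (C.d h f) := by
    rw [C.d_reindex, C.reindex_d, zpow_zero, one_smul]
  refine (pretr_d_apply h (C.stalkMap X Y n f) i j).trans ((congrArg₂ _ (congrArg₂ _ h₁
    (Finset.sum_eq_zero fun k _ => ?_)) ((congrArg _ (Finset.sum_eq_zero fun k _ => ?_)).trans
      (smul_zero _))).trans ((sub_zero _).trans (add_zero _)))
  · exact LinearMap.map_zero₂ _ _
  · exact map_zero _

theorem stalkMap_injective (X Y : C.Obj) (n : ℤ) : Function.Injective (C.stalkMap X Y n) := by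
  refine (injective_iff_map_eq_zero _).2 fun f hf => ?_
  have h : C.reindex (show n = n + 0 - 0 by omega) f = 0 :=
    congrFun (congrFun hf (0 : Fin 1)) (0 : Fin 1)
  have h' := congrArg (C.reindex (show n + 0 - 0 = n by omega)) h
  rwa [reindex_reindex, reindex_rfl, map_zero] at h'

/-- A morphism between stalks is a 1 × 1 matrix, so the embedding is full. -/
theorem stalkMap_surjective (X Y : C.Obj) (n : ℤ) : Function.Surjective (C.stalkMap X Y n) := by
  intro f
  refine ⟨C.reindex (show n + 0 - 0 = n by omega) (f (0 : Fin 1) (0 : Fin 1)), ?_⟩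
  funext i j
  obtain rfl : i = (0 : Fin 1) := Subsingleton.elim (α := Fin 1) _ _
  obtain rfl : j = (0 : Fin 1) := Subsingleton.elim (α := Fin 1) _ _
  exact (C.reindex_reindex _ _ _).trans (C.reindex_rfl _ _)

theorem projMor_comp_inclMor_same (X : C.pretr.Obj) (k : Fin (TwistedComplex.len X)) {n : ℤ}
    (h : TwistedComplex.sh X k + -TwistedComplex.sh X k = n) (h' : 0 = n) :
    C.pretr.comp h (projMor X k) (inclMor X k)
      = C.pretr.reindex h' (C.pretr.id (C.stalkObj (TwistedComplex.obj X k))) := by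
  subst h'
  rw [reindex_rfl, ← stalkMap_id]
  funext i j
  refine (pretr_comp_apply h _ _ i j).trans ((Finset.sum_eq_single k
    (fun l _ hl => ?_) (fun hk => absurd (Finset.mem_univ k) hk)).trans ?_)
  · exact (congrArg _ (inclMor_ne X j hl)).trans (map_zero _)
  · refine (congrArg₂ (fun g f => C.comp _ g f) (projMor_same X i) (inclMor_same X j)).trans ?_
    exact (reindex_id_comp _ _ (show -TwistedComplex.sh X k + TwistedComplex.sh X k - 0 = 0 + 0 - 0
      by omega) _).trans (C.reindex_reindex _ _ _)

theorem projMor_comp_inclMor_ne (X : C.pretr.Obj) {k l : Fin (TwistedComplex.len X)} (hkl : k ≠ l)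
    {n : ℤ} (h : TwistedComplex.sh X k + -TwistedComplex.sh X l = n) :
    C.pretr.comp h (projMor X k) (inclMor X l) = 0 := by
  funext i j
  refine (pretr_comp_apply h _ _ i j).trans (Finset.sum_eq_zero fun m _ => ?_)
  by_cases hm : m = k
  · subst hm
    rw [inclMor_ne X j hkl, map_zero]
  · rw [projMor_ne X i hm, map_zero, LinearMap.zero_apply]

theorem inclMor_comp_projMor (X : C.pretr.Obj) (k i j : Fin (TwistedComplex.len X)) :
    C.pretr.comp (neg_add_cancel _) (inclMor X k) (projMor X k) i j
      = if i = k then C.pretr.id X i j else 0 := by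
  refine (pretr_comp_apply _ (inclMor X k) (projMor X k) i j).trans
    ((Fin.sum_univ_one _).trans ?_)
  split_ifs with hi
  · subst hi
    refine (congrArg (fun g => C.comp _ g _) (inclMor_same X 0)).trans
      ((reindex_id_comp _ _ (show TwistedComplex.sh X i + 0 - TwistedComplex.sh X j
        = 0 + TwistedComplex.sh X i - TwistedComplex.sh X j by omega) _).trans ?_)
    by_cases hj : j = i
    · subst hj
      exact (congrArg _ (projMor_same X 0)).trans
        ((C.reindex_reindex _ _ _).trans (pretr_id_same X).symm)
    · exact (congrArg _ (projMor_ne X 0 hj)).trans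
        ((map_zero _).trans (pretr_id_ne X (Ne.symm hj)).symm)
  · exact (congrArg (fun g => C.comp _ g _) (inclMor_ne X 0 hi)).trans (LinearMap.map_zero₂ _ _)

theorem pretr_id_eq_sum (X : C.pretr.Obj) :
    C.pretr.id X = ∑ k, C.pretr.comp (neg_add_cancel _) (inclMor X k) (projMor X k) := by
  funext i j
  let φ : C.pretr.Hom X X 0 →+ C.Hom (TwistedComplex.obj X j) (TwistedComplex.obj X i)
      (0 + TwistedComplex.sh X i - TwistedComplex.sh X j) :=
    { toFun := fun f => f i j, map_zero' := rfl, map_add' := fun _ _ => rfl }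
  refine Eq.symm ((map_sum φ
    (fun k => C.pretr.comp (neg_add_cancel _) (inclMor X k) (projMor X k)) Finset.univ).trans
      ((Finset.sum_congr rfl fun k _ =>
    inclMor_comp_projMor X k i j).trans ?_))
  rw [Finset.sum_ite_eq, if_pos (Finset.mem_univ i)]

theorem d_inclMor_apply (X : C.pretr.Obj) (k i : Fin (TwistedComplex.len X)) (j : Fin 1) {m : ℤ}
    (h : -TwistedComplex.sh X k + TwistedComplex.sh X i - 0 + 1 = m) :
    C.d h (inclMor X k i j) = 0 := by
  by_cases hi : i = k
  · subst hi
    exact (congrArg _ (inclMor_same X j)).trans ((C.d_reindex _ _ _).trans (C.d_id _ _))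
  · exact (congrArg _ (inclMor_ne X j hi)).trans (map_zero _)

theorem d_projMor_apply (X : C.pretr.Obj) (k i : Fin (TwistedComplex.len X)) (j : Fin 1) {m : ℤ}
    (h : TwistedComplex.sh X k + 0 - TwistedComplex.sh X i + 1 = m) :
    C.d h (projMor X k j i) = 0 := by
  by_cases hi : i = k
  · subst hi
    exact (congrArg _ (projMor_same X j)).trans ((C.d_reindex _ _ _).trans (C.d_id _ _))
  · exact (congrArg _ (projMor_ne X j hi)).trans (map_zero _)

/-- Entries of the inclusion are closed and its source has zero differential, so d is composition
with ∂. If column k of ∂ has its only possible nonzero entry in row l, this is the inclusion of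
summand l after that entry. -/
theorem d_inclMor {X : C.pretr.Obj} {k l : Fin (TwistedComplex.len X)}
    (hX : ∀ i, i ≠ l → TwistedComplex.del X i k = 0)
    {n a : ℤ} (h : -TwistedComplex.sh X k + 1 = n) (h' : -TwistedComplex.sh X l + a = n)
    (h'' : 1 + TwistedComplex.sh X l - TwistedComplex.sh X k = a) :
    C.pretr.d h (inclMor X k)
      = C.pretr.comp h' (inclMor X l) (C.stalkMap _ _ _ (C.reindex h''
        (TwistedComplex.del X l k))) := by
  funext i j
  have h₁ : (-1 : K) ^ TwistedComplex.sh X i • C.d (show -TwistedComplex.sh X k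
      + TwistedComplex.sh X i - 0 + 1 = n + TwistedComplex.sh X i - 0 by omega)
      (inclMor X k i j) = 0 := (congrArg _ (d_inclMor_apply X k i j _)).trans (smul_zero _)
  refine (pretr_d_apply h (inclMor X k) i j).trans ((congrArg₂ _ ((congrArg₂ _ h₁ ?_).trans
    (zero_add _)) ((congrArg _ (Finset.sum_eq_zero fun k _ => ?_)).trans
      (smul_zero _))).trans ((sub_zero _).trans (comp_stalkMap_apply h' _ _ i j).symm))
  · refine (Finset.sum_eq_single k (fun m _ hm => ?_)
      (fun hk => absurd (Finset.mem_univ k) hk)).trans ?_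
    · exact (congrArg _ (inclMor_ne X j hm)).trans (map_zero _)
    · refine (congrArg _ (inclMor_same X j)).trans ((comp_reindex_id _ _
        (show 1 + TwistedComplex.sh X i - TwistedComplex.sh X k = n + TwistedComplex.sh X i - 0
          by omega) _).trans ?_)
      by_cases hi : i = l
      · subst hi
        exact (((congrArg (fun g => C.comp _ g (C.reindex h'' (TwistedComplex.del X i k)))
          (inclMor_same X 0)).trans (reindex_id_comp _ _
            (show a = n + TwistedComplex.sh X i - 0 by omega) _)).trans
            (C.reindex_reindex _ _ _)).symm
      · exact ((congrArg _ (hX i hi)).trans (map_zero _)).trans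
          ((congrArg (fun g => C.comp _ g _) (inclMor_ne X 0 hi)).trans
            (LinearMap.map_zero₂ _ _)).symm
  · exact map_zero _

/-- Dual to `d_inclMor`, with row k of ∂. The sign is that of f ∂ in the differential of a twisted
complex, f having degree `sh X k`. -/
theorem d_projMor {X : C.pretr.Obj} {k l : Fin (TwistedComplex.len X)}
    (hX : ∀ j, j ≠ l → TwistedComplex.del X k j = 0)
    {n a : ℤ} (h : TwistedComplex.sh X k + 1 = n) (h' : a + TwistedComplex.sh X l = n)
    (h'' : 1 + TwistedComplex.sh X k - TwistedComplex.sh X l = a) :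
    C.pretr.d h (projMor X k)
      = -((-1 : K) ^ TwistedComplex.sh X k • C.pretr.comp h'
        (C.stalkMap _ _ _ (C.reindex h'' (TwistedComplex.del X k l))) (projMor X l)) := by
  funext i j
  have h₁ : (-1 : K) ^ (0 : ℤ) • C.d (show TwistedComplex.sh X k
      + 0 - TwistedComplex.sh X j + 1 = n + 0 - TwistedComplex.sh X j by omega)
      (projMor X k i j) = 0 := (congrArg _ (d_projMor_apply X k j i _)).trans (smul_zero _)
  refine (pretr_d_apply h (projMor X k) i j).trans ((congrArg₂ _ ((congrArg₂ _ h₁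
    (Finset.sum_eq_zero fun m _ => ?_)).trans
    (zero_add _)) (congrArg _ ?_)).trans ((zero_sub _).trans
      (congrArg (fun f => -((-1 : K) ^ TwistedComplex.sh X k • f))
        (stalkMap_comp_apply h' (C.reindex h'' (TwistedComplex.del X k l)) (projMor X l) i
          j).symm)))
  · exact LinearMap.map_zero₂ (C.comp (X := TwistedComplex.obj X j) (Y := TwistedComplex.obj X k)
      (Z := TwistedComplex.obj X k) (show 1 + 0 - 0 + (TwistedComplex.sh X k + 0
        - TwistedComplex.sh X j) = n + 0 - TwistedComplex.sh X j by omega)) (projMor X k m j)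
  · refine (Finset.sum_eq_single k (fun m _ hm => ?_)
      (fun hk => absurd (Finset.mem_univ k) hk)).trans ?_
    · exact (congrArg (fun g => C.comp _ g _) (projMor_ne X i hm)).trans (LinearMap.map_zero₂ _ _)
    · refine (congrArg (fun g => C.comp _ g _) (projMor_same X i)).trans ((reindex_id_comp _ _
        (show 1 + TwistedComplex.sh X k - TwistedComplex.sh X j = n + 0 - TwistedComplex.sh X j
          by omega) _).trans ?_)
      by_cases hj : j = l
      · subst hj
        exact (((congrArg (C.comp _ (C.reindex h'' (TwistedComplex.del X k j)))
          (projMor_same X 0)).trans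
          (comp_reindex_id _ _ (show a = n + 0 - TwistedComplex.sh X j by omega) _)).trans
            (C.reindex_reindex _ _ _)).symm
      · exact ((congrArg _ (hX j hj)).trans (map_zero _)).trans
          ((congrArg _ (projMor_ne X 0 hj)).trans (map_zero _)).symm

end DGCat

end PinchedDG

/-! ### The band object as a cone in 𝒜 -/

namespace PinchedDG

namespace DGCat

variable {K : Type w} [Field K]

/-- Transport of a strip along an isomorphism of graded categories. -/
def RightStrip.transfer {C : DGCat.{w, u, v} K} {D : DGCat.{w, u', v'} K} {o : C.Obj → D.Obj}
    (e : ∀ {X Y : C.Obj} {n : ℤ}, C.Hom X Y n ≃ₗ[K] D.Hom (o X) (o Y) n)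
    (he : ∀ {X Y Z : C.Obj} {p q r : ℤ} (h : p + q = r) (g : C.Hom Y Z p) (f : C.Hom X Y q),
      e (C.comp h g f) = D.comp h (e g) (e f))
    {X₁ X₂ Y : C.Obj} {a q : ℤ} {ω : C.Hom X₁ X₂ a} {gen : C.Hom X₁ Y q}
    (R : C.RightStrip ω gen) {gen' : D.Hom (o X₁) (o Y) q} (hgen : e gen = gen') :
    D.RightStrip (e ω) gen' where
  sec h := e.toLinearMap.comp ((R.sec h).comp e.symm.toLinearMap)
  coeff := R.coeff.comp e.symm.toLinearMap
  sec_comp h f := by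
    obtain ⟨f, rfl⟩ := e.surjective f
    simp [← he, R.sec_comp]
  coeff_comp h f := by
    obtain ⟨f, rfl⟩ := e.surjective f
    simp [← he, R.coeff_comp]
  coeff_gen := R.coeff_gen.imp (fun h => by rw [← hgen, h, map_zero])
    (fun h => by simpa [← hgen] using h)
  eq_of_ne h f hn := by
    obtain ⟨f, rfl⟩ := e.surjective f
    simp [← he, ← R.eq_of_ne h f hn]
  eq_add h f := by
    obtain ⟨f, rfl⟩ := e.surjective f
    simp only [LinearMap.comp_apply, LinearEquiv.coe_coe, LinearEquiv.symm_apply_apply]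
    rw [← hgen, ← he, ← map_smul, ← map_add, ← R.eq_add h f]

theorem RightStrip.coeff_transfer {C : DGCat.{w, u, v} K} {D : DGCat.{w, u', v'} K}
    {o : C.Obj → D.Obj} (e : ∀ {X Y : C.Obj} {n : ℤ}, C.Hom X Y n ≃ₗ[K] D.Hom (o X) (o Y) n)
    (he : ∀ {X Y Z : C.Obj} {p q r : ℤ} (h : p + q = r) (g : C.Hom Y Z p) (f : C.Hom X Y q),
      e (C.comp h g f) = D.comp h (e g) (e f))
    {X₁ X₂ Y : C.Obj} {a q : ℤ} {ω : C.Hom X₁ X₂ a} {gen : C.Hom X₁ Y q}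
    (R : C.RightStrip ω gen) {gen' : D.Hom (o X₁) (o Y) q} (hgen : e gen = gen') :
    (R.transfer e he hgen).coeff gen' = R.coeff gen := by
  simp [transfer, ← hgen]

/-- Transport of a strip along an isomorphism of graded categories. -/
def LeftStrip.transfer {C : DGCat.{w, u, v} K} {D : DGCat.{w, u', v'} K} {o : C.Obj → D.Obj}
    (e : ∀ {X Y : C.Obj} {n : ℤ}, C.Hom X Y n ≃ₗ[K] D.Hom (o X) (o Y) n)
    (he : ∀ {X Y Z : C.Obj} {p q r : ℤ} (h : p + q = r) (g : C.Hom Y Z p) (f : C.Hom X Y q),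
      e (C.comp h g f) = D.comp h (e g) (e f))
    {X₁ X₂ X : C.Obj} {a : ℤ} {ω : C.Hom X₁ X₂ a} (L : C.LeftStrip ω X) :
    D.LeftStrip (e ω) (o X) where
  sec h := e.toLinearMap.comp ((L.sec h).comp e.symm.toLinearMap)
  sec_comp h f := by
    obtain ⟨f, rfl⟩ := e.surjective f
    simp [← he, L.sec_comp]

end DGCat

namespace PinchedGentle.IsKronecker

variable {Λ : PinchedGentle.{u}} {K : Type w} [Field K] {α β : Λ.E} (hK : Λ.IsKronecker α β)
  (μ : K) (s : ℤ)

/-- A projective, as an object of `𝒜`. -/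
def projA (x : (Λ.catP K).Obj) : (hK.catA μ s).Obj := some x

/-- The band object, as an object of `𝒜`. -/
def bandA : (hK.catA μ s).Obj := none

/-- The embedding of `𝒫(Λ)` in `𝒜`. -/
def stalkA {x y : (Λ.catP K).Obj} {n : ℤ} : (Λ.catP K).Hom x y n ≃ₗ[K]
    (hK.catA μ s).Hom (hK.projA μ s x) (hK.projA μ s y) n :=
  LinearEquiv.ofBijective ((Λ.catP K).stalkMap x y n)
    ⟨DGCat.stalkMap_injective x y n, DGCat.stalkMap_surjective x y n⟩

theorem stalkA_comp {x y z : (Λ.catP K).Obj} {p q r : ℤ} (h : p + q = r)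
    (g : (Λ.catP K).Hom y z p) (f : (Λ.catP K).Hom x y q) :
    hK.stalkA μ s ((Λ.catP K).comp h g f)
      = (hK.catA μ s).comp h (hK.stalkA μ s g) (hK.stalkA μ s f) := DGCat.stalkMap_comp h g f

theorem stalkA_id (x : (Λ.catP K).Obj) :
    hK.stalkA μ s ((Λ.catP K).id x) = (hK.catA μ s).id (hK.projA μ s x) := DGCat.stalkMap_id x

/-- Morphisms between projectives come from 𝒫(Λ), which has zero differential. -/
theorem noDiff (x y : (Λ.catP K).Obj) :
    (hK.catA μ s).NoDiff (hK.projA μ s x) (hK.projA μ s y) := by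
  intro n m h f
  obtain ⟨f, rfl⟩ := (hK.stalkA μ s).surjective f
  refine (DGCat.d_stalkMap h f).trans ?_
  exact map_zero (hK.stalkA μ s)

theorem reindex_omega {n m : ℤ} (hn : Λ.deg α = n) (h : n = m) :
    (Λ.catP K).reindex h (hK.omega μ hn) = hK.omega μ (hn.trans h) := by
  subst h
  exact DGCat.reindex_rfl _ _ _

theorem bandEntry_one (i : Fin 2) (h : i ≠ 0) : hK.bandEntry μ s i 1 = 0 :=
  hK.bandEntry_eq_zero μ s i 1 (by omega)

theorem bandEntry_zero (j : Fin 2) (h : j ≠ 1) : hK.bandEntry μ s 0 j = 0 :=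
  hK.bandEntry_eq_zero μ s 0 j (by omega)

/-- The band object, as an object of the category of twisted complexes. -/
def bandP : (Λ.catP K).pretr.Obj := hK.band μ s

theorem bandP_id : (Λ.catP K).pretr.id (hK.bandP μ s)
    = (Λ.catP K).pretr.comp (neg_add_cancel (1 + s)) (DGCat.inclMor (hK.bandP μ s) (1 : Fin 2))
        (DGCat.projMor (hK.bandP μ s) (1 : Fin 2))
      + (Λ.catP K).pretr.comp (neg_add_cancel (Λ.deg α + s))
        (DGCat.inclMor (hK.bandP μ s) (0 : Fin 2)) (DGCat.projMor (hK.bandP μ s) (0 : Fin 2)) :=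
  (DGCat.pretr_id_eq_sum (hK.bandP μ s)).trans ((Fin.sum_univ_two _).trans (add_comm _ _))

/-- The inclusion of `P₁` in the band object. -/
def inclA₁ : (hK.catA μ s).Hom (hK.projA μ s (catObj K (Λ.src α))) (hK.bandA μ s) (-(1 + s)) :=
  DGCat.inclMor (hK.bandP μ s) (1 : Fin 2)

/-- The inclusion of `P₂` in the band object. -/
def inclA₂ : (hK.catA μ s).Hom (hK.projA μ s (catObj K (Λ.tgt α))) (hK.bandA μ s)
    (-(Λ.deg α + s)) :=
  DGCat.inclMor (hK.bandP μ s) (0 : Fin 2)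

/-- The projection of the band object to `P₁`. -/
def projA₁ : (hK.catA μ s).Hom (hK.bandA μ s) (hK.projA μ s (catObj K (Λ.src α))) (1 + s) :=
  DGCat.projMor (hK.bandP μ s) (1 : Fin 2)

/-- The projection of the band object to `P₂`. -/
def projA₂ : (hK.catA μ s).Hom (hK.bandA μ s) (hK.projA μ s (catObj K (Λ.tgt α)))
    (Λ.deg α + s) :=
  DGCat.projMor (hK.bandP μ s) (0 : Fin 2)

theorem d_inclA₁ {n : ℤ} (h : -(1 + s) + 1 = n) (h' : -(Λ.deg α + s) + Λ.deg α = n) :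
    (hK.catA μ s).d h (hK.inclA₁ μ s)
      = (hK.catA μ s).comp h' (hK.inclA₂ μ s) (hK.stalkA μ s (hK.omegaP μ)) :=
  (DGCat.d_inclMor (X := hK.bandP μ s) (k := (1 : Fin 2)) (l := (0 : Fin 2))
    (hK.bandEntry_one μ s) h h' (show 1 + (Λ.deg α + s) - (1 + s) = Λ.deg α by ring)).trans
      (congrArg (fun f => (hK.catA μ s).comp h' (hK.inclA₂ μ s) (hK.stalkA μ s f))
        (hK.reindex_omega μ _ _))

theorem d_inclA₂ {n : ℤ} (h : -(Λ.deg α + s) + 1 = n) :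
    (hK.catA μ s).d h (hK.inclA₂ μ s) = 0 :=
  -- The whole column of P₂ in ∂ vanishes, so any row can play the role of `l`; the diagonal one is
  -- taken.
  (DGCat.d_inclMor (X := hK.bandP μ s) (k := (0 : Fin 2)) (l := (0 : Fin 2))
    (fun (i : Fin 2) _ => hK.bandEntry_eq_zero μ s i 0 (Fin.zero_le i)) h
      (show -(Λ.deg α + s) + 1 = n from h)
      (show 1 + (Λ.deg α + s) - (Λ.deg α + s) = 1 by ring)).trans ((congrArg (fun f =>
        (hK.catA μ s).comp h (hK.inclA₂ μ s) (hK.stalkA μ s f))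
          (map_zero ((Λ.catP K).reindex _))).trans (by rw [map_zero, map_zero]; rfl))

theorem d_projA₁ {n : ℤ} (h : 1 + s + 1 = n) : (hK.catA μ s).d h (hK.projA₁ μ s) = 0 :=
  (DGCat.d_projMor (X := hK.bandP μ s) (k := (1 : Fin 2)) (l := (1 : Fin 2))
    (fun (i : Fin 2) _ => hK.bandEntry_eq_zero μ s 1 i (by omega)) h
      (show 1 + (1 + s) = n by omega)
      (show 1 + (1 + s) - (1 + s) = 1 by ring)).trans ((congrArg (fun f =>
        -((-1 : K) ^ (1 + s) • (hK.catA μ s).comp (show 1 + (1 + s) = n by omega)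
          (hK.stalkA μ s f) (hK.projA₁ μ s)))
          (map_zero ((Λ.catP K).reindex _))).trans
            (by rw [map_zero, map_zero, LinearMap.zero_apply, smul_zero, neg_zero]; rfl))

theorem d_projA₂ {n : ℤ} (h : Λ.deg α + s + 1 = n) (h' : Λ.deg α + (1 + s) = n) :
    (hK.catA μ s).d h (hK.projA₂ μ s) = -((-1 : K) ^ (Λ.deg α + s) •
      (hK.catA μ s).comp h' (hK.stalkA μ s (hK.omegaP μ)) (hK.projA₁ μ s)) :=
  (DGCat.d_projMor (X := hK.bandP μ s) (k := (0 : Fin 2)) (l := (1 : Fin 2))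
    (hK.bandEntry_zero μ s) h h' (show 1 + (Λ.deg α + s) - (1 + s) = Λ.deg α by ring)).trans
      (congrArg (fun f => -((-1 : K) ^ (Λ.deg α + s) • (hK.catA μ s).comp h'
        (hK.stalkA μ s f) (hK.projA₁ μ s))) (hK.reindex_omega μ _ _))

/-- The band object is a shifted cone of `ω`. -/
def bandCone : (hK.catA μ s).Cone (hK.stalkA μ s (hK.omegaP μ)) (hK.bandA μ s) (1 + s)
    (Λ.deg α + s) where
  shift := by ring
  i₁ := hK.inclA₁ μ s
  i₂ := hK.inclA₂ μ s
  p₁ := hK.projA₁ μ s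
  p₂ := hK.projA₂ μ s
  p₁_i₁ h h' := DGCat.projMor_comp_inclMor_same (hK.bandP μ s) (1 : Fin 2) h h'
  p₂_i₂ h h' := DGCat.projMor_comp_inclMor_same (hK.bandP μ s) (0 : Fin 2) h h'
  p₁_i₂ h := DGCat.projMor_comp_inclMor_ne (hK.bandP μ s) (show (1 : Fin 2) ≠ 0 by decide) h
  p₂_i₁ h := DGCat.projMor_comp_inclMor_ne (hK.bandP μ s) (show (0 : Fin 2) ≠ 1 by decide) h
  id_eq := hK.bandP_id μ s
  d_i₁ := hK.d_inclA₁ μ s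
  d_i₂ := hK.d_inclA₂ μ s
  d_p₁ := hK.d_projA₁ μ s
  d_p₂ := hK.d_projA₂ μ s

/-- The right strip at any vertex, in `𝒜`. -/
theorem exists_rightStrip {μ : K} (hμ : μ ≠ 0) (y : Λ.V) :
    ∃ (q : ℤ) (gen : (Λ.catP K).Hom (catObj K (Λ.src α)) (catObj K y) q),
      Nonempty ((hK.catA μ s).RightStrip (hK.stalkA μ s (hK.omegaP μ)) (hK.stalkA μ s gen)) := by
  by_cases h₁ : Λ.src α = y
  · subst h₁
    exact ⟨_, _, ⟨(hK.rightStripSrc hμ).transfer (hK.stalkA μ s) (hK.stalkA_comp μ s) rfl⟩⟩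
  · by_cases h₂ : Λ.tgt α = y
    · subst h₂
      exact ⟨_, _, ⟨(hK.rightStripTgt hμ).transfer (hK.stalkA μ s) (hK.stalkA_comp μ s) rfl⟩⟩
    · exact ⟨_, _, ⟨(hK.rightStripOther hμ h₁ h₂).transfer (hK.stalkA μ s)
        (hK.stalkA_comp μ s) rfl⟩⟩

/-- The closed morphisms of `𝒜/ℬ` between projectives, up to exact ones. -/
theorem exists_eq_of_closed {μ : K} (hμ : μ ≠ 0) (x y : Λ.V)
    (A : ∀ n, Submodule K (DGCat.QuotHom (hK.catA μ s) {hK.bandA μ s} (hK.projA μ s (catObj K x))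
      (hK.projA μ s (catObj K (Λ.tgt α))) n))
    (hA : ∀ n (f : (Λ.catP K).Hom (catObj K x) (catObj K (Λ.tgt α)) n),
      DGCat.QuotHom.of {hK.bandA μ s} (hK.stalkA μ s f) ∈ A n)
    (hβ : ∀ {n m : ℤ} (h : -Λ.deg α + n = m) (h' : Λ.deg α + m = n), ∀ z ∈ A n,
      DGCat.QuotHom.comp h' (DGCat.QuotHom.of _ (hK.stalkA μ s (hK.betaP K)))
        (DGCat.QuotHom.comp h (hK.bandCone μ s).delta z) ∈ A n) {n n' l : ℤ} (hn : n + 1 = n')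
    (hl : l + 1 = n) (f : DGCat.QuotHom (hK.catA μ s) {hK.bandA μ s} (hK.projA μ s (catObj K x))
      (hK.projA μ s (catObj K y)) n) (hf : DGCat.QuotHom.d hn f = 0) :
    ∃ (g : DGCat.QuotHom (hK.catA μ s) {hK.bandA μ s} (hK.projA μ s (catObj K x))
        (hK.projA μ s (catObj K y)) l) (b : (Λ.catP K).Hom (catObj K x) (catObj K y) n)
      (k q m : ℤ) (hq : k + q = n) (hm : -Λ.deg α + m = q)
      (gen : (Λ.catP K).Hom (catObj K (Λ.src α)) (catObj K y) k), ∃ z ∈ A m,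
      f = DGCat.QuotHom.d hl g + DGCat.QuotHom.of _ (hK.stalkA μ s b)
        + DGCat.QuotHom.comp hq (DGCat.QuotHom.of _ (hK.stalkA μ s gen))
          (DGCat.QuotHom.comp hm (hK.bandCone μ s).delta z) := by
  obtain ⟨k, gen, ⟨R⟩⟩ := hK.exists_rightStrip s hμ y
  have hA' : ∀ n (f : (hK.catA μ s).Hom (hK.projA μ s (catObj K x))
      (hK.projA μ s (catObj K (Λ.tgt α))) n), DGCat.QuotHom.of {hK.bandA μ s} f ∈ A n := by
    intro n f
    obtain ⟨f, rfl⟩ := (hK.stalkA μ s).surjective f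
    exact hA n f
  obtain ⟨g, b, z, hz, h⟩ := (hK.bandCone μ s).exists_eq_of_closed
    ((hK.rightStripSrc hμ).transfer (hK.stalkA μ s) (hK.stalkA_comp μ s) (hK.stalkA_id μ s _))
    ((hK.rightStripTgt hμ).transfer (hK.stalkA μ s) (hK.stalkA_comp μ s) rfl)
    ((DGCat.RightStrip.coeff_transfer _ _ _ _).trans (hK.rightCoeff₁_id hμ))
    ((DGCat.RightStrip.coeff_transfer _ _ _ _).trans (hK.rightCoeff₂_β hμ))
    ((hK.leftStrip hμ x).transfer (hK.stalkA μ s) (hK.stalkA_comp μ s)) R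
    (hK.noDiff μ s _ _) (hK.noDiff μ s _ _) (hK.noDiff μ s _ _) (hK.noDiff μ s _ _)
    (hK.noDiff μ s _ _) (hK.noDiff μ s _ _) (hK.noDiff μ s _ _) (hK.noDiff μ s _ _)
    -- The degrees are forced by gen having degree k and δ having degree -|α|.
    A hA' hβ (m := n - k + Λ.deg α) (q := n - k) hn hl (by ring) (by ring) f hf
  obtain ⟨b, rfl⟩ := (hK.stalkA μ s).surjective b
  exact ⟨g, b, _, _, _, _, _, gen, z, hz, h⟩

end PinchedGentle.IsKronecker

end PinchedDG

/-! ### Contractions of cones, and generators of the Drinfeld quotient -/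

namespace PinchedDG

open Quiver

namespace DGCat

variable {K : Type w} [Field K]

namespace Cone

variable {C : DGCat.{w, u, v} K} {P₁ P₂ B : C.Obj} {a c₁ c₂ : ℤ} {ω : C.Hom P₁ P₂ a}
  (T : C.Cone ω B c₁ c₂)

/-- The image of a cone under a DG functor. -/
def map {D : DGCat.{w, u', v} K} {o : C.Obj → D.Obj} (F : DGFunctor C D o) :
    D.Cone (F.map ω) (o B) c₁ c₂ where
  shift := T.shift
  i₁ := F.map T.i₁
  i₂ := F.map T.i₂
  p₁ := F.map T.p₁
  p₂ := F.map T.p₂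
  p₁_i₁ h h' := by rw [← F.map_comp, T.p₁_i₁ h h', F.map_reindex, F.map_id]
  p₂_i₂ h h' := by rw [← F.map_comp, T.p₂_i₂ h h', F.map_reindex, F.map_id]
  p₁_i₂ h := by rw [← F.map_comp, T.p₁_i₂ h, map_zero]
  p₂_i₁ h := by rw [← F.map_comp, T.p₂_i₁ h, map_zero]
  id_eq := by rw [← F.map_id, T.id_eq, map_add, F.map_comp, F.map_comp]
  d_i₁ h h' := by rw [← F.map_comp, ← F.map_d, T.d_i₁ h h']
  d_i₂ h := by rw [← F.map_d, T.d_i₂ h, map_zero]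
  d_p₁ h := by rw [← F.map_d, T.d_p₁ h, map_zero]
  d_p₂ h h' := by rw [← F.map_d, T.d_p₂ h h', map_neg, map_smul, F.map_comp]

/-- The contraction of a cone of `ω` given by an inverse of `ω`. -/
def contraction (δ : C.Hom P₂ P₁ (-a)) : C.Hom B B (-1) :=
  C.comp (show -c₁ + (-a + c₂) = -1 by have := T.shift; omega) T.i₁ (C.comp rfl δ T.p₂)

/-- In i₁ δ p₂ the differential of i₁ gives i₂ ω δ p₂ = i₂ p₂ and that of p₂ gives i₁ δ ω p₁ = i₁
p₁, both with sign +. -/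
theorem d_contraction (δ : C.Hom P₂ P₁ (-a)) (hδ : C.d rfl δ = 0)
    (h₁ : C.comp (neg_add_cancel a) δ ω = C.id P₁)
    (h₂ : C.comp (add_neg_cancel a) ω δ = C.id P₂) (h : (-1 : ℤ) + 1 = 0) :
    C.d h (T.contraction δ) = C.id B := by
  have hs := T.shift
  rw [contraction, C.leibniz (p' := -c₂ + a) (q' := c₁) _ h (by omega) (by omega) (by omega)
    (by omega), T.d_i₁ _ rfl, T.d_comp_p₂ _ _ rfl (by omega) (neg_add_cancel a) (by omega), hδ,
    map_zero, LinearMap.zero_apply, zero_sub, h₁, map_neg, map_smul, T.id_eq]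
  rw [← C.assoc (qr := c₂) (by omega) (by omega) _ _ T.i₂ ω,
    C.assoc (pq := 0) rfl (by omega) (by omega) (by omega) ω δ T.p₂, h₂]
  rw [C.id_comp (zero_add c₂), C.id_comp (zero_add c₁), smul_neg, smul_smul, ← zpow_add₀ (by simp),
    show -c₁ + (-a + c₂) = -1 by omega, zpow_neg_one, inv_neg, inv_one, neg_smul, one_smul,
    neg_neg, add_comm]

/-- Closure properties that force a family of subspaces to contain all morphisms of the Drinfeld
quotient between objects other than the cone. -/
theorem mem_of_generators {O : Type*} (ι : O → C.Obj) {x₁ x₂ : O} {ω : C.Hom (ι x₁) (ι x₂) a}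
    (T : C.Cone ω B c₁ c₂) (hι : ∀ X, X = B ∨ ∃ x, ι x = X)
    (A : ∀ x y n, Submodule K (QuotHom C {B} (ι x) (ι y) n))
    (h_of : ∀ {x y n} (f : C.Hom (ι x) (ι y) n), QuotHom.of {B} f ∈ A x y n)
    (h_comp : ∀ {x y z p q r} (h : p + q = r), ∀ g ∈ A y z p, ∀ f ∈ A x y q,
      QuotHom.comp h g f ∈ A x z r)
    (h₁₁ : ∀ {n} (h : c₁ + (-1 + -c₁) = n), QuotHom.sandwich h T.p₁ T.i₁ ∈ A x₁ x₁ n)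
    (h₁₂ : ∀ {n} (h : c₁ + (-1 + -c₂) = n), QuotHom.sandwich h T.p₁ T.i₂ ∈ A x₂ x₁ n)
    (h₂₁ : ∀ {n} (h : c₂ + (-1 + -c₁) = n), QuotHom.sandwich h T.p₂ T.i₁ ∈ A x₁ x₂ n)
    (h₂₂ : ∀ {n} (h : c₂ + (-1 + -c₂) = n), QuotHom.sandwich h T.p₂ T.i₂ ∈ A x₂ x₂ n)
    {x y : O} {n : ℤ} (f : QuotHom C {B} (ι x) (ι y) n) : f ∈ A x y n := by
  -- Subexpressions may start or end at B, so the induction runs over expressions closed off by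
  -- morphisms of C to and from objects of the family.
  have key : ∀ {X Y : C.Obj} {n : ℤ} (f : QuotExpr C {B} X Y n) {x y : O} {p q r m : ℤ}
      (b : C.Hom Y (ι y) p) (c : C.Hom (ι x) X q) (h : n + q = r) (h' : p + r = m),
      QuotHom.comp h' (QuotHom.of {B} b) (QuotHom.comp h (QuotHom.mk f) (QuotHom.of {B} c))
        ∈ A x y m := by
    intro X Y n f
    induction f with
    | of f =>
      intro x y p q r m b c h h'
      rw [QuotHom.mk_of, ← QuotHom.of_comp, ← QuotHom.of_comp]
      exact h_of _
    | @eps U n hU hn =>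
      intro x y p q r m b c h h'
      obtain rfl : U = B := hU
      subst hn
      subst h
      subst h'
      have hg : ∀ {u v p₁ q₁ n : ℤ} {x' y' : O} (b₁ : C.Hom U (ι y') p₁) (c₁ : C.Hom (ι x') U q₁)
          (b' : C.Hom (ι y') (ι y) u) (c' : C.Hom (ι x) (ι x') v) (hp : u + p₁ = p)
          (hq : q₁ + v = q) (hn : p₁ + (-1 + q₁) = n)
          (_ : QuotHom.sandwich hn b₁ c₁ ∈ A x' y' n),
          QuotHom.sandwich rfl (C.comp hp b' b₁) (C.comp hq c₁ c') ∈ A x y (p + (-1 + q)) := by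
        intro u v p₁ q₁ n x' y' b₁ c₁ b' c' hp hq hn hA
        rw [← QuotHom.comp_sandwich (n := p₁ + (-1 + q)) rfl (by omega) hp rfl,
          ← QuotHom.sandwich_comp hn (by omega) hq rfl]
        exact h_comp _ _ (h_of _) _ (h_comp _ _ hA _ (h_of _))
      have he : QuotHom.comp rfl (QuotHom.of {U} b) (QuotHom.comp rfl
          (QuotHom.mk (.eps (Set.mem_singleton U) rfl)) (QuotHom.of {U} c))
            = QuotHom.sandwich rfl b c := rfl
      rw [he, T.eq_in rfl rfl c, T.eq_out rfl rfl b]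
      simp only [QuotHom.sandwich, map_add, LinearMap.add_apply]
      -- The four terms are the composites p_k ε i_l, multiplied by morphisms of C between objects
      -- of the family.
      refine add_mem (add_mem ?_ ?_) (add_mem ?_ ?_)
      · exact hg T.p₁ T.i₁ _ _ _ _ rfl (h₁₁ _)
      · exact hg T.p₂ T.i₁ _ _ _ _ rfl (h₂₁ _)
      · exact hg T.p₁ T.i₂ _ _ _ _ rfl (h₁₂ _)
      · exact hg T.p₂ T.i₂ _ _ _ _ rfl (h₂₂ _)
    | @comp X Y Z k l n hkl g f ihg ihf =>
      intro x y p q r m b c h h'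
      rw [QuotHom.mk_comp]
      -- Inserting a composite Y → ι w → Y between g and f cuts the word into two to which the
      -- induction hypotheses apply.
      have hsplit : ∀ {t t' : ℤ} {w : O} (b' : C.Hom (ι w) Y t) (c' : C.Hom Y (ι w) t')
          (ht : t + t' = 0),
          QuotHom.comp h' (QuotHom.of {B} b) (QuotHom.comp h (QuotHom.comp hkl (QuotHom.mk g)
            (QuotHom.comp (zero_add l) (QuotHom.of {B} (C.comp ht b' c')) (QuotHom.mk f)))
              (QuotHom.of {B} c)) ∈ A x y m := by
        intro t t' w b' c' ht
        rw [QuotHom.of_comp ht,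
          ← QuotHom.assoc (p := t) (q := t') (r := l) (qr := t' + l) rfl (by omega) ht,
          ← QuotHom.assoc (p := k) (q := l) (r := q) (qr := l + q) rfl (by omega) hkl h,
          ← QuotHom.assoc (p := t) (q := t' + l) (r := q) (pq := l) (qr := t' + l + q) rfl
            (by omega) (by omega) rfl,
          QuotHom.assoc (p := k) (q := t) (r := t' + l + q) (qr := l + q) (pq := k + t)
            (by omega) _ rfl (by omega),
          QuotHom.assoc (p := p) (q := k + t) (r := t' + l + q) (pq := p + (k + t)) _ _ rfl
            (by omega)]
        refine h_comp _ _ (ihg _ _ _ _) _ ?_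
        rw [← QuotHom.assoc (q := l) (r := q) (qr := l + q) (pq := t' + l) rfl (by omega) rfl rfl]
        exact ihf _ _ _ _
      -- At B the identity is i₁ p₁ + i₂ p₂; at an object of the family it factors through itself.
      rcases hι Y with rfl | ⟨y', rfl⟩
      · have := add_mem (hsplit T.i₁ T.p₁ (neg_add_cancel c₁))
          (hsplit T.i₂ T.p₂ (neg_add_cancel c₂))
        simp only [← map_add, ← LinearMap.add_apply] at this
        rwa [← T.id_eq, QuotHom.id_comp] at this
      · have := hsplit (C.id _) (C.id _) (add_zero 0)
        rwa [C.id_comp, QuotHom.id_comp] at this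
    | add f g ihf ihg =>
      intro x y p q r m b c h h'
      rw [QuotHom.mk_add, map_add, LinearMap.add_apply, map_add]
      exact add_mem (ihf b c h h') (ihg b c h h')
    | smul t f ih =>
      intro x y p q r m b c h h'
      rw [QuotHom.mk_smul, map_smul, LinearMap.smul_apply, map_smul]
      exact Submodule.smul_mem _ _ (ih b c h h')
  induction f using QuotHom.ind with
  | h f =>
    have := key f (C.id (ι y)) (C.id (ι x)) (add_zero n) (zero_add n)
    rwa [QuotHom.comp_id, QuotHom.id_comp] at this

end Cone

end DGCat

end PinchedDG

/-! ### The localization Λ[ω⁻¹] and the localization functor -/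

namespace PinchedDG

open Quiver

namespace GradedQuiver

variable {K : Type w} [Field K] (Q : GradedQuiver.{u}) (D : DGCat.{w, u', v'} K) (o : Q.V → D.Obj)
  (f : ∀ {x y : Q.V} (e : Q.Arrow x y), D.Hom (o x) (o y) (Q.deg e.1))

/-- The common shape of the relations δω - e_1 and ωδ - e_2. They are homogeneous of degree 0, so in
other degrees the evaluation vanishes term by term. -/
theorem evalDeg_inverse {x y : Q.V} (a a' : Q.Arrow x y) (b b' : Q.Arrow y x)
    (h : Q.deg b.1 + Q.deg a.1 = 0) (h' : Q.deg b'.1 + Q.deg a'.1 = 0) (μ : K)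
    (H : D.comp h (f b) (f a) + μ • D.comp h' (f b') (f a') = D.id (o x)) (n : ℤ) :
    Q.evalDeg D o f n (Finsupp.single ((Hom.toPath a).comp (Hom.toPath b)) 1
        + μ • Finsupp.single ((Hom.toPath a').comp (Hom.toPath b')) 1
        - Finsupp.single Path.nil 1) = 0 := by
  have h₀ : Q.pathDeg (Path.nil : Path x x) = 0 := rfl
  rw [map_sub, map_add, map_smul]
  by_cases hn : 0 = n
  · subst hn
    rw [Q.evalDeg_toPath_comp D o f a b h, Q.evalDeg_toPath_comp D o f a' b' h',
      Q.evalDeg_single D o f Path.nil h₀, one_smul, one_smul, one_smul, H]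
    exact sub_eq_zero.2 (D.reindex_rfl _ _).symm
  · rw [Q.evalDeg_toPath_comp_ne D o f a b (by omega),
      Q.evalDeg_toPath_comp_ne D o f a' b' (by omega),
      Q.evalDeg_single_ne D o f Path.nil (by omega), smul_zero, add_zero, sub_zero]

end GradedQuiver

namespace PinchedGentle

variable {Λ : PinchedGentle.{u}} {K : Type w} [Field K] {α β : Λ.E}

section eval

variable (D : DGCat.{w, u', v'} K) (o : Λ.V → D.Obj)
  (f : ∀ {x y : Λ.V} (e : Λ.Arrow x y), D.Hom (o x) (o y) (Λ.deg e.1))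
  (δ : D.Hom (o (Λ.tgt α)) (o (Λ.src α)) (-Λ.deg α))

/-- A map on vertices, as a map on the vertices of the enlarged quiver. -/
def locVertex {D : DGCat.{w, u', v'} K} (α : Λ.E) (o : Λ.V → D.Obj) : (Λ.locQuiver α).V → D.Obj := o

/-- The image of `δ`, with transported source and target. -/
def locFunδ {x y : Λ.V} (hx : Λ.tgt α = x) (hy : Λ.src α = y) :
    D.Hom (o x) (o y) (-Λ.deg α) := by
  subst hx
  subst hy
  exact δ

/-- An assignment of morphisms to arrows, extended to the enlarged quiver. -/
def locFun : ∀ {x y : (Λ.locQuiver α).V} (e : (Λ.locQuiver α).Arrow x y),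
    D.Hom (locVertex α o x) (locVertex α o y) ((Λ.locQuiver α).deg e.1)
  | _, _, ⟨some e, h⟩ => f ⟨e, h⟩
  | _, _, ⟨none, h⟩ => locFunδ D o δ h.1 h.2

theorem pathDeg_mapPath {x y : Λ.V} (p : Path x y) :
    (Λ.locQuiver α).pathDeg ((Λ.locIncl α).mapPath p) = Λ.pathDeg p := by
  induction p with
  | nil => rfl
  | cons p e ih => exact congrArg (· + Λ.deg e.1) ih

theorem evalPath_mapPath {x y : Λ.V} (p : Path x y) {n : ℤ} (h : Λ.pathDeg p = n)
    (h' : (Λ.locQuiver α).pathDeg ((Λ.locIncl α).mapPath p) = n) :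
    D.reindex h' ((Λ.locQuiver α).evalPath D (locVertex α o) (locFun D o f δ)
      ((Λ.locIncl α).mapPath p)) = D.reindex h (Λ.evalPath D o f p) := by
  subst h
  induction p with
  | nil => rfl
  | cons p e ih =>
    have := ih (pathDeg_mapPath p)
    rw [D.reindex_rfl] at this ⊢
    refine (D.reindex_comp _ _ _ _).trans ?_
    refine Eq.trans ?_ (congrArg (D.comp (add_comm _ _) (f e)) this)
    exact (D.comp_reindex_right _ _ _ _).symm

/-- The extended assignment agrees with the given one on the arrows of Q. Hence the relations
inherited from Λ need not be checked again. -/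
theorem evalDeg_mapPath {x y : Λ.V} (r : Λ.FreeHom K x y) (n : ℤ) :
    (Λ.locQuiver α).evalDeg D (locVertex α o) (locFun D o f δ) n
      (Finsupp.mapDomain (Λ.locIncl α).mapPath r) = Λ.evalDeg D o f n r := by
  induction r using Finsupp.induction_linear with
  | zero => rw [Finsupp.mapDomain_zero, map_zero, map_zero]; rfl
  | add r s hr hs =>
    rw [Finsupp.mapDomain_add, map_add, map_add, hr, hs]
    rfl
  | single p c =>
    rw [Finsupp.mapDomain_single]
    by_cases h : Λ.pathDeg p = n
    · have h' := (pathDeg_mapPath (α := α) p).trans h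
      refine ((Λ.locQuiver α).evalDeg_single D _ _ _ h' c).trans ?_
      rw [Λ.evalDeg_single D o f p h]
      exact congrArg (c • ·) (evalPath_mapPath D o f δ p h h')
    · rw [Λ.evalDeg_single_ne D o f p h]
      refine ((Λ.locQuiver α).evalDeg_single_ne D _ _ _ ?_ c).trans rfl
      rwa [pathDeg_mapPath]

/-- To give a graded functor on `𝒫(Λ[ω⁻¹])`, it suffices to check the following relations. -/
theorem evalDeg_loc_eq_zero (hK : Λ.IsKronecker α β) (μ : K)
    (hf : ∀ x y, ∀ r ∈ Λ.relations K x y, ∀ n, Λ.evalDeg D o f n r = 0)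
    (h_left : D.comp (neg_add_cancel _) δ (f ⟨α, rfl, rfl⟩)
      + μ • D.comp (show -Λ.deg α + Λ.deg β = 0 by rw [hK.deg_eq, neg_add_cancel]) δ
        (f ⟨β, hK.src_eq, hK.tgt_eq⟩) = D.id _)
    (h_right : D.comp (add_neg_cancel _) (f ⟨α, rfl, rfl⟩) δ
      + μ • D.comp (show Λ.deg β + -Λ.deg α = 0 by rw [hK.deg_eq, add_neg_cancel])
        (f ⟨β, hK.src_eq, hK.tgt_eq⟩) δ = D.id _) :
    ∀ x y, ∀ r ∈ hK.locRelations μ x y, ∀ n,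
      (Λ.locQuiver α).evalDeg D (locVertex α o) (locFun D o f δ) n r = 0 := by
  rintro x y r hr n
  cases hr with
  | old r h => exact (evalDeg_mapPath D o f δ r n).trans (hf _ _ r h n)
  | left =>
    exact (Λ.locQuiver α).evalDeg_inverse D (locVertex α o) (locFun D o f δ) hK.locα hK.locβ
      (Λ.locδ α) (Λ.locδ α)
      (neg_add_cancel _) (show -Λ.deg α + Λ.deg β = 0 by rw [hK.deg_eq, neg_add_cancel]) μ
      h_left n
  | right =>
    exact (Λ.locQuiver α).evalDeg_inverse D (locVertex α o) (locFun D o f δ) (Λ.locδ α) (Λ.locδ α)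
      hK.locα hK.locβ (add_neg_cancel _)
      (show Λ.deg β + -Λ.deg α = 0 by rw [hK.deg_eq, add_neg_cancel]) μ
      h_right n

end eval

/-- The relations hold for the images of the arrows under a graded functor. -/
theorem evalDeg_functor {D : DGCat.{w, u', v'} K} {o : Λ.V → D.Obj}
    (G : GradedFunctor (Λ.catP K) D (Λ.projObj (Λ.relations K) o)) :
    ∀ x y, ∀ r ∈ Λ.relations K x y, ∀ n, Λ.evalDeg D o
      (fun {x y} e => G.onComponent x y _ (Λ.arrowHom _ e.1 e.2.1 e.2.2 rfl)) n r = 0 := by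
  have hcomp : ∀ {x y z : Λ.V} {p q r : ℤ} (h : p + q = r) (g : Λ.component (Λ.relations K) y z p)
      (f : Λ.component (Λ.relations K) x y q),
      D.comp h (G.onComponent y z p g) (G.onComponent x y q f)
        = G.onComponent x z r (Λ.compHom _ h g f) := fun h g f => (G.map_comp h g f).symm
  refine evalDeg_eq_zero D o _ (fun a b h => ?_) (fun c b hc hb => ?_) (fun a c hc ha => ?_)
  · rw [hcomp]
    refine (congrArg _ (Subtype.ext ?_)).trans (map_zero _)
    exact mul_arrowClass_of_rel a b h
  · rw [hcomp, ← map_smul]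
    exact congrArg _ (Subtype.ext (mul_arrowClass_pinched_out c b hc hb))
  · rw [hcomp, ← map_smul]
    exact congrArg _ (Subtype.ext (mul_arrowClass_pinched_in a c hc ha))

namespace IsKronecker

variable (hK : Λ.IsKronecker α β) (μ : K)

/-- The class in `𝒫(Λ[ω⁻¹])` of a linear combination of paths of `Q`. -/
def locClass (x y : Λ.V) : Λ.FreeHom K x y →ₗ[K]
    (Λ.locQuiver α).QuotAlg (hK.locRelations μ) ((Λ.locIncl α).obj x) ((Λ.locIncl α).obj y) :=
  (Submodule.mkQ _).comp (Finsupp.lmapDomain K K (Λ.locIncl α).mapPath)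

theorem locClass_single {x y : Λ.V} (p : Path x y) (c : K) :
    hK.locClass μ x y (Finsupp.single p c)
      = c • (Λ.locQuiver α).pathClass (hK.locRelations μ) ((Λ.locIncl α).mapPath p) := by
  rw [locClass, LinearMap.comp_apply, Finsupp.lmapDomain_apply, Finsupp.mapDomain_single,
    GradedQuiver.pathClass, ← map_smul, Finsupp.smul_single, smul_eq_mul, mul_one]

theorem locClass_relation {x y : Λ.V} {r : Λ.FreeHom K x y} (hr : Λ.IsRelation K x y r) :
    hK.locClass μ x y r = 0 :=
  (Submodule.Quotient.mk_eq_zero _).2 ((Λ.locQuiver α).mem_ideal _ (IsLocRelation.old r hr))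

/-- A vertex, as an object of `𝒫(Λ[ω⁻¹])`. -/
def locObj (x : Λ.V) : (hK.locCat μ).Obj := x

/-- An arrow of `Q`, as a morphism of `𝒫(Λ[ω⁻¹])`. -/
def locArrow {x y : Λ.V} (e : Λ.Arrow x y) :
    (hK.locCat μ).Hom (hK.locObj μ x) (hK.locObj μ y) (Λ.deg e.1) :=
  (Λ.locQuiver α).arrowHom (hK.locRelations μ) (some e.1) e.2.1 e.2.2 rfl

/-- The new arrow `δ`, as a morphism of `𝒫(Λ[ω⁻¹])`. -/
def locDelta : (hK.locCat μ).Hom (hK.locObj μ (Λ.tgt α)) (hK.locObj μ (Λ.src α)) (-Λ.deg α) :=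
  (Λ.locQuiver α).arrowHom (hK.locRelations μ) none rfl rfl rfl

/-- The relations of Λ are among those of the localization; reading each in the quotient gives the
identities to check. -/
theorem locArrow_relations : ∀ x y, ∀ r ∈ Λ.relations K x y, ∀ n,
    Λ.evalDeg (hK.locCat μ) (hK.locObj μ) (hK.locArrow μ) n r = 0 := by
  refine evalDeg_eq_zero _ _ _ (fun a b h => Subtype.ext ?_) (fun c b hc hb => Subtype.ext ?_)
    (fun a c hc ha => Subtype.ext ?_)
  · have := hK.locClass_relation μ (IsRelation.gentle a b h)
    rw [locClass_single, one_smul] at this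
    exact ((Λ.locQuiver α).mul_pathClass _ _ _).trans this
  · have := hK.locClass_relation μ (IsRelation.pinched_out c b hc hb)
    rw [map_sub, locClass_single, locClass_single, one_smul, sub_eq_zero] at this
    exact ((Λ.locQuiver α).mul_pathClass _ _ _).trans this
  · have := hK.locClass_relation μ (IsRelation.pinched_in a c hc ha)
    rw [map_sub, locClass_single, locClass_single, one_smul, sub_eq_zero] at this
    exact ((Λ.locQuiver α).mul_pathClass _ _ _).trans this

/-- The localization functor. -/
def locFunctor : GradedFunctor (Λ.catP K) (hK.locCat μ) (Λ.projObj (Λ.relations K) (hK.locObj μ)) :=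
  Λ.lift (fun {x y} (e : Λ.Arrow x y) => hK.locArrow μ e) (hK.locArrow_relations μ)

theorem locFunctor_arrow (e : Λ.E) {x y : Λ.V} {n : ℤ} (hx : Λ.src e = x) (hy : Λ.tgt e = y)
    (hn : Λ.deg e = n) :
    (hK.locFunctor μ).onComponent x y n (Λ.arrowHom _ e hx hy hn)
      = (Λ.locQuiver α).arrowHom (hK.locRelations μ) (some e) hx hy hn := by
  subst hn
  exact Λ.liftHom_arrowHom _ (hK.locArrow_relations μ) (⟨e, hx, hy⟩ : Λ.Arrow x y)

/-- The localization functor, as a DG functor. -/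
def locDGFunctor : DGFunctor (Λ.catP K) (hK.locCat μ)
    (Λ.projObj (Λ.relations K) (hK.locObj μ)) where
  map := (hK.locFunctor μ).map
  map_id := (hK.locFunctor μ).map_id
  map_comp := (hK.locFunctor μ).map_comp
  map_d _ _ := map_zero (hK.locFunctor μ).map

/-- `ω`, as a morphism of `𝒫(Λ[ω⁻¹])`. -/
def locOmega : (hK.locCat μ).Hom (hK.locObj μ (Λ.src α)) (hK.locObj μ (Λ.tgt α)) (Λ.deg α) :=
  (hK.locFunctor μ).map (hK.omegaP μ)

theorem locOmega_val : Subtype.val (p := (· ∈ (Λ.locQuiver α).component (hK.locRelations μ)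
      (Λ.src α) (Λ.tgt α) (Λ.deg α))) (hK.locOmega μ)
    = (Λ.locQuiver α).pathClass (hK.locRelations μ) (Hom.toPath hK.locα)
      + μ • (Λ.locQuiver α).pathClass (hK.locRelations μ) (Hom.toPath hK.locβ) := by
  have h := congrArg Subtype.val ((map_add ((hK.locFunctor μ).onComponent (Λ.src α) (Λ.tgt α)
    (Λ.deg α)) (Λ.arrowHom _ α rfl rfl rfl)
    (μ • Λ.arrowHom _ β hK.src_eq hK.tgt_eq hK.deg_eq)).trans (congrArg _ (map_smul _ μ _)))
  exact h.trans (congrArg₂ (fun s t => s + μ • t)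
    (congrArg Subtype.val (hK.locFunctor_arrow μ α rfl rfl rfl))
    (congrArg Subtype.val (hK.locFunctor_arrow μ β hK.src_eq hK.tgt_eq hK.deg_eq)))

/-- This is the defining relation δω - e_1, after expanding ω = α + μ β into path classes. -/
theorem comp_delta_omega :
    (hK.locCat μ).comp (neg_add_cancel _) (hK.locDelta μ) (hK.locOmega μ)
      = (hK.locCat μ).id _ := by
  refine Subtype.ext ?_
  have h : ((Λ.locQuiver α).ideal (hK.locRelations μ) _ _).mkQ _ = 0 :=
    (Submodule.Quotient.mk_eq_zero _).2 ((Λ.locQuiver α).mem_ideal _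
      (IsLocRelation.left (hK := hK) (μ := μ)))
  rw [map_sub, map_add, map_smul, sub_eq_zero] at h
  refine Eq.trans ?_ h
  refine (congrArg ((Λ.locQuiver α).mul _ ((Λ.locQuiver α).pathClass (hK.locRelations μ)
    (Hom.toPath (Λ.locδ α)))) (hK.locOmega_val μ)).trans ?_
  rw [map_add, map_smul]
  exact congrArg₂ (fun s t => s + μ • t) ((Λ.locQuiver α).mul_pathClass _ _ _)
    ((Λ.locQuiver α).mul_pathClass _ _ _)

theorem comp_omega_delta :
    (hK.locCat μ).comp (add_neg_cancel _) (hK.locOmega μ) (hK.locDelta μ)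
      = (hK.locCat μ).id _ := by
  refine Subtype.ext ?_
  have h : ((Λ.locQuiver α).ideal (hK.locRelations μ) _ _).mkQ _ = 0 :=
    (Submodule.Quotient.mk_eq_zero _).2 ((Λ.locQuiver α).mem_ideal _
      (IsLocRelation.right (hK := hK) (μ := μ)))
  rw [map_sub, map_add, map_smul, sub_eq_zero] at h
  refine Eq.trans ?_ h
  refine (congrArg (fun f => (Λ.locQuiver α).mul _ f ((Λ.locQuiver α).pathClass (hK.locRelations μ)
    (Hom.toPath (Λ.locδ α)))) (hK.locOmega_val μ)).trans ?_
  rw [map_add, map_smul, LinearMap.add_apply, LinearMap.smul_apply]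
  exact congrArg₂ (fun s t => s + μ • t) ((Λ.locQuiver α).mul_pathClass _ _ _)
    ((Λ.locQuiver α).mul_pathClass _ _ _)

end IsKronecker

end PinchedGentle

end PinchedDG

/-! ### Construction of the functor F -/

namespace PinchedDG

open Quiver

namespace DGFunctor

variable {K : Type w} [Field K]

/-- The map on the objects of a full DG subcategory. -/
def fullObj {C : DGCat.{w, u, v} K} {D : DGCat.{w, u', v} K} {O : Type*} (ι : O → C.Obj)
    (o : C.Obj → D.Obj) : (C.full ι).Obj → D.Obj := fun x => o (ι x)

/-- The restriction of a DG functor to a full DG subcategory. -/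
def restrict {C : DGCat.{w, u, v} K} {D : DGCat.{w, u', v} K} {o : C.Obj → D.Obj}
    (F : DGFunctor C D o) {O : Type*} (ι : O → C.Obj) : DGFunctor (C.full ι) D (fullObj ι o) where
  map := F.map
  map_id _ := F.map_id _
  map_comp := F.map_comp
  map_d := F.map_d

end DGFunctor

theorem DGCat.pretr_d_eq_zero {K : Type w} [Field K] {C : DGCat.{w, u, v} K}
    (hC : ∀ {X Y : C.Obj} {n m : ℤ} (h : n + 1 = m) (f : C.Hom X Y n), C.d h f = 0)
    {X Y : TwistedComplex C} (hX : X.del = 0) (hY : Y.del = 0) {n m : ℤ} (h : n + 1 = m)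
    (f : C.shiftSum.Hom X.base Y.base n) : C.pretr.d (X := X) (Y := Y) h f =
      (0 : C.shiftSum.Hom X.base Y.base m) := by
  change C.shiftSum.d h f + C.shiftSum.comp (show 1 + n = m by omega) Y.del f
    - (-1 : K) ^ n • C.shiftSum.comp h f X.del = 0
  have h₀ : C.shiftSum.d h f = 0 := by
    funext i j
    exact (congrArg _ (hC _ _)).trans (smul_zero _)
  rw [h₀, hX, hY, map_zero, map_zero, LinearMap.zero_apply, smul_zero, add_zero, sub_zero]

namespace DGCat.Cone

variable {K : Type w} [Field K] {C : DGCat.{w, u, v} K} {P₁ P₂ B : C.Obj} {a c₁ c₂ : ℤ}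
  {ω : C.Hom P₁ P₂ a} (T : C.Cone ω B c₁ c₂) (δ : C.Hom P₂ P₁ (-a))

/-- Since p₂ i₁ = 0; this makes F vanish on ε₂ and γ. -/
theorem p₂_comp_contraction {n k m : ℤ} (h : c₂ + m = n) (h' : -1 + k = m) {X : C.Obj}
    (c : C.Hom X B k) : C.comp h T.p₂ (C.comp h' (T.contraction δ) c) = 0 := by
  have hs := T.shift
  rw [contraction, ← C.assoc (q := -a + c₂) (qr := -a + c₂ + k) rfl (by omega) _ h',
    T.p₂_comp_i₁ _ h]

/-- Again p₂ i₁ = 0, now on the right; this makes F vanish on ε₁. -/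
theorem contraction_comp_i₁ {n : ℤ} (h : -1 + -c₁ = n) :
    C.comp h (T.contraction δ) T.i₁ = 0 := by
  have hs := T.shift
  rw [contraction, ← C.assoc (q := -a + c₂) (qr := -a + c₂ + -c₁) rfl (by omega) _ h,
    ← C.assoc (q := c₂) (r := -c₁) rfl (by omega) rfl rfl, T.p₂_i₁, map_zero, map_zero]

/-- p₁ i₁ and p₂ i₂ are identities, so δ is recovered; this gives the value of F on p₁ ε i₂. -/
theorem p₁_comp_contraction_comp_i₂ {k : ℤ} (h : -1 + -c₂ = k) (h' : c₁ + k = -a) :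
    C.comp h' T.p₁ (C.comp h (T.contraction δ) T.i₂) = δ := by
  have hs := T.shift
  rw [contraction, ← C.assoc (q := -a + c₂) (r := -c₂) (qr := -a) (by omega) (by omega) _ h,
    T.p₁_comp_i₁, ← C.assoc (q := c₂) (r := -c₂) (qr := 0) (by omega) (by omega) rfl (by omega),
    T.p₂_i₂ _ rfl, reindex_rfl, C.comp_id]

end DGCat.Cone

namespace PinchedGentle.IsKronecker

variable {Λ : PinchedGentle.{u}} {K : Type w} [Field K] {α β : Λ.E} (hK : Λ.IsKronecker α β)
  (μ : K) (s : ℤ)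

/-- The localization functor, on objects. -/
def locP : (Λ.catP K).Obj → (hK.locCat μ).Obj := Λ.projObj (Λ.relations K) (hK.locObj μ)

/-- The objects of `𝒜`, as twisted complexes over `𝒫(Λ[ω⁻¹])`. -/
def objA : (hK.catA μ s).Obj → (hK.locCat μ).pretr.Obj :=
  DGFunctor.fullObj _ (hK.locDGFunctor μ).twistedMap

/-- The localization functor on `𝒜`. -/
def locA : DGFunctor (hK.catA μ s) (hK.locCat μ).pretr (hK.objA μ s) :=
  (hK.locDGFunctor μ).pretrMap.restrict _

/-- The embedding of `𝒫(Λ[ω⁻¹])` in its twisted complexes. -/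
def stalkL {x y : (Λ.catP K).Obj} {n : ℤ} : (hK.locCat μ).Hom (hK.locP μ x) (hK.locP μ y) n ≃ₗ[K]
    (hK.locCat μ).pretr.Hom (hK.objA μ s (hK.projA μ s x)) (hK.objA μ s (hK.projA μ s y)) n :=
  LinearEquiv.ofBijective ((hK.locCat μ).stalkMap (hK.locP μ x) (hK.locP μ y) n)
    ⟨DGCat.stalkMap_injective _ _ n, DGCat.stalkMap_surjective _ _ n⟩

theorem stalkL_comp {x y z : (Λ.catP K).Obj} {p q r : ℤ} (h : p + q = r)
    (g : (hK.locCat μ).Hom (hK.locP μ y) (hK.locP μ z) p)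
    (f : (hK.locCat μ).Hom (hK.locP μ x) (hK.locP μ y) q) :
    hK.stalkL μ s ((hK.locCat μ).comp h g f)
      = (hK.locCat μ).pretr.comp h (hK.stalkL μ s g) (hK.stalkL μ s f) := DGCat.stalkMap_comp h g f

theorem stalkL_id (x : (Λ.catP K).Obj) :
    hK.stalkL μ s ((hK.locCat μ).id (hK.locP μ x)) = (hK.locCat μ).pretr.id _ :=
  DGCat.stalkMap_id (hK.locP μ x)

theorem locA_stalkA {x y : (Λ.catP K).Obj} {n : ℤ} (f : (Λ.catP K).Hom x y n) :
    (hK.locA μ s).map (hK.stalkA μ s f) = hK.stalkL μ s ((hK.locFunctor μ).map f) := by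
  funext i j
  exact (hK.locFunctor μ).map_reindex (show n = n + 0 - 0 by omega) f

theorem d_stalkL {x y : (Λ.catP K).Obj} {n m : ℤ} (h : n + 1 = m)
    (f : (hK.locCat μ).pretr.Hom (hK.objA μ s (hK.projA μ s x)) (hK.objA μ s (hK.projA μ s y)) n) :
    (hK.locCat μ).pretr.d h f = 0 := by
  have hdel : ∀ x : (Λ.catP K).Obj,
      DGCat.TwistedComplex.del (hK.objA μ s (hK.projA μ s x)) = 0 := fun x =>
    map_zero (hK.locDGFunctor μ).shiftSumMap.map
  exact DGCat.pretr_d_eq_zero (fun _ _ => rfl) (hdel x) (hdel y) h f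

/-- The contraction of the image of the band object. -/
def bandContraction : ∀ U ∈ ({none} : Set (hK.catA μ s).Obj),
    (hK.locCat μ).pretr.Hom (hK.objA μ s U) (hK.objA μ s U) (-1)
  | none, _ => ((hK.bandCone μ s).map (hK.locA μ s)).contraction (hK.stalkL μ s (hK.locDelta μ))
  | some _, h => absurd h (Option.some_ne_none _)

theorem d_bandContraction : ∀ U (hU : U ∈ ({none} : Set (hK.catA μ s).Obj)),
    (hK.locCat μ).pretr.d (m := 0) (by omega) (hK.bandContraction μ s U hU) =
      (hK.locCat μ).pretr.id (hK.objA μ s U)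
  | none, _ => by
    refine ((hK.bandCone μ s).map (hK.locA μ s)).d_contraction _ (hK.d_stalkL μ s _ _) ?_ ?_ _
    · rw [locA_stalkA]
      exact (hK.stalkL_comp μ s _ _ _).symm.trans
        ((congrArg _ (hK.comp_delta_omega μ)).trans (hK.stalkL_id μ s _))
    · rw [locA_stalkA]
      exact (hK.stalkL_comp μ s _ _ _).symm.trans
        ((congrArg _ (hK.comp_omega_delta μ)).trans (hK.stalkL_id μ s _))
  | some _, h => absurd h (Option.some_ne_none _)

/-- The functor on the Drinfeld quotient `𝒜/ℬ`. -/
def quotFunctor : DGFunctor (hK.catAB μ s) (hK.locCat μ).pretr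
    (DGCat.drinfeldObj (C := hK.catA μ s) {none} (hK.objA μ s)) :=
  DGCat.drinfeldLift (hK.locA μ s).toGraded (hK.locA μ s).map_d (hK.bandContraction μ s)
    (hK.d_bandContraction μ s)

/-- A vertex, as an object of `(𝒜/ℬ)_∘`. -/
def projAB (x : (Λ.catP K).Obj) : (hK.catABProj μ s).Obj := x

/-- The functor `(𝒜/ℬ)_∘ → 𝒫(Λ[ω⁻¹])`. -/
def phi : DGFunctor (hK.catABProj μ s) (hK.locCat μ) (hK.objMap μ s) where
  map {X Y n} := (hK.stalkL μ s (x := X) (y := Y) (n := n)).symm.toLinearMap.comp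
    (hK.quotFunctor μ s).map
  map_id X := (hK.stalkL μ s).injective <| ((hK.stalkL μ s).apply_symm_apply _).trans <|
    ((hK.quotFunctor μ s).map_id _).trans (hK.stalkL_id μ s X).symm
  map_comp h g f := (hK.stalkL μ s).injective <| ((hK.stalkL μ s).apply_symm_apply _).trans <|
    ((hK.quotFunctor μ s).map_comp h g f).trans <| by
      refine Eq.trans ?_ (hK.stalkL_comp μ s h _ _).symm
      exact congrArg₂ (fun s t => (hK.locCat μ).pretr.comp h s t)
        ((hK.stalkL μ s).apply_symm_apply _).symm ((hK.stalkL μ s).apply_symm_apply _).symm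
  map_d h f := (congrArg (hK.stalkL μ s).symm (((hK.quotFunctor μ s).map_d h f).trans
    (hK.d_stalkL μ s h _))).trans (map_zero (hK.stalkL μ s).symm)

theorem phi_of {x y : (Λ.catP K).Obj} {n : ℤ} (f : (Λ.catP K).Hom x y n) :
    (hK.phi μ s).map (DGCat.QuotHom.of (C := hK.catA μ s) {hK.bandA μ s} (hK.stalkA μ s f))
      = (hK.locFunctor μ).map f :=
  (congrArg (hK.stalkL μ s).symm (hK.locA_stalkA μ s f)).trans
    ((hK.stalkL μ s).symm_apply_apply _)

/-- Computed inside twisted complexes, where F is the extension to the Drinfeld quotient and ε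
becomes the contraction. -/
theorem phi_sandwich {x y : (Λ.catP K).Obj} {p q n : ℤ} (h : p + (-1 + q) = n)
    (b : (hK.catA μ s).Hom (hK.bandA μ s) (hK.projA μ s y) p)
    (c : (hK.catA μ s).Hom (hK.projA μ s x) (hK.bandA μ s) q) :
    hK.stalkL μ s ((hK.phi μ s).map (DGCat.QuotHom.sandwich h b c))
      = (hK.locCat μ).pretr.comp h ((hK.locA μ s).map b) ((hK.locCat μ).pretr.comp rfl
        (((hK.bandCone μ s).map (hK.locA μ s)).contraction (hK.stalkL μ s (hK.locDelta μ)))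
          ((hK.locA μ s).map c)) := by
  refine ((hK.stalkL μ s).apply_symm_apply _).trans ?_
  refine ((hK.quotFunctor μ s).map_comp (X := hK.projA μ s x) (Y := hK.bandA μ s)
    (Z := hK.projA μ s y) h _ _).trans ?_
  refine congrArg ((hK.locCat μ).pretr.comp h ((hK.locA μ s).map b)) ?_
  refine ((hK.quotFunctor μ s).map_comp (X := hK.projA μ s x) (Y := hK.bandA μ s)
    (Z := hK.bandA μ s) rfl _ _).trans ?_
  refine congrArg (fun t => (hK.locCat μ).pretr.comp rfl t ((hK.locA μ s).map c)) ?_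
  exact DGCat.QuotHom.lift_eps _ _ _

theorem isInducedByφ_phi : hK.IsInducedByφ μ s (hK.phi μ s) where
  map_arrow e := (hK.phi_of μ s _).trans (hK.locFunctor_arrow μ e rfl rfl rfl)
  map_delta := (hK.stalkL μ s).injective ((hK.phi_sandwich μ s _ _ _).trans
    (((hK.bandCone μ s).map (hK.locA μ s)).p₁_comp_contraction_comp_i₂ _ _ _))
  map_eps₁ := (hK.stalkL μ s).injective
    ((hK.phi_sandwich μ s _ (hK.projA₁ μ s) (hK.inclA₁ μ s)).trans ((congrArg _
      (((hK.bandCone μ s).map (hK.locA μ s)).contraction_comp_i₁ _ _)).trans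
        ((map_zero _).trans (map_zero (hK.stalkL μ s)).symm)))
  map_eps₂ := (hK.stalkL μ s).injective ((hK.phi_sandwich μ s _ _ _).trans
    ((((hK.bandCone μ s).map (hK.locA μ s)).p₂_comp_contraction _ _ _ _).trans
      (map_zero (hK.stalkL μ s)).symm))
  map_gamma := (hK.stalkL μ s).injective ((hK.phi_sandwich μ s _ _ _).trans
    ((((hK.bandCone μ s).map (hK.locA μ s)).p₂_comp_contraction _ _ _ _).trans
      (map_zero (hK.stalkL μ s)).symm))

end PinchedGentle.IsKronecker

end PinchedDG

/-! ### Functors to the graded homotopy category, and the universal property of Λ[ω⁻¹] -/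

namespace PinchedDG

open Quiver

section graded

variable {K : Type w} [Field K] {L : DGCat.{w, u', v'} K} {C : DGCat.{w, u, v} K}

/-- A map to the objects of `C`, as a map to those of the graded homotopy category. -/
def toHObj {ι : Type*} (o : ι → C.Obj) : ι → C.H.Obj := o

/-- A graded functor to the closed morphisms of `C` induces one to the graded homotopy category. -/
def GradedFunctor.toH {o : L.Obj → C.Obj} (F : GradedFunctor L C o)
    (hF : ∀ {X Y : L.Obj} {n m : ℤ} (h : n + 1 = m) (f : L.Hom X Y n), C.d h (F.map f) = 0) :
    GradedFunctor L C.H (toHObj o) where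
  map {X Y n} := (Submodule.mkQ _).comp (F.map.codRestrict (C.cocycles (o X) (o Y) n)
    fun f => (C.mem_cocycles rfl _).2 (hF rfl f))
  map_id X := congrArg Submodule.Quotient.mk (Subtype.ext (F.map_id X))
  map_comp h g f := congrArg Submodule.Quotient.mk (Subtype.ext (F.map_comp h g f))

/-- A graded functor to the graded homotopy category, on morphisms. -/
def GradedFunctor.onCohomology {o : L.Obj → C.Obj} (σ : GradedFunctor L C.H (toHObj o))
    (X Y : L.Obj) (n : ℤ) : L.Hom X Y n →ₗ[K] C.Cohomology (o X) (o Y) n := σ.map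

/-- The closed morphisms whose class is in the image of a graded functor. -/
def GradedFunctor.closedImage {o : L.Obj → C.Obj} (σ : GradedFunctor L C.H (toHObj o))
    (X Y : L.Obj) (n : ℤ) : Submodule K (C.Hom (o X) (o Y) n) :=
  ((LinearMap.range (σ.onCohomology X Y n)).comap (Submodule.mkQ _)).map
    (C.cocycles (o X) (o Y) n).subtype

namespace GradedFunctor

variable {o : L.Obj → C.Obj} (σ : GradedFunctor L C.H (toHObj o))

theorem mem_closedImage {X Y : L.Obj} {n : ℤ} (f : C.cocycles (o X) (o Y) n)
    (g : L.Hom X Y n) (h : σ.onCohomology X Y n g = Submodule.Quotient.mk f) :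
    f.1 ∈ σ.closedImage X Y n := ⟨f, ⟨g, h⟩, rfl⟩

theorem exists_of_mem_closedImage {X Y : L.Obj} {n : ℤ} (f : C.cocycles (o X) (o Y) n)
    (hf : f.1 ∈ σ.closedImage X Y n) :
    ∃ g : L.Hom X Y n, σ.onCohomology X Y n g = Submodule.Quotient.mk f := by
  obtain ⟨f', ⟨g, hg⟩, h⟩ := hf
  obtain rfl : f' = f := Subtype.ext h
  exact ⟨g, hg⟩

theorem comp_mem_closedImage {X Y Z : L.Obj} {p q r : ℤ} (h : p + q = r)
    {g : C.Hom (o Y) (o Z) p} (hg : g ∈ σ.closedImage Y Z p) {f : C.Hom (o X) (o Y) q}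
    (hf : f ∈ σ.closedImage X Y q) : C.comp h g f ∈ σ.closedImage X Z r := by
  obtain ⟨g, ⟨g', hg'⟩, rfl⟩ := hg
  obtain ⟨f, ⟨f', hf'⟩, rfl⟩ := hf
  refine σ.mem_closedImage (C.cocycleComp h g f) (L.comp h g' f') ((σ.map_comp h g' f').trans ?_)
  exact congrArg₂ (fun s t => C.cohomComp h s t) hg' hf'

/-- Exact morphisms have class zero, so working modulo exact ones is harmless for membership. -/
theorem d_mem_closedImage {X Y : L.Obj} {n m : ℤ} (h : n + 1 = m) (f : C.Hom (o X) (o Y) n) :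
    C.d h f ∈ σ.closedImage X Y m := by
  have hf : C.d h f ∈ C.cocycles (o X) (o Y) m := (C.mem_cocycles rfl _).2 (C.d_d h rfl f)
  refine σ.mem_closedImage ⟨_, hf⟩ 0 ((map_zero (σ.onCohomology X Y m)).trans ?_)
  exact ((Submodule.Quotient.mk_eq_zero _).2 ((C.mem_coboundaries h _).2 ⟨f, rfl⟩)).symm

end GradedFunctor

end graded

namespace PinchedGentle.IsKronecker

variable {Λ : PinchedGentle.{u}} {K : Type w} [Field K] {α β : Λ.E} (hK : Λ.IsKronecker α β)

section lift

variable {D : DGCat.{w, u', v'} K} {o : Λ.V → D.Obj}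
  (G : GradedFunctor (Λ.catP K) D (Λ.projObj (Λ.relations K) o))
  (δ : D.Hom (o (Λ.tgt α)) (o (Λ.src α)) (-Λ.deg α))

/-- The values of a graded functor on the arrows. -/
def onArrow {x y : Λ.V} (e : Λ.Arrow x y) : D.Hom (o x) (o y) (Λ.deg e.1) :=
  G.onComponent x y _ (Λ.arrowHom _ e.1 e.2.1 e.2.2 rfl)

/-- β has degree |α| only by a hypothesis, so its composites occur with two spellings of the degree,
which are identified here. -/
theorem comp_onComponent_reindex (e : Λ.E) {x y : Λ.V} {n : ℤ} (hx : Λ.src e = x)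
    (hy : Λ.tgt e = y) (hn : Λ.deg e = n) {z : D.Obj} {p r : ℤ} (δ : D.Hom (o y) z p)
    (h : p + Λ.deg e = r) (h' : p + n = r) :
    D.comp h δ (onArrow G ⟨e, hx, hy⟩)
      = D.comp h' δ (G.onComponent x y n (Λ.arrowHom _ e hx hy hn)) := by
  subst hn
  rfl

theorem onComponent_comp_reindex (e : Λ.E) {x y : Λ.V} {n : ℤ} (hx : Λ.src e = x)
    (hy : Λ.tgt e = y) (hn : Λ.deg e = n) {z : D.Obj} {p r : ℤ} (δ : D.Hom z (o x) p)
    (h : Λ.deg e + p = r) (h' : n + p = r) :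
    D.comp h (onArrow G ⟨e, hx, hy⟩) δ
      = D.comp h' (G.onComponent x y n (Λ.arrowHom _ e hx hy hn)) δ := by
  subst hn
  rfl

/-- The value of a graded functor on `ω`. -/
def onOmega (μ : K) : D.Hom (o (Λ.src α)) (o (Λ.tgt α)) (Λ.deg α) := G.map (hK.omegaP μ)

theorem onOmega_eq (μ : K) : hK.onOmega G μ
    = G.onComponent (Λ.src α) (Λ.tgt α) (Λ.deg α) (Λ.arrowHom _ α rfl rfl rfl)
      + μ • G.onComponent (Λ.src α) (Λ.tgt α) (Λ.deg α)
        (Λ.arrowHom _ β hK.src_eq hK.tgt_eq hK.deg_eq) :=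
  (map_add (G.onComponent (Λ.src α) (Λ.tgt α) (Λ.deg α)) (Λ.arrowHom _ α rfl rfl rfl)
    (μ • Λ.arrowHom _ β hK.src_eq hK.tgt_eq hK.deg_eq)).trans (congrArg _ (map_smul _ μ _))

variable {μ : K}

/-- A functor on 𝒫(Λ) respects the old relations automatically; the two new ones state that δ is a
two-sided inverse of the image of ω. -/
theorem locRelations_eq_zero (h_left : D.comp (neg_add_cancel _) δ (hK.onOmega G μ) = D.id _)
    (h_right : D.comp (add_neg_cancel _) (hK.onOmega G μ) δ = D.id _) :
    ∀ x y, ∀ r ∈ hK.locRelations μ x y, ∀ n,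
    (Λ.locQuiver α).evalDeg D (locVertex α o) (locFun D o (onArrow G) δ) n r = 0 := by
  refine evalDeg_loc_eq_zero D o (onArrow G) δ hK μ (evalDeg_functor G) ?_ ?_
  · rw [← h_left, onOmega_eq, map_add, map_smul,
      comp_onComponent_reindex G β hK.src_eq hK.tgt_eq hK.deg_eq δ _ (neg_add_cancel _)]
    rfl
  · rw [← h_right, onOmega_eq, map_add, map_smul, LinearMap.add_apply, LinearMap.smul_apply,
      onComponent_comp_reindex G β hK.src_eq hK.tgt_eq hK.deg_eq δ _ (add_neg_cancel _)]
    rfl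

variable (h_left : D.comp (neg_add_cancel _) δ (hK.onOmega G μ) = D.id _)
  (h_right : D.comp (add_neg_cancel _) (hK.onOmega G μ) δ = D.id _)

/-- The universal property of `𝒫(Λ[ω⁻¹])`. -/
def locLift : GradedFunctor (hK.locCat μ) D
    ((Λ.locQuiver α).projObj (hK.locRelations μ) (locVertex α o)) :=
  (Λ.locQuiver α).lift (locFun D o (onArrow G) δ) (hK.locRelations_eq_zero G δ h_left h_right)

theorem locLift_delta : (hK.locLift G δ h_left h_right).map (hK.locDelta μ) = δ :=
  (Λ.locQuiver α).liftHom_arrowHom _ (hK.locRelations_eq_zero G δ h_left h_right) (Λ.locδ α)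

theorem locLift_arrow {x y : Λ.V} (e : Λ.Arrow x y) :
    (hK.locLift G δ h_left h_right).map (hK.locArrow μ e) = onArrow G e :=
  (Λ.locQuiver α).liftHom_arrowHom _ (hK.locRelations_eq_zero G δ h_left h_right)
    ((Λ.locIncl α).map e)

end lift

end PinchedGentle.IsKronecker

end PinchedDG

/-! ### Uniqueness of F and its inverse in cohomology -/

namespace PinchedDG

open Quiver

/-- The composite of two graded functors. -/
def GradedFunctor.trans {K : Type w} [Field K] {C : DGCat.{w, u, v} K} {D : DGCat.{w, u', v'} K}
    {E : DGCat.{w, u, v} K} {o : C.Obj → D.Obj} {o' : D.Obj → E.Obj}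
    (F : GradedFunctor C D o) (G : GradedFunctor D E o') :
    GradedFunctor C E (fun X => o' (o X)) where
  map := G.map.comp F.map
  map_id X := (congrArg G.map (F.map_id X)).trans (G.map_id _)
  map_comp h g f := (congrArg G.map (F.map_comp h g f)).trans (G.map_comp h _ _)

namespace PinchedGentle.IsKronecker

variable {Λ : PinchedGentle.{u}} {K : Type w} [Field K] {α β : Λ.E} (hK : Λ.IsKronecker α β)
  (μ : K) (s : ℤ)

/-- The functor `𝒫(Λ) → (𝒜/ℬ)_∘`. -/
def embAB : GradedFunctor (Λ.catP K) (hK.catABProj μ s) (hK.projAB μ s) where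
  map {x y n} := (DGCat.QuotHom.of (C := hK.catA μ s) {hK.bandA μ s}).comp
    (hK.stalkA μ s (x := x) (y := y) (n := n)).toLinearMap
  map_id x := congrArg (DGCat.QuotHom.of (C := hK.catA μ s) {hK.bandA μ s}) (hK.stalkA_id μ s x)
  map_comp h g f := (congrArg (DGCat.QuotHom.of (C := hK.catA μ s) {hK.bandA μ s})
    (hK.stalkA_comp μ s h g f)).trans (DGCat.QuotHom.of_comp _ _ _)

theorem d_embAB {x y : (Λ.catP K).Obj} {n m : ℤ} (h : n + 1 = m) (f : (Λ.catP K).Hom x y n) :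
    (hK.catABProj μ s).d h ((hK.embAB μ s).map f) = 0 :=
  (congrArg (DGCat.QuotHom.of (C := hK.catA μ s) {hK.bandA μ s})
    (hK.noDiff μ s x y h (hK.stalkA μ s f))).trans (map_zero _)

-- Two such functors agree on arrows, hence on 𝒫(Λ), and on the four composites p_k ε i_l. Their
-- equalizer is closed under composition, so `mem_of_generators` makes it everything.
variable {μ s} in
theorem eq_of_isInducedByφ {F G : DGFunctor (hK.catABProj μ s) (hK.locCat μ) (hK.objMap μ s)}
    (hF : hK.IsInducedByφ μ s F) (hG : hK.IsInducedByφ μ s G) : F = G := by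
  have hemb : ∀ {x y : (Λ.catP K).Obj} {n : ℤ} (f : (Λ.catP K).Hom x y n),
      F.map ((hK.embAB μ s).map f) = G.map ((hK.embAB μ s).map f) := by
    intro x y n f
    refine Λ.map_ext (I := Λ.relations K) (o := hK.locObj μ) ((hK.embAB μ s).trans F.toGraded)
      ((hK.embAB μ s).trans G.toGraded) ?_ f
    rintro _ _ ⟨e, rfl, rfl⟩
    exact (hF.map_arrow e).trans (hG.map_arrow e).symm
  have key := fun (x y : (Λ.catP K).Obj) n
      (f : DGCat.QuotHom (hK.catA μ s) {hK.bandA μ s} (hK.projA μ s x) (hK.projA μ s y) n) =>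
    (hK.bandCone μ s).mem_of_generators (hK.projA μ s)
      (x₁ := catObj K (Λ.src α)) (x₂ := catObj K (Λ.tgt α)) (x := x) (y := y)
      (by rintro (_ | x); exacts [Or.inl rfl, Or.inr ⟨x, rfl⟩])
      (fun x y n => LinearMap.eqLocus (F.map (X := x) (Y := y) (n := n)) G.map)
      (fun {x y n} f => by
        obtain ⟨f, rfl⟩ := (hK.stalkA μ s).surjective f
        exact hemb f)
      (fun {x y z p q r} h g hg f hf => (F.map_comp h g f).trans
        ((congrArg₂ (fun s t => (hK.locCat μ).comp h s t) hg hf).trans (G.map_comp h g f).symm))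
      (fun {n} h => by
        obtain rfl : n = -1 := by omega
        exact hF.map_eps₁.trans hG.map_eps₁.symm)
      (fun {n} h => by
        obtain rfl : n = -Λ.deg α := by omega
        exact hF.map_delta.trans hG.map_delta.symm)
      (fun {n} h => by
        obtain rfl : n = Λ.deg α - 2 := by omega
        exact hF.map_gamma.trans hG.map_gamma.symm)
      (fun {n} h => by
        obtain rfl : n = -1 := by omega
        exact hF.map_eps₂.trans hG.map_eps₂.symm) f
  refine DGFunctor.ext ?_
  funext x y n
  exact LinearMap.ext (key x y n)

/-- The functor `𝒫(Λ) → H^*((𝒜/ℬ)_∘)`. -/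
def embH : GradedFunctor (Λ.catP K) (hK.catABProj μ s).H
    (Λ.projObj (Λ.relations K) (toHObj (hK.projAB μ s))) :=
  (hK.embAB μ s).toH (hK.d_embAB μ s)

theorem delta_mem_cocycles : hK.delta μ s ∈
    (hK.catABProj μ s).cocycles (hK.projAB μ s (Λ.tgt α)) (hK.projAB μ s (Λ.src α)) (-Λ.deg α) :=
  (hK.bandCone μ s).d_delta rfl

/-- The class of `δ`. -/
def deltaH : (hK.catABProj μ s).H.Hom (toHObj (hK.projAB μ s) (Λ.tgt α))
    (toHObj (hK.projAB μ s) (Λ.src α)) (-Λ.deg α) :=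
  Submodule.Quotient.mk (p := (hK.catABProj μ s).coboundaries (hK.projAB μ s (Λ.tgt α))
    (hK.projAB μ s (Λ.src α)) (-Λ.deg α)) ⟨hK.delta μ s, hK.delta_mem_cocycles μ s⟩

/-- Up to sign, p₁ ε i₁ is a homotopy between the identity and δω, by `delta_omega`. -/
theorem deltaH_omega : (hK.catABProj μ s).H.comp (neg_add_cancel _) (hK.deltaH μ s)
    (hK.onOmega (hK.embH μ s) μ) = (hK.catABProj μ s).H.id _ := by
  refine ((Submodule.Quotient.eq _).2 (((hK.catABProj μ s).mem_coboundaries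
    (show (-1 : ℤ) + 1 = 0 by rfl) _).2 ⟨_, ((hK.bandCone μ s).delta_omega (by ring))⟩)).symm

theorem omega_deltaH : (hK.catABProj μ s).H.comp (add_neg_cancel _)
    (hK.onOmega (hK.embH μ s) μ) (hK.deltaH μ s) = (hK.catABProj μ s).H.id _ := by
  refine ((Submodule.Quotient.eq _).2 (((hK.catABProj μ s).mem_coboundaries
    (show (-1 : ℤ) + 1 = 0 by rfl) _).2 ⟨_, ((hK.bandCone μ s).omega_delta (by ring))⟩)).symm

/-- The inverse functor `𝒫(Λ[ω⁻¹]) → H^*((𝒜/ℬ)_∘)`. -/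
def sigma : GradedFunctor (hK.locCat μ) (hK.catABProj μ s).H
    ((Λ.locQuiver α).projObj (hK.locRelations μ) (locVertex α (toHObj (hK.projAB μ s)))) :=
  hK.locLift (hK.embH μ s) (hK.deltaH μ s) (hK.deltaH_omega μ s) (hK.omega_deltaH μ s)

theorem sigma_locFunctor {x y : (Λ.catP K).Obj} {n : ℤ} (f : (Λ.catP K).Hom x y n) :
    (hK.sigma μ s).map ((hK.locFunctor μ).map f) = (hK.embH μ s).map f := by
  refine Λ.map_ext (I := Λ.relations K) (o := toHObj (hK.projAB μ s))
    ((hK.locFunctor μ).trans (hK.sigma μ s)) (hK.embH μ s) ?_ f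
  rintro _ _ ⟨e, rfl, rfl⟩
  exact (congrArg (hK.sigma μ s).map (hK.locFunctor_arrow μ e rfl rfl rfl)).trans
    (hK.locLift_arrow (hK.embH μ s) (hK.deltaH μ s) _ _ ⟨e, rfl, rfl⟩)

theorem sigma_locDelta : (hK.sigma μ s).map (hK.locDelta μ) = hK.deltaH μ s :=
  hK.locLift_delta (hK.embH μ s) (hK.deltaH μ s) _ _

theorem d_loc {X Y : (hK.locCat μ).Obj} {n m : ℤ} (h : n + 1 = m)
    (f : (hK.locCat μ).Hom X Y n) : (hK.locCat μ).d h f = 0 := rfl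

/-- Both sides are functors on 𝒫(Λ[ω⁻¹]), and they agree on δ and on the arrows of Q. This gives
surjectivity of H^*(F) and injectivity of σ. -/
theorem ofHMap_sigma {x y : Λ.V} {n : ℤ} (g : (hK.locCat μ).Hom (hK.locObj μ x) (hK.locObj μ y) n) :
    (hK.phi μ s).ofHMap (hK.d_loc μ) x y n ((hK.sigma μ s).map g) = g := by
  refine (Λ.locQuiver α).map_ext (I := hK.locRelations μ) (o := locVertex α (hK.locObj μ))
    ((hK.sigma μ s).trans ((hK.phi μ s).ofH (hK.d_loc μ)).toGraded) (.refl _) ?_ g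
  rintro _ _ ⟨_ | e, rfl, rfl⟩
  · exact (congrArg ((hK.phi μ s).ofHMap (hK.d_loc μ) _ _ _) (hK.sigma_locDelta μ s)).trans
      (hK.isInducedByφ_phi μ s).map_delta
  · exact (congrArg ((hK.phi μ s).ofHMap (hK.d_loc μ) _ _ _)
      (hK.locLift_arrow (hK.embH μ s) (hK.deltaH μ s) _ _ ⟨e, rfl, rfl⟩)).trans
      ((hK.isInducedByφ_phi μ s).map_arrow e)

/-- The identity map on objects. -/
def locProjAB : (hK.locCat μ).Obj → (hK.catABProj μ s).Obj := fun (x : Λ.V) => x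

/-- The closed morphisms of `(𝒜/ℬ)_∘` whose class is in the image of `𝒫(Λ[ω⁻¹])`. -/
def closedImage (x y : Λ.V) (n : ℤ) : Submodule K ((hK.catABProj μ s).Hom (hK.projAB μ s x)
    (hK.projAB μ s y) n) :=
  (hK.sigma μ s).closedImage (o := hK.locProjAB μ s) x y n

theorem embAB_mem_closedImage {x y : (Λ.catP K).Obj} {n : ℤ} (f : (Λ.catP K).Hom x y n) :
    (hK.embAB μ s).map f ∈ hK.closedImage μ s x y n :=
  (hK.sigma μ s).mem_closedImage (o := hK.locProjAB μ s)
    ⟨_, (DGCat.mem_cocycles _ rfl _).2 (hK.d_embAB μ s rfl f)⟩ _ (hK.sigma_locFunctor μ s f)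

theorem delta_mem_closedImage :
    hK.delta μ s ∈ hK.closedImage μ s (Λ.tgt α) (Λ.src α) (-Λ.deg α) :=
  (hK.sigma μ s).mem_closedImage (o := hK.locProjAB μ s) ⟨_, hK.delta_mem_cocycles μ s⟩ _
    (hK.sigma_locDelta μ s)

theorem comp_mem_closedImage {x y z : Λ.V} {p q r : ℤ} (h : p + q = r)
    {g : (hK.catABProj μ s).Hom (hK.projAB μ s y) (hK.projAB μ s z) p}
    (hg : g ∈ hK.closedImage μ s y z p)
    {f : (hK.catABProj μ s).Hom (hK.projAB μ s x) (hK.projAB μ s y) q}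
    (hf : f ∈ hK.closedImage μ s x y q) :
    (hK.catABProj μ s).comp h g f ∈ hK.closedImage μ s x z r :=
  (hK.sigma μ s).comp_mem_closedImage (o := hK.locProjAB μ s) h hg hf

-- The heart of the quasi-equivalence: the closed morphisms whose class lies in the image of σ
-- contain 𝒫(Λ) and δ and are closed under composition, so they serve as the family `A` for the
-- description of closed morphisms.
variable {μ} in
theorem mem_closedImage (hμ : μ ≠ 0) {x y : Λ.V} {n : ℤ}
    (f : (hK.catABProj μ s).Hom (hK.projAB μ s x) (hK.projAB μ s y) n)
    (hf : (hK.catABProj μ s).d rfl f = 0) : f ∈ hK.closedImage μ s x y n := by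
  obtain ⟨g, b, k, q, m, hq, hm, gen, z, hz, rfl⟩ := hK.exists_eq_of_closed s hμ x y
    (fun n => hK.closedImage μ s x (Λ.tgt α) n)
    (fun n f => hK.embAB_mem_closedImage μ s f)
    (fun h h' z hz => hK.comp_mem_closedImage μ s h' (hK.embAB_mem_closedImage μ s (hK.betaP K))
      (hK.comp_mem_closedImage μ s h (hK.delta_mem_closedImage μ s) hz)) rfl (sub_add_cancel n 1)
    f hf
  refine add_mem (add_mem ?_ ?_) ?_
  · exact (hK.sigma μ s).d_mem_closedImage (o := hK.locProjAB μ s) _ g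
  · exact hK.embAB_mem_closedImage μ s b
  · exact hK.comp_mem_closedImage μ s hq (hK.embAB_mem_closedImage μ s gen)
      (hK.comp_mem_closedImage μ s hm (hK.delta_mem_closedImage μ s) hz)

-- σ is a right inverse of H^*(F) by `ofHMap_sigma` and is onto by `mem_closedImage`; hence the two
-- are mutually inverse.
variable {μ} in
theorem bijective_ofHMap_phi (hμ : μ ≠ 0) (x y : (hK.catABProj μ s).Obj) (n : ℤ) :
    Function.Bijective ((hK.phi μ s).ofHMap (hK.d_loc μ) x y n) := by
  refine ⟨fun f f' h => ?_, fun g => ⟨_, hK.ofHMap_sigma μ s g⟩⟩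
  have hσ : ∀ f : (hK.catABProj μ s).Cohomology x y n, ∃ g,
      (hK.sigma μ s).onCohomology (o := hK.locProjAB μ s) x y n g = f := by
    intro f
    obtain ⟨f, rfl⟩ := Submodule.Quotient.mk_surjective _ f
    exact (hK.sigma μ s).exists_of_mem_closedImage (o := hK.locProjAB μ s) f
      (hK.mem_closedImage s hμ f.1 ((DGCat.mem_cocycles _ rfl _).1 f.2))
  obtain ⟨g, rfl⟩ := hσ f
  obtain ⟨g', rfl⟩ := hσ f'
  exact congrArg _ ((hK.ofHMap_sigma μ s g).symm.trans (h.trans (hK.ofHMap_sigma μ s g')))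

end PinchedGentle.IsKronecker

end PinchedDG

theorem mainTheorem9 {K : Type w} [Field K] (Λ : PinchedDG.PinchedGentle.{u}) (α β : Λ.E)
    (hαβ : Λ.IsAcyclicKronecker α β) (μ : K) (hμ : μ ≠ 0) (s : ℤ) :
    ∃ F : PinchedDG.DGFunctor (hαβ.catABProj μ s) (hαβ.locCat μ) (hαβ.objMap μ s),
      hαβ.toIsKronecker.IsInducedByφ μ s F ∧
      (∀ G : PinchedDG.DGFunctor (hαβ.catABProj μ s) (hαβ.locCat μ) (hαβ.objMap μ s),
        hαβ.toIsKronecker.IsInducedByφ μ s G → G = F) ∧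
      F.IsQuasiEquivalence ∧
      (hαβ.catABProj μ s).IsFormal := by
  have hK := hαβ.toIsKronecker
  have ho : Function.Surjective (hK.objMap μ s) := fun x => ⟨x, rfl⟩
  have hF := hK.bijective_ofHMap_phi s hμ
  exact ⟨hK.phi μ s, hK.isInducedByφ_phi μ s,
    fun G hG => hK.eq_of_isInducedByφ hG (hK.isInducedByφ_phi μ s),
    (hK.phi μ s).isQuasiEquivalence_of_bijective (hK.d_loc μ) ho hF,
    (hK.phi μ s).isFormal_of_bijective (hK.d_loc μ) ho hF⟩
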